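/- **Theorem.** Let $d\ge 0$ be an integer, $A$ a real $d\times d$ matrix with transpose $A^*$, $p,q\in[1,\infty]$ with $p\le q$, and let $\Phi_1,\Phi_2,\Psi_1,\Psi_2:[0,\infty]\to[0,\infty]$ be Young functions (convex, $\Phi(0)=0$, $\lim_{t\to\infty}\Phi(t)=\Phi(\infty)=\infty$). If $p<\infty$, assume in addition that * each of the four functions is $p$-steered, i.e. either $\liminf_{t\to0+}\Phi(t)/t^p>0$, or $t\mapsto\Phi(t^{1/p})$ coincides near $0$ with a Young function; * each of them satisfies a local $\Delta_2$-condition: $\Phi(2t)\le C\,\Phi(t)$ for $t\in[0,r_0]$, for some $r_0,C>0$; * for some $r,c>0$ and $j=1,2$, $$t^q\le c\,\Phi_j(t),\quad t^q\le c\,\Psi_j(t)\qquad (0\le t\le r),$$ $$\Phi_1^{-\&}(s)\,\Phi_2^{-\&}(s)\le c\,s^{\frac1p+\frac1q},\quad \Psi_1^{-\&}(s)\,\Psi_2^{-\&}(s)\le c\,s^{\frac1p+\frac1q}\qquad(0\le s\le r),$$ where $t^\infty$ means $0$ for $t\le 1$ and $\infty$ for $t>1$. Here $\Phi^{-\&}$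 is the essential inverse: with $t_1=\sup\{\Phi=0\}$, $t_2=\sup\{\Phi<\infty\}$ and $s_0=\sup\{\Phi(t):t<t_2\}$, one has $\Phi^{-\&}(0)=0$, $\Phi^{-\&}(\Phi(t))=t$ for $t_1<t<t_2$, and $\Phi^{-\&}(s)=t_2$ for $s\ge s_0$, $s>0$. Let $\omega$ on $\mathbf R^{4d}$ and $\omega_1,\omega_2$ on $\mathbf R^{2d}$ be moderate weights (positive, locally bounded together with their reciprocals, and $\omega(x+y)\le C\omega(x)v(y)$ for some such $v$) such that, for some constant $c$ and all $x,\xi,\eta,y\in\mathbf R^d$, $$\omega(x,\xi,\eta,y)\le c\,\omega_1(x-Ay,\ \xi+(I-A^*)\eta)\ \omega_2(x+(I-A)y,\ \xi-A^*\eta).$$ For $f$ in the Gelfand–Shilov distribution space $\mathcal S_{1/2}'(\mathbf R^n)$ and $\phi(x)=\pi^{-n/4}e^{-|x|^2/2}$ put $V_\phi f(x,\xi)=(2\pi)^{-n/2}\langle f,\overline{\phi(\cdot-x)}\,e^{-i\langle\cdot,\xi\rangle}\rangle$. Let $M^{\Phi,\Psi}_{(\omega)}(\mathbf R^n)$, respectively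 $M^{p,q}_{(\omega)}(\mathbf R^n)$, be the set of $f\in\mathcal S_{1/2}'(\mathbf R^n)$ whose norm is finite, the norm being obtained from $V_\phi f\cdot\omega$ by taking first the Luxemburg norm of $L^\Phi$ (the $L^p$ norm) in $x$ and then that of $L^\Psi$ (the $L^q$ norm) in $\xi$. Let $W^A_{f_1,f_2}$ be the $A$-Wigner distribution, i.e. the map $\Sigma_1'(\mathbf R^d)\times\Sigma_1'(\mathbf R^d)\to\Sigma_1'(\mathbf R^{2d})$ given, in the sense of distributions, by $$W^A_{f_1,f_2}(x,\xi)=(2\pi)^{-d/2}\int f_1(x+Ay)\,\overline{f_2(x+(A-I)y)}\,e^{-i\langle y,\xi\rangle}\,dy .$$ Then $M^{\Phi_j,\Psi_j}_{(\omega_j)}(\mathbf R^d)\subseteq\Sigma_1'(\mathbf R^d)$ for $j=1,2$, and $(f_1,f_2)\mapsto W^A_{f_1,f_2}$ restricts to a continuous map from $M^{\Phi_1,\Psi_1}_{(\omega_1)}(\mathbf R^d)\times M^{\Phi_2,\Psi_2}_{(\omega_2)}(\mathbf R^d)$ to $M^{p,q}_{(\omega)}(\mathbf R^{2d})$; moreover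 there is a constant $C$ with $$\|W^A_{f_1,f_2}\|_{M^{p,q}_{(\omega)}}\le C\,\|f_1\|_{M^{\Phi_1,\Psi_1}_{(\omega_1)}}\|f_2\|_{M^{\Phi_2,\Psi_2}_{(\omega_2)}},\qquad f_j\in M^{\Phi_j,\Psi_j}_{(\omega_j)}(\mathbf R^d),\ j=1,2.$$ -/

import Mathlib

open MeasureTheory Filter Topology
open scoped ENNReal NNReal Nat ComplexConjugate

namespace OrliczModulation

noncomputable section

/-! ## Gelfand-Shilov spaces and their duals -/

/-- `GSNormLE s h B f` says that the Gelfand-Shilov seminorm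
`sup_{k, l, x} |x| ^ k |D ^ l f (x)| / (h ^ (k + l) (k! l!) ^ s)` of `f` is at most `B`.
With `k = |β|` and `l = |α|` these seminorms and the multi-index ones
`sup |x ^ β ∂ ^ α f (x)| / (h ^ |α + β| (α! β!) ^ s)` dominate each other after multiplying `h`
with a constant that depends only on the dimension and on `s`. -/
def GSNormLE {V : Type*} [NormedAddCommGroup V] [NormedSpace ℝ V]
    (s h B : ℝ) (f : V → ℂ) : Prop :=
  ∀ (k l : ℕ) (x : V),
    ‖x‖ ^ k * ‖iteratedFDeriv ℝ l f x‖ ≤ B * (h ^ (k + l) * ((k ! : ℝ) * (l ! : ℝ)) ^ s)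

section GS

variable {V : Type*} [NormedAddCommGroup V] [NormedSpace ℝ V]

theorem GSNormLE.nonneg {s h B : ℝ} {f : V → ℂ} (hf : GSNormLE s h B f) : 0 ≤ B := by
  have := hf 0 0 0
  simp at this
  exact (norm_nonneg _).trans this

theorem GSNormLE.zero (s h : ℝ) : GSNormLE s h 0 (0 : V → ℂ) := by
  intro k l x
  have : iteratedFDeriv ℝ l (0 : V → ℂ) x = 0 := by
    change iteratedFDeriv ℝ l (fun _ : V => (0 : ℂ)) x = 0
    simp
  simp [this]

theorem GSNormLE.add {s h B C : ℝ} {f g : V → ℂ} (hfs : ContDiff ℝ ((⊤ : ℕ∞) : WithTop ℕ∞) f) (hgs : ContDiff ℝ ((⊤ : ℕ∞) : WithTop ℕ∞) g)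
    (hf : GSNormLE s h B f) (hg : GSNormLE s h C g) : GSNormLE s h (B + C) (f + g) := by
  intro k l x
  have hl : ((l : ℕ∞) : WithTop ℕ∞) ≤ ((⊤ : ℕ∞) : WithTop ℕ∞) := by exact_mod_cast le_top
  rw [iteratedFDeriv_add (hfs.of_le hl) (hgs.of_le hl), Pi.add_apply, add_mul]
  calc _ ≤ ‖x‖ ^ k * (‖iteratedFDeriv ℝ l f x‖ + ‖iteratedFDeriv ℝ l g x‖) := by
        gcongr; exact norm_add_le _ _
    _ = ‖x‖ ^ k * ‖iteratedFDeriv ℝ l f x‖ + ‖x‖ ^ k * ‖iteratedFDeriv ℝ l g x‖ := by ring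
    _ ≤ _ := add_le_add (hf k l x) (hg k l x)

theorem GSNormLE.smul {s h B : ℝ} {f : V → ℂ} (c : ℂ) (hfs : ContDiff ℝ ((⊤ : ℕ∞) : WithTop ℕ∞) f)
    (hf : GSNormLE s h B f) : GSNormLE s h (‖c‖ * B) (c • f) := by
  intro k l x
  have hl : ((l : ℕ∞) : WithTop ℕ∞) ≤ ((⊤ : ℕ∞) : WithTop ℕ∞) := by exact_mod_cast le_top
  rw [iteratedFDeriv_const_smul_apply (hfs.of_le hl).contDiffAt, norm_smul]
  calc _ = ‖c‖ * (‖x‖ ^ k * ‖iteratedFDeriv ℝ l f x‖) := by ring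
    _ ≤ ‖c‖ * (B * (h ^ (k + l) * ((k ! : ℝ) * (l ! : ℝ)) ^ s)) :=
        mul_le_mul_of_nonneg_left (hf k l x) (norm_nonneg _)
    _ = _ := by ring

theorem GSNormLE.mono {s h h' B : ℝ} {f : V → ℂ} (h0 : 0 ≤ h) (hh : h ≤ h')
    (hf : GSNormLE s h B f) : GSNormLE s h' B f := by
  intro k l x
  have := hf.nonneg
  exact (hf k l x).trans (by gcongr)

theorem pow_le_exp_mul_sqrt_factorial {a : ℝ} (ha : 0 ≤ a) (k : ℕ) :
    a ^ k ≤ Real.exp (a ^ 2) * (k ! : ℝ) ^ (1 / 2 : ℝ) := by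
  have hk : (0 : ℝ) < (k ! : ℝ) := by exact_mod_cast k.factorial_pos
  have h1 : (a ^ 2) ^ k / (k ! : ℝ) ≤ Real.exp (a ^ 2) :=
    Real.pow_div_factorial_le_exp (x := a ^ 2) (by positivity) k
  have h2 : 1 ≤ Real.exp (a ^ 2) := Real.one_le_exp (by positivity)
  rw [← Real.sqrt_eq_rpow]
  refine le_of_sq_le_sq ?_ (by positivity)
  rw [mul_pow, Real.sq_sqrt hk.le]
  rw [div_le_iff₀ hk] at h1
  calc (a ^ k) ^ 2 = (a ^ 2) ^ k := by ring
    _ ≤ Real.exp (a ^ 2) * k ! := h1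
    _ ≤ Real.exp (a ^ 2) ^ 2 * k ! := by
      gcongr
      nlinarith

/-- Comparison of the seminorms of order `1 / 2` with those of order `1`. -/
theorem GSNormLE.half_to_one {h h' : ℝ} (hh : 0 < h) (hh' : 0 < h') :
    ∃ C : ℝ, 0 ≤ C ∧ ∀ (f : V → ℂ) (B : ℝ),
      GSNormLE (1 / 2) h B f → GSNormLE 1 h' (C * B) f := by
  set a := h / h' with ha_def
  have ha0 : 0 ≤ a := by positivity
  refine ⟨Real.exp (a ^ 2) * Real.exp (a ^ 2), by positivity, fun f B hf k l x => ?_⟩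
  have hB := hf.nonneg
  refine (hf k l x).trans ?_
  have hk : (0 : ℝ) < (k ! : ℝ) := by exact_mod_cast k.factorial_pos
  have hl : (0 : ℝ) < (l ! : ℝ) := by exact_mod_cast l.factorial_pos
  have e1 := pow_le_exp_mul_sqrt_factorial ha0 k
  have e2 := pow_le_exp_mul_sqrt_factorial ha0 l
  have hha : h = a * h' := by
    rw [ha_def]
    field_simp
  have sk : (k ! : ℝ) ^ (1 / 2 : ℝ) * (k ! : ℝ) ^ (1 / 2 : ℝ) = k ! := by
    rw [← Real.rpow_add hk]; norm_num
  have sl : (l ! : ℝ) ^ (1 / 2 : ℝ) * (l ! : ℝ) ^ (1 / 2 : ℝ) = l ! := by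
    rw [← Real.rpow_add hl]; norm_num
  rw [Real.rpow_one, Real.mul_rpow hk.le hl.le, hha]
  set u := (k ! : ℝ) ^ (1 / 2 : ℝ)
  set v := (l ! : ℝ) ^ (1 / 2 : ℝ)
  have hu : 0 ≤ u := by positivity
  have hv : 0 ≤ v := by positivity
  rw [← sk, ← sl]
  calc B * ((a * h') ^ (k + l) * (u * v))
      = (B * h' ^ (k + l) * (u * v)) * (a ^ k * a ^ l) := by rw [mul_pow, pow_add a]; ring
    _ ≤ (B * h' ^ (k + l) * (u * v)) *
        ((Real.exp (a ^ 2) * u) * (Real.exp (a ^ 2) * v)) := by gcongr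
    _ = _ := by ring

variable (V) in
/-- The Gelfand-Shilov space `Σ_s` of Beurling type. -/
def GSBeurling (s : ℝ) : Submodule ℂ (V → ℂ) where
  carrier := {f | ContDiff ℝ ((⊤ : ℕ∞) : WithTop ℕ∞) f ∧ ∀ h : ℝ, 0 < h → ∃ B : ℝ, GSNormLE s h B f}
  zero_mem' := ⟨contDiff_const, fun h _ => ⟨0, GSNormLE.zero s h⟩⟩
  add_mem' := by
    rintro f g ⟨hf, hf'⟩ ⟨hg, hg'⟩
    refine ⟨hf.add hg, fun h hh => ?_⟩
    obtain ⟨B, hB⟩ := hf' h hh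
    obtain ⟨C, hC⟩ := hg' h hh
    exact ⟨B + C, hB.add hf hg hC⟩
  smul_mem' := by
    rintro c f ⟨hf, hf'⟩
    refine ⟨hf.const_smul c, fun h hh => ?_⟩
    obtain ⟨B, hB⟩ := hf' h hh
    exact ⟨‖c‖ * B, hB.smul c hf⟩

variable (V) in
/-- The Gelfand-Shilov space `S_s` of Roumieu type. -/
def GSRoumieu (s : ℝ) : Submodule ℂ (V → ℂ) where
  carrier := {f | ContDiff ℝ ((⊤ : ℕ∞) : WithTop ℕ∞) f ∧ ∃ h : ℝ, 0 < h ∧ ∃ B : ℝ, GSNormLE s h B f}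
  zero_mem' := ⟨contDiff_const, 1, one_pos, 0, GSNormLE.zero s 1⟩
  add_mem' := by
    rintro f g ⟨hf, h, hh, B, hB⟩ ⟨hg, h', hh', C, hC⟩
    exact ⟨hf.add hg, max h h', lt_max_of_lt_left hh, B + C,
      (hB.mono hh.le (le_max_left _ _)).add hf hg (hC.mono hh'.le (le_max_right _ _))⟩
  smul_mem' := by
    rintro c f ⟨hf, h, hh, B, hB⟩
    exact ⟨hf.const_smul c, h, hh, ‖c‖ * B, hB.smul c hf⟩

variable (V) in
/-- The distribution space `Σ_s'`: the linear functionals on `Σ_s` that are continuous for the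
projective limit topology, that is, bounded by one of the seminorms. -/
def GSBeurlingDual (s : ℝ) : Submodule ℂ (GSBeurling V s →ₗ[ℂ] ℂ) where
  carrier := {u | ∃ h : ℝ, 0 < h ∧ ∃ C : ℝ, 0 ≤ C ∧
    ∀ (g : GSBeurling V s) (B : ℝ), GSNormLE s h B (g : V → ℂ) → ‖u g‖ ≤ C * B}
  zero_mem' := ⟨1, one_pos, 0, le_rfl, fun g B _ => by simp⟩
  add_mem' := by
    rintro u w ⟨h, hh, C, hC, hu⟩ ⟨h', hh', C', hC', hw⟩
    refine ⟨min h h', lt_min hh hh', C + C', by positivity, fun g B hB => ?_⟩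
    rw [LinearMap.add_apply, add_mul]
    exact (norm_add_le _ _).trans (add_le_add
      (hu g B (hB.mono (lt_min hh hh').le (min_le_left _ _)))
      (hw g B (hB.mono (lt_min hh hh').le (min_le_right _ _))))
  smul_mem' := by
    rintro c u ⟨h, hh, C, hC, hu⟩
    refine ⟨h, hh, ‖c‖ * C, by positivity, fun g B hB => ?_⟩
    rw [LinearMap.smul_apply, norm_smul, mul_assoc]
    exact mul_le_mul_of_nonneg_left (hu g B hB) (norm_nonneg _)

variable (V) in
/-- The distribution space `S_s'`: the linear functionals on `S_s` that are continuous for the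
inductive limit topology, that is, bounded on each of the steps. -/
def GSRoumieuDual (s : ℝ) : Submodule ℂ (GSRoumieu V s →ₗ[ℂ] ℂ) where
  carrier := {u | ∀ h : ℝ, 0 < h → ∃ C : ℝ, 0 ≤ C ∧
    ∀ (g : GSRoumieu V s) (B : ℝ), GSNormLE s h B (g : V → ℂ) → ‖u g‖ ≤ C * B}
  zero_mem' := fun h _ => ⟨0, le_rfl, fun g B _ => by simp⟩
  add_mem' := by
    intro u w hu hw h hh
    obtain ⟨C, hC, hu⟩ := hu h hh
    obtain ⟨C', hC', hw⟩ := hw h hh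
    refine ⟨C + C', by positivity, fun g B hB => ?_⟩
    rw [LinearMap.add_apply, add_mul]
    exact (norm_add_le _ _).trans (add_le_add (hu g B hB) (hw g B hB))
  smul_mem' := by
    intro c u hu h hh
    obtain ⟨C, hC, hu⟩ := hu h hh
    refine ⟨‖c‖ * C, by positivity, fun g B hB => ?_⟩
    rw [LinearMap.smul_apply, norm_smul, mul_assoc]
    exact mul_le_mul_of_nonneg_left (hu g B hB) (norm_nonneg _)

theorem roumieu_half_le_beurling_one : GSRoumieu V (1 / 2) ≤ GSBeurling V 1 := by
  rintro f ⟨hf, h, hh, B, hB⟩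
  refine ⟨hf, fun h' hh' => ?_⟩
  obtain ⟨C, -, hC⟩ := GSNormLE.half_to_one (V := V) hh hh'
  exact ⟨C * B, hC f B hB⟩

/-- The embedding `Σ_1' ⊆ S_{1/2}'`: restriction of functionals to `S_{1/2} ⊆ Σ_1`. -/
def toHalf (F : GSBeurlingDual V 1) : GSRoumieuDual V (1 / 2) :=
  ⟨(F : GSBeurling V 1 →ₗ[ℂ] ℂ) ∘ₗ Submodule.inclusion roumieu_half_le_beurling_one, by
    obtain ⟨u, h', hh', C', hC', hu⟩ := F
    intro h hh
    obtain ⟨C, hC0, hC⟩ := GSNormLE.half_to_one (V := V) hh hh'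
    refine ⟨C' * C, by positivity, fun g B hB => ?_⟩
    rw [mul_assoc]
    exact hu (Submodule.inclusion roumieu_half_le_beurling_one g) (C * B) (hC _ B hB)⟩

open Classical in
/-- The value `⟨F, g⟩` of `F ∈ Σ_1'` at a function `g` known to lie in `Σ_1`. The form is
bilinear; it extends `∫ F g`. -/
def pairOne (F : GSBeurlingDual V 1) (g : V → ℂ) : ℂ :=
  if hg : g ∈ GSBeurling V 1 then (F : GSBeurling V 1 →ₗ[ℂ] ℂ) ⟨g, hg⟩ else 0

open Classical in
/-- The value `⟨f, g⟩` of `f ∈ S_{1/2}'` at a function `g` known to lie in `S_{1/2}`. -/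
def pairHalf (f : GSRoumieuDual V (1 / 2)) (g : V → ℂ) : ℂ :=
  if hg : g ∈ GSRoumieu V (1 / 2) then (f : GSRoumieu V (1 / 2) →ₗ[ℂ] ℂ) ⟨g, hg⟩ else 0

end GS

/-! ## Weights -/

/-- A weight: a positive function `ω` such that `ω` and `1 / ω` are in `L^∞_loc`. -/
def IsWeight {V : Type*} [TopologicalSpace V] [MeasureSpace V] (ω : V → ℝ) : Prop :=
  (∀ x, 0 < ω x) ∧ ∀ K : Set V, IsCompact K →
    MemLp ω ∞ (volume.restrict K) ∧ MemLp (fun x => (ω x)⁻¹) ∞ (volume.restrict K)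

/-- The class `P_E` of moderate weights. -/
def IsModerateWeight {V : Type*} [AddCommGroup V] [TopologicalSpace V] [MeasureSpace V]
    (ω : V → ℝ) : Prop :=
  IsWeight ω ∧ ∃ v : V → ℝ, IsWeight v ∧ ∃ C : ℝ, ∀ x y, ω (x + y) ≤ C * (ω x * v y)

/-! ## Young functions -/

structure IsYoung (Φ : ℝ≥0∞ → ℝ≥0∞) : Prop where
  convex : ∀ a b : ℝ≥0, a + b = 1 → ∀ t u : ℝ≥0, Φ (a * t + b * u) ≤ a * Φ t + b * Φ u
  zero : Φ 0 = 0
  lim : Tendsto (fun t : ℝ≥0 => Φ t) atTop (𝓝 ∞)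
  top : Φ ∞ = ∞

/-- The `Δ₂`-condition near the origin. -/
def LocalDelta2 (Φ : ℝ≥0∞ → ℝ≥0∞) : Prop :=
  ∃ r : ℝ≥0, 0 < r ∧ ∃ C : ℝ≥0, ∀ t : ℝ≥0∞, t ≤ r → Φ (2 * t) ≤ C * Φ t

/-- `Φ` is `p`-steered: either `liminf_{t → 0+} Φ (t) / t ^ p > 0`, or `t ↦ Φ (t ^ (1 / p))` is
equal to a Young function near the origin. -/
def IsSteered (p : ℝ) (Φ : ℝ≥0∞ → ℝ≥0∞) : Prop :=
  0 < liminf (fun t : ℝ≥0∞ => Φ t / t ^ p) (𝓝[>] 0) ∨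
  ∃ Φ₀ : ℝ≥0∞ → ℝ≥0∞, IsYoung Φ₀ ∧ ∃ r : ℝ≥0, 0 < r ∧
    ∀ t : ℝ≥0∞, t ≤ r → Φ (t ^ (1 / p)) = Φ₀ t

/-- The zero point of `Φ`. -/
def zeroPoint (Φ : ℝ≥0∞ → ℝ≥0∞) : ℝ≥0∞ := sSup {t | Φ t = 0}

/-- The infinity point of `Φ`. -/
def inftyPoint (Φ : ℝ≥0∞ → ℝ≥0∞) : ℝ≥0∞ := sSup {t | Φ t < ∞}

open Classical in
/-- The essential inverse of a Young function `Φ`: with `t₁`, `t₂` the zero and infinity points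
and `s₀ = sup {Φ t | t < t₂}`, its value at `s` is `0` if `s = 0`, `t₂` if `0 < s` and `s₀ ≤ s`,
and otherwise the unique `t` with `t₁ < t < t₂` and `Φ t = s`. -/
def essInv (Φ : ℝ≥0∞ → ℝ≥0∞) (s : ℝ≥0∞) : ℝ≥0∞ :=
  if s = 0 then 0
  else if sSup (Φ '' {t | t < inftyPoint Φ}) ≤ s then inftyPoint Φ
  else sSup {t | zeroPoint Φ < t ∧ t < inftyPoint Φ ∧ Φ t = s}

open Classical in
/-- The function `t ^ q` for `q ∈ (0, ∞]`, where `t ^ ∞` is `0` for `t ≤ 1` and `∞` for `t > 1`. -/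
def extPow (q t : ℝ≥0∞) : ℝ≥0∞ :=
  if q = ∞ then (if t ≤ 1 then 0 else ∞) else t ^ q.toReal

/-! ## Orlicz modulation spaces -/

/-- The Luxemburg norm of `L^Φ`. -/
def luxNorm {V : Type*} [MeasureSpace V] (Φ : ℝ≥0∞ → ℝ≥0∞) (g : V → ℝ≥0∞) : ℝ≥0∞ :=
  sInf {l | 0 < l ∧ l < ∞ ∧ ∫⁻ x, Φ (g x / l) ≤ 1}

section Modulation

variable {ι : Type*} [Fintype ι]

/-- The Gaussian `π ^ (-n / 4) exp (-|x| ^ 2 / 2)` on `ℝ^n`. -/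
def gauss (x : EuclideanSpace ℝ ι) : ℂ :=
  ((Real.pi ^ (-(Fintype.card ι : ℝ) / 4) * Real.exp (-‖x‖ ^ 2 / 2) : ℝ) : ℂ)

/-- The short-time Fourier transform
`(2π) ^ (-n / 2) ⟨f, conj (φ (· - x)) exp (-i ⟨·, ξ⟩)⟩` of `f ∈ S_{1/2}'(ℝ^n)`, with the Gaussian
`φ` as window. -/
def stft (f : GSRoumieuDual (EuclideanSpace ℝ ι) (1 / 2)) (x ξ : EuclideanSpace ℝ ι) : ℂ :=
  (((2 * Real.pi) ^ (-(Fintype.card ι : ℝ) / 2) : ℝ) : ℂ) *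
    pairHalf f (fun y => conj (gauss (y - x)) * Complex.exp (-Complex.I * (inner ℝ y ξ : ℝ)))

/-- The norm of the Orlicz modulation space `M^{Φ,Ψ}_{(ω)}(ℝ^n)`, possibly infinite. -/
def orliczModNorm (Φ Ψ : ℝ≥0∞ → ℝ≥0∞) (ω : EuclideanSpace ℝ ι × EuclideanSpace ℝ ι → ℝ)
    (f : GSRoumieuDual (EuclideanSpace ℝ ι) (1 / 2)) : ℝ≥0∞ :=
  luxNorm Ψ (fun ξ => luxNorm Φ (fun x => ‖stft f x ξ‖ₑ * ENNReal.ofReal (ω (x, ξ))))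

/-- The Orlicz modulation space `M^{Φ,Ψ}_{(ω)}(ℝ^n)`. -/
def OrliczMod (Φ Ψ : ℝ≥0∞ → ℝ≥0∞) (ω : EuclideanSpace ℝ ι × EuclideanSpace ℝ ι → ℝ) :
    Set (GSRoumieuDual (EuclideanSpace ℝ ι) (1 / 2)) :=
  {f | orliczModNorm Φ Ψ ω f < ∞}

/-- The norm of the classical modulation space `M^{p,q}_{(ω)}(ℝ^n)`, possibly infinite. -/
def modNorm (p q : ℝ≥0∞) (ω : EuclideanSpace ℝ ι × EuclideanSpace ℝ ι → ℝ)
    (f : GSRoumieuDual (EuclideanSpace ℝ ι) (1 / 2)) : ℝ≥0∞ :=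
  eLpNorm (fun ξ => eLpNorm (fun x => ‖stft f x ξ‖ₑ * ENNReal.ofReal (ω (x, ξ))) p volume)
    q volume

/-- The classical modulation space `M^{p,q}_{(ω)}(ℝ^n)`. -/
def Modulation (p q : ℝ≥0∞) (ω : EuclideanSpace ℝ ι × EuclideanSpace ℝ ι → ℝ) :
    Set (GSRoumieuDual (EuclideanSpace ℝ ι) (1 / 2)) :=
  {f | modNorm p q ω f < ∞}

/-! ## Wigner distributions -/

/-- The point `(x, ξ)` of `ℝ^{2d} = ℝ^d × ℝ^d`. -/
def pair (x ξ : EuclideanSpace ℝ ι) : EuclideanSpace ℝ (ι ⊕ ι) :=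
  WithLp.toLp 2 (Sum.elim x ξ)

/-- The action of a real matrix on `ℝ^d`. -/
def act [DecidableEq ι] (A : Matrix ι ι ℝ) (x : EuclideanSpace ℝ ι) : EuclideanSpace ℝ ι :=
  WithLp.toLp 2 (A.mulVec x)

/-- The transpose of the map `f₁ ⊗ conj f₂ ↦ W^A_{f₁,f₂}`:
`(u, v) ↦ (2π) ^ (-d / 2) ∫ G (u - A (u - v), ξ) exp (-i ⟨u - v, ξ⟩) dξ`. -/
def wignerTranspose [DecidableEq ι] (A : Matrix ι ι ℝ) (G : EuclideanSpace ℝ (ι ⊕ ι) → ℂ)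
    (u v : EuclideanSpace ℝ ι) : ℂ :=
  (((2 * Real.pi) ^ (-(Fintype.card ι : ℝ) / 2) : ℝ) : ℂ) *
    ∫ ξ : EuclideanSpace ℝ ι,
      G (pair (u - act A (u - v)) ξ) * Complex.exp (-Complex.I * (inner ℝ (u - v) ξ : ℝ))

/-- `W ∈ Σ_1'(ℝ^{2d})` is the `A`-Wigner distribution of `F₁, F₂ ∈ Σ_1'(ℝ^d)`, that is, the
partial Fourier transform in `y` of `F₁ (x + A y) conj (F₂ (x + (A - I) y))` in the sense of
distributions: with `u = x + A y` and `v = x + (A - I) y`,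
`⟨W, G⟩ = ⟨F₁ ⊗ conj F₂, K⟩` for every `G ∈ Σ_1(ℝ^{2d})`, where `K = wignerTranspose A G`,
`⟨F₁ ⊗ H, K⟩ = ⟨F₁, u ↦ ⟨H, K (u, ·)⟩⟩` and `⟨conj F₂, g⟩ = conj ⟨F₂, conj g⟩`. -/
def IsWigner [DecidableEq ι] (A : Matrix ι ι ℝ) (F₁ F₂ : GSBeurlingDual (EuclideanSpace ℝ ι) 1)
    (W : GSBeurlingDual (EuclideanSpace ℝ (ι ⊕ ι)) 1) : Prop :=
  ∀ G ∈ GSBeurling (EuclideanSpace ℝ (ι ⊕ ι)) 1,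
    pairOne W G =
      pairOne F₁ (fun u => conj (pairOne F₂ (fun v => conj (wignerTranspose A G u v))))

end Modulation

end

end OrliczModulation

open OrliczModulation

open OrliczModulation
open MeasureTheory Filter Topology
open scoped ENNReal NNReal Nat ComplexConjugate

/-! The argument takes place in phase space. Let φ_{x,ξ} be the time-frequency shift `atomW gauss x
ξ` of the Gaussian; up to a constant, V_φ f(x,ξ) is ⟨f, φ_{x,ξ}⟩. A test function is recovered from
its own transform, g = c² ∫ `hat g`(z) φ_z dz (`hat_inversion`). Here `hat g` decays faster than
every exponential if g ∈ Σ_1, and like a Gaussian if g ∈ S_{1/2}, so functionals may be moved under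
the integral (`functional_superposition`). Hence a functional is determined by its values on the
φ_z, every exponentially bounded density on phase space defines an element of Σ_1', and |V_φ f| is
dominated by its own averages against a rapidly decaying kernel. The last fact makes V_φ f
exponentially bounded when f lies in an Orlicz modulation space, which gives the inclusion in Σ_1'.

The transposed Wigner map sends a shifted Gaussian on ℝ^{2d} to a phase times a time-frequency shift
of one fixed window, the shift depending linearly on the point of phase space
(`wignerTranspose_atomW`). This yields existence of W and, for a = |V_φ f| averaged against an
exponential kernel of any prescribed rate, the bound |V_φ W(x,ξ,η,y)| ≤ C a₁(x-Ay, ξ+(1-A*)η)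
a₂(x+(1-A)y, ξ-A*η) (`exists_enorm_wignerSTFT_le`). A moderate weight is equivalent to a continuous
w with w(x+y) ≤ e^{r|y|} w(x), and such a w can be moved inside the average at the price of r in the
rate. What remains is a bilinear estimate from L^{Φ₁,Ψ₁} × L^{Φ₂,Ψ₂} to L^{p,q} for averaged
functions.

Averaging makes the behaviour of the Young functions near 0 the only relevant one. If a lies in the
unit ball of L^{Φ,Ψ}, its average is at most K H(ξ) u(x,ξ), where ∫Ψ(H) ≤ 1, ∫Φ(u(·,ξ)) ≤ 1 for
every ξ, and H, u, Ψ(H), Φ(u) are all below a prescribed κ > 0 (`IsKernel.exists_isEnvelope`).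

For small arguments and θ = p/q one has (xy)^p ≤ C(Φ₁(x)Φ₂(y)^θ + Φ₂(y)Φ₁(x)^θ)
(`exists_mul_rpow_le`), and likewise for Ψ₁, Ψ₂. If Φ₁ dominates t^p, combine this with t^q ≤
cΦ₂(t); the situation with the roles exchanged is the same. If both functions are convex in t^p,
shrink the argument with the larger Young value until the two values are at most a common level s;
there the condition on the essential inverses gives (xy)^p ≤ c^p s^{1+θ}.

Inserting this in the inner integral and using Jensen for the concave power θ, in x and then in ξ,
bounds the inner p-th power by a constant times N(η,y)^θ. Here N is a correlation of the functions
Φ_j(u_j), Ψ_j(H_j) and has total mass at most 1 (`lintegral_corrTwo_le`); the outer L^q norm is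
therefore bounded. Homogeneity gives the norm estimate, and sesquilinearity of W gives continuity.
-/

namespace OrliczModulation

noncomputable section

/-! ## Elementary estimates with factorials -/

/-- Smooth functions. -/
abbrev Smooth {V W : Type*} [NormedAddCommGroup V] [NormedSpace ℝ V] [NormedAddCommGroup W]
    [NormedSpace ℝ W] (f : V → W) : Prop :=
  ContDiff ℝ ((⊤ : ℕ∞) : WithTop ℕ∞) f

theorem natCast_le_smooth (l : ℕ) : (l : WithTop ℕ∞) ≤ ((⊤ : ℕ∞) : WithTop ℕ∞) := by
  exact_mod_cast le_top

theorem factorial_mul_rpow (k l : ℕ) (s : ℝ) :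
    ((k ! : ℝ) * (l ! : ℝ)) ^ s = (k ! : ℝ) ^ s * (l ! : ℝ) ^ s :=
  Real.mul_rpow (by positivity) (by positivity)

theorem one_le_factorial_rpow {s : ℝ} (hs : 0 ≤ s) (k : ℕ) : 1 ≤ (k ! : ℝ) ^ s :=
  Real.one_le_rpow (by exact_mod_cast k.factorial_pos) hs

theorem factorial_rpow_mul_le {s : ℝ} (hs : 0 ≤ s) {j l : ℕ} (h : j ≤ l) :
    (j ! : ℝ) ^ s * ((l - j)! : ℝ) ^ s ≤ (l ! : ℝ) ^ s := by
  rw [← factorial_mul_rpow]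
  refine Real.rpow_le_rpow (by positivity) ?_ hs
  exact_mod_cast Nat.le_of_dvd l.factorial_pos (Nat.factorial_mul_factorial_dvd_factorial h)

theorem factorial_add_rpow_le {s : ℝ} (hs : 0 ≤ s) (hs1 : s ≤ 1) (k N : ℕ) :
    ((k + N)! : ℝ) ^ s ≤ 2 ^ (k + N) * (k ! : ℝ) ^ s * (N ! : ℝ) ^ s := by
  have h1 : ((k + N)! : ℝ) ≤ 2 ^ (k + N) * ((k ! : ℝ) * (N ! : ℝ)) := by
    have h := Nat.add_choose_mul_factorial_mul_factorial k N
    have h2 : (k + N).choose N ≤ 2 ^ (k + N) := Nat.choose_le_two_pow _ _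
    have h3 : (k + N)! ≤ 2 ^ (k + N) * (k ! * N !) := by
      rw [← h, mul_assoc]
      exact Nat.mul_le_mul_right _ h2
    exact_mod_cast h3
  calc ((k + N)! : ℝ) ^ s ≤ (2 ^ (k + N) * ((k ! : ℝ) * (N ! : ℝ))) ^ s :=
        Real.rpow_le_rpow (by positivity) h1 hs
    _ = ((2 : ℝ) ^ (k + N)) ^ s * ((k ! : ℝ) ^ s * (N ! : ℝ) ^ s) := by
        rw [Real.mul_rpow (by positivity) (by positivity), factorial_mul_rpow]
    _ ≤ ((2 : ℝ) ^ (k + N)) * ((k ! : ℝ) ^ s * (N ! : ℝ) ^ s) := by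
        gcongr
        exact Real.rpow_le_self_of_one_le (one_le_pow₀ (by norm_num)) hs1
    _ = _ := by ring

theorem factorial_succ_rpow_le {s : ℝ} (hs : 0 ≤ s) (hs1 : s ≤ 1) (k : ℕ) :
    ((k + 1)! : ℝ) ^ s ≤ 2 ^ (k + 1) * (k ! : ℝ) ^ s := by
  simpa using factorial_add_rpow_le hs hs1 k 1

theorem pow_le_exp_mul_factorial {a : ℝ} (ha : 0 ≤ a) (k : ℕ) :
    a ^ k ≤ Real.exp a * (k ! : ℝ) ^ (1 : ℝ) := by
  have hk : (0 : ℝ) < (k ! : ℝ) := by exact_mod_cast k.factorial_pos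
  have h1 := Real.pow_div_factorial_le_exp (x := a) ha k
  rw [div_le_iff₀ hk] at h1
  simpa using h1

/-- Sum the moment bounds against the coefficients of exp(t/(2h)): the k-th term is at most B
2^{-k}, and the geometric series gives 2B. -/
theorem le_exp_of_moments {t a B h : ℝ} (hh : 0 < h)
    (H : ∀ k : ℕ, t ^ k * a ≤ B * (h ^ k * (k ! : ℝ))) :
    a ≤ 2 * B * Real.exp (-(t / (2 * h))) := by
  have h1 : HasSum (fun k : ℕ => (t / (2 * h)) ^ k / (k ! : ℝ)) (Real.exp (t / (2 * h))) := by
    rw [Real.exp_eq_exp_ℝ]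
    exact NormedSpace.expSeries_div_hasSum_exp (t / (2 * h))
  have h2 : HasSum (fun k : ℕ => B * (1 / 2 : ℝ) ^ k) (B * 2) := hasSum_geometric_two.mul_left B
  have h3 : Real.exp (t / (2 * h)) * a ≤ B * 2 := by
    refine hasSum_le (fun k => ?_) (h1.mul_right a) h2
    have hk : (0 : ℝ) < (k ! : ℝ) := by exact_mod_cast k.factorial_pos
    have := H k
    rw [div_pow, mul_pow, one_div, inv_pow]
    calc t ^ k / (2 ^ k * h ^ k) / (k ! : ℝ) * a
        = (t ^ k * a) / (2 ^ k * h ^ k * (k ! : ℝ)) := by field_simp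
      _ ≤ (B * (h ^ k * (k ! : ℝ))) / (2 ^ k * h ^ k * (k ! : ℝ)) := by gcongr
      _ = _ := by field_simp
  rw [Real.exp_neg, ← div_eq_mul_inv, le_div_iff₀ (Real.exp_pos _)]
  linarith

/-- Only even moments are used: since (2k)!^{1/2} ≤ 2^k k!, they are moments of t² of the kind
treated in `le_exp_of_moments`, with 2h² in place of h. -/
theorem le_exp_sq_of_moments {t a B h : ℝ} (hh : 0 < h) (hB : 0 ≤ B)
    (H : ∀ k : ℕ, t ^ k * a ≤ B * (h ^ k * (k ! : ℝ) ^ (1 / 2 : ℝ))) :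
    a ≤ 2 * B * Real.exp (-(t ^ 2 / (4 * h ^ 2))) := by
  have := le_exp_of_moments (t := t ^ 2) (a := a) (B := B) (h := 2 * h ^ 2)
    (by positivity) (fun k => ?_)
  · convert this using 4
    ring
  · have h1 := H (k + k)
    have h2 := factorial_add_rpow_le (s := 1 / 2) (by norm_num) (by norm_num) k k
    have sk : (k ! : ℝ) ^ (1 / 2 : ℝ) * (k ! : ℝ) ^ (1 / 2 : ℝ) = k ! := by
      rw [← Real.rpow_add (by exact_mod_cast k.factorial_pos)]; norm_num
    have h4 : (((k + k)! : ℝ)) ≤ (2 ^ k * (k ! : ℝ)) ^ 2 := by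
      have h := Nat.add_choose_mul_factorial_mul_factorial k k
      have h2 : (k + k).choose k ≤ 2 ^ (k + k) := Nat.choose_le_two_pow _ _
      have h3 : (k + k)! ≤ (2 ^ k * k !) ^ 2 := by
        rw [← h]
        calc (k + k).choose k * k ! * k ! ≤ 2 ^ (k + k) * k ! * k ! := by gcongr
          _ = _ := by ring
      exact_mod_cast h3
    have h5 : ((k + k)! : ℝ) ^ (1 / 2 : ℝ) ≤ 2 ^ k * (k ! : ℝ) := by
      rw [← Real.sqrt_eq_rpow]
      exact Real.sqrt_le_iff.2 ⟨by positivity, h4⟩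
    calc (t ^ 2) ^ k * a = t ^ (k + k) * a := by ring
      _ ≤ _ := h1
      _ ≤ B * (h ^ (k + k) * (2 ^ k * (k ! : ℝ))) := by gcongr
      _ = _ := by ring

theorem add_pow_le_two_pow {a b : ℝ} (ha : 0 ≤ a) (hb : 0 ≤ b) (k : ℕ) :
    (a + b) ^ k ≤ 2 ^ k * (a ^ k + b ^ k) := by
  refine (add_pow_le ha hb k).trans ?_
  gcongr
  · norm_num
  · omega

/-! ## Leibniz estimates -/

section Tools

variable {V : Type*} [NormedAddCommGroup V] [NormedSpace ℝ V]

/-- In the Leibniz sum j!^s (l-j)!^s ≤ l!^s, and what is left is the binomial expansion of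
(h₁+h₂)^l. The factor K stands for a power of ‖x‖ that is charged to f alone. -/
theorem norm_iteratedFDeriv_mul_le_of_bounds {s a b h₁ h₂ K : ℝ} (hs : 0 ≤ s) (hK : 0 ≤ K)
    (hh₁ : 0 ≤ h₁) (hh₂ : 0 ≤ h₂) (ha : 0 ≤ a) {f g : V → ℂ} (hf : Smooth f)
    (hg : Smooth g) (x : V)
    (Hf : ∀ j, K * ‖iteratedFDeriv ℝ j f x‖ ≤ a * (h₁ ^ j * (j ! : ℝ) ^ s))
    (Hg : ∀ j, ‖iteratedFDeriv ℝ j g x‖ ≤ b * (h₂ ^ j * (j ! : ℝ) ^ s)) (l : ℕ) :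
    K * ‖iteratedFDeriv ℝ l (fun y => f y * g y) x‖ ≤
      a * b * ((h₁ + h₂) ^ l * (l ! : ℝ) ^ s) := by
  have hb : 0 ≤ b := by
    have := (norm_nonneg _).trans (Hg 0)
    simpa using this
  have h1 := norm_iteratedFDeriv_mul_le (𝕜 := ℝ) hf hg x (natCast_le_smooth l)
  calc K * ‖iteratedFDeriv ℝ l (fun y => f y * g y) x‖
      ≤ K * ∑ i ∈ Finset.range (l + 1), (l.choose i : ℝ) * ‖iteratedFDeriv ℝ i f x‖ *
          ‖iteratedFDeriv ℝ (l - i) g x‖ := by gcongr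
    _ = ∑ i ∈ Finset.range (l + 1), (l.choose i : ℝ) * (K * ‖iteratedFDeriv ℝ i f x‖) *
          ‖iteratedFDeriv ℝ (l - i) g x‖ := by
        rw [Finset.mul_sum]; exact Finset.sum_congr rfl fun i _ => by ring
    _ ≤ ∑ i ∈ Finset.range (l + 1), (l.choose i : ℝ) * (a * (h₁ ^ i * (i ! : ℝ) ^ s)) *
          (b * (h₂ ^ (l - i) * ((l - i)! : ℝ) ^ s)) := by
        refine Finset.sum_le_sum fun i _ => ?_
        have := Hf i
        have := Hg (l - i)
        gcongr
    _ ≤ ∑ i ∈ Finset.range (l + 1), a * b * (l ! : ℝ) ^ s *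
          (h₁ ^ i * h₂ ^ (l - i) * (l.choose i : ℝ)) := by
        refine Finset.sum_le_sum fun i hi => ?_
        have hil : i ≤ l := by
          have := Finset.mem_range.1 hi
          omega
        have := factorial_rpow_mul_le hs hil
        calc _ = a * b * ((i ! : ℝ) ^ s * ((l - i)! : ℝ) ^ s) *
              (h₁ ^ i * h₂ ^ (l - i) * (l.choose i : ℝ)) := by ring
          _ ≤ _ := by gcongr
    _ = _ := by
        rw [← Finset.mul_sum, ← add_pow]; ring

/-- The hypothesis says that f is an exponential with linear exponent c, so every differentiation
produces one more factor ‖c‖. -/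
theorem norm_iteratedFDeriv_le_of_fderiv_eq_smul {f : V → ℂ} (hf : Smooth f)
    (c : V →L[ℝ] ℂ) (hc : ∀ x, fderiv ℝ f x = f x • c) (l : ℕ) (x : V) :
    ‖iteratedFDeriv ℝ l f x‖ ≤ ‖c‖ ^ l * ‖f x‖ := by
  induction l with
  | zero => simp
  | succ l ih =>
    rw [← norm_iteratedFDeriv_fderiv]
    let T : ℂ →L[ℝ] (V →L[ℝ] ℂ) :=
      (ContinuousLinearMap.lsmul ℝ ℂ : ℂ →L[ℝ] (V →L[ℝ] ℂ) →L[ℝ] (V →L[ℝ] ℂ)).flip c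
    have h1 : fderiv ℝ f = T ∘ f := by
      ext1 x
      rw [hc x]; rfl
    have hT : ‖T‖ ≤ ‖c‖ := by
      refine ContinuousLinearMap.opNorm_le_bound _ (norm_nonneg _) fun z => ?_
      change ‖z • c‖ ≤ _
      rw [norm_smul, mul_comm]
    rw [h1, T.iteratedFDeriv_comp_left (hf.contDiffAt) (natCast_le_smooth l)]
    refine (ContinuousLinearMap.norm_compContinuousMultilinearMap_le _ _).trans ?_
    calc ‖T‖ * ‖iteratedFDeriv ℝ l f x‖ ≤ ‖c‖ * (‖c‖ ^ l * ‖f x‖) := by gcongr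
      _ = _ := by ring

/-- Powers of ‖x‖ are split between x - a and a. Stating the bound on ‖a‖ through its powers serves
both orders: E is exp((‖a‖/h)²) for s = 1/2 and exp(‖a‖/h) for s = 1. The case k = 0 gives E ≥ 1. -/
theorem GSNormLE.translate {s h B E : ℝ} {f : V → ℂ} {a : V} (hs : 0 ≤ s) (hh : 0 ≤ h)
    (hf : GSNormLE s h B f)
    (ha : ∀ k : ℕ, ‖a‖ ^ k ≤ E * (h ^ k * (k ! : ℝ) ^ s)) :
    GSNormLE s (2 * h) (2 * (B * E)) (fun y => f (y - a)) := by
  intro k l x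
  have hB := hf.nonneg
  have hE : 1 ≤ E := by simpa using ha 0
  rw [iteratedFDeriv_comp_sub, factorial_mul_rpow]
  have h1 : ‖x‖ ^ k ≤ 2 ^ k * (‖x - a‖ ^ k + ‖a‖ ^ k) := by
    refine (pow_le_pow_left₀ (norm_nonneg _) ?_ k).trans
      (add_pow_le_two_pow (norm_nonneg (x - a)) (norm_nonneg a) k)
    simpa using norm_add_le (x - a) a
  have h2 := hf k l (x - a)
  have h3 := hf 0 l (x - a)
  rw [factorial_mul_rpow] at h2 h3
  simp only [pow_zero, one_mul, zero_add, Nat.factorial_zero, Nat.cast_one, Real.one_rpow] at h3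
  set D := ‖iteratedFDeriv ℝ l f (x - a)‖
  have hl := one_le_factorial_rpow hs l
  calc ‖x‖ ^ k * D ≤ (2 ^ k * (‖x - a‖ ^ k + ‖a‖ ^ k)) * D := by gcongr
    _ = 2 ^ k * (‖x - a‖ ^ k * D + ‖a‖ ^ k * D) := by ring
    _ ≤ 2 ^ k * (B * (h ^ (k + l) * ((k ! : ℝ) ^ s * (l ! : ℝ) ^ s)) +
          (E * (h ^ k * (k ! : ℝ) ^ s)) * (B * (h ^ l * (l ! : ℝ) ^ s))) := by
        have := ha k
        gcongr
    _ = 2 ^ k * (B * (1 + E)) * (h ^ (k + l) * ((k ! : ℝ) ^ s * (l ! : ℝ) ^ s)) := by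
        rw [pow_add]; ring
    _ ≤ 2 ^ (k + l) * (B * (E + E)) * (h ^ (k + l) * ((k ! : ℝ) ^ s * (l ! : ℝ) ^ s)) := by
        gcongr
        · norm_num
        · omega
    _ = _ := by rw [mul_pow]; ring

theorem GSNormLE.mul_bounded {s h h' B b : ℝ} {f g : V → ℂ} (hs : 0 ≤ s) (hh : 0 ≤ h)
    (hh' : 0 ≤ h') (hfs : Smooth f) (hgs : Smooth g) (hf : GSNormLE s h B f)
    (hg : ∀ (j : ℕ) (x : V), ‖iteratedFDeriv ℝ j g x‖ ≤ b * (h' ^ j * (j ! : ℝ) ^ s)) :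
    GSNormLE s (h + h') (B * b) (fun y => f y * g y) := by
  intro k l x
  have hB := hf.nonneg
  have hb : 0 ≤ b := by
    have := (norm_nonneg _).trans (hg 0 x)
    simpa using this
  have := norm_iteratedFDeriv_mul_le_of_bounds (a := B * (h ^ k * (k ! : ℝ) ^ s)) (b := b)
    (K := ‖x‖ ^ k) hs (by positivity) hh hh' (by positivity) hfs hgs x
    (fun j => by
      have := hf k j x
      rw [factorial_mul_rpow] at this
      refine this.trans (le_of_eq ?_)
      rw [pow_add]; ring) (fun j => hg j x) l
  refine this.trans ?_
  rw [factorial_mul_rpow, pow_add]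
  calc _ = (B * b * ((k ! : ℝ) ^ s * (l ! : ℝ) ^ s)) * (h ^ k * (h + h') ^ l) := by ring
    _ ≤ (B * b * ((k ! : ℝ) ^ s * (l ! : ℝ) ^ s)) * ((h + h') ^ k * (h + h') ^ l) := by
        gcongr
        linarith
    _ = _ := by ring

/-- Moments cost powers of the norm of the inverse map, derivatives powers of the norm of the map
itself; the maximum covers both. -/
theorem GSNormLE.comp_equiv {W : Type*} [NormedAddCommGroup W] [NormedSpace ℝ W]
    {s h B : ℝ} {f : V → ℂ} (hfs : Smooth f) (hf : GSNormLE s h B f) (e : W ≃L[ℝ] V) :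
    GSNormLE s (max ‖(e : W →L[ℝ] V)‖ ‖(e.symm : V →L[ℝ] W)‖ * h) B (f ∘ e) := by
  intro k l x
  have hB := hf.nonneg
  set M := max ‖(e : W →L[ℝ] V)‖ ‖(e.symm : V →L[ℝ] W)‖
  have hx : ‖x‖ ≤ M * ‖e x‖ := by
    calc ‖x‖ = ‖(e.symm : V →L[ℝ] W) (e x)‖ := by simp
      _ ≤ ‖(e.symm : V →L[ℝ] W)‖ * ‖e x‖ := ContinuousLinearMap.le_opNorm _ _
      _ ≤ M * ‖e x‖ := by gcongr; exact le_max_right _ _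
  have hD : ‖iteratedFDeriv ℝ l (f ∘ e) x‖ ≤ M ^ l * ‖iteratedFDeriv ℝ l f (e x)‖ := by
    have := (e : W →L[ℝ] V).iteratedFDeriv_comp_right hfs x (natCast_le_smooth l)
    rw [ContinuousLinearEquiv.coe_coe] at this
    rw [this]
    refine (ContinuousMultilinearMap.norm_compContinuousLinearMap_le _ _).trans ?_
    rw [Finset.prod_const, Finset.card_univ, Fintype.card_fin, mul_comm]
    gcongr
    exact le_max_left _ _
  have hM : 0 ≤ M := (norm_nonneg _).trans (le_max_left _ _)
  calc ‖x‖ ^ k * ‖iteratedFDeriv ℝ l (f ∘ e) x‖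
      ≤ (M * ‖e x‖) ^ k * (M ^ l * ‖iteratedFDeriv ℝ l f (e x)‖) := by gcongr
    _ = M ^ (k + l) * (‖e x‖ ^ k * ‖iteratedFDeriv ℝ l f (e x)‖) := by
        rw [mul_pow, pow_add]; ring
    _ ≤ M ^ (k + l) * (B * (h ^ (k + l) * ((k ! : ℝ) * (l ! : ℝ)) ^ s)) := by
        exact mul_le_mul_of_nonneg_left (hf k l (e x)) (by positivity)
    _ = _ := by rw [mul_pow]; ring

end Tools

/-! ## The Gaussian -/

section Gauss

variable {V : Type*} [NormedAddCommGroup V] [InnerProductSpace ℝ V]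

theorem norm_iteratedFDeriv_clm_succ_le (L : V →L[ℝ] (V →L[ℝ] ℝ)) (m : ℕ) (x : V) :
    ‖iteratedFDeriv ℝ (m + 1) (fun y => L y) x‖ ≤ if m = 0 then ‖L‖ else 0 := by
  rw [← norm_iteratedFDeriv_fderiv]
  have : fderiv ℝ (fun y => L y) = fun _ => L := by
    ext1 y
    exact L.fderiv
  rw [this]
  split_ifs with hm
  · subst hm; simp
  · rw [iteratedFDeriv_const_of_ne hm]; simp

/-- Since g' = -⟨y,·⟩ g with a linear first factor, only two Leibniz terms survive: the norm of
order l+1 is at most ‖x‖ times that of order l plus l times that of order l-1. The bound (‖x‖+√l)^l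
reproduces itself under this recursion. -/
theorem norm_iteratedFDeriv_gaussian_le (c : ℝ) (hc : 0 ≤ c) (l : ℕ) (x : V) :
    ‖iteratedFDeriv ℝ l (fun y : V => c * Real.exp (-‖y‖ ^ 2 / 2)) x‖ ≤
      (‖x‖ + √l) ^ l * (c * Real.exp (-‖x‖ ^ 2 / 2)) := by
  set g : V → ℝ := fun y => c * Real.exp (-‖y‖ ^ 2 / 2) with hg
  have hgs : Smooth g := by
    have : ContDiff ℝ ((⊤ : ℕ∞) : WithTop ℕ∞) fun y : V => ‖y‖ ^ 2 := contDiff_norm_sq ℝ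
    exact contDiff_const.mul ((this.neg.div_const 2).exp)
  have hg0 : ∀ y, 0 ≤ g y := fun y => by positivity
  let L : V →L[ℝ] (V →L[ℝ] ℝ) := -innerSL ℝ
  have hLx : ∀ y, ‖L y‖ = ‖y‖ := fun y => by
    have : L y = -(innerSL ℝ y) := rfl
    rw [this, norm_neg, innerSL_apply_norm]
  have hL : ‖L‖ ≤ 1 := ContinuousLinearMap.opNorm_le_bound _ zero_le_one fun y => by
    rw [hLx, one_mul]
  have hfd : fderiv ℝ g = fun y => g y • L y := by
    ext1 y
    have h1 : HasFDerivAt (fun y : V => ‖y‖ ^ 2) (2 • innerSL ℝ y) y :=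
      (hasStrictFDerivAt_norm_sq y).hasFDerivAt
    have h2 := (((h1.neg.mul_const (1 / 2 : ℝ)).exp).const_mul c)
    have h3 : g = fun y : V => c * Real.exp ((-fun y : V => ‖y‖ ^ 2) y * (1 / 2)) := by
      ext y
      simp only [hg, Pi.neg_apply]
      congr 2; ring
    rw [h3, h2.fderiv]
    ext v
    have : L y v = -(inner ℝ y v) := rfl
    simp only [_root_.smul_apply, _root_.neg_apply, Pi.neg_apply,
      smul_eq_mul, this, innerSL_apply_apply, nsmul_eq_mul]
    push_cast
    ring
  have key : ∀ l, ‖iteratedFDeriv ℝ (l + 1) g x‖ ≤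
      ‖x‖ * ‖iteratedFDeriv ℝ l g x‖ + l * ‖iteratedFDeriv ℝ (l - 1) g x‖ := by
    intro l
    rw [← norm_iteratedFDeriv_fderiv, hfd]
    have h1 := norm_iteratedFDeriv_smul_le (𝕜 := ℝ) hgs
      (L.contDiff (n := ((⊤ : ℕ∞) : WithTop ℕ∞))) x (natCast_le_smooth l)
    refine h1.trans ?_
    rw [Finset.sum_range_succ]
    rw [Nat.choose_self, Nat.cast_one, one_mul, Nat.sub_self, norm_iteratedFDeriv_zero, hLx,
      add_comm, mul_comm ‖x‖]
    refine add_le_add le_rfl ?_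
    cases l with
    | zero => simp
    | succ l =>
      rw [Finset.sum_range_succ, Finset.sum_eq_zero, zero_add]
      · have := norm_iteratedFDeriv_clm_succ_le L 0 x
        rw [if_pos rfl] at this
        have h5 : (l + 1).choose l = l + 1 := by simp
        have h6 : l + 1 - l = 0 + 1 := by omega
        rw [h5, h6, Nat.add_sub_cancel]
        calc _ ≤ ((l + 1 : ℕ) : ℝ) * ‖iteratedFDeriv ℝ l g x‖ * 1 := by
              gcongr
              exact this.trans hL
          _ = _ := by ring
      · intro i hi
        have hi' := Finset.mem_range.1 hi
        obtain ⟨m, hm⟩ : ∃ m, l + 1 - i = (m + 1) + 1 := ⟨l - 1 - i, by omega⟩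
        have := norm_iteratedFDeriv_clm_succ_le L (m + 1) x
        rw [if_neg (by omega)] at this
        rw [hm, le_antisymm this (norm_nonneg _), mul_zero]
  -- The recursion has depth two, so the induction carries two consecutive orders.
  have main : ∀ l, ‖iteratedFDeriv ℝ l g x‖ ≤ (‖x‖ + √l) ^ l * g x ∧
      ‖iteratedFDeriv ℝ (l + 1) g x‖ ≤ (‖x‖ + √(l + 1 : ℕ)) ^ (l + 1) * g x := by
    intro l
    induction l with
    | zero =>
      refine ⟨by simp [abs_of_nonneg (hg0 x)], ?_⟩
      have := key 0
      simp only [norm_iteratedFDeriv_zero, Real.norm_of_nonneg (hg0 x)] at this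
      simp only [zero_add, Nat.cast_one, Real.sqrt_one, pow_one]
      refine this.trans ?_
      have := hg0 x
      simp
      linarith
    | succ l ih =>
      refine ⟨ih.2, ?_⟩
      have h1 := key (l + 1)
      rw [Nat.add_sub_cancel] at h1
      set t := ‖x‖
      have ht : 0 ≤ t := norm_nonneg _
      set S := √((l + 1 + 1 : ℕ) : ℝ) with hS
      have hSS : S ^ 2 = (l + 1 + 1 : ℕ) := Real.sq_sqrt (by positivity)
      have hS0 : 0 ≤ S := Real.sqrt_nonneg _
      have hS1 : √((l + 1 : ℕ) : ℝ) ≤ S := Real.sqrt_le_sqrt (by push_cast; linarith)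
      have hS2 : √((l : ℕ) : ℝ) ≤ S := Real.sqrt_le_sqrt (by push_cast; linarith)
      have hgx := hg0 x
      calc ‖iteratedFDeriv ℝ (l + 1 + 1) g x‖ ≤ _ := h1
        _ ≤ t * ((t + S) ^ (l + 1) * g x) + ((l + 1 : ℕ) : ℝ) * ((t + S) ^ l * g x) := by
            gcongr
            · refine ih.2.trans ?_
              gcongr
            · refine ih.1.trans ?_
              gcongr
        _ = (t + S) ^ l * g x * (t * (t + S) + ((l + 1 : ℕ) : ℝ)) := by ring
        -- Here S² = l+2 pays for the summand l+1.
        _ ≤ (t + S) ^ l * g x * (t + S) ^ 2 := by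
            gcongr
            push_cast at hSS ⊢
            nlinarith [mul_nonneg ht hS0]
        _ = _ := by ring
  exact (main l).1

variable {ι : Type*} [Fintype ι]

theorem smooth_gauss : Smooth (gauss : EuclideanSpace ℝ ι → ℂ) := by
  have : ContDiff ℝ ((⊤ : ℕ∞) : WithTop ℕ∞) fun y : EuclideanSpace ℝ ι => ‖y‖ ^ 2 :=
    contDiff_norm_sq ℝ
  exact Complex.ofRealCLM.contDiff.comp (contDiff_const.mul ((this.neg.div_const 2).exp))

/-- Of the two factors exp(-t²/4) of the Gaussian, one absorbs t^k and the other t^l, each power at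
the price of 2 to that power times the root of a factorial. With √l^l ≤ 3^l l!^{1/2} this leads to
the radius 6 = 2·3. -/
theorem exists_gsNormLE_gauss :
    ∃ B : ℝ, GSNormLE (1 / 2) 6 B (gauss : EuclideanSpace ℝ ι → ℂ) := by
  set c : ℝ := Real.pi ^ (-(Fintype.card ι : ℝ) / 4) with hc
  have hc0 : 0 ≤ c := by positivity
  refine ⟨2 * c, fun k l x => ?_⟩
  have h0 : ‖iteratedFDeriv ℝ l (gauss : EuclideanSpace ℝ ι → ℂ) x‖ =
      ‖iteratedFDeriv ℝ l
        (fun y : EuclideanSpace ℝ ι => c * Real.exp (-‖y‖ ^ 2 / 2)) x‖ := by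
    have : ContDiff ℝ ((⊤ : ℕ∞) : WithTop ℕ∞) fun y : EuclideanSpace ℝ ι => ‖y‖ ^ 2 :=
      contDiff_norm_sq ℝ
    exact Complex.ofRealLI.norm_iteratedFDeriv_comp_left
      (f := fun y : EuclideanSpace ℝ ι => c * Real.exp (-‖y‖ ^ 2 / 2))
      (contDiff_const.mul ((this.neg.div_const 2).exp)).contDiffAt (natCast_le_smooth l)
  rw [h0, factorial_mul_rpow]
  have h1 := norm_iteratedFDeriv_gaussian_le c hc0 l x
  set t := ‖x‖ with ht_def
  have ht : 0 ≤ t := norm_nonneg _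
  have e1 : ∀ m : ℕ, t ^ m ≤ 2 ^ m * (Real.exp (t ^ 2 / 4) * (m ! : ℝ) ^ (1 / 2 : ℝ)) := by
    intro m
    have := pow_le_exp_mul_sqrt_factorial (a := t / 2) (by positivity) m
    rw [div_pow, div_pow, div_le_iff₀ (by positivity)] at this
    refine this.trans (le_of_eq ?_)
    norm_num
    ring
  have e2 : √l ^ l ≤ 3 ^ l * (l ! : ℝ) ^ (1 / 2 : ℝ) := by
    refine (pow_le_exp_mul_sqrt_factorial (Real.sqrt_nonneg l) l).trans ?_
    rw [Real.sq_sqrt (by positivity)]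
    gcongr
    rw [← mul_one (l : ℝ), Real.exp_nat_mul]
    gcongr
    exact Real.exp_one_lt_d9.le.trans (by norm_num)
  set fk := (k ! : ℝ) ^ (1 / 2 : ℝ)
  set fl := (l ! : ℝ) ^ (1 / 2 : ℝ)
  have hfk : 0 ≤ fk := by positivity
  have hfl : 0 ≤ fl := by positivity
  set E := Real.exp (t ^ 2 / 4) with hE
  have hE1 : 1 ≤ E := Real.one_le_exp (by positivity)
  have hEE : Real.exp (-t ^ 2 / 2) * (E * E) = 1 := by
    rw [hE, ← Real.exp_add, ← Real.exp_add]
    convert Real.exp_zero using 2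
    ring
  calc t ^ k * ‖iteratedFDeriv ℝ l
        (fun y : EuclideanSpace ℝ ι => c * Real.exp (-‖y‖ ^ 2 / 2)) x‖
      ≤ t ^ k * ((t + √l) ^ l * (c * Real.exp (-t ^ 2 / 2))) := by gcongr
    _ ≤ (2 ^ k * (E * fk)) * ((2 ^ l * (t ^ l + √l ^ l)) * (c * Real.exp (-t ^ 2 / 2))) := by
        gcongr
        · exact e1 k
        · exact add_pow_le_two_pow ht (Real.sqrt_nonneg _) l
    _ ≤ (2 ^ k * (E * fk)) * ((2 ^ l * (2 ^ l * (E * fl) + 3 ^ l * (E * fl))) *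
          (c * Real.exp (-t ^ 2 / 2))) := by
        gcongr
        · exact e1 l
        · refine e2.trans ?_
          gcongr
          nlinarith
    _ = (Real.exp (-t ^ 2 / 2) * (E * E)) * c * (2 ^ k * 2 ^ l * (2 ^ l + 3 ^ l)) * (fk * fl) := by
        ring
    _ = c * (2 ^ k * 2 ^ l * (2 ^ l + 3 ^ l)) * (fk * fl) := by rw [hEE, one_mul]
    _ ≤ c * (6 ^ k * 2 ^ l * (3 ^ l + 3 ^ l)) * (fk * fl) := by
        gcongr <;> norm_num
    _ = 2 * c * (6 ^ (k + l) * (fk * fl)) := by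
        rw [pow_add, show (6 : ℝ) ^ l = 2 ^ l * 3 ^ l by rw [← mul_pow]; norm_num]
        ring

end Gauss


/-! ## Time-frequency shifts -/

theorem pow_le_exp_sq_div {V : Type*} [NormedAddCommGroup V] {H : ℝ} (hH : 0 < H) (x : V) (k : ℕ) :
    ‖x‖ ^ k ≤ Real.exp ((‖x‖ / H) ^ 2) * (H ^ k * (k ! : ℝ) ^ (1 / 2 : ℝ)) := by
  have := pow_le_exp_mul_sqrt_factorial (a := ‖x‖ / H) (by positivity) k
  rw [div_pow, div_le_iff₀ (by positivity)] at this
  exact this.trans (le_of_eq (by ring))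

theorem pow_le_exp_div {V : Type*} [NormedAddCommGroup V] {H : ℝ} (hH : 0 < H) (x : V) (k : ℕ) :
    ‖x‖ ^ k ≤ Real.exp (‖x‖ / H) * (H ^ k * (k ! : ℝ) ^ (1 : ℝ)) := by
  have := pow_le_exp_mul_factorial (a := ‖x‖ / H) (by positivity) k
  rw [div_pow, div_le_iff₀ (by positivity)] at this
  exact this.trans (le_of_eq (by ring))

section Atoms

variable {V : Type*} [NormedAddCommGroup V] [InnerProductSpace ℝ V]

/-- The modulation factor `exp (-i ⟨y, ξ⟩)`. -/
def modul (ξ y : V) : ℂ := Complex.exp (-Complex.I * (inner ℝ y ξ : ℝ))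

/-- The time-frequency shift of the window `Q`. -/
def atomW (Q : V → ℂ) (x ξ y : V) : ℂ := Q (y - x) * modul ξ y

theorem norm_modul (ξ y : V) : ‖modul ξ y‖ = 1 := by
  rw [modul, Complex.norm_exp]
  simp

theorem modul_add_left (ξ η y : V) : modul (ξ + η) y = modul ξ y * modul η y := by
  simp only [modul, ← Complex.exp_add, inner_add_right]
  congr 1; push_cast; ring

theorem modul_add_right (ξ x y : V) : modul ξ (x + y) = modul ξ x * modul ξ y := by
  simp only [modul, ← Complex.exp_add, inner_add_left]
  congr 1; push_cast; ring

@[simp] theorem modul_zero_left (y : V) : modul 0 y = 1 := by simp [modul]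

theorem conj_modul (ξ y : V) : conj (modul ξ y) = modul (-ξ) y := by
  simp [modul, ← Complex.exp_conj]

theorem continuous_modul : Continuous fun z : V × V => modul z.1 z.2 := by
  unfold modul
  fun_prop

theorem smooth_modul (ξ : V) : Smooth (modul ξ) := by
  have : ContDiff ℝ ((⊤ : ℕ∞) : WithTop ℕ∞) fun y : V => inner ℝ y ξ :=
    contDiff_id.inner ℝ contDiff_const
  exact (contDiff_const.mul (Complex.ofRealCLM.contDiff.comp this)).cexp

theorem norm_iteratedFDeriv_modul_le (ξ : V) (l : ℕ) (y : V) :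
    ‖iteratedFDeriv ℝ l (modul ξ) y‖ ≤ ‖ξ‖ ^ l := by
  let c : V →L[ℝ] ℂ := (-Complex.I) • (Complex.ofRealCLM.comp (innerSL ℝ ξ))
  have hcy : ∀ y, c y = -Complex.I * (inner ℝ y ξ : ℝ) := fun y => by
    change (-Complex.I) • ((inner ℝ ξ y : ℝ) : ℂ) = _
    rw [real_inner_comm, smul_eq_mul]
  have hc : ‖c‖ ≤ ‖ξ‖ := by
    refine ContinuousLinearMap.opNorm_le_bound _ (norm_nonneg _) fun y => ?_
    rw [hcy, norm_mul, norm_neg, Complex.norm_I, one_mul, Complex.norm_real, mul_comm]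
    exact norm_inner_le_norm y ξ
  have hm : modul ξ = fun y => Complex.exp (c y) := by
    ext y; rw [hcy]; rfl
  have h := norm_iteratedFDeriv_le_of_fderiv_eq_smul (smooth_modul ξ) c (fun x => by
    rw [hm]
    exact (c.hasFDerivAt.cexp).fderiv) l y
  rw [norm_modul, mul_one] at h
  exact h.trans (by gcongr)

theorem norm_modul_sub_one_le (ξ y : V) : ‖modul ξ y - 1‖ ≤ ‖ξ‖ * ‖y‖ := by
  have h : modul ξ y = Complex.exp (Complex.I * ((-inner ℝ y ξ : ℝ))) := by
    rw [modul]; congr 1; push_cast; ring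
  rw [h]
  refine (Real.norm_exp_I_mul_ofReal_sub_one_le (x := -inner ℝ y ξ)).trans ?_
  rw [norm_neg, mul_comm]
  exact norm_inner_le_norm y ξ

theorem smooth_atomW {Q : V → ℂ} (hQ : Smooth Q) (x ξ : V) : Smooth (atomW Q x ξ) :=
  (hQ.comp (contDiff_id.sub contDiff_const)).mul (smooth_modul ξ)

theorem GSNormLE.shift {s H B Ex Eξ : ℝ} {Q : V → ℂ} {x ξ : V} (hs : 0 ≤ s) (hH : 0 ≤ H)
    (hQs : Smooth Q) (hQ : GSNormLE s H B Q)
    (hx : ∀ k : ℕ, ‖x‖ ^ k ≤ Ex * (H ^ k * (k ! : ℝ) ^ s))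
    (hξ : ∀ k : ℕ, ‖ξ‖ ^ k ≤ Eξ * (H ^ k * (k ! : ℝ) ^ s)) :
    GSNormLE s (3 * H) (2 * (B * Ex) * Eξ) (atomW Q x ξ) := by
  have h1 := hQ.translate hs hH hx
  have h2 := h1.mul_bounded (h' := H) (b := Eξ) hs (by positivity) hH
    (hQs.comp (contDiff_id.sub contDiff_const)) (smooth_modul ξ)
    (fun j y => (norm_iteratedFDeriv_modul_le ξ j y).trans (hξ j))
  rw [show 3 * H = 2 * H + H by ring]
  exact h2

theorem GSNormLE.atomW_half {H B : ℝ} {Q : V → ℂ} (hH : 0 < H)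
    (hQs : Smooth Q) (hQ : GSNormLE (1 / 2) H B Q) (x ξ : V) :
    GSNormLE (1 / 2) (3 * H)
      (2 * (B * Real.exp ((‖x‖ / H) ^ 2)) * Real.exp ((‖ξ‖ / H) ^ 2))
      (atomW Q x ξ) :=
  hQ.shift (by norm_num) hH.le hQs (pow_le_exp_sq_div hH x) (pow_le_exp_sq_div hH ξ)

theorem GSNormLE.atomW_one {H B : ℝ} {Q : V → ℂ} (hH : 0 < H)
    (hQs : Smooth Q) (hQ : GSNormLE 1 H B Q) (x ξ : V) :
    GSNormLE 1 (3 * H)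
      (2 * (B * Real.exp (‖x‖ / H)) * Real.exp (‖ξ‖ / H))
      (atomW Q x ξ) :=
  hQ.shift (by norm_num) hH.le hQs (pow_le_exp_div hH x) (pow_le_exp_div hH ξ)

/-- The mean value inequality on the unit ball around y, applied to the derivative of order l, gains
the factor ‖a‖. The additional derivative turns l! into (l+1)!, which doubling h absorbs. -/
theorem GSNormLE.translate_sub {s h B : ℝ} {f : V → ℂ} {a : V} (hs : 0 ≤ s) (hs1 : s ≤ 1)
    (hh : 1 ≤ h) (ha : ‖a‖ ≤ 1) (hfs : Smooth f) (hf : GSNormLE s h B f) :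
    GSNormLE s (2 * h) (4 * B * h * ‖a‖) (fun y => f (y - a) - f y) := by
  intro k l y
  have hB := hf.nonneg
  have e0 : (fun y => f (y - a) - f y) = (fun y => f (y - a)) - f := rfl
  have hfa : Smooth fun y => f (y - a) := hfs.comp (contDiff_id.sub contDiff_const)
  rw [e0, iteratedFDeriv_sub (hfa.of_le (natCast_le_smooth l)) (hfs.of_le (natCast_le_smooth l)),
    Pi.sub_apply, iteratedFDeriv_comp_sub, factorial_mul_rpow]
  set M := 4 * B * h * ((2 * h) ^ (k + l) * ((k ! : ℝ) ^ s * (l ! : ℝ) ^ s)) with hM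
  have hd : ∀ w, DifferentiableAt ℝ (iteratedFDeriv ℝ l f) w := fun w =>
    (hfs.differentiable_iteratedFDeriv (by exact_mod_cast WithTop.coe_lt_top (l : ℕ))) w
  have key := Convex.norm_image_sub_le_of_norm_fderiv_le (𝕜 := ℝ)
    (f := fun w => (‖y‖ ^ k) • iteratedFDeriv ℝ l f w) (C := M) (s := Metric.closedBall y 1)
    (x := y) (y := y - a) (fun w _ => (hd w).fun_const_smul _) (fun w hw => ?_)
    (convex_closedBall y 1) (by simp) (by simpa using ha)
  · rw [← smul_sub, norm_smul, Real.norm_of_nonneg (by positivity)] at key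
    refine key.trans (le_of_eq ?_)
    rw [sub_sub_cancel_left, norm_neg]
    ring
  · rw [fderiv_fun_const_smul (hd w), norm_smul, norm_fderiv_iteratedFDeriv,
      Real.norm_of_nonneg (by positivity)]
    have h1 := hf k (l + 1) w
    have h2 := hf 0 (l + 1) w
    rw [factorial_mul_rpow] at h1 h2
    simp only [pow_zero, one_mul, zero_add, Nat.factorial_zero, Nat.cast_one, Real.one_rpow] at h2
    have hy : ‖y‖ ^ k ≤ 2 ^ k * (‖w‖ ^ k + 1 ^ k) := by
      refine (pow_le_pow_left₀ (norm_nonneg _) ?_ k).trans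
        (add_pow_le_two_pow (norm_nonneg w) zero_le_one k)
      rw [mem_closedBall_iff_norm'] at hw
      calc ‖y‖ = ‖w + (y - w)‖ := by congr 1; abel
        _ ≤ ‖w‖ + ‖y - w‖ := norm_add_le _ _
        _ ≤ ‖w‖ + 1 := by gcongr
    set D := ‖iteratedFDeriv ℝ (l + 1) f w‖
    have hk := one_le_factorial_rpow hs k
    have hhk : 1 ≤ h ^ k := one_le_pow₀ hh
    calc ‖y‖ ^ k * D ≤ (2 ^ k * (‖w‖ ^ k + 1 ^ k)) * D := by gcongr
      _ = 2 ^ k * (‖w‖ ^ k * D + D) := by ring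
      _ ≤ 2 ^ k * (B * (h ^ (k + (l + 1)) * ((k ! : ℝ) ^ s * ((l + 1)! : ℝ) ^ s)) +
            (h ^ k * (k ! : ℝ) ^ s) * (B * (h ^ (l + 1) * ((l + 1)! : ℝ) ^ s))) := by
          gcongr
          have : 1 ≤ h ^ k * (k ! : ℝ) ^ s := one_le_mul_of_one_le_of_one_le hhk hk
          refine h2.trans (le_mul_of_one_le_left (by positivity) this)
      _ = 2 ^ k * (2 * B * h ^ (k + l) * h * (k ! : ℝ) ^ s) * ((l + 1)! : ℝ) ^ s := by
          rw [pow_add h k (l + 1), pow_add h k l]; ring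
      _ ≤ 2 ^ k * (2 * B * h ^ (k + l) * h * (k ! : ℝ) ^ s) *
            (2 ^ (l + 1) * (l ! : ℝ) ^ s) := by
          gcongr
          exact factorial_succ_rpow_le hs hs1 l
      _ = M := by rw [hM, mul_pow]; ring

/-- The derivatives of `modul b - 1` are at most ‖b‖(1+‖y‖). The growth 1+‖y‖ is paid for by one
more moment of f. -/
theorem GSNormLE.mul_modul_sub_one {s h B : ℝ} {f : V → ℂ} {b : V} (hs : 0 ≤ s) (hs1 : s ≤ 1)
    (hh : 0 ≤ h) (hb : ‖b‖ ≤ 1) (hfs : Smooth f) (hf : GSNormLE s h B f) :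
    GSNormLE s (2 * h + 1) (B * (1 + 2 * h) * ‖b‖) (fun y => f y * (modul b y - 1)) := by
  intro k l y
  have hB := hf.nonneg
  have hg : ∀ j, ‖iteratedFDeriv ℝ j (fun y => modul b y - 1) y‖ ≤
      ‖b‖ * (1 + ‖y‖) * (1 ^ j * (j ! : ℝ) ^ s) := by
    intro j
    rw [one_pow, one_mul]
    have hj := one_le_factorial_rpow hs j
    refine le_trans ?_ (le_mul_of_one_le_right (by positivity) hj)
    have hn := norm_nonneg y
    cases j with
    | zero =>
      rw [norm_iteratedFDeriv_zero]
      refine (norm_modul_sub_one_le b y).trans ?_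
      gcongr
      linarith
    | succ j =>
      have e0 : (fun y => modul b y - 1) = modul b - fun _ => (1 : ℂ) := rfl
      rw [e0, iteratedFDeriv_sub ((smooth_modul b).of_le (natCast_le_smooth _)) contDiff_const,
        Pi.sub_apply, iteratedFDeriv_const_of_ne (by omega), Pi.zero_apply, sub_zero]
      refine (norm_iteratedFDeriv_modul_le b (j + 1) y).trans ?_
      calc ‖b‖ ^ (j + 1) ≤ ‖b‖ := pow_le_of_le_one (norm_nonneg _) hb (by omega)
        _ ≤ ‖b‖ * (1 + ‖y‖) := le_mul_of_one_le_right (norm_nonneg _) (by linarith)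
  have hy : 0 < 1 + ‖y‖ := by positivity
  set A := B * (1 + 2 * h) * ((2 * h) ^ k * (k ! : ℝ) ^ s) with hA
  -- The bound for f is divided by 1+‖y‖, to be cancelled by the bound for `modul b - 1`.
  have key := norm_iteratedFDeriv_mul_le_of_bounds (K := ‖y‖ ^ k) (a := A / (1 + ‖y‖))
    (h₁ := h) hs (by positivity) hh zero_le_one (by positivity) hfs
    ((smooth_modul b).sub contDiff_const) y (fun j => ?_) hg l
  · refine key.trans ?_
    rw [factorial_mul_rpow]
    calc A / (1 + ‖y‖) * (‖b‖ * (1 + ‖y‖)) * ((h + 1) ^ l * (l ! : ℝ) ^ s)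
        = (B * (1 + 2 * h) * ‖b‖) * ((k ! : ℝ) ^ s * (l ! : ℝ) ^ s) *
            ((2 * h) ^ k * (h + 1) ^ l) := by
          rw [hA]; field_simp
      _ ≤ (B * (1 + 2 * h) * ‖b‖) * ((k ! : ℝ) ^ s * (l ! : ℝ) ^ s) *
            ((2 * h + 1) ^ k * (2 * h + 1) ^ l) := by
          gcongr <;> linarith
      _ = _ := by rw [pow_add]; ring
  · have h1 := hf k j y
    have h2 := hf (k + 1) j y
    rw [factorial_mul_rpow] at h1 h2
    have h3 := factorial_succ_rpow_le hs hs1 k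
    set D := ‖iteratedFDeriv ℝ j f y‖
    rw [div_mul_eq_mul_div, le_div_iff₀ hy]
    calc ‖y‖ ^ k * D * (1 + ‖y‖) = ‖y‖ ^ k * D + ‖y‖ ^ (k + 1) * D := by ring
      _ ≤ B * (h ^ (k + j) * ((k ! : ℝ) ^ s * (j ! : ℝ) ^ s)) +
          B * (h ^ (k + 1 + j) * ((2 ^ (k + 1) * (k ! : ℝ) ^ s) * (j ! : ℝ) ^ s)) := by
          refine add_le_add h1 (h2.trans ?_)
          gcongr
      _ = B * ((h ^ k + 2 * h * (2 * h) ^ k) * (k ! : ℝ) ^ s) * (h ^ j * (j ! : ℝ) ^ s) := by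
          rw [pow_add h (k + 1) j, pow_add h k j, mul_pow, pow_succ, pow_succ]; ring
      _ ≤ B * (((2 * h) ^ k + 2 * h * (2 * h) ^ k) * (k ! : ℝ) ^ s) *
            (h ^ j * (j ! : ℝ) ^ s) := by
          gcongr
          linarith
      _ = _ := by rw [hA]; ring

/-- The increment separates into a translation of the window, a modulation of the window and a
change of the constant phase; each is small when the two points are close. -/
theorem atomW_sub_atomW (Q : V → ℂ) (x ξ x' ξ' : V) :
    atomW Q x' ξ' - atomW Q x ξ =
      atomW (fun y => Q (y - (x' - x)) - Q y) x ξ' +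
        (modul (ξ' - ξ) x • atomW (fun y => Q y * (modul (ξ' - ξ) y - 1)) x ξ +
          (modul (ξ' - ξ) x - 1) • atomW Q x ξ) := by
  ext y
  have h1 : modul ξ' y = modul ξ y * (modul (ξ' - ξ) x * modul (ξ' - ξ) (y - x)) := by
    rw [← modul_add_right, add_sub_cancel, ← modul_add_left, add_sub_cancel]
  have h2 : y - x - (x' - x) = y - x' := by abel
  simp only [atomW, Pi.sub_apply, Pi.add_apply, Pi.smul_apply, smul_eq_mul, h2]
  rw [h1]
  ring

/-- Continuity of z ↦ `atomW Q z.1 z.2` within a single step: N is an explicit continuous majorant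
with N(z₀) = 0. The window differences have radius at most 3h, and a shift triples it, which gives
9h. -/
theorem eventually_gsNormLE_atomW_sub {h B : ℝ} {Q : V → ℂ} (hh : 1 ≤ h)
    (hQs : Smooth Q) (hQ : GSNormLE (1 / 2) h B Q) (z₀ : V × V) {ε : ℝ} (hε : 0 < ε) :
    ∀ᶠ z in 𝓝 z₀, GSNormLE (1 / 2) (9 * h) ε (atomW Q z.1 z.2 - atomW Q z₀.1 z₀.2) := by
  have hB := hQ.nonneg
  let E : V → ℝ := fun x => Real.exp ((‖x‖ / (3 * h)) ^ 2)
  let N : V × V → ℝ := fun z =>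
    2 * ((4 * B * h * ‖z.1 - z₀.1‖) * E z₀.1) * E z.2 +
      (‖modul (z.2 - z₀.2) z₀.1‖ * (2 * ((B * (1 + 2 * h) * ‖z.2 - z₀.2‖) * E z₀.1) * E z₀.2) +
        ‖modul (z.2 - z₀.2) z₀.1 - 1‖ * (2 * (B * E z₀.1) * E z₀.2))
  have hE : Continuous E := by fun_prop
  have hm : Continuous fun z : V × V => modul (z.2 - z₀.2) z₀.1 :=
    continuous_modul.comp (f := fun z : V × V => (z.2 - z₀.2, z₀.1)) (by fun_prop)
  have hN : Continuous N := by
    have : Continuous fun z : V × V => E z.2 := hE.comp continuous_snd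
    fun_prop
  have hN0 : N z₀ = 0 := by simp [N]
  have ev1 : ∀ᶠ z in 𝓝 z₀, N z < ε := by
    have := hN.continuousAt (x := z₀)
    exact this.eventually_lt_const (by rwa [hN0])
  have ev2 : ∀ᶠ z in 𝓝 z₀, ‖z.1 - z₀.1‖ < 1 :=
    (by fun_prop : Continuous fun z : V × V => ‖z.1 - z₀.1‖).continuousAt.eventually_lt_const
      (by simp)
  have ev3 : ∀ᶠ z in 𝓝 z₀, ‖z.2 - z₀.2‖ < 1 :=
    (by fun_prop : Continuous fun z : V × V => ‖z.2 - z₀.2‖).continuousAt.eventually_lt_const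
      (by simp)
  filter_upwards [ev1, ev2, ev3] with z h1 h2 h3
  rw [atomW_sub_atomW]
  have h3h : (0 : ℝ) < 3 * h := by linarith
  have s1 : Smooth fun y => Q (y - (z.1 - z₀.1)) - Q y :=
    (hQs.comp (contDiff_id.sub contDiff_const)).sub hQs
  have s2 : Smooth fun y => Q y * (modul (z.2 - z₀.2) y - 1) :=
    hQs.mul ((smooth_modul _).sub contDiff_const)
  have g1 := ((hQ.translate_sub (a := z.1 - z₀.1) (by norm_num) (by norm_num) hh h2.le hQs).mono
    (by linarith) (show 2 * h ≤ 3 * h by linarith)).atomW_half h3h s1 z₀.1 z.2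
  have g2 := ((hQ.mul_modul_sub_one (b := z.2 - z₀.2) (by norm_num) (by norm_num) (by linarith)
    h3.le hQs).mono (by linarith) (show 2 * h + 1 ≤ 3 * h by linarith)).atomW_half
      h3h s2 z₀.1 z₀.2
  have g3 := (hQ.mono (by linarith) (show h ≤ 3 * h by linarith)).atomW_half h3h hQs z₀.1 z₀.2
  have t2 := smooth_atomW s2 z₀.1 z₀.2
  have t3 := smooth_atomW hQs z₀.1 z₀.2
  have g := g1.add (smooth_atomW s1 z₀.1 z.2)
    ((t2.const_smul (modul (z.2 - z₀.2) z₀.1)).add (t3.const_smul (modul (z.2 - z₀.2) z₀.1 - 1)))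
    ((g2.smul (modul (z.2 - z₀.2) z₀.1) t2).add (t2.const_smul _) (t3.const_smul _)
      (g3.smul (modul (z.2 - z₀.2) z₀.1 - 1) t3))
  have g' : GSNormLE (1 / 2) (3 * (3 * h)) (N z) _ := g
  have e9 : 3 * (3 * h) = 9 * h := by ring
  rw [e9] at g'
  intro k l x
  refine (g' k l x).trans ?_
  gcongr

end Atoms


/-! ## Integrals with parameters and functionals -/

section Commute

variable {V : Type*} [NormedAddCommGroup V] [NormedSpace ℝ V]
variable {Z : Type*} [MeasurableSpace Z] {μ : Measure Z}

/-- Differentiation under the integral sign, repeated: the bound of order l+1 dominates the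
difference quotients of the derivative of order l. The currying isometry, which commutes with
integrals, passes from order l to order l+1. -/
theorem smooth_integral_and_iteratedFDeriv {u : Z → V → ℂ} (hu : ∀ z, Smooth (u z))
    (hm : ∀ l y, AEStronglyMeasurable (fun z => iteratedFDeriv ℝ l (u z) y) μ)
    (hb : ∀ l : ℕ, ∃ b : Z → ℝ, Integrable b μ ∧ ∀ z y, ‖iteratedFDeriv ℝ l (u z) y‖ ≤ b z) :
    Smooth (fun y => ∫ z, u z y ∂μ) ∧
      ∀ l y, iteratedFDeriv ℝ l (fun y => ∫ z, u z y ∂μ) y =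
        ∫ z, iteratedFDeriv ℝ l (u z) y ∂μ := by
  have hint : ∀ l y, Integrable (fun z => iteratedFDeriv ℝ l (u z) y) μ := fun l y => by
    obtain ⟨b, hb, hb'⟩ := hb l
    exact hb.mono' (hm l y) (Eventually.of_forall fun z => hb' z y)
  have hstep : ∀ l y, HasFDerivAt (fun y => ∫ z, iteratedFDeriv ℝ l (u z) y ∂μ)
      (∫ z, fderiv ℝ (iteratedFDeriv ℝ l (u z)) y ∂μ) y := by
    intro l y
    obtain ⟨b, hbi, hb'⟩ := hb (l + 1)
    refine hasFDerivAt_integral_of_dominated_of_fderiv_le (𝕜 := ℝ) (bound := b) (s := Set.univ)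
      (F := fun y z => iteratedFDeriv ℝ l (u z) y)
      (F' := fun y z => fderiv ℝ (iteratedFDeriv ℝ l (u z)) y)
      univ_mem (Eventually.of_forall fun x => hm l x) (hint l y) ?_ ?_ hbi ?_
    · have h1 : (fun z => fderiv ℝ (iteratedFDeriv ℝ l (u z)) y) =
          fun z => (continuousMultilinearCurryLeftEquiv ℝ (fun _ : Fin (l + 1) => V) ℂ)
            (iteratedFDeriv ℝ (l + 1) (u z) y) := by
        ext1 z
        rw [iteratedFDeriv_succ_eq_comp_left]
        simp
      rw [h1]
      exact (continuousMultilinearCurryLeftEquiv ℝ (fun _ : Fin (l + 1) => V)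
        ℂ).continuous.comp_aestronglyMeasurable (hm (l + 1) y)
    · refine Eventually.of_forall fun z x _ => ?_
      rw [norm_fderiv_iteratedFDeriv]
      exact hb' z x
    · refine Eventually.of_forall fun z x _ => ?_
      exact ((hu z).differentiable_iteratedFDeriv
        (by exact_mod_cast WithTop.coe_lt_top (l : ℕ)) x).hasFDerivAt
  have hD : ∀ l, iteratedFDeriv ℝ l (fun y => ∫ z, u z y ∂μ) =
      fun y => ∫ z, iteratedFDeriv ℝ l (u z) y ∂μ := by
    intro l
    induction l with
    | zero =>
      ext1 y
      rw [iteratedFDeriv_zero_eq_comp]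
      simp only [Function.comp_apply]
      exact ((continuousMultilinearCurryFin0 ℝ V ℂ).symm.toContinuousLinearEquiv.integral_comp_comm
        _).symm
    | succ l ih =>
      ext1 y
      rw [iteratedFDeriv_succ_eq_comp_left, Function.comp_apply, ih, (hstep l y).fderiv]
      refine (ContinuousLinearEquiv.integral_comp_comm (μ := μ) (𝕜 := ℝ)
        (E := V →L[ℝ] (V [×l]→L[ℝ] ℂ))
        (F := V [×(l + 1)]→L[ℝ] ℂ) (continuousMultilinearCurryLeftEquiv ℝ
          (fun _ : Fin (l + 1) => V) ℂ).symm.toContinuousLinearEquiv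
        (fun z => fderiv ℝ (iteratedFDeriv ℝ l (u z)) y)).symm.trans ?_
      simp only [iteratedFDeriv_succ_eq_comp_left, Function.comp_apply]
      rfl
  refine ⟨?_, fun l y => congrFun (hD l) y⟩
  refine contDiff_of_differentiable_iteratedFDeriv fun m _ => ?_
  rw [hD m]
  exact fun y => (hstep m y).differentiableAt

/-! ### Weighted jets: functionals commute with superpositions -/

/-- The weight of the seminorm of index `(k, l)`. -/
def gsWeight (s h : ℝ) (k l : ℕ) : ℝ := h ^ (k + l) * ((k ! : ℝ) * (l ! : ℝ)) ^ s

theorem gsWeight_pos {h : ℝ} (hh : 0 < h) (s : ℝ) (k l : ℕ) : 0 < gsWeight s h k l := by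
  unfold gsWeight; positivity

variable (V) in
/-- The ambient Banach space of weighted jets. -/
abbrev JetSpace : Type _ := lp (fun i : ℕ × ℕ × V => V [×i.2.1]→L[ℝ] ℂ) ∞

/-- The weighted jet of a function. -/
def jetFun (s h : ℝ) (f : V → ℂ) (i : ℕ × ℕ × V) : V [×i.2.1]→L[ℝ] ℂ :=
  ((‖i.2.2‖ ^ i.1 / gsWeight s h i.1 i.2.1 : ℝ) : ℂ) • iteratedFDeriv ℝ i.2.1 f i.2.2

theorem norm_jetFun {s h : ℝ} (hh : 0 < h) (f : V → ℂ) (i : ℕ × ℕ × V) :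
    ‖jetFun s h f i‖ = ‖i.2.2‖ ^ i.1 * ‖iteratedFDeriv ℝ i.2.1 f i.2.2‖ /
      gsWeight s h i.1 i.2.1 := by
  have := gsWeight_pos hh s i.1 i.2.1
  rw [jetFun, norm_smul, Complex.norm_real, Real.norm_of_nonneg (by positivity)]
  ring

theorem gsNormLE_iff_jetFun {s h B : ℝ} (hh : 0 < h) (f : V → ℂ) :
    GSNormLE s h B f ↔ ∀ i, ‖jetFun s h f i‖ ≤ B := by
  constructor
  · intro hf i
    rw [norm_jetFun hh, div_le_iff₀ (gsWeight_pos hh s _ _)]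
    exact hf _ _ _
  · intro hf k l x
    have := hf (k, l, x)
    rwa [norm_jetFun hh, div_le_iff₀ (gsWeight_pos hh s _ _)] at this

theorem memℓp_jetFun {s h B : ℝ} (hh : 0 < h) {f : V → ℂ} (hf : GSNormLE s h B f) :
    Memℓp (jetFun s h f) ∞ := by
  refine memℓp_infty ⟨B, ?_⟩
  rintro _ ⟨i, rfl⟩
  exact (gsNormLE_iff_jetFun hh f).1 hf i

/-- The elements of `S` with finite seminorm. -/
def gsStep (S : Submodule ℂ (V → ℂ)) (hS : ∀ f ∈ S, Smooth f) (s h : ℝ) : Submodule ℂ S where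
  carrier := {f | ∃ B, GSNormLE s h B (f : V → ℂ)}
  zero_mem' := ⟨0, GSNormLE.zero s h⟩
  add_mem' := by
    rintro f g ⟨B, hB⟩ ⟨C, hC⟩
    exact ⟨B + C, hB.add (hS _ f.2) (hS _ g.2) hC⟩
  smul_mem' := by
    rintro c f ⟨B, hB⟩
    exact ⟨‖c‖ * B, hB.smul c (hS _ f.2)⟩

/-- The embedding of a step into the space of jets. -/
def gsJet (S : Submodule ℂ (V → ℂ)) (hS : ∀ f ∈ S, Smooth f) {s h : ℝ} (hh : 0 < h) :
    gsStep S hS s h →ₗ[ℂ] JetSpace V where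
  toFun f := ⟨jetFun s h ((f : S) : V → ℂ), memℓp_jetFun hh f.2.choose_spec⟩
  map_add' f g := by
    ext1
    funext i
    have h1 := (hS _ (f : S).2).of_le (natCast_le_smooth i.2.1)
    have h2 := (hS _ (g : S).2).of_le (natCast_le_smooth i.2.1)
    change jetFun s h (((f : S) : V → ℂ) + ((g : S) : V → ℂ)) i =
      jetFun s h ((f : S) : V → ℂ) i + jetFun s h ((g : S) : V → ℂ) i
    rw [jetFun, iteratedFDeriv_add h1 h2, Pi.add_apply, smul_add]
    rfl
  map_smul' c f := by
    ext1
    funext i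
    have h1 := (hS _ (f : S).2).of_le (natCast_le_smooth i.2.1)
    change jetFun s h (c • ((f : S) : V → ℂ)) i = c • jetFun s h ((f : S) : V → ℂ) i
    rw [jetFun, iteratedFDeriv_const_smul_apply h1.contDiffAt, jetFun, smul_comm]

theorem gsNormLE_norm_gsJet {S : Submodule ℂ (V → ℂ)} {hS : ∀ f ∈ S, Smooth f} {s h : ℝ}
    (hh : 0 < h) (f : gsStep S hS s h) :
    GSNormLE s h ‖gsJet S hS hh f‖ ((f : S) : V → ℂ) :=
  (gsNormLE_iff_jetFun hh _).2 fun i =>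
    lp.norm_apply_le_norm ENNReal.top_ne_zero (gsJet S hS hh f) i

theorem norm_gsJet_le {S : Submodule ℂ (V → ℂ)} {hS : ∀ f ∈ S, Smooth f} {s h B : ℝ}
    (hh : 0 < h) (f : gsStep S hS s h) (hf : GSNormLE s h B ((f : S) : V → ℂ)) :
    ‖gsJet S hS hh f‖ ≤ B :=
  lp.norm_le_of_forall_le hf.nonneg fun i => (gsNormLE_iff_jetFun hh _).1 hf i

theorem gsJet_injective {S : Submodule ℂ (V → ℂ)} {hS : ∀ f ∈ S, Smooth f} {s h : ℝ}
    (hh : 0 < h) : Function.Injective (gsJet S hS (s := s) hh) := by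
  refine (injective_iff_map_eq_zero _).2 fun f hf => ?_
  have h1 := gsNormLE_norm_gsJet hh f
  rw [hf, norm_zero] at h1
  ext x
  have := h1 0 0 x
  simpa using this

/-- A seminorm is the sup norm of the weighted jet, so a functional bounded by it is a bounded
functional on a subspace of a Banach space. Hahn-Banach extends it. -/
theorem exists_dual_jetSpace {S : Submodule ℂ (V → ℂ)} (hS : ∀ f ∈ S, Smooth f) {s h C : ℝ}
    (hh : 0 < h) (F : S →ₗ[ℂ] ℂ)
    (hF : ∀ (g : S) (B : ℝ), GSNormLE s h B (g : V → ℂ) → ‖F g‖ ≤ C * B) :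
    ∃ T : JetSpace V →L[ℂ] ℂ, ∀ f : gsStep S hS s h, T (gsJet S hS hh f) = F f := by
  let e := LinearEquiv.ofInjective (gsJet S hS (s := s) hh) (gsJet_injective hh)
  let T₀ : LinearMap.range (gsJet S hS (s := s) hh) →L[ℂ] ℂ :=
    LinearMap.mkContinuous (F ∘ₗ (gsStep S hS s h).subtype ∘ₗ e.symm.toLinearMap) C fun x => by
      obtain ⟨f, rfl⟩ := e.surjective x
      have h1 : ‖e f‖ = ‖gsJet S hS hh f‖ := rfl
      simp only [LinearMap.comp_apply, LinearEquiv.coe_coe, LinearEquiv.symm_apply_apply]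
      rw [h1]
      exact hF _ _ (gsNormLE_norm_gsJet hh f)
  obtain ⟨T, hT, -⟩ := exists_extension_norm_eq _ T₀
  refine ⟨T, fun f => ?_⟩
  have h1 : T (gsJet S hS hh f) = T₀ (e f) := hT (e f)
  rw [h1]
  change F ((e.symm (e f) : gsStep S hS s h) : S) = F f
  rw [LinearEquiv.symm_apply_apply]

theorem continuous_iteratedFDeriv_of_gsNormLE {Z : Type*} [TopologicalSpace Z] {s h : ℝ}
    {Φ : Z → V → ℂ}
    (hs : ∀ z, Smooth (Φ z))
    (hcont : ∀ z₀ : Z, ∀ ε : ℝ, 0 < ε → ∀ᶠ z in 𝓝 z₀, GSNormLE s h ε (Φ z - Φ z₀))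
    (hh : 0 < h) (l : ℕ) (y : V) : Continuous fun z => iteratedFDeriv ℝ l (Φ z) y := by
  refine continuous_iff_continuousAt.2 fun z₀ => ?_
  refine Metric.tendsto_nhds.2 fun ε hε => ?_
  have hw := gsWeight_pos hh s 0 l
  filter_upwards [hcont z₀ (ε / (2 * gsWeight s h 0 l)) (by positivity)] with z hz
  have h1 := hz 0 l y
  rw [iteratedFDeriv_sub ((hs z).of_le (natCast_le_smooth l)) ((hs z₀).of_le (natCast_le_smooth l)),
    pow_zero, one_mul, Pi.sub_apply, ← dist_eq_norm] at h1
  refine h1.trans_lt ?_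
  change ε / (2 * gsWeight s h 0 l) * gsWeight s h 0 l < ε
  field_simp
  linarith

variable [TopologicalSpace Z] [OpensMeasurableSpace Z] [SecondCountableTopology Z]

/-- Superpositions of a continuous family in a Gelfand-Shilov step are smooth, satisfy the
corresponding bound, and commute with functionals. -/
theorem superposition {s h : ℝ} (hh : 0 < h) {Φ : Z → V → ℂ} {N : Z → ℝ} {c : Z → ℂ}
    (hs : ∀ z, Smooth (Φ z)) (hΦ : ∀ z, GSNormLE s h (N z) (Φ z))
    (hcont : ∀ z₀ : Z, ∀ ε : ℝ, 0 < ε → ∀ᶠ z in 𝓝 z₀, GSNormLE s h ε (Φ z - Φ z₀))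
    (hc : AEStronglyMeasurable c μ) (hcN : Integrable (fun z => ‖c z‖ * N z) μ) :
    Smooth (fun y => ∫ z, c z * Φ z y ∂μ) ∧
      (∀ l y, iteratedFDeriv ℝ l (fun y => ∫ z, c z * Φ z y ∂μ) y =
        ∫ z, c z • iteratedFDeriv ℝ l (Φ z) y ∂μ) ∧
      GSNormLE s h (∫ z, ‖c z‖ * N z ∂μ) (fun y => ∫ z, c z * Φ z y ∂μ) := by
  have hD : ∀ z l y, iteratedFDeriv ℝ l (fun y => c z * Φ z y) y =
      c z • iteratedFDeriv ℝ l (Φ z) y := fun z l y =>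
    iteratedFDeriv_const_smul_apply (a := c z) (f := Φ z)
      ((hs z).of_le (natCast_le_smooth l)).contDiffAt
  have hle : ∀ z k l y, ‖y‖ ^ k * ‖c z • iteratedFDeriv ℝ l (Φ z) y‖ ≤
      (‖c z‖ * N z) * gsWeight s h k l := fun z k l y => by
    rw [norm_smul]
    calc _ = ‖c z‖ * (‖y‖ ^ k * ‖iteratedFDeriv ℝ l (Φ z) y‖) := by ring
      _ ≤ ‖c z‖ * (N z * gsWeight s h k l) :=
          mul_le_mul_of_nonneg_left (hΦ z k l y) (norm_nonneg _)
      _ = _ := by ring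
  obtain ⟨h1, h2⟩ := smooth_integral_and_iteratedFDeriv (μ := μ)
    (u := fun z y => c z * Φ z y) (fun z => contDiff_const.mul (hs z))
    (fun l y => by
      simp only [hD]
      exact hc.smul (continuous_iteratedFDeriv_of_gsNormLE hs hcont hh l y).aestronglyMeasurable)
    (fun l => ⟨fun z => (‖c z‖ * N z) * gsWeight s h 0 l, hcN.mul_const _, fun z y => by
      rw [hD]
      simpa using hle z 0 l y⟩)
  simp only [hD] at h2
  refine ⟨h1, h2, fun k l y => ?_⟩
  rw [h2, ← Real.norm_of_nonneg (show 0 ≤ ‖y‖ ^ k by positivity), ← norm_smul,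
    ← integral_smul]
  refine (norm_integral_le_of_norm_le (hcN.mul_const (gsWeight s h k l))
    (Eventually.of_forall fun z => ?_)).trans (le_of_eq ?_)
  · rw [norm_smul, Real.norm_of_nonneg (by positivity)]
    exact hle z k l y
  · rw [integral_mul_const]
    rfl

/-- After extension to the space of jets, F is a continuous functional on a Banach space and
commutes with the Bochner integral of a continuous, absolutely integrable family. -/
theorem functional_superposition {S : Submodule ℂ (V → ℂ)} (hS : ∀ f ∈ S, Smooth f)
    {s h C : ℝ} (hh : 0 < h) (F : S →ₗ[ℂ] ℂ)
    (hF : ∀ (g : S) (B : ℝ), GSNormLE s h B (g : V → ℂ) → ‖F g‖ ≤ C * B)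
    {Φ : Z → S} {N : Z → ℝ} {c : Z → ℂ} (hΦ : ∀ z, GSNormLE s h (N z) (Φ z : V → ℂ))
    (hcont : ∀ z₀ : Z, ∀ ε : ℝ, 0 < ε →
      ∀ᶠ z in 𝓝 z₀, GSNormLE s h ε ((Φ z : V → ℂ) - (Φ z₀ : V → ℂ)))
    (hc : AEStronglyMeasurable c μ) (hcN : Integrable (fun z => ‖c z‖ * N z) μ)
    (G : S) (hG : (G : V → ℂ) = fun y => ∫ z, c z * (Φ z : V → ℂ) y ∂μ) :
    F G = ∫ z, c z * F (Φ z) ∂μ := by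
  obtain ⟨-, h2, h3⟩ := superposition hh (fun z => hS _ (Φ z).2) hΦ hcont hc hcN
  rw [← hG] at h2 h3
  obtain ⟨T, hT⟩ := exists_dual_jetSpace hS (s := s) hh F hF
  let Ψ : Z → gsStep S hS s h := fun z => ⟨Φ z, N z, hΦ z⟩
  let Γ : gsStep S hS s h := ⟨G, _, h3⟩
  have hJc : Continuous fun z => gsJet S hS hh (Ψ z) := by
    refine continuous_iff_continuousAt.2 fun z₀ => Metric.tendsto_nhds.2 fun ε hε => ?_
    filter_upwards [hcont z₀ (ε / 2) (by positivity)] with z hz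
    rw [dist_eq_norm, ← map_sub]
    exact (norm_gsJet_le hh (Ψ z - Ψ z₀) hz).trans_lt (by linarith)
  have hJi : Integrable (fun z => c z • gsJet S hS hh (Ψ z)) μ := by
    refine hcN.mono' (hc.smul hJc.aestronglyMeasurable) (Eventually.of_forall fun z => ?_)
    rw [norm_smul]
    exact mul_le_mul_of_nonneg_left (norm_gsJet_le hh (Ψ z) (hΦ z)) (norm_nonneg _)
  -- Checked coordinatewise: evaluation of a jet at an index is continuous and linear, hence
  -- commutes with the integral, and `h2` identifies the result.
  have hJ : gsJet S hS hh Γ = ∫ z, c z • gsJet S hS hh (Ψ z) ∂μ := by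
    ext1
    funext i
    have e1 := (lp.evalCLM ℂ (fun i : ℕ × ℕ × V => V [×i.2.1]→L[ℝ] ℂ) ∞ i).integral_comp_comm hJi
    have e2 : (lp.evalCLM ℂ (fun i : ℕ × ℕ × V => V [×i.2.1]→L[ℝ] ℂ) ∞ i)
      (∫ z, c z • gsJet S hS hh (Ψ z) ∂μ) =
        (∫ z, c z • gsJet S hS hh (Ψ z) ∂μ : JetSpace V) i := rfl
    rw [← e2, ← e1]
    change jetFun s h (G : V → ℂ) i = ∫ z, c z • jetFun s h (Φ z : V → ℂ) i ∂μ
    simp only [jetFun]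
    rw [h2, ← integral_smul]
    refine integral_congr_ae (Eventually.of_forall fun z => ?_)
    exact smul_comm _ _ _
  calc F G = T (gsJet S hS hh Γ) := (hT Γ).symm
    _ = ∫ z, T (c z • gsJet S hS hh (Ψ z)) ∂μ := by rw [hJ, T.integral_comp_comm hJi]
    _ = ∫ z, c z * F (Φ z) ∂μ := by
        refine integral_congr_ae (Eventually.of_forall fun z => ?_)
        change T (c z • gsJet S hS hh (Ψ z)) = _
        rw [map_smul, hT, smul_eq_mul]

end Commute


/-! ## Decay of the short-time Fourier transform -/

section Analysis

variable {ι : Type*} [Fintype ι]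

local notation "𝔼" => EuclideanSpace ℝ ι

variable (ι) in
/-- An integrable polynomial weight. -/
def japWeight (y : EuclideanSpace ℝ ι) : ℝ := ((1 + ‖y‖) ^ (Fintype.card ι + 1))⁻¹

theorem japWeight_pos (y : 𝔼) : 0 < japWeight ι y := by unfold japWeight; positivity

theorem integrable_japWeight : Integrable (japWeight ι) := by
  have h := integrable_one_add_norm (E := 𝔼) (μ := volume)
    (r := ((Fintype.card ι + 1 : ℕ) : ℝ)) (by simp)
  refine h.congr (Eventually.of_forall fun y => ?_)
  simp only [japWeight]
  rw [Real.rpow_neg (by positivity), Real.rpow_natCast]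

theorem exp_neg_le_japWeight {r : ℝ} (hr : 0 < r) (y : 𝔼) :
    Real.exp (-(r * ‖y‖)) ≤ Real.exp r * ((Fintype.card ι + 1)! : ℝ) / r ^ (Fintype.card ι + 1) *
      japWeight ι y := by
  set N := Fintype.card ι + 1 with hN
  have h := Real.pow_div_factorial_le_exp (x := r * (1 + ‖y‖)) (by positivity) N
  rw [div_le_iff₀ (by positivity), mul_pow, mul_add, mul_one, Real.exp_add] at h
  rw [Real.exp_neg, japWeight, ← hN, ← div_eq_mul_inv, div_div, inv_eq_one_div,
    div_le_div_iff₀ (Real.exp_pos _) (by positivity)]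
  linarith

theorem integrable_exp_neg_mul_norm {r : ℝ} (hr : 0 < r) :
    Integrable fun y : 𝔼 => Real.exp (-(r * ‖y‖)) := by
  refine (integrable_japWeight.const_mul
    (Real.exp r * ((Fintype.card ι + 1)! : ℝ) / r ^ (Fintype.card ι + 1))).mono' (by fun_prop)
    (Eventually.of_forall fun y => ?_)
  rw [Real.norm_of_nonneg (Real.exp_pos _).le]
  exact exp_neg_le_japWeight hr y

theorem norm_gauss (y : 𝔼) :
    ‖gauss y‖ = Real.pi ^ (-(Fintype.card ι : ℝ) / 4) * Real.exp (-‖y‖ ^ 2 / 2) := by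
  rw [gauss, Complex.norm_real, Real.norm_of_nonneg (by positivity)]

theorem conj_gauss (y : 𝔼) : conj (gauss y) = gauss y := by
  rw [gauss, Complex.conj_ofReal]

theorem continuous_gauss : Continuous (gauss : 𝔼 → ℂ) := smooth_gauss.continuous

theorem integrable_exp_sq_mul_gauss {ε : ℝ} (hε : ε ≤ 1 / 8) :
    Integrable fun y : 𝔼 => Real.exp (ε * ‖y‖ ^ 2) * ‖gauss y‖ := by
  refine ((integrable_exp_neg_mul_norm (ι := ι) one_pos).const_mul
    (Real.pi ^ (-(Fintype.card ι : ℝ) / 4) * Real.exp 1)).mono'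
    (by have := continuous_gauss (ι := ι); fun_prop) (Eventually.of_forall fun y => ?_)
  rw [Real.norm_of_nonneg (by positivity), norm_gauss]
  have h : Real.exp (ε * ‖y‖ ^ 2) * Real.exp (-‖y‖ ^ 2 / 2) ≤
      Real.exp 1 * Real.exp (-(1 * ‖y‖)) := by
    rw [← Real.exp_add, ← Real.exp_add]
    refine Real.exp_le_exp.2 ?_
    nlinarith [sq_nonneg (‖y‖ - 2), mul_le_mul_of_nonneg_right hε (sq_nonneg ‖y‖)]
  have hc : 0 ≤ Real.pi ^ (-(Fintype.card ι : ℝ) / 4) := by positivity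
  nlinarith [mul_le_mul_of_nonneg_left h hc]

theorem integrable_exp_mul_gauss (r : ℝ) :
    Integrable fun y : 𝔼 => Real.exp (r * ‖y‖) * ‖gauss y‖ := by
  refine ((integrable_exp_sq_mul_gauss (ι := ι) le_rfl).const_mul
    (Real.exp (2 * r ^ 2))).mono'
    (by have := continuous_gauss (ι := ι); fun_prop) (Eventually.of_forall fun y => ?_)
  rw [Real.norm_of_nonneg (by positivity), ← mul_assoc, ← Real.exp_add]
  gcongr
  nlinarith [sq_nonneg (‖y‖ - 4 * r)]

/-- The short-time Fourier transform of functions, without normalising constant. -/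
def hat (g : 𝔼 → ℂ) (x ξ : 𝔼) : ℂ := ∫ y, g y * atomW gauss x (-ξ) y

theorem norm_atomW (Q : 𝔼 → ℂ) (x ξ y : 𝔼) : ‖atomW Q x ξ y‖ = ‖Q (y - x)‖ := by
  rw [atomW, norm_mul, norm_modul, mul_one]

theorem continuous_atomW {Q : 𝔼 → ℂ} (hQ : Continuous Q) :
    Continuous fun p : 𝔼 × 𝔼 × 𝔼 => atomW Q p.1 p.2.1 p.2.2 := by
  unfold atomW
  have := continuous_modul (V := 𝔼)
  have h2 : Continuous fun p : 𝔼 × 𝔼 × 𝔼 => modul p.2.1 p.2.2 := this.comp continuous_snd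
  fun_prop

/-- The triangle inequality splits exp(-r‖y‖) into exp(-r‖x‖) and exp(r‖y-x‖); the Gaussian window
integrates the latter. -/
theorem norm_hat_le_of_exp {g : 𝔼 → ℂ} {r M : ℝ} (hr : 0 ≤ r)
    (hg : ∀ y, ‖g y‖ ≤ M * Real.exp (-(r * ‖y‖))) (x ξ : 𝔼) :
    ‖hat g x ξ‖ ≤ M * (∫ w : 𝔼, Real.exp (r * ‖w‖) * ‖gauss w‖) * Real.exp (-(r * ‖x‖)) := by
  have hM : 0 ≤ M := by
    have := (norm_nonneg _).trans (hg 0)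
    simpa using this
  have h := norm_integral_le_of_norm_le (f := fun y => g y * atomW gauss x (-ξ) y)
    (((integrable_exp_mul_gauss (ι := ι) r).comp_sub_right x).const_mul
      (M * Real.exp (-(r * ‖x‖)))) (Eventually.of_forall fun y => ?_)
  · refine h.trans (le_of_eq ?_)
    rw [integral_const_mul,
      integral_sub_right_eq_self (fun w : 𝔼 => Real.exp (r * ‖w‖) * ‖gauss w‖) x]
    ring
  · rw [norm_mul, norm_atomW]
    have h1 : Real.exp (-(r * ‖y‖)) ≤ Real.exp (-(r * ‖x‖)) * Real.exp (r * ‖y - x‖) := by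
      rw [← Real.exp_add]
      refine Real.exp_le_exp.2 ?_
      have : ‖x‖ ≤ ‖y‖ + ‖y - x‖ := by
        calc ‖x‖ = ‖y - (y - x)‖ := by congr 1; abel
          _ ≤ _ := norm_sub_le _ _
      nlinarith
    calc ‖g y‖ * ‖gauss (y - x)‖ ≤ M * (Real.exp (-(r * ‖x‖)) * Real.exp (r * ‖y - x‖)) *
          ‖gauss (y - x)‖ := by
          gcongr
          exact (hg y).trans (by gcongr)
      _ = _ := by ring

/-- As for exponential decay, but ‖x‖² ≤ 2‖y‖² + 2‖y-x‖² costs half of the rate. The condition ε ≤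
1/8 keeps the window integrable against exp(ε‖·‖²). -/
theorem norm_hat_le_of_exp_sq {g : 𝔼 → ℂ} {ε M : ℝ} (hε : 0 ≤ ε) (hε8 : ε ≤ 1 / 8)
    (hg : ∀ y, ‖g y‖ ≤ M * Real.exp (-(ε * ‖y‖ ^ 2))) (x ξ : 𝔼) :
    ‖hat g x ξ‖ ≤ M * (∫ w : 𝔼, Real.exp (ε * ‖w‖ ^ 2) * ‖gauss w‖) *
      Real.exp (-(ε / 2 * ‖x‖ ^ 2)) := by
  have hM : 0 ≤ M := by
    have := (norm_nonneg _).trans (hg 0)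
    simpa using this
  have h := norm_integral_le_of_norm_le (f := fun y => g y * atomW gauss x (-ξ) y)
    (((integrable_exp_sq_mul_gauss (ι := ι) hε8).comp_sub_right x).const_mul
      (M * Real.exp (-(ε / 2 * ‖x‖ ^ 2)))) (Eventually.of_forall fun y => ?_)
  · refine h.trans (le_of_eq ?_)
    rw [integral_const_mul,
      integral_sub_right_eq_self (fun w : 𝔼 => Real.exp (ε * ‖w‖ ^ 2) * ‖gauss w‖) x]
    ring
  · rw [norm_mul, norm_atomW]
    have h1 : Real.exp (-(ε * ‖y‖ ^ 2)) ≤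
        Real.exp (-(ε / 2 * ‖x‖ ^ 2)) * Real.exp (ε * ‖y - x‖ ^ 2) := by
      rw [← Real.exp_add]
      refine Real.exp_le_exp.2 ?_
      have h2 : ‖x‖ ≤ ‖y‖ + ‖y - x‖ := by
        calc ‖x‖ = ‖y - (y - x)‖ := by congr 1; abel
          _ ≤ _ := norm_sub_le _ _
      have h3 : ‖x‖ ^ 2 ≤ 2 * ‖y‖ ^ 2 + 2 * ‖y - x‖ ^ 2 := by
        nlinarith [sq_nonneg (‖y‖ - ‖y - x‖), norm_nonneg x, norm_nonneg y, norm_nonneg (y - x)]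
      nlinarith
    calc ‖g y‖ * ‖gauss (y - x)‖ ≤ M * (Real.exp (-(ε / 2 * ‖x‖ ^ 2)) *
          Real.exp (ε * ‖y - x‖ ^ 2)) * ‖gauss (y - x)‖ := by
          gcongr
          exact (hg y).trans (by gcongr)
      _ = _ := by ring

theorem norm_iteratedFDeriv_gauss_le_japWeight {s h B : ℝ} (hh : 0 ≤ h)
    (hB : GSNormLE s h B (gauss : 𝔼 → ℂ)) :
    ∃ D : ℝ, 0 ≤ D ∧ ∀ (j : ℕ) (y : 𝔼),
      ‖iteratedFDeriv ℝ j (gauss : 𝔼 → ℂ) y‖ ≤ D * japWeight ι y * (h ^ j * (j ! : ℝ) ^ s) := by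
  have hB0 := hB.nonneg
  set N := Fintype.card ι + 1 with hN
  refine ⟨2 ^ N * (B * (1 + h ^ N * (N ! : ℝ) ^ s)), by positivity, fun j y => ?_⟩
  have h1 := hB 0 j y
  have h2 := hB N j y
  rw [factorial_mul_rpow] at h1 h2
  simp only [pow_zero, one_mul, zero_add, Nat.factorial_zero, Nat.cast_one, Real.one_rpow] at h1
  set D := ‖iteratedFDeriv ℝ j (gauss : 𝔼 → ℂ) y‖
  have h3 : (1 + ‖y‖) ^ N ≤ 2 ^ N * (1 ^ N + ‖y‖ ^ N) :=
    add_pow_le_two_pow zero_le_one (norm_nonneg y) N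
  have h4 : (1 + ‖y‖) ^ N * D ≤
      2 ^ N * (B * (1 + h ^ N * (N ! : ℝ) ^ s)) * (h ^ j * (j ! : ℝ) ^ s) := by
    calc (1 + ‖y‖) ^ N * D ≤ (2 ^ N * (1 ^ N + ‖y‖ ^ N)) * D := by gcongr
      _ = 2 ^ N * (D + ‖y‖ ^ N * D) := by rw [one_pow]; ring
      _ ≤ 2 ^ N * (B * (h ^ j * (j ! : ℝ) ^ s) +
            B * (h ^ (N + j) * ((N ! : ℝ) ^ s * (j ! : ℝ) ^ s))) := by gcongr
      _ = _ := by rw [pow_add]; ring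
  rw [japWeight, ← hN]
  have h5 : (0 : ℝ) < (1 + ‖y‖) ^ N := by positivity
  calc D = ((1 + ‖y‖) ^ N)⁻¹ * ((1 + ‖y‖) ^ N * D) := by field_simp
    _ ≤ ((1 + ‖y‖) ^ N)⁻¹ *
          (2 ^ N * (B * (1 + h ^ N * (N ! : ℝ) ^ s)) * (h ^ j * (j ! : ℝ) ^ s)) := by gcongr
    _ = _ := by ring

/-- The Fourier transform of the l-th derivative is bounded by the L¹ norm. Evaluated at (w,…,w) it
equals (2π‖w‖²)^l times the transform of p in modulus, and one factor ‖w‖^l is cancelled, which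
makes w = 0 a separate case. -/
theorem fourier_decay {p : 𝔼 → ℂ} (hp : Smooth p)
    (hi : ∀ l, Integrable (iteratedFDeriv ℝ l p)) (l : ℕ) (w : 𝔼) :
    (2 * Real.pi * ‖w‖) ^ l * ‖FourierTransform.fourier p w‖ ≤
      ∫ y, ‖iteratedFDeriv ℝ l p y‖ := by
  have h1 := congrFun (Real.fourier_iteratedFDeriv (N := ⊤) hp (fun n _ => hi n) (n := l) le_top) w
  have h2 : ‖FourierTransform.fourier (iteratedFDeriv ℝ l p) w‖ ≤
      ∫ y, ‖iteratedFDeriv ℝ l p y‖ :=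
    VectorFourier.norm_fourierIntegral_le_integral_norm _ _ _ _ _
  have hI : 0 ≤ ∫ y, ‖iteratedFDeriv ℝ l p y‖ := integral_nonneg fun _ => norm_nonneg _
  rcases eq_or_ne w 0 with rfl | hw
  · rcases Nat.eq_zero_or_pos l with rfl | hl
    · refine le_trans (le_of_eq ?_) h2
      rw [h1]
      simp only [pow_zero, one_mul]
      rw [← norm_iteratedFDeriv_zero (𝕜 := ℝ)]
      have : ∀ m : Fin 0 → 𝔼, VectorFourier.fourierPowSMulRight (-innerSL ℝ)
        (FourierTransform.fourier p) (0 : 𝔼) 0 m = FourierTransform.fourier p 0 := by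
        intro m
        simp
      refine le_antisymm ?_ ?_
      · rw [norm_iteratedFDeriv_zero, ← this 0]
        refine (ContinuousMultilinearMap.le_opNorm _ _).trans ?_
        simp
      · rw [norm_iteratedFDeriv_zero]
        refine ContinuousMultilinearMap.opNorm_le_bound (norm_nonneg _) fun m => ?_
        rw [this m]
        simp
    · simp only [norm_zero, mul_zero, zero_pow hl.ne', zero_mul]
      exact hI
  · have h3 := ContinuousMultilinearMap.le_opNorm
      (FourierTransform.fourier (iteratedFDeriv ℝ l p) w) (fun _ => w)
    rw [h1, VectorFourier.fourierPowSMulRight_apply] at h3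
    have h4 : ∀ i : Fin l, (-innerSL ℝ) w w = -(‖w‖ ^ 2) := fun _ => by
      change -(inner ℝ w w) = _
      rw [real_inner_self_eq_norm_sq]
    simp only [Finset.prod_const, Finset.card_univ, Fintype.card_fin, norm_smul, norm_pow,
      norm_neg, norm_mul, Complex.norm_I, mul_one] at h3
    have h5 : ‖(-innerSL ℝ) w w‖ = ‖w‖ ^ 2 := by
      have : (-innerSL ℝ) w w = -(inner ℝ w w) := rfl
      rw [this, real_inner_self_eq_norm_sq, norm_neg, norm_pow, norm_norm]
    rw [h5, ← h1] at h3
    have hw' : 0 < ‖w‖ ^ l := by positivity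
    have h6 : ‖(2 : ℂ)‖ * ‖(Real.pi : ℂ)‖ = 2 * Real.pi := by
      rw [Complex.norm_real, Real.norm_of_nonneg Real.pi_pos.le]
      simp
    rw [h6] at h3
    refine le_of_mul_le_mul_right ?_ hw'
    calc (2 * Real.pi * ‖w‖) ^ l * ‖FourierTransform.fourier p w‖ * ‖w‖ ^ l
        = (2 * Real.pi) ^ l * ((‖w‖ ^ 2) ^ l * ‖FourierTransform.fourier p w‖) := by
          rw [mul_pow]; ring
      _ ≤ _ := h3
      _ ≤ _ := by gcongr

theorem modul_neg_eq_fourier (ξ y : 𝔼) :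
    modul (-ξ) y =
      Complex.exp ((↑(-2 * Real.pi * inner ℝ y (-((2 * Real.pi)⁻¹ • ξ))) * Complex.I)) := by
  have hpi := Real.pi_ne_zero
  rw [modul]
  congr 1
  rw [inner_neg_right, inner_neg_right, inner_smul_right]
  push_cast
  field_simp

theorem hat_eq_fourier (g : 𝔼 → ℂ) (x ξ : 𝔼) :
    hat g x ξ = FourierTransform.fourier (fun y => g y * gauss (y - x))
      (-((2 * Real.pi)⁻¹ • ξ)) := by
  rw [Real.fourier_eq', hat]
  refine integral_congr_ae (Eventually.of_forall fun y => ?_)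
  simp only [atomW, smul_eq_mul]
  rw [modul_neg_eq_fourier]
  ring

theorem norm_iteratedFDeriv_mul_gauss_le {s h B D : ℝ} (hs : 0 ≤ s) (hh : 0 ≤ h) {g : 𝔼 → ℂ}
    (hgs : Smooth g) (hg : GSNormLE s h B g)
    (hD : ∀ (j : ℕ) (y : 𝔼), ‖iteratedFDeriv ℝ j (gauss : 𝔼 → ℂ) y‖ ≤
      D * japWeight ι y * (h ^ j * (j ! : ℝ) ^ s)) (x : 𝔼) (l : ℕ) (y : 𝔼) :
    ‖iteratedFDeriv ℝ l (fun y => g y * gauss (y - x)) y‖ ≤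
      B * (D * japWeight ι (y - x)) * ((2 * h) ^ l * (l ! : ℝ) ^ s) := by
  have := norm_iteratedFDeriv_mul_le_of_bounds (K := 1) (h₁ := h) (h₂ := h) (a := B)
    (b := D * japWeight ι (y - x)) (f := g) (g := fun y => gauss (y - x)) (s := s) hs zero_le_one
    hh hh hg.nonneg hgs (smooth_gauss.comp (contDiff_id.sub contDiff_const)) y (fun j => by
      have := hg 0 j y
      rw [factorial_mul_rpow] at this
      simpa using this) (fun j => by
      rw [iteratedFDeriv_comp_sub]
      exact hD j (y - x)) l
  rw [one_mul, ← two_mul] at this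
  exact this

theorem integrable_iteratedFDeriv_mul_gauss {s h B D : ℝ} (hs : 0 ≤ s) (hh : 0 ≤ h) {g : 𝔼 → ℂ}
    (hgs : Smooth g) (hg : GSNormLE s h B g)
    (hD : ∀ (j : ℕ) (y : 𝔼), ‖iteratedFDeriv ℝ j (gauss : 𝔼 → ℂ) y‖ ≤
      D * japWeight ι y * (h ^ j * (j ! : ℝ) ^ s)) (x : 𝔼) (l : ℕ) :
    Integrable (iteratedFDeriv ℝ l (fun y => g y * gauss (y - x))) := by
  have hps : Smooth fun y => g y * gauss (y - x) :=
    hgs.mul (smooth_gauss.comp (contDiff_id.sub contDiff_const))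
  refine ((((integrable_japWeight (ι := ι)).comp_sub_right x).const_mul
    (B * D * ((2 * h) ^ l * (l ! : ℝ) ^ s)))).mono'
    (hps.continuous_iteratedFDeriv (natCast_le_smooth l)).aestronglyMeasurable
    (Eventually.of_forall fun y => ?_)
  refine (norm_iteratedFDeriv_mul_gauss_le hs hh hgs hg hD x l y).trans (le_of_eq ?_)
  ring

theorem pow_mul_norm_hat_le {s h B D : ℝ} (hs : 0 ≤ s) (hh : 0 ≤ h) {g : 𝔼 → ℂ}
    (hgs : Smooth g) (hg : GSNormLE s h B g)
    (hD : ∀ (j : ℕ) (y : 𝔼), ‖iteratedFDeriv ℝ j (gauss : 𝔼 → ℂ) y‖ ≤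
      D * japWeight ι y * (h ^ j * (j ! : ℝ) ^ s)) (x ξ : 𝔼) (l : ℕ) :
    ‖ξ‖ ^ l * ‖hat g x ξ‖ ≤
      (B * D * ∫ y, japWeight ι y) * ((2 * h) ^ l * (l ! : ℝ) ^ s) := by
  have hps : Smooth fun y => g y * gauss (y - x) :=
    hgs.mul (smooth_gauss.comp (contDiff_id.sub contDiff_const))
  have h1 := fourier_decay hps (integrable_iteratedFDeriv_mul_gauss hs hh hgs hg hD x) l
    (-((2 * Real.pi)⁻¹ • ξ))
  rw [← hat_eq_fourier] at h1
  have hpi := Real.pi_pos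
  have h2 : 2 * Real.pi * ‖-((2 * Real.pi)⁻¹ • ξ)‖ = ‖ξ‖ := by
    rw [norm_neg, norm_smul, Real.norm_of_nonneg (by positivity)]
    field_simp
  rw [h2] at h1
  refine h1.trans ?_
  calc ∫ y, ‖iteratedFDeriv ℝ l (fun y => g y * gauss (y - x)) y‖
      ≤ ∫ y, (B * D * ((2 * h) ^ l * (l ! : ℝ) ^ s)) * japWeight ι (y - x) := by
        refine integral_mono_of_nonneg (Eventually.of_forall fun _ => norm_nonneg _)
          (((integrable_japWeight (ι := ι)).comp_sub_right x).const_mul _)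
          (Eventually.of_forall fun y => ?_)
        refine (norm_iteratedFDeriv_mul_gauss_le hs hh hgs hg hD x l y).trans (le_of_eq ?_)
        ring
    _ = _ := by
        rw [integral_const_mul, integral_sub_right_eq_self (japWeight ι) x]
        ring

/-- The geometric mean of a bound that decays in u alone and one that decays in v alone decays in
both, at half of the rates. -/
theorem le_of_two_bounds {a C₁ C₂ B u v : ℝ} (hC₁ : 0 ≤ C₁) (hC₂ : 0 ≤ C₂) (hB : 0 ≤ B)
    (ha : 0 ≤ a) (h₁ : a ≤ C₁ * B * Real.exp (-(2 * u))) (h₂ : a ≤ C₂ * B * Real.exp (-(2 * v))) :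
    a ≤ (C₁ + C₂) * B * Real.exp (-(u + v)) := by
  refine le_of_sq_le_sq ?_ (by positivity)
  calc a ^ 2 = a * a := sq a
    _ ≤ (C₁ * B * Real.exp (-(2 * u))) * (C₂ * B * Real.exp (-(2 * v))) := by gcongr
    _ = (C₁ * C₂) * (B * B * (Real.exp (-(2 * u)) * Real.exp (-(2 * v)))) := by ring
    _ ≤ (C₁ + C₂) ^ 2 * (B * B * (Real.exp (-(2 * u)) * Real.exp (-(2 * v)))) := by
        gcongr
        nlinarith [mul_nonneg hC₁ hC₂]
    _ = ((C₁ + C₂) * B * Real.exp (-(u + v))) ^ 2 := by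
        rw [mul_pow, mul_pow, ← Real.exp_add, ← Real.exp_nat_mul, sq B]
        rw [show -(2 * u) + -(2 * v) = ((2 : ℕ) : ℝ) * -(u + v) by push_cast; ring]
        ring

theorem exists_gsNormLE_one_gauss {h : ℝ} (hh : 0 < h) :
    ∃ B : ℝ, GSNormLE 1 h B (gauss : 𝔼 → ℂ) := by
  obtain ⟨B, hB⟩ := exists_gsNormLE_gauss (ι := ι)
  obtain ⟨C, -, hC⟩ := GSNormLE.half_to_one (V := 𝔼) (by norm_num : (0 : ℝ) < 6) hh
  exact ⟨_, hC _ _ hB⟩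

/-- Decay in x comes from the moments of g and decay in ξ from its derivatives; the two are combined
by `le_of_two_bounds`. -/
theorem hat_decay_one {r : ℝ} (hr : 0 ≤ r) :
    ∃ h : ℝ, 0 < h ∧ ∃ C : ℝ, 0 ≤ C ∧ ∀ (g : 𝔼 → ℂ) (B : ℝ), Smooth g → GSNormLE 1 h B g →
      ∀ x ξ, ‖hat g x ξ‖ ≤ C * B * Real.exp (-(r * ‖x‖ + r * ‖ξ‖)) := by
  -- The moments give the rate 1/(2h) in x and 1/(4h) in ξ; both have to exceed 2r.
  set h : ℝ := 1 / (8 * (r + 1)) with hh_def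
  have hh : 0 < h := by positivity
  obtain ⟨B', hB'⟩ := exists_gsNormLE_one_gauss (ι := ι) hh
  obtain ⟨D, hD0, hD⟩ := norm_iteratedFDeriv_gauss_le_japWeight hh.le hB'
  have hJ : 0 ≤ ∫ y, japWeight ι y := integral_nonneg fun y => (japWeight_pos y).le
  have hI : 0 ≤ ∫ w : 𝔼, Real.exp (2 * r * ‖w‖) * ‖gauss w‖ :=
    integral_nonneg fun y => by positivity
  refine ⟨h, hh, _, add_nonneg (mul_nonneg zero_le_two hI)
    (mul_nonneg zero_le_two (mul_nonneg hD0 hJ)), fun g B hgs hg x ξ => ?_⟩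
  have hB := hg.nonneg
  refine le_of_two_bounds (mul_nonneg zero_le_two hI)
    (mul_nonneg zero_le_two (mul_nonneg hD0 hJ)) hB (norm_nonneg _) ?_ ?_
  · have h1 : ∀ y, ‖g y‖ ≤ 2 * B * Real.exp (-(2 * r * ‖y‖)) := fun y => by
      refine (le_exp_of_moments (t := ‖y‖) (B := B) hh (fun k => ?_)).trans ?_
      · have := hg k 0 y
        rw [factorial_mul_rpow] at this
        simpa using this
      · gcongr
        rw [hh_def, le_div_iff₀ (by positivity)]
        have := norm_nonneg y
        field_simp
        nlinarith [mul_nonneg hr this]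
    refine (norm_hat_le_of_exp (by positivity) h1 x ξ).trans (le_of_eq ?_)
    rw [show 2 * r * ‖x‖ = 2 * (r * ‖x‖) by ring]
    ring
  · refine (le_exp_of_moments (t := ‖ξ‖) (h := 2 * h) (B := B * D * ∫ y, japWeight ι y)
      (by positivity) (fun k => ?_)).trans ?_
    · simpa using pow_mul_norm_hat_le (by norm_num) hh.le hgs hg hD x ξ k
    · rw [show 2 * (B * D * ∫ y, japWeight ι y) = 2 * (D * ∫ y, japWeight ι y) * B by ring]
      gcongr
      rw [hh_def, le_div_iff₀ (by positivity)]
      have := norm_nonneg ξ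
      field_simp
      nlinarith [mul_nonneg hr this]

theorem hat_decay_half {h : ℝ} (hh : 0 < h) :
    ∃ ε : ℝ, 0 < ε ∧ ∃ C : ℝ, 0 ≤ C ∧ ∀ (g : 𝔼 → ℂ) (B : ℝ), Smooth g →
      GSNormLE (1 / 2) h B g →
      ∀ x ξ, ‖hat g x ξ‖ ≤ C * B * Real.exp (-(ε * ‖x‖ ^ 2 + ε * ‖ξ‖ ^ 2)) := by
  obtain ⟨B', hB'⟩ := exists_gsNormLE_gauss (ι := ι)
  -- A radius that is admissible for g and for the Gaussian window.
  set H : ℝ := h + 6 with hH_def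
  have hH : 0 < H := by positivity
  have hB'' := hB'.mono (by norm_num) (show 6 ≤ H by linarith)
  obtain ⟨D, hD0, hD⟩ := norm_iteratedFDeriv_gauss_le_japWeight hH.le hB''
  -- In ξ the moments of radius 2H give the rate 1/(16H²) = 2ε. In x the available rate 1/(4H²)
  -- exceeds 4ε, of which the window keeps 2ε.
  set ε : ℝ := 1 / (32 * H ^ 2) with hε
  have hε0 : 0 < ε := by positivity
  have hε8 : 4 * ε ≤ 1 / 8 := by
    rw [hε, mul_one_div, div_le_iff₀ (by positivity)]
    nlinarith
  have hJ : 0 ≤ ∫ y, japWeight ι y := integral_nonneg fun y => (japWeight_pos y).le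
  have hI : 0 ≤ ∫ w : 𝔼, Real.exp (4 * ε * ‖w‖ ^ 2) * ‖gauss w‖ :=
    integral_nonneg fun y => by positivity
  refine ⟨ε, hε0, _, add_nonneg (mul_nonneg zero_le_two hI)
    (mul_nonneg zero_le_two (mul_nonneg hD0 hJ)), fun g B hgs hg x ξ => ?_⟩
  have hgH := hg.mono hh.le (show h ≤ H by linarith)
  have hB := hg.nonneg
  refine le_of_two_bounds (mul_nonneg zero_le_two hI)
    (mul_nonneg zero_le_two (mul_nonneg hD0 hJ)) hB (norm_nonneg _) ?_ ?_
  · have h1 : ∀ y, ‖g y‖ ≤ 2 * B * Real.exp (-(4 * ε * ‖y‖ ^ 2)) := fun y => by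
      refine (le_exp_sq_of_moments (t := ‖y‖) (a := ‖g y‖) (B := B) hH hB (fun k => ?_)).trans ?_
      · have := hgH k 0 y
        rw [factorial_mul_rpow] at this
        simpa using this
      · gcongr
        rw [hε]
        apply le_of_eq_of_le (b := ‖y‖ ^ 2 / (8 * H ^ 2))
        · field_simp; ring
        · gcongr; norm_num
    refine (norm_hat_le_of_exp_sq (by positivity) hε8 h1 x ξ).trans (le_of_eq ?_)
    rw [show 4 * ε / 2 * ‖x‖ ^ 2 = 2 * (ε * ‖x‖ ^ 2) by ring]
    ring
  · refine (le_exp_sq_of_moments (t := ‖ξ‖) (h := 2 * H) (by positivity)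
      (show 0 ≤ B * D * ∫ y, japWeight ι y by positivity)
      (fun k => pow_mul_norm_hat_le (by norm_num) hH.le hgs hgH hD x ξ k)).trans ?_
    rw [show 2 * (B * D * ∫ y, japWeight ι y) = 2 * (D * ∫ y, japWeight ι y) * B by ring]
    gcongr
    rw [hε]
    apply le_of_eq
    field_simp
    ring

end Analysis


/-! ## Superpositions of time-frequency shifts -/

section Shifts

variable {V : Type*} [NormedAddCommGroup V] [InnerProductSpace ℝ V]

theorem smooth_of_mem_roumieu {s : ℝ} : ∀ f ∈ GSRoumieu V s, Smooth f := fun _ hf => hf.1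

theorem smooth_of_mem_beurling {s : ℝ} : ∀ f ∈ GSBeurling V s, Smooth f := fun _ hf => hf.1

theorem pairOne_of_mem (F : GSBeurlingDual V 1) {g : V → ℂ} (hg : g ∈ GSBeurling V 1) :
    pairOne F g = (F : GSBeurling V 1 →ₗ[ℂ] ℂ) ⟨g, hg⟩ := dif_pos hg

theorem pairHalf_of_mem (f : GSRoumieuDual V (1 / 2)) {g : V → ℂ}
    (hg : g ∈ GSRoumieu V (1 / 2)) :
    pairHalf f g = (f : GSRoumieu V (1 / 2) →ₗ[ℂ] ℂ) ⟨g, hg⟩ := dif_pos hg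

theorem pairHalf_toHalf (F : GSBeurlingDual V 1) {g : V → ℂ} (hg : g ∈ GSRoumieu V (1 / 2)) :
    pairHalf (toHalf F) g = pairOne F g := by
  rw [pairHalf_of_mem _ hg, pairOne_of_mem _ (roumieu_half_le_beurling_one hg)]
  rfl

/-- Windows of order `1 / 2`. -/
structure IsWindow (Q : V → ℂ) : Prop where
  smooth : Smooth Q
  bound : ∃ h : ℝ, 1 ≤ h ∧ ∃ B : ℝ, GSNormLE (1 / 2) h B Q

theorem IsWindow.gsNormLE_one {Q : V → ℂ} (hQ : IsWindow Q) {h : ℝ} (hh : 0 < h) :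
    ∃ B, 0 ≤ B ∧ GSNormLE 1 h B Q := by
  obtain ⟨hs, H, hH, B, hB⟩ := hQ
  obtain ⟨C, hC0, hC⟩ := GSNormLE.half_to_one (V := V) (by linarith : 0 < H) hh
  exact ⟨C * B, mul_nonneg hC0 hB.nonneg, hC _ _ hB⟩

theorem atomW_mem_roumieu {Q : V → ℂ} (hQ : IsWindow Q) (x ξ : V) :
    atomW Q x ξ ∈ GSRoumieu V (1 / 2) := by
  obtain ⟨hs, H, hH, B, hB⟩ := hQ
  exact ⟨smooth_atomW hs x ξ, 3 * H, by linarith, _, hB.atomW_half (by linarith) hs x ξ⟩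

theorem atomW_mem_beurling {Q : V → ℂ} (hQ : IsWindow Q) (x ξ : V) :
    atomW Q x ξ ∈ GSBeurling V 1 :=
  roumieu_half_le_beurling_one (atomW_mem_roumieu hQ x ξ)

theorem IsWindow.atomW_gsNormLE_one {Q : V → ℂ} (hQ : IsWindow Q) {h : ℝ} (hh : 0 < h) :
    ∃ C, 0 ≤ C ∧ ∀ x ξ, GSNormLE 1 h (C * Real.exp (3 / h * (‖x‖ + ‖ξ‖))) (atomW Q x ξ) := by
  obtain ⟨B, hB0, hB⟩ := hQ.gsNormLE_one (show 0 < h / 3 by positivity)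
  refine ⟨2 * B, by positivity, fun x ξ => ?_⟩
  have := hB.atomW_one (by positivity) hQ.smooth x ξ
  rw [mul_div_cancel₀ h (by norm_num)] at this
  convert this using 1
  rw [mul_add, Real.exp_add, div_mul_eq_mul_div, div_mul_eq_mul_div, div_div_eq_mul_div,
    div_div_eq_mul_div, mul_comm 3, mul_comm 3]
  ring

theorem IsWindow.continuous_atomW_one {Q : V → ℂ} (hQ : IsWindow Q) {h : ℝ} (hh : 0 < h)
    (z₀ : V × V) {ε : ℝ} (hε : 0 < ε) :
    ∀ᶠ z in 𝓝 z₀, GSNormLE 1 h ε (atomW Q z.1 z.2 - atomW Q z₀.1 z₀.2) := by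
  obtain ⟨hs, H, hH, B, hB⟩ := hQ
  obtain ⟨C, hC0, hC⟩ := GSNormLE.half_to_one (V := V) (by linarith : 0 < 9 * H) hh
  filter_upwards [eventually_gsNormLE_atomW_sub hH hs hB z₀
    (show 0 < ε / (C + 1) by positivity)] with z hz k l x
  refine (hC _ _ hz k l x).trans ?_
  gcongr
  rw [mul_div_assoc', div_le_iff₀ (by positivity)]
  nlinarith

variable {Z : Type*} [TopologicalSpace Z] [MeasurableSpace Z] [OpensMeasurableSpace Z]
  [SecondCountableTopology Z] {μ : Measure Z} {X Ξ : Z → V}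

/-- A coefficient function all of whose exponential moments are finite. -/
structure IsCoeff (μ : Measure Z) (X Ξ : Z → V) (c : Z → ℂ) : Prop where
  meas : AEStronglyMeasurable c μ
  int : ∀ r : ℝ, Integrable (fun z => ‖c z‖ * Real.exp (r * (‖X z‖ + ‖Ξ z‖))) μ

theorem gsNormLE_superposition {Q : V → ℂ} (hQ : IsWindow Q) (hX : Continuous X)
    (hΞ : Continuous Ξ) {h : ℝ} (hh : 0 < h) :
    ∃ C, 0 ≤ C ∧ ∀ c : Z → ℂ, IsCoeff μ X Ξ c →
      Smooth (fun y => ∫ z, c z * atomW Q (X z) (Ξ z) y ∂μ) ∧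
      GSNormLE 1 h (C * ∫ z, ‖c z‖ * Real.exp (3 / h * (‖X z‖ + ‖Ξ z‖)) ∂μ)
        (fun y => ∫ z, c z * atomW Q (X z) (Ξ z) y ∂μ) := by
  obtain ⟨C, hC0, hC⟩ := hQ.atomW_gsNormLE_one hh
  refine ⟨C, hC0, fun c hc => ?_⟩
  have hcI := hc.int (3 / h)
  obtain ⟨h1, -, h3⟩ := superposition (μ := μ) hh (Φ := fun z => atomW Q (X z) (Ξ z))
    (N := fun z => C * Real.exp (3 / h * (‖X z‖ + ‖Ξ z‖))) (c := c)
    (fun z => smooth_atomW hQ.smooth _ _) (fun z => hC _ _)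
    (fun z₀ ε hε => (hX.prodMk hΞ).continuousAt.eventually
      (hQ.continuous_atomW_one hh (X z₀, Ξ z₀) hε)) hc.meas
    ((hcI.const_mul C).congr (Eventually.of_forall fun z => by ring))
  refine ⟨h1, ?_⟩
  convert h3 using 1
  rw [← integral_const_mul]
  exact integral_congr_ae (Eventually.of_forall fun z => by ring)

/-- In the seminorm of radius h the shifts grow like exp(3/h (‖x‖+‖ξ‖)). Membership in Σ_1 concerns
every h > 0, so all exponential moments of c are needed. -/
theorem superposition_mem_beurling {Q : V → ℂ} (hQ : IsWindow Q) (hX : Continuous X)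
    (hΞ : Continuous Ξ) {c : Z → ℂ} (hc : IsCoeff μ X Ξ c) :
    (fun y => ∫ z, c z * atomW Q (X z) (Ξ z) y ∂μ) ∈ GSBeurling V 1 := by
  refine ⟨?_, fun h hh => ?_⟩
  · obtain ⟨C, -, hC⟩ := gsNormLE_superposition (μ := μ) hQ hX hΞ one_pos
    exact (hC c hc).1
  · obtain ⟨C, -, hC⟩ := gsNormLE_superposition (μ := μ) hQ hX hΞ hh
    exact ⟨_, (hC c hc).2⟩

theorem pairOne_superposition (F : GSBeurlingDual V 1) {Q : V → ℂ} (hQ : IsWindow Q)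
    (hX : Continuous X) (hΞ : Continuous Ξ) {c : Z → ℂ} (hc : IsCoeff μ X Ξ c) :
    pairOne F (fun y => ∫ z, c z * atomW Q (X z) (Ξ z) y ∂μ) =
      ∫ z, c z * pairOne F (atomW Q (X z) (Ξ z)) ∂μ := by
  obtain ⟨h, hh, D, hD0, hD⟩ := F.2
  obtain ⟨C, hC0, hC⟩ := hQ.atomW_gsNormLE_one hh
  have hmem := superposition_mem_beurling hQ hX hΞ hc
  rw [pairOne_of_mem F hmem]
  have := functional_superposition (μ := μ) smooth_of_mem_beurling hh
    (F : GSBeurling V 1 →ₗ[ℂ] ℂ) hD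
    (Φ := fun z => ⟨atomW Q (X z) (Ξ z), atomW_mem_beurling hQ _ _⟩)
    (N := fun z => C * Real.exp (3 / h * (‖X z‖ + ‖Ξ z‖))) (c := c) (fun z => hC _ _)
    (fun z₀ ε hε => (hX.prodMk hΞ).continuousAt.eventually
      (hQ.continuous_atomW_one hh (X z₀, Ξ z₀) hε)) hc.meas
    (((hc.int (3 / h)).const_mul C).congr (Eventually.of_forall fun z => by ring))
    ⟨_, hmem⟩ rfl
  rw [this]
  refine integral_congr_ae (Eventually.of_forall fun z => ?_)
  simp only [pairOne_of_mem F (atomW_mem_beurling hQ _ _)]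

theorem pairOne_atomW_growth (F : GSBeurlingDual V 1) {Q : V → ℂ} (hQ : IsWindow Q) :
    ∃ C r : ℝ, 0 ≤ C ∧ 0 ≤ r ∧
      ∀ x ξ, ‖pairOne F (atomW Q x ξ)‖ ≤ C * Real.exp (r * (‖x‖ + ‖ξ‖)) := by
  obtain ⟨h, hh, D, hD0, hD⟩ := F.2
  obtain ⟨C, hC0, hC⟩ := hQ.atomW_gsNormLE_one hh
  refine ⟨D * C, 3 / h, by positivity, by positivity, fun x ξ => ?_⟩
  rw [pairOne_of_mem F (atomW_mem_beurling hQ _ _), mul_assoc]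
  exact hD _ _ (hC x ξ)

theorem continuous_pairHalf_atomW (f : GSRoumieuDual V (1 / 2)) {Q : V → ℂ} (hQ : IsWindow Q) :
    Continuous fun z : V × V => pairHalf f (atomW Q z.1 z.2) := by
  obtain ⟨H, hH, B, hB⟩ := hQ.bound
  obtain ⟨C, hC0, hC⟩ := f.2 (9 * H) (by linarith)
  have key : ∀ z₀ z : V × V, ∀ ε, GSNormLE (1 / 2) (9 * H) ε
      (atomW Q z.1 z.2 - atomW Q z₀.1 z₀.2) →
      dist (pairHalf f (atomW Q z.1 z.2)) (pairHalf f (atomW Q z₀.1 z₀.2)) ≤ C * ε := by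
    intro z₀ z ε hz
    let a : GSRoumieu V (1 / 2) := ⟨atomW Q z.1 z.2, atomW_mem_roumieu hQ z.1 z.2⟩
    let b : GSRoumieu V (1 / 2) := ⟨atomW Q z₀.1 z₀.2, atomW_mem_roumieu hQ z₀.1 z₀.2⟩
    have h1 := hC (a - b) ε hz
    rw [map_sub, ← dist_eq_norm] at h1
    rw [pairHalf_of_mem f a.2, pairHalf_of_mem f b.2]
    exact h1
  clear hC
  refine continuous_iff_continuousAt.2 fun z₀ => Metric.tendsto_nhds.2 fun ε hε => ?_
  filter_upwards [eventually_gsNormLE_atomW_sub hH hQ.smooth hB z₀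
    (show 0 < ε / (C + 1) by positivity)] with z hz
  refine (key _ _ _ hz).trans_lt ?_
  rw [mul_div_assoc', div_lt_iff₀ (by positivity)]
  nlinarith

theorem continuous_pairOne_atomW (F : GSBeurlingDual V 1) {Q : V → ℂ} (hQ : IsWindow Q) :
    Continuous fun z : V × V => pairOne F (atomW Q z.1 z.2) := by
  have := continuous_pairHalf_atomW (toHalf F) hQ
  simpa only [pairHalf_toHalf F (atomW_mem_roumieu hQ _ _)] using this

/-- The analogue of `pairOne_superposition` for functionals of order `1 / 2` needs Gaussian
moments of the coefficients. -/
theorem pairHalf_superposition (f : GSRoumieuDual V (1 / 2)) {Q : V → ℂ} (hQ : IsWindow Q)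
    (hX : Continuous X) (hΞ : Continuous Ξ) {c : Z → ℂ} (hcm : AEStronglyMeasurable c μ)
    {ε : ℝ} (hε : 0 < ε)
    (hc : Integrable (fun z => ‖c z‖ * Real.exp (ε * (‖X z‖ ^ 2 + ‖Ξ z‖ ^ 2))) μ) {g : V → ℂ}
    (hg : g ∈ GSRoumieu V (1 / 2)) (hgc : g = fun y => ∫ z, c z * atomW Q (X z) (Ξ z) y ∂μ) :
    pairHalf f g = ∫ z, c z * pairHalf f (atomW Q (X z) (Ξ z)) ∂μ := by
  obtain ⟨H₀, hH₀, B, hB⟩ := hQ.bound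
  -- In the chosen seminorms the shifts grow no faster than exp((‖x‖²+‖ξ‖²)/H²); enlarging H until
  -- 1/H² ≤ ε makes the available moment sufficient.
  set H := max H₀ (1 / √ε) with hH_def
  have hH : 1 ≤ H := hH₀.trans (le_max_left _ _)
  have hBH := hB.mono (by linarith) (le_max_left H₀ (1 / √ε))
  have hHε : 1 / H ^ 2 ≤ ε := by
    have h1 : 1 / √ε ≤ H := le_max_right _ _
    have h2 : 0 < √ε := Real.sqrt_pos.2 hε
    have h3 : (1 / √ε) ^ 2 ≤ H ^ 2 := by gcongr
    rw [div_pow, Real.sq_sqrt hε.le, one_pow] at h3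
    rw [div_le_iff₀ (by positivity)]
    rw [div_le_iff₀ hε] at h3
    linarith
  have h9 : 0 < 9 * H := by linarith
  obtain ⟨D, hD0, hD⟩ := f.2 (9 * H) h9
  have hB0 := hB.nonneg
  have hbd : ∀ x ξ, GSNormLE (1 / 2) (9 * H)
      (2 * B * Real.exp (ε * (‖x‖ ^ 2 + ‖ξ‖ ^ 2))) (atomW Q x ξ) := by
    intro x ξ k l y
    have h1 := ((hBH.atomW_half (by linarith) hQ.smooth x ξ).mono (by linarith)
      (show 3 * H ≤ 9 * H by linarith)) k l y
    refine h1.trans ?_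
    have h2 : Real.exp ((‖x‖ / H) ^ 2) * Real.exp ((‖ξ‖ / H) ^ 2) ≤
        Real.exp (ε * (‖x‖ ^ 2 + ‖ξ‖ ^ 2)) := by
      rw [← Real.exp_add, div_pow, div_pow, ← add_div, div_eq_mul_one_div, mul_comm]
      gcongr
    calc _ = 2 * B * (Real.exp ((‖x‖ / H) ^ 2) * Real.exp ((‖ξ‖ / H) ^ 2)) *
          ((9 * H) ^ (k + l) * ((k ! : ℝ) * (l ! : ℝ)) ^ (1 / 2 : ℝ)) := by ring
      _ ≤ _ := by gcongr
  rw [pairHalf_of_mem f hg]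
  have := functional_superposition (μ := μ) smooth_of_mem_roumieu h9
    (f : GSRoumieu V (1 / 2) →ₗ[ℂ] ℂ) hD
    (Φ := fun z => ⟨atomW Q (X z) (Ξ z), atomW_mem_roumieu hQ _ _⟩)
    (N := fun z => 2 * B * Real.exp (ε * (‖X z‖ ^ 2 + ‖Ξ z‖ ^ 2))) (c := c) (fun z => hbd _ _)
    (fun z₀ ε hε => (hX.prodMk hΞ).continuousAt.eventually
      (eventually_gsNormLE_atomW_sub hH hQ.smooth hBH (X z₀, Ξ z₀) hε)) hcm
    ((hc.const_mul (2 * B)).congr (Eventually.of_forall fun z => by ring)) ⟨g, hg⟩ hgc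
  rw [this]
  refine integral_congr_ae (Eventually.of_forall fun z => ?_)
  simp only [pairHalf_of_mem f (atomW_mem_roumieu hQ _ _)]

end Shifts


/-! ## The inversion formula -/

section Inversion

variable {ι : Type*} [Fintype ι]

local notation "𝔼" => EuclideanSpace ℝ ι

variable (ι) in
/-- The normalising constant of the short-time Fourier transform. -/
def stftConst : ℝ := (2 * Real.pi) ^ (-(Fintype.card ι : ℝ) / 2)

theorem stftConst_pos : 0 < stftConst ι := by
  unfold stftConst
  have := Real.pi_pos
  positivity

theorem stftConst_sq : stftConst ι ^ 2 * (2 * Real.pi) ^ (Fintype.card ι) = 1 := by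
  have h : (0 : ℝ) < 2 * Real.pi := by positivity
  rw [stftConst, ← Real.rpow_natCast, ← Real.rpow_natCast, ← Real.rpow_mul h.le,
    ← Real.rpow_add h]
  convert Real.rpow_zero _ using 2
  push_cast
  ring

theorem isWindow_gauss : IsWindow (gauss : 𝔼 → ℂ) := by
  obtain ⟨B, hB⟩ := exists_gsNormLE_gauss (ι := ι)
  exact ⟨smooth_gauss, 6, by norm_num, B, hB⟩

theorem stft_eq (f : GSRoumieuDual 𝔼 (1 / 2)) (x ξ : 𝔼) :
    stft f x ξ = (stftConst ι : ℂ) * pairHalf f (atomW gauss x ξ) := by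
  have : (fun y => conj (gauss (y - x)) * Complex.exp (-Complex.I * (inner ℝ y ξ : ℝ))) =
      atomW gauss x ξ := by
    ext y
    rw [conj_gauss]
    rfl
  rw [stft, this]
  rfl

theorem norm_le_of_gsNormLE {V : Type*} [NormedAddCommGroup V] [NormedSpace ℝ V] {s h B : ℝ}
    {g : V → ℂ} (hg : GSNormLE s h B g) (y : V) : ‖g y‖ ≤ B := by
  simpa using hg 0 0 y

theorem exists_bound_of_mem_beurling {V : Type*} [NormedAddCommGroup V] [NormedSpace ℝ V]
    {g : V → ℂ} (hg : g ∈ GSBeurling V 1) : ∃ B, ∀ y, ‖g y‖ ≤ B := by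
  obtain ⟨B, hB⟩ := hg.2 1 one_pos
  exact ⟨B, norm_le_of_gsNormLE hB⟩

theorem integrable_gauss : Integrable (gauss : 𝔼 → ℂ) := by
  have := integrable_exp_mul_gauss (ι := ι) 0
  simp only [zero_mul, Real.exp_zero, one_mul] at this
  exact (integrable_norm_iff continuous_gauss.aestronglyMeasurable).1 this

theorem integrable_atomW_gauss (x ξ : 𝔼) : Integrable (atomW gauss x ξ) := by
  refine ((integrable_gauss.comp_sub_right x).norm).mono'
    (smooth_atomW smooth_gauss x ξ).continuous.aestronglyMeasurable
    (Eventually.of_forall fun y => ?_)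
  rw [norm_atomW]

theorem integrable_mul_atomW {g : 𝔼 → ℂ} (hg : Continuous g) {B : ℝ} (hB : ∀ y, ‖g y‖ ≤ B)
    (x ξ : 𝔼) : Integrable fun y => g y * atomW gauss x ξ y :=
  (integrable_atomW_gauss x ξ).bdd_mul hg.aestronglyMeasurable (Eventually.of_forall hB)

theorem stronglyMeasurable_hat {g : 𝔼 → ℂ} (hg : Continuous g) :
    StronglyMeasurable fun z : 𝔼 × 𝔼 => hat g z.1 z.2 := by
  have h1 : Continuous fun p : (𝔼 × 𝔼) × 𝔼 => g p.2 * atomW gauss p.1.1 (-p.1.2) p.2 := by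
    have h2 := (continuous_atomW (continuous_gauss (ι := ι))).comp
      (show Continuous fun p : (𝔼 × 𝔼) × 𝔼 => (p.1.1, -p.1.2, p.2) by fun_prop)
    have h3 : Continuous fun p : (𝔼 × 𝔼) × 𝔼 => atomW gauss p.1.1 (-p.1.2) p.2 := h2
    fun_prop
  exact h1.stronglyMeasurable.integral_prod_right (ν := (volume : Measure 𝔼))

theorem integrable_exp_neg_prod {r : ℝ} (hr : 0 < r) :
    Integrable fun z : 𝔼 × 𝔼 => Real.exp (-(r * ‖z.1‖ + r * ‖z.2‖)) := by
  have := (integrable_exp_neg_mul_norm (ι := ι) hr).mul_prod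
    (integrable_exp_neg_mul_norm (ι := ι) hr)
  refine this.congr (Eventually.of_forall fun z => ?_)
  simp only [← Real.exp_add]
  congr 1
  ring

theorem integrable_hat_mul_exp {g : 𝔼 → ℂ} (hg : g ∈ GSBeurling 𝔼 1) (r : ℝ) :
    Integrable fun z : 𝔼 × 𝔼 => ‖hat g z.1 z.2‖ * Real.exp (r * (‖z.1‖ + ‖z.2‖)) := by
  obtain ⟨h, hh, C, hC0, hC⟩ := hat_decay_one (ι := ι) (r := |r| + 1) (by positivity)
  obtain ⟨B, hB⟩ := hg.2 h hh
  refine ((integrable_exp_neg_prod (ι := ι) one_pos).const_mul (C * B)).mono' ?_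
    (Eventually.of_forall fun z => ?_)
  · exact (stronglyMeasurable_hat hg.1.continuous).norm.aestronglyMeasurable.mul
      (by fun_prop : Continuous fun z : 𝔼 × 𝔼 =>
        Real.exp (r * (‖z.1‖ + ‖z.2‖))).aestronglyMeasurable
  · rw [Real.norm_of_nonneg (by positivity)]
    have hB0 := hB.nonneg
    calc ‖hat g z.1 z.2‖ * Real.exp (r * (‖z.1‖ + ‖z.2‖))
        ≤ (C * B * Real.exp (-((|r| + 1) * ‖z.1‖ + (|r| + 1) * ‖z.2‖))) *
            Real.exp (|r| * (‖z.1‖ + ‖z.2‖)) := by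
          gcongr
          · exact hC g B hg.1 hB z.1 z.2
          · exact le_abs_self r
      _ = _ := by
          rw [mul_assoc, ← Real.exp_add]
          congr 2
          ring

theorem isCoeff_hat {g : 𝔼 → ℂ} (hg : g ∈ GSBeurling 𝔼 1) (a : ℂ) :
    IsCoeff (volume : Measure (𝔼 × 𝔼)) Prod.fst Prod.snd (fun z => a * hat g z.1 z.2) := by
  refine ⟨((stronglyMeasurable_hat hg.1.continuous).const_mul a).aestronglyMeasurable,
    fun r => ?_⟩
  refine ((integrable_hat_mul_exp hg r).const_mul ‖a‖).congr (Eventually.of_forall fun z => ?_)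
  simp only [norm_mul]
  ring

/-- Fourier inversion for y ↦ g(y) `gauss`(y-x) with x fixed; the constant comes from passing
between the frequency normalisations. -/
theorem integral_hat_mul_modul {g : 𝔼 → ℂ} (hg : g ∈ GSBeurling 𝔼 1) (x y : 𝔼) :
    ∫ ξ, hat g x ξ * modul ξ y =
      ((2 * Real.pi) ^ (Fintype.card ι) : ℝ) * (g y * gauss (y - x)) := by
  obtain ⟨B₁, hB₁⟩ := exists_bound_of_mem_beurling hg
  have hgc := hg.1.continuous
  set p : 𝔼 → ℂ := fun y => g y * gauss (y - x) with hp
  have hpc : Continuous p := by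
    have := continuous_gauss (ι := ι)
    fun_prop
  have hpi : Integrable p :=
    (integrable_gauss.comp_sub_right x).bdd_mul hgc.aestronglyMeasurable
      (Eventually.of_forall hB₁)
  have hpi0 := Real.pi_pos
  have hF : ∀ w, FourierTransform.fourier p w = hat g x (-((2 * Real.pi) • w)) := by
    intro w
    rw [hat_eq_fourier, smul_neg, neg_neg, smul_smul, inv_mul_cancel₀ (by positivity), one_smul]
  have hFi : Integrable (FourierTransform.fourier p) := by
    obtain ⟨h, hh, C, hC0, hC⟩ := hat_decay_one (ι := ι) (r := 1) zero_le_one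
    obtain ⟨B, hB⟩ := hg.2 h hh
    have hB0 := hB.nonneg
    refine ((integrable_exp_neg_mul_norm (ι := ι)
      (show 0 < 2 * Real.pi by positivity)).const_mul (C * B)).mono' ?_
      (Eventually.of_forall fun w => ?_)
    · have h1 : FourierTransform.fourier p = fun w => hat g x (-((2 * Real.pi) • w)) :=
        funext hF
      rw [h1]
      exact ((stronglyMeasurable_hat hgc).comp_measurable
        (show Measurable fun w : 𝔼 => (x, -((2 * Real.pi) • w)) by fun_prop)).aestronglyMeasurable
    · rw [hF w]
      refine (hC g B hg.1 hB x _).trans ?_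
      rw [norm_neg, norm_smul, Real.norm_of_nonneg (by positivity : 0 ≤ 2 * Real.pi)]
      gcongr
      have := norm_nonneg x
      linarith
  have hinv := congrFun (hpc.fourierInv_fourier_eq hpi hFi) y
  rw [Real.fourierInv_eq'] at hinv
  have h2 := Measure.integral_comp_smul (volume : Measure 𝔼)
    (fun ξ => hat g x ξ * modul ξ y) (-(2 * Real.pi))
  have h3 : (∫ w : 𝔼, hat g x (-(2 * Real.pi) • w) * modul (-(2 * Real.pi) • w) y) = p y := by
    rw [← hinv]
    refine integral_congr_ae (Eventually.of_forall fun w => ?_)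
    simp only [smul_eq_mul, hF w, neg_smul]
    rw [mul_comm]
    congr 1
    rw [modul, inner_neg_right, inner_smul_right, real_inner_comm]
    congr 1
    push_cast
    ring
  rw [h3, finrank_euclideanSpace] at h2
  have h4 : |((-(2 * Real.pi)) ^ (Fintype.card ι))⁻¹| = ((2 * Real.pi) ^ (Fintype.card ι))⁻¹ := by
    rw [abs_inv, abs_pow, abs_neg, abs_of_pos (by positivity)]
  rw [h4] at h2
  have h5 : ((2 * Real.pi) ^ (Fintype.card ι) : ℝ) ≠ 0 := by positivity
  change _ = ((2 * Real.pi) ^ (Fintype.card ι) : ℝ) * p y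
  rw [h2, Complex.real_smul, ← mul_assoc, ← Complex.ofReal_mul, mul_inv_cancel₀ h5]
  simp

theorem integral_gauss_mul_gauss : ∫ w : 𝔼, gauss w * gauss w = 1 := by
  have h1 : ∀ w : 𝔼, gauss w * gauss w =
      ((Real.pi ^ (-(Fintype.card ι : ℝ) / 2) * Real.exp (-1 * ‖w‖ ^ 2) : ℝ) : ℂ) := by
    intro w
    rw [gauss, ← Complex.ofReal_mul]
    congr 1
    rw [mul_mul_mul_comm, ← Real.exp_add, ← Real.rpow_add Real.pi_pos]
    congr 2 <;> ring
  simp only [h1]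
  rw [integral_complex_ofReal, integral_const_mul,
    GaussianFourier.integral_rexp_neg_mul_sq_norm one_pos, div_one, finrank_euclideanSpace,
    ← Real.rpow_add Real.pi_pos]
  norm_num
  rw [neg_div, neg_add_cancel, Real.rpow_zero]

theorem integrable_hat_mul {g : 𝔼 → ℂ} (hg : g ∈ GSBeurling 𝔼 1) {v : 𝔼 × 𝔼 → ℂ} {C R : ℝ}
    (hv : AEStronglyMeasurable v) (hvb : ∀ z, ‖v z‖ ≤ C * Real.exp (R * (‖z.1‖ + ‖z.2‖))) :
    Integrable fun z : 𝔼 × 𝔼 => hat g z.1 z.2 * v z := by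
  refine ((integrable_hat_mul_exp hg R).const_mul C).mono'
    ((stronglyMeasurable_hat hg.1.continuous).aestronglyMeasurable.mul hv)
    (Eventually.of_forall fun z => ?_)
  rw [norm_mul]
  calc _ ≤ ‖hat g z.1 z.2‖ * (C * Real.exp (R * (‖z.1‖ + ‖z.2‖))) := by
        gcongr
        exact hvb z
    _ = _ := by ring

theorem norm_gauss_le (w : 𝔼) :
    ‖gauss w‖ ≤ Real.pi ^ (-(Fintype.card ι : ℝ) / 4) := by
  rw [norm_gauss]
  refine mul_le_of_le_one_right (by positivity) ?_
  rw [Real.exp_le_one_iff]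
  have := sq_nonneg ‖w‖
  linarith

theorem integrable_hat_mul_atomW {g : 𝔼 → ℂ} (hg : g ∈ GSBeurling 𝔼 1) (y : 𝔼) :
    Integrable fun z : 𝔼 × 𝔼 => hat g z.1 z.2 * atomW gauss z.1 z.2 y := by
  have h2 := (continuous_atomW (continuous_gauss (ι := ι))).comp
    (show Continuous fun z : 𝔼 × 𝔼 => (z.1, z.2, y) by fun_prop)
  have h3 : Continuous fun z : 𝔼 × 𝔼 => atomW gauss z.1 z.2 y := h2
  refine integrable_hat_mul hg (C := Real.pi ^ (-(Fintype.card ι : ℝ) / 4)) (R := 0)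
    h3.aestronglyMeasurable fun z => ?_
  rw [norm_atomW, zero_mul, Real.exp_zero, mul_one]
  exact norm_gauss_le _

theorem integral_hat_mul_atomW {g : 𝔼 → ℂ} (hg : g ∈ GSBeurling 𝔼 1) (x y : 𝔼) :
    ∫ ξ, hat g x ξ * atomW gauss x ξ y =
      (((2 * Real.pi) ^ (Fintype.card ι) : ℝ) * g y) * (gauss (y - x) * gauss (y - x)) := by
  have : ∀ ξ, hat g x ξ * atomW gauss x ξ y = gauss (y - x) * (hat g x ξ * modul ξ y) :=
    fun ξ => by rw [atomW]; ring
  simp only [this]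
  rw [integral_const_mul, integral_hat_mul_modul hg]
  ring

/-- Integration in ξ returns (2π)^n g(y) `gauss`(y-x)², and the Gaussian has L² norm one. -/
theorem hat_inversion {g : 𝔼 → ℂ} (hg : g ∈ GSBeurling 𝔼 1) (y : 𝔼) :
    g y = ∫ z : 𝔼 × 𝔼, ((stftConst ι ^ 2 : ℝ) : ℂ) * hat g z.1 z.2 * atomW gauss z.1 z.2 y := by
  have h0 : ∫ z : 𝔼 × 𝔼, hat g z.1 z.2 * atomW gauss z.1 z.2 y =
      ∫ x, ∫ ξ, hat g x ξ * atomW gauss x ξ y :=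
    integral_prod (μ := (volume : Measure 𝔼)) (ν := (volume : Measure 𝔼))
      (fun z : 𝔼 × 𝔼 => hat g z.1 z.2 * atomW gauss z.1 z.2 y) (integrable_hat_mul_atomW hg y)
  have h2 : ∫ x : 𝔼, gauss (y - x) * gauss (y - x) = 1 := by
    rw [integral_sub_left_eq_self (fun w : 𝔼 => gauss w * gauss w) volume y,
      integral_gauss_mul_gauss]
  simp only [mul_assoc]
  rw [integral_const_mul, h0, integral_congr_ae (Eventually.of_forall fun x =>
    integral_hat_mul_atomW hg x y), integral_const_mul, h2, mul_one, ← mul_assoc,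
    ← Complex.ofReal_mul, stftConst_sq]
  simp

theorem integrable_exp_neg_sq_prod {r : ℝ} (hr : 0 < r) :
    Integrable fun z : 𝔼 × 𝔼 => Real.exp (-(r * ‖z.1‖ ^ 2 + r * ‖z.2‖ ^ 2)) := by
  refine ((integrable_exp_neg_prod (ι := ι) one_pos).const_mul (Real.exp (1 / (2 * r)))).mono'
    (by fun_prop) (Eventually.of_forall fun z => ?_)
  rw [Real.norm_of_nonneg (Real.exp_pos _).le, ← Real.exp_add]
  refine Real.exp_le_exp.2 ?_
  have h : ∀ t : ℝ, t ≤ r * t ^ 2 + 1 / (4 * r) := fun t => by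
    have h1 : r * t ^ 2 + 1 / (4 * r) - t = (2 * r * t - 1) ^ 2 / (4 * r) := by
      field_simp; ring
    have h2 : 0 ≤ (2 * r * t - 1) ^ 2 / (4 * r) := by positivity
    linarith
  have h1 := h ‖z.1‖
  have h2 := h ‖z.2‖
  have h3 : 1 / (2 * r) = 1 / (4 * r) + 1 / (4 * r) := by field_simp; norm_num
  linarith

/-- Half of the Gaussian decay of `hat g` pays for the growth of the atoms in a suitable seminorm,
the other half for integrability. -/
theorem pairHalf_eq_integral_hat (f : GSRoumieuDual 𝔼 (1 / 2)) {g : 𝔼 → ℂ}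
    (hg : g ∈ GSRoumieu 𝔼 (1 / 2)) :
    pairHalf f g = ∫ z : 𝔼 × 𝔼, ((stftConst ι ^ 2 : ℝ) : ℂ) * hat g z.1 z.2 *
      pairHalf f (atomW gauss z.1 z.2) := by
  obtain ⟨h, hh, B, hB⟩ := hg.2
  obtain ⟨ε, hε, C, hC0, hC⟩ := hat_decay_half (ι := ι) hh
  have hB0 := hB.nonneg
  have hm := (stronglyMeasurable_hat hg.1.continuous).const_mul ((stftConst ι ^ 2 : ℝ) : ℂ)
  refine pairHalf_superposition f isWindow_gauss continuous_fst continuous_snd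
    hm.aestronglyMeasurable (show 0 < ε / 2 by positivity) ?_ hg
    (funext fun y => hat_inversion (roumieu_half_le_beurling_one hg) y)
  refine ((integrable_exp_neg_sq_prod (ι := ι) (show 0 < ε / 2 by positivity)).const_mul
    (‖((stftConst ι ^ 2 : ℝ) : ℂ)‖ * (C * B))).mono' ?_ (Eventually.of_forall fun z => ?_)
  · exact hm.norm.aestronglyMeasurable.mul (by fun_prop : Continuous fun z : 𝔼 × 𝔼 =>
      Real.exp (ε / 2 * (‖z.1‖ ^ 2 + ‖z.2‖ ^ 2))).aestronglyMeasurable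
  · rw [Real.norm_of_nonneg (by positivity), norm_mul]
    calc ‖((stftConst ι ^ 2 : ℝ) : ℂ)‖ * ‖hat g z.1 z.2‖ *
          Real.exp (ε / 2 * (‖z.1‖ ^ 2 + ‖z.2‖ ^ 2))
        ≤ ‖((stftConst ι ^ 2 : ℝ) : ℂ)‖ *
            (C * B * Real.exp (-(ε * ‖z.1‖ ^ 2 + ε * ‖z.2‖ ^ 2))) *
            Real.exp (ε / 2 * (‖z.1‖ ^ 2 + ‖z.2‖ ^ 2)) := by
          gcongr
          exact hC g B hg.1 hB z.1 z.2
      _ = ‖((stftConst ι ^ 2 : ℝ) : ℂ)‖ * (C * B) *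
            (Real.exp (-(ε * ‖z.1‖ ^ 2 + ε * ‖z.2‖ ^ 2)) *
            Real.exp (ε / 2 * (‖z.1‖ ^ 2 + ‖z.2‖ ^ 2))) := by ring
      _ = _ := by
          rw [← Real.exp_add]
          congr 2
          ring

/-- Covariance: a time-frequency shift translates the transform in phase space, up to a phase. This
turns the inversion formula into a bound by convolution type averages. -/
theorem norm_hat_atomW (Q : 𝔼 → ℂ) (x ξ x' ξ' : 𝔼) :
    ‖hat (atomW Q x ξ) x' ξ'‖ = ‖hat Q (x' - x) (ξ' - ξ)‖ := by
  have h1 : hat (atomW Q x ξ) x' ξ' = modul (ξ - ξ') x * hat Q (x' - x) (ξ' - ξ) := by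
    rw [hat, hat, ← integral_const_mul,
      ← integral_add_right_eq_self (fun y => atomW Q x ξ y * atomW gauss x' (-ξ') y) x]
    refine integral_congr_ae (Eventually.of_forall fun y => ?_)
    simp only [atomW]
    have e1 : y + x - x = y := by abel
    have e2 : y + x - x' = y - (x' - x) := by abel
    have e3 : -(ξ' - ξ) = ξ + -ξ' := by abel
    rw [e1, e2, e3, sub_eq_add_neg ξ ξ', modul_add_left, modul_add_left, modul_add_right,
      modul_add_right]
    ring
  rw [h1, norm_mul, norm_modul, one_mul]

theorem IsWindow.hat_decay {Q : 𝔼 → ℂ} (hQ : IsWindow Q) {r : ℝ} (hr : 0 ≤ r) :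
    ∃ C : ℝ, 0 ≤ C ∧ ∀ x ξ, ‖hat Q x ξ‖ ≤ C * Real.exp (-(r * ‖x‖ + r * ‖ξ‖)) := by
  obtain ⟨h, hh, C, hC0, hC⟩ := hat_decay_one (ι := ι) hr
  obtain ⟨B, hB0, hB⟩ := hQ.gsNormLE_one hh
  exact ⟨C * B, by positivity, fun x ξ => hC Q B hQ.smooth hB x ξ⟩

/-- The reproducing inequality for the short-time Fourier transform. -/
theorem enorm_pairHalf_atomW_le {r : ℝ} (hr : 0 ≤ r) :
    ∃ C : ℝ≥0, ∀ (f : GSRoumieuDual 𝔼 (1 / 2)) (x ξ : 𝔼),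
      ‖pairHalf f (atomW gauss x ξ)‖ₑ ≤ C * ∫⁻ z : 𝔼 × 𝔼,
        ENNReal.ofReal (Real.exp (-(r * ‖z.1 - x‖ + r * ‖z.2 - ξ‖))) *
          ‖pairHalf f (atomW gauss z.1 z.2)‖ₑ := by
  obtain ⟨C, hC0, hC⟩ := (isWindow_gauss (ι := ι)).hat_decay hr
  refine ⟨Real.toNNReal (stftConst ι ^ 2 * C), fun f x ξ => ?_⟩
  rw [pairHalf_eq_integral_hat f (atomW_mem_roumieu isWindow_gauss x ξ),
    ← lintegral_const_mul' _ _ ENNReal.coe_ne_top]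
  refine (enorm_integral_le_lintegral_enorm _).trans (lintegral_mono fun z => ?_)
  have hs := stftConst_pos (ι := ι)
  rw [enorm_mul, ← mul_assoc]
  gcongr
  rw [← ofReal_norm, norm_mul, norm_hat_atomW]
  change _ ≤ ENNReal.ofReal (stftConst ι ^ 2 * C) * _
  rw [← ENNReal.ofReal_mul (by positivity)]
  refine ENNReal.ofReal_le_ofReal ?_
  rw [Complex.norm_real, Real.norm_of_nonneg (by positivity), mul_assoc]
  gcongr
  exact hC _ _

theorem hat_add {g g' : 𝔼 → ℂ} (hg : g ∈ GSBeurling 𝔼 1) (hg' : g' ∈ GSBeurling 𝔼 1) (x ξ : 𝔼) :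
    hat (g + g') x ξ = hat g x ξ + hat g' x ξ := by
  obtain ⟨B, hB⟩ := exists_bound_of_mem_beurling hg
  obtain ⟨B', hB'⟩ := exists_bound_of_mem_beurling hg'
  rw [hat, hat, hat, ← integral_add (integrable_mul_atomW hg.1.continuous hB _ _)
    (integrable_mul_atomW hg'.1.continuous hB' _ _)]
  refine integral_congr_ae (Eventually.of_forall fun y => ?_)
  simp only [Pi.add_apply]
  ring

theorem hat_smul (a : ℂ) (g : 𝔼 → ℂ) (x ξ : 𝔼) : hat (a • g) x ξ = a * hat g x ξ := by
  rw [hat, hat, ← integral_const_mul]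
  refine integral_congr_ae (Eventually.of_forall fun y => ?_)
  simp only [Pi.smul_apply, smul_eq_mul]
  ring

/-- The functional on `Σ_1` with an exponentially bounded phase space density. -/
theorem exists_beurlingDual {v : 𝔼 × 𝔼 → ℂ} {C R : ℝ} (hC : 0 ≤ C)
    (hv : AEStronglyMeasurable v) (hvb : ∀ z, ‖v z‖ ≤ C * Real.exp (R * (‖z.1‖ + ‖z.2‖))) :
    ∃ F : GSBeurlingDual 𝔼 1, ∀ g ∈ GSBeurling 𝔼 1,
      pairOne F g = ∫ z : 𝔼 × 𝔼, hat g z.1 z.2 * v z := by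
  let L : GSBeurling 𝔼 1 →ₗ[ℂ] ℂ :=
    { toFun := fun g => ∫ z : 𝔼 × 𝔼, hat (g : 𝔼 → ℂ) z.1 z.2 * v z
      map_add' := fun g g' => by
        rw [← integral_add (integrable_hat_mul g.2 hv hvb) (integrable_hat_mul g'.2 hv hvb)]
        refine integral_congr_ae (Eventually.of_forall fun z => ?_)
        simp only [Submodule.coe_add]
        rw [hat_add g.2 g'.2, add_mul]
      map_smul' := fun a g => by
        rw [RingHom.id_apply, smul_eq_mul, ← integral_const_mul]
        refine integral_congr_ae (Eventually.of_forall fun z => ?_)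
        simp only [Submodule.coe_smul]
        rw [hat_smul, mul_assoc] }
  -- The rate |R| compensates the growth of v, and the additional 1 leaves an integrable
  -- exponential.
  obtain ⟨h, hh, D, hD0, hD⟩ := hat_decay_one (ι := ι) (r := |R| + 1) (by positivity)
  have hL : L ∈ GSBeurlingDual 𝔼 1 := by
    refine ⟨h, hh, D * C * ∫ z : 𝔼 × 𝔼, Real.exp (-(1 * ‖z.1‖ + 1 * ‖z.2‖)),
      mul_nonneg (by positivity) (integral_nonneg fun _ => (Real.exp_pos _).le),
      fun g B hB => ?_⟩
    have hB0 := hB.nonneg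
    have h1 := norm_integral_le_of_norm_le
      (f := fun z : 𝔼 × 𝔼 => hat (g : 𝔼 → ℂ) z.1 z.2 * v z)
      ((integrable_exp_neg_prod (ι := ι) one_pos).const_mul (D * B * C))
      (Eventually.of_forall fun z => ?_)
    · refine h1.trans (le_of_eq ?_)
      rw [integral_const_mul]
      ring
    · rw [norm_mul]
      calc ‖hat (g : 𝔼 → ℂ) z.1 z.2‖ * ‖v z‖
          ≤ (D * B * Real.exp (-((|R| + 1) * ‖z.1‖ + (|R| + 1) * ‖z.2‖))) *
            (C * Real.exp (|R| * (‖z.1‖ + ‖z.2‖))) := by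
            gcongr
            · exact hD _ _ g.2.1 hB _ _
            · refine (hvb z).trans ?_
              gcongr
              exact le_abs_self R
        _ = D * B * C * (Real.exp (-((|R| + 1) * ‖z.1‖ + (|R| + 1) * ‖z.2‖)) *
              Real.exp (|R| * (‖z.1‖ + ‖z.2‖))) := by ring
        _ = _ := by
            rw [← Real.exp_add]
            congr 2
            ring
  refine ⟨⟨L, hL⟩, fun g hg => ?_⟩
  rw [pairOne_of_mem _ hg]
  rfl

/-- The density that represents f on S_{1/2} is exponentially bounded, so the same integral defines
a functional on the larger space Σ_1. -/
theorem exists_toHalf_eq (f : GSRoumieuDual 𝔼 (1 / 2)) {C R : ℝ} (hC : 0 ≤ C)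
    (hf : ∀ x ξ, ‖pairHalf f (atomW gauss x ξ)‖ ≤ C * Real.exp (R * (‖x‖ + ‖ξ‖))) :
    ∃ F : GSBeurlingDual 𝔼 1, toHalf F = f := by
  have hc := continuous_pairHalf_atomW f (isWindow_gauss (ι := ι))
  obtain ⟨F, hF⟩ := exists_beurlingDual
    (v := fun z => ((stftConst ι ^ 2 : ℝ) : ℂ) * pairHalf f (atomW gauss z.1 z.2))
    (C := ‖((stftConst ι ^ 2 : ℝ) : ℂ)‖ * C) (R := R) (by positivity)
    (hc.const_mul _).aestronglyMeasurable (fun z => by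
      rw [norm_mul, mul_assoc]
      gcongr
      exact hf _ _)
  refine ⟨F, ?_⟩
  ext g
  have h1 := pairHalf_of_mem (toHalf F) g.2
  have h2 := pairHalf_of_mem f g.2
  have h3 : pairHalf (toHalf F) (g : 𝔼 → ℂ) = pairHalf f g := by
    rw [pairHalf_toHalf F g.2, hF _ (roumieu_half_le_beurling_one g.2),
      pairHalf_eq_integral_hat f g.2]
    exact integral_congr_ae (Eventually.of_forall fun z => by ring)
  rw [h1, h2] at h3
  exact h3

end Inversion


/-! ## Tensor products -/

section Pair

set_option linter.unusedSectionVars false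

variable {ι : Type*} [Fintype ι]

local notation "𝔼" => EuclideanSpace ℝ ι

local notation "ℙ" => EuclideanSpace ℝ (ι ⊕ ι)

/-- The first component of a point of `ℝ^{2d}`. -/
def fstP : ℙ →L[ℝ] 𝔼 :=
  LinearMap.toContinuousLinearMap
    { toFun := fun z => WithLp.toLp 2 fun i => z (Sum.inl i)
      map_add' := fun _ _ => rfl
      map_smul' := fun _ _ => rfl }

/-- The second component of a point of `ℝ^{2d}`. -/
def sndP : ℙ →L[ℝ] 𝔼 :=
  LinearMap.toContinuousLinearMap
    { toFun := fun z => WithLp.toLp 2 fun i => z (Sum.inr i)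
      map_add' := fun _ _ => rfl
      map_smul' := fun _ _ => rfl }

@[simp] theorem fstP_pair (x ξ : 𝔼) : fstP (pair x ξ) = x := rfl

@[simp] theorem sndP_pair (x ξ : 𝔼) : sndP (pair x ξ) = ξ := rfl

@[simp] theorem pair_fstP_sndP (z : ℙ) : pair (fstP z) (sndP z) = z := by
  ext i
  cases i <;> rfl

theorem pair_add (x ξ x' ξ' : 𝔼) : pair (x + x') (ξ + ξ') = pair x ξ + pair x' ξ' := by
  ext i
  cases i <;> rfl

theorem pair_sub (x ξ x' ξ' : 𝔼) : pair (x - x') (ξ - ξ') = pair x ξ - pair x' ξ' := by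
  ext i
  cases i <;> rfl

theorem inner_pair (x ξ x' ξ' : 𝔼) :
    inner ℝ (pair x ξ) (pair x' ξ') = inner ℝ x x' + inner ℝ ξ ξ' := by
  simp [PiLp.inner_apply, pair]

theorem norm_pair_sq (x ξ : 𝔼) : ‖pair x ξ‖ ^ 2 = ‖x‖ ^ 2 + ‖ξ‖ ^ 2 := by
  rw [← real_inner_self_eq_norm_sq, inner_pair, real_inner_self_eq_norm_sq,
    real_inner_self_eq_norm_sq]

theorem norm_fst_le_norm_pair (x ξ : 𝔼) : ‖x‖ ≤ ‖pair x ξ‖ := by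
  refine le_of_sq_le_sq ?_ (norm_nonneg _)
  rw [norm_pair_sq]
  nlinarith [sq_nonneg ‖ξ‖]

theorem norm_snd_le_norm_pair (x ξ : 𝔼) : ‖ξ‖ ≤ ‖pair x ξ‖ := by
  refine le_of_sq_le_sq ?_ (norm_nonneg _)
  rw [norm_pair_sq]
  nlinarith [sq_nonneg ‖x‖]

theorem norm_fstP_le (z : ℙ) : ‖fstP z‖ ≤ ‖z‖ := by
  simpa using norm_fst_le_norm_pair (fstP z) (sndP z)

theorem norm_sndP_le (z : ℙ) : ‖sndP z‖ ≤ ‖z‖ := by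
  simpa using norm_snd_le_norm_pair (fstP z) (sndP z)

theorem norm_pair_le (x ξ : 𝔼) : ‖pair x ξ‖ ≤ ‖x‖ + ‖ξ‖ := by
  refine le_of_sq_le_sq ?_ (by positivity)
  rw [norm_pair_sq]
  nlinarith [norm_nonneg x, norm_nonneg ξ, mul_nonneg (norm_nonneg x) (norm_nonneg ξ)]

theorem continuous_pair : Continuous fun z : 𝔼 × 𝔼 => pair z.1 z.2 := by
  refine (PiLp.continuous_toLp 2 _).comp (continuous_pi fun i => ?_)
  cases i
  · simp only [Sum.elim_inl]; fun_prop
  · simp only [Sum.elim_inr]; fun_prop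

variable (ι) in
/-- The identification of `ℝ^d × ℝ^d` with `ℝ^{2d}`. -/
def pairEquiv : (𝔼 × 𝔼) ≃L[ℝ] ℙ where
  toFun z := pair z.1 z.2
  invFun z := (fstP z, sndP z)
  map_add' z w := pair_add _ _ _ _
  map_smul' c z := by
    ext i
    cases i <;> rfl
  left_inv _ := rfl
  right_inv z := pair_fstP_sndP z
  continuous_toFun := continuous_pair
  continuous_invFun := by fun_prop

variable (ι) in
theorem measurePreserving_pair :
    MeasurePreserving (fun z : 𝔼 × 𝔼 => pair z.1 z.2) := by
  have h1 : MeasurePreserving (fun z : 𝔼 × 𝔼 => (WithLp.ofLp z.1, WithLp.ofLp z.2)) :=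
    (PiLp.volume_preserving_ofLp ι).prod (PiLp.volume_preserving_ofLp ι)
  have h2 := (volume_measurePreserving_sumPiEquivProdPi (fun _ : ι ⊕ ι => ℝ)).symm
  have h3 := (PiLp.volume_preserving_toLp (ι ⊕ ι)).comp (h2.comp h1)
  convert h3 using 1
  ext z i
  cases i <;> rfl

variable (ι) in
theorem measurableEmbedding_pair : MeasurableEmbedding (fun z : 𝔼 × 𝔼 => pair z.1 z.2) :=
  (pairEquiv ι).toHomeomorph.measurableEmbedding

theorem modul_pair (a b x y : 𝔼) : modul (pair a b) (pair x y) = modul a x * modul b y := by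
  simp only [modul, inner_pair, ← Complex.exp_add]
  congr 1
  push_cast
  ring

theorem gauss_pair (x y : 𝔼) : gauss (pair x y) = gauss x * gauss y := by
  rw [gauss, gauss, gauss, ← Complex.ofReal_mul, norm_pair_sq]
  congr 1
  rw [mul_mul_mul_comm, ← Real.exp_add, ← Real.rpow_add Real.pi_pos, Fintype.card_sum]
  congr 2
  · push_cast; ring
  · ring

theorem atomW_gauss_pair (x y ξ η u v : 𝔼) :
    atomW gauss (pair x y) (pair ξ η) (pair u v) = atomW gauss x ξ u * atomW gauss y η v := by
  simp only [atomW, ← pair_sub, gauss_pair, modul_pair]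
  ring

theorem conj_atomW_gauss (x ξ v : 𝔼) : conj (atomW gauss x ξ v) = atomW gauss x (-ξ) v := by
  rw [atomW, map_mul, conj_gauss, conj_modul, atomW]

/-- The density in phase space of the tensor product `F₁ ⊗ conj F₂`. -/
def tensorDensity (F₁ F₂ : GSBeurlingDual 𝔼 1) (Z : ℙ × ℙ) : ℂ :=
  pairOne F₁ (atomW gauss (fstP Z.1) (fstP Z.2)) *
    conj (pairOne F₂ (atomW gauss (sndP Z.1) (-sndP Z.2)))

theorem continuous_tensorDensity (F₁ F₂ : GSBeurlingDual 𝔼 1) :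
    Continuous (tensorDensity F₁ F₂) := by
  have h1 := (continuous_pairOne_atomW F₁ (isWindow_gauss (ι := ι))).comp
    (show Continuous fun Z : ℙ × ℙ => (fstP Z.1, fstP Z.2) by fun_prop)
  have h2 := (continuous_pairOne_atomW F₂ (isWindow_gauss (ι := ι))).comp
    (show Continuous fun Z : ℙ × ℙ => (sndP Z.1, -sndP Z.2) by fun_prop)
  exact h1.mul (Complex.continuous_conj.comp h2)

theorem tensorDensity_growth (F₁ F₂ : GSBeurlingDual 𝔼 1) :
    ∃ C r : ℝ, 0 ≤ C ∧ 0 ≤ r ∧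
      ∀ Z, ‖tensorDensity F₁ F₂ Z‖ ≤ C * Real.exp (r * (‖Z.1‖ + ‖Z.2‖)) := by
  obtain ⟨C₁, r₁, hC₁, hr₁, h₁⟩ := pairOne_atomW_growth F₁ (isWindow_gauss (ι := ι))
  obtain ⟨C₂, r₂, hC₂, hr₂, h₂⟩ := pairOne_atomW_growth F₂ (isWindow_gauss (ι := ι))
  refine ⟨C₁ * C₂, r₁ + r₂, by positivity, by positivity, fun Z => ?_⟩
  rw [tensorDensity, norm_mul, RCLike.norm_conj]
  calc _ ≤ (C₁ * Real.exp (r₁ * (‖fstP Z.1‖ + ‖fstP Z.2‖))) *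
        (C₂ * Real.exp (r₂ * (‖sndP Z.1‖ + ‖-sndP Z.2‖))) := by
        gcongr
        · exact h₁ _ _
        · exact h₂ _ _
    _ ≤ (C₁ * Real.exp (r₁ * (‖Z.1‖ + ‖Z.2‖))) * (C₂ * Real.exp (r₂ * (‖Z.1‖ + ‖Z.2‖))) := by
        rw [norm_neg]
        have e1 := norm_fstP_le Z.1
        have e2 := norm_fstP_le Z.2
        have e3 := norm_sndP_le Z.1
        have e4 := norm_sndP_le Z.2
        gcongr
    _ = _ := by
        rw [add_mul, Real.exp_add]
        ring

/-- The tensor product of functionals in terms of their short-time Fourier transforms. -/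
theorem nested_pairOne_eq (F₁ F₂ : GSBeurlingDual 𝔼 1) {K : ℙ → ℂ} (hK : K ∈ GSBeurling ℙ 1) :
    pairOne F₁ (fun u => conj (pairOne F₂ (fun v => conj (K (pair u v))))) =
      ∫ Z : ℙ × ℙ, ((stftConst (ι ⊕ ι) ^ 2 : ℝ) : ℂ) * hat K Z.1 Z.2 * tensorDensity F₁ F₂ Z := by
  set k : ℂ := ((stftConst (ι ⊕ ι) ^ 2 : ℝ) : ℂ) with hk
  have hcK := isCoeff_hat hK k
  have hatomc : ∀ u : 𝔼, Continuous fun Z : ℙ × ℙ => atomW gauss (fstP Z.1) (fstP Z.2) u := by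
    intro u
    have h2 := (continuous_atomW (continuous_gauss (ι := ι))).comp
      (show Continuous fun Z : ℙ × ℙ => (fstP Z.1, fstP Z.2, u) by fun_prop)
    exact h2
  -- K is expanded into atoms of ℝ^{2d}, each the product of an atom in u and one in v. Moving F₂
  -- under the integral leaves a superposition of atoms in u, to which F₁ can be applied in the same
  -- way. Conjugation reverses the frequency in v.
  have hinner : ∀ u : 𝔼, conj (pairOne F₂ (fun v => conj (K (pair u v)))) =
      ∫ Z : ℙ × ℙ, (k * hat K Z.1 Z.2 *
        conj (pairOne F₂ (atomW gauss (sndP Z.1) (-sndP Z.2)))) *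
          atomW gauss (fstP Z.1) (fstP Z.2) u := by
    intro u
    have h1 : (fun v => conj (K (pair u v))) = fun v => ∫ Z : ℙ × ℙ,
        conj (k * hat K Z.1 Z.2 * atomW gauss (fstP Z.1) (fstP Z.2) u) *
          atomW gauss (sndP Z.1) (-sndP Z.2) v := by
      ext v
      rw [hat_inversion hK, ← integral_conj]
      refine integral_congr_ae (Eventually.of_forall fun Z => ?_)
      simp only
      rw [← conj_atomW_gauss, ← map_mul]
      congr 1
      conv_lhs => rw [← pair_fstP_sndP Z.1, ← pair_fstP_sndP Z.2, atomW_gauss_pair]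
      simp only [pair_fstP_sndP]
      ring
    have hc : IsCoeff (volume : Measure (ℙ × ℙ)) (fun Z => sndP Z.1) (fun Z => -sndP Z.2)
        (fun Z => conj (k * hat K Z.1 Z.2 * atomW gauss (fstP Z.1) (fstP Z.2) u)) := by
      have hm : AEStronglyMeasurable (fun Z : ℙ × ℙ =>
          conj (k * hat K Z.1 Z.2 * atomW gauss (fstP Z.1) (fstP Z.2) u)) :=
        Complex.continuous_conj.comp_aestronglyMeasurable
          (hcK.meas.mul (hatomc u).aestronglyMeasurable)
      refine ⟨hm, fun r => ?_⟩
      refine ((hcK.int |r|).const_mul (Real.pi ^ (-(Fintype.card ι : ℝ) / 4))).mono'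
        (hm.norm.mul (by fun_prop : Continuous fun Z : ℙ × ℙ =>
          Real.exp (r * (‖sndP Z.1‖ + ‖-sndP Z.2‖))).aestronglyMeasurable)
        (Eventually.of_forall fun Z => ?_)
      rw [Real.norm_of_nonneg (by positivity), RCLike.norm_conj, norm_mul, norm_atomW, norm_neg]
      have e1 : Real.exp (r * (‖sndP Z.1‖ + ‖sndP Z.2‖)) ≤
          Real.exp (|r| * (‖Z.1‖ + ‖Z.2‖)) := by
        refine Real.exp_le_exp.2 ?_
        gcongr
        · exact le_abs_self r
        · exact norm_sndP_le _
        · exact norm_sndP_le _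
      calc _ ≤ ‖k * hat K Z.1 Z.2‖ * (Real.pi ^ (-(Fintype.card ι : ℝ) / 4)) *
            Real.exp (|r| * (‖Z.1‖ + ‖Z.2‖)) := by
            gcongr
            exact norm_gauss_le _
        _ = _ := by ring
    rw [h1, pairOne_superposition F₂ isWindow_gauss (by fun_prop) (by fun_prop) hc,
      ← integral_conj]
    refine integral_congr_ae (Eventually.of_forall fun Z => ?_)
    simp only [map_mul, Complex.conj_conj]
    ring
  have hc2 : IsCoeff (volume : Measure (ℙ × ℙ)) (fun Z => fstP Z.1) (fun Z => fstP Z.2)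
      (fun Z => k * hat K Z.1 Z.2 *
        conj (pairOne F₂ (atomW gauss (sndP Z.1) (-sndP Z.2)))) := by
    -- The values of F₂ on atoms grow at most exponentially; this uses up R of the exponential
    -- moments of `hat K`.
    obtain ⟨C, R, hC, hR, hF⟩ := pairOne_atomW_growth F₂ (isWindow_gauss (ι := ι))
    have h2 := (continuous_pairOne_atomW F₂ (isWindow_gauss (ι := ι))).comp
      (show Continuous fun Z : ℙ × ℙ => (sndP Z.1, -sndP Z.2) by fun_prop)
    have hm : AEStronglyMeasurable (fun Z : ℙ × ℙ => k * hat K Z.1 Z.2 *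
        conj (pairOne F₂ (atomW gauss (sndP Z.1) (-sndP Z.2)))) :=
      hcK.meas.mul (Complex.continuous_conj.comp h2).aestronglyMeasurable
    refine ⟨hm, fun r => ?_⟩
    refine ((hcK.int (R + |r|)).const_mul C).mono'
      (hm.norm.mul (by fun_prop : Continuous fun Z : ℙ × ℙ =>
        Real.exp (r * (‖fstP Z.1‖ + ‖fstP Z.2‖))).aestronglyMeasurable)
      (Eventually.of_forall fun Z => ?_)
    rw [Real.norm_of_nonneg (by positivity), norm_mul, RCLike.norm_conj]
    calc _ ≤ ‖k * hat K Z.1 Z.2‖ * (C * Real.exp (R * (‖Z.1‖ + ‖Z.2‖))) *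
          Real.exp (|r| * (‖Z.1‖ + ‖Z.2‖)) := by
          gcongr
          · refine (hF _ _).trans ?_
            rw [norm_neg]
            gcongr <;> exact norm_sndP_le _
          · exact le_abs_self r
          · exact norm_fstP_le _
          · exact norm_fstP_le _
      _ = _ := by
          rw [add_mul R, Real.exp_add]
          ring
  simp only [hinner]
  rw [pairOne_superposition F₁ isWindow_gauss (by fun_prop) (by fun_prop) hc2]
  refine integral_congr_ae (Eventually.of_forall fun Z => ?_)
  simp only [tensorDensity]
  ring

theorem exists_tensor (F₁ F₂ : GSBeurlingDual 𝔼 1) :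
    ∃ T : GSBeurlingDual ℙ 1, ∀ K ∈ GSBeurling ℙ 1,
      pairOne T K = pairOne F₁ (fun u => conj (pairOne F₂ (fun v => conj (K (pair u v))))) := by
  obtain ⟨C, r, hC, hr, h⟩ := tensorDensity_growth F₁ F₂
  obtain ⟨T, hT⟩ := exists_beurlingDual
    (v := fun Z => ((stftConst (ι ⊕ ι) ^ 2 : ℝ) : ℂ) * tensorDensity F₁ F₂ Z)
    (C := ‖((stftConst (ι ⊕ ι) ^ 2 : ℝ) : ℂ)‖ * C) (R := r) (by positivity)
    ((continuous_tensorDensity F₁ F₂).const_mul _).aestronglyMeasurable (fun Z => by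
      rw [norm_mul, mul_assoc]
      gcongr
      exact h Z)
  refine ⟨T, fun K hK => ?_⟩
  rw [hT K hK, nested_pairOne_eq F₁ F₂ hK]
  exact integral_congr_ae (Eventually.of_forall fun Z => by ring)

end Pair

/-! ## Wigner distributions -/

section WignerTranspose

set_option linter.unusedSectionVars false

variable {ι : Type*} [Fintype ι]

local notation "𝔼" => EuclideanSpace ℝ ι

local notation "ℙ" => EuclideanSpace ℝ (ι ⊕ ι)

/-- The Gaussian is invariant under the unitary Fourier transform. -/
theorem integral_gauss_mul_modul (w : 𝔼) :
    (stftConst ι : ℂ) * ∫ ξ : 𝔼, gauss ξ * modul w ξ = gauss w := by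
  have h := GaussianFourier.integral_cexp_neg_mul_sq_norm_add (V := 𝔼) (b := 1 / 2)
    (by norm_num) (-Complex.I) w
  have h1 : ∀ ξ : 𝔼, gauss ξ * modul w ξ = ((Real.pi ^ (-(Fintype.card ι : ℝ) / 4) : ℝ) : ℂ) *
      Complex.exp (-(1 / 2) * ‖ξ‖ ^ 2 + -Complex.I * (inner ℝ w ξ : ℝ)) := by
    intro ξ
    rw [gauss, modul, Complex.exp_add, Complex.ofReal_mul, Complex.ofReal_exp, mul_assoc,
      real_inner_comm]
    congr 3
    push_cast
    ring
  simp only [h1]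
  rw [integral_const_mul, h, gauss, Complex.ofReal_mul, Complex.ofReal_exp, finrank_euclideanSpace]
  have h2 : ((Real.pi : ℂ) / (1 / 2)) ^ ((Fintype.card ι : ℂ) / 2) =
      (((2 * Real.pi) ^ ((Fintype.card ι : ℝ) / 2) : ℝ) : ℂ) := by
    rw [Complex.ofReal_cpow (by positivity)]
    push_cast
    congr 1
    ring
  have h3 : stftConst ι * (2 * Real.pi) ^ ((Fintype.card ι : ℝ) / 2) = 1 := by
    rw [stftConst, ← Real.rpow_add (by positivity), neg_div, neg_add_cancel, Real.rpow_zero]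
  have h4 : (-Complex.I) ^ 2 * (‖w‖ : ℂ) ^ 2 / (4 * (1 / 2)) = ((-‖w‖ ^ 2 / 2 : ℝ) : ℂ) := by
    rw [neg_sq, Complex.I_sq]
    push_cast
    ring
  rw [h2, h4]
  calc _ = (((stftConst ι * (2 * Real.pi) ^ ((Fintype.card ι : ℝ) / 2) : ℝ)) : ℂ) *
        (((Real.pi ^ (-(Fintype.card ι : ℝ) / 4) : ℝ) : ℂ) *
          Complex.exp ((-‖w‖ ^ 2 / 2 : ℝ) : ℂ)) := by
        rw [Complex.ofReal_mul]
        ring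
    _ = _ := by rw [h3, Complex.ofReal_one, one_mul]

variable [DecidableEq ι]

/-- The action of a matrix as a continuous linear map. -/
def actL (A : Matrix ι ι ℝ) : 𝔼 →L[ℝ] 𝔼 :=
  LinearMap.toContinuousLinearMap
    { toFun := act A
      map_add' := fun x y => by
        ext i
        simp [act, Matrix.mulVec_add]
      map_smul' := fun c x => by
        ext i
        simp [act, Matrix.mulVec_smul] }

theorem act_eq_actL (A : Matrix ι ι ℝ) : act A = actL A := rfl

theorem act_one_sub (A : Matrix ι ι ℝ) (x : 𝔼) : act (1 - A) x = x - act A x := by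
  ext i
  simp [act, Matrix.sub_mulVec]

theorem inner_act (A : Matrix ι ι ℝ) (x y : 𝔼) :
    inner ℝ (act A x) y = inner ℝ x (act A.transpose y) := by
  simp only [EuclideanSpace.inner_eq_star_dotProduct, act, star_trivial]
  rw [Matrix.mulVec_transpose, ← Matrix.dotProduct_mulVec]

/-- The change of variables `(u, v) ↦ (u - A (u - v), u - v)`. -/
def wignerEquiv (A : Matrix ι ι ℝ) : ℙ ≃L[ℝ] ℙ where
  toFun z := pair (fstP z - actL A (fstP z - sndP z)) (fstP z - sndP z)
  invFun z := pair (fstP z + actL A (sndP z)) (fstP z + actL A (sndP z) - sndP z)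
  map_add' z w := by
    rw [← pair_add]
    simp only [map_add, map_sub]
    congr 1 <;> abel
  map_smul' c z := by
    change _ = c • pairEquiv ι (_, _)
    rw [← map_smul]
    change pair _ _ = pair _ _
    simp only [map_smul, ← smul_sub]
    rfl
  left_inv z := by
    simp only [fstP_pair, sndP_pair]
    conv_rhs => rw [← pair_fstP_sndP z]
    congr 1 <;> abel
  right_inv z := by
    simp only [fstP_pair, sndP_pair]
    conv_rhs => rw [← pair_fstP_sndP z]
    have : fstP z + actL A (sndP z) - (fstP z + actL A (sndP z) - sndP z) = sndP z := by abel
    rw [this]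
    congr 1
    abel
  continuous_toFun := by
    have := continuous_pair.comp (show Continuous fun z : ℙ =>
      (fstP z - actL A (fstP z - sndP z), fstP z - sndP z) by fun_prop)
    exact this
  continuous_invFun := by
    have := continuous_pair.comp (show Continuous fun z : ℙ =>
      (fstP z + actL A (sndP z), fstP z + actL A (sndP z) - sndP z) by fun_prop)
    exact this

theorem wignerEquiv_pair (A : Matrix ι ι ℝ) (u v : 𝔼) :
    wignerEquiv A (pair u v) = pair (u - act A (u - v)) (u - v) := rfl

/-- The Gaussian in the variables of the Wigner transform. -/
def wignerWindow (A : Matrix ι ι ℝ) : ℙ → ℂ := gauss ∘ wignerEquiv A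

theorem isWindow_wignerWindow (A : Matrix ι ι ℝ) : IsWindow (wignerWindow A) := by
  obtain ⟨hs, h, hh, B, hB⟩ := isWindow_gauss (ι := ι ⊕ ι)
  refine ⟨hs.comp (wignerEquiv A).contDiff, _, le_max_right _ 1, B,
    (hB.comp_equiv hs (wignerEquiv A)).mono (by positivity) (le_max_left _ _)⟩

/-- The positions of the wave packet that corresponds to a point of phase space. -/
def wignerX (A : Matrix ι ι ℝ) (Z : ℙ × ℙ) : ℙ :=
  pair (fstP Z.1 - act A (sndP Z.2)) (fstP Z.1 + act (1 - A) (sndP Z.2))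

/-- The frequencies of the wave packet that corresponds to a point of phase space. -/
def wignerXi (A : Matrix ι ι ℝ) (Z : ℙ × ℙ) : ℙ :=
  pair (sndP Z.1 + act (1 - A.transpose) (fstP Z.2)) (act A.transpose (fstP Z.2) - sndP Z.1)

theorem continuous_wignerX (A : Matrix ι ι ℝ) : Continuous (wignerX A) := by
  have := continuous_pair.comp (show Continuous fun Z : ℙ × ℙ =>
      (fstP Z.1 - actL A (sndP Z.2), fstP Z.1 + actL (1 - A) (sndP Z.2)) by fun_prop)
  exact this

theorem continuous_wignerXi (A : Matrix ι ι ℝ) : Continuous (wignerXi A) := by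
  have := continuous_pair.comp (show Continuous fun Z : ℙ × ℙ =>
      (sndP Z.1 + actL (1 - A.transpose) (fstP Z.2),
        actL A.transpose (fstP Z.2) - sndP Z.1) by fun_prop)
  exact this

/-- Time-frequency shifts are mapped to time-frequency shifts. -/
theorem wignerTranspose_atomW (A : Matrix ι ι ℝ) (Z : ℙ × ℙ) (u v : 𝔼) :
    wignerTranspose A (atomW gauss Z.1 Z.2) u v =
      modul (sndP Z.1) (sndP Z.2) *
        atomW (wignerWindow A) (wignerX A Z) (wignerXi A Z) (pair u v) := by
  obtain ⟨⟨x, ξ⟩, hX⟩ := (pairEquiv ι).surjective Z.1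
  obtain ⟨⟨η, y⟩, hΞ⟩ := (pairEquiv ι).surjective Z.2
  change pair x ξ = _ at hX
  change pair η y = _ at hΞ
  rw [wignerX, wignerXi, ← hX, ← hΞ, wignerTranspose]
  simp only [fstP_pair, sndP_pair]
  have h1 : ∀ ζ : 𝔼, atomW gauss (pair x ξ) (pair η y) (pair (u - act A (u - v)) ζ) *
      Complex.exp (-Complex.I * (inner ℝ (u - v) ζ : ℝ)) =
      atomW gauss x η (u - act A (u - v)) * (gauss (ζ - ξ) * modul (y + (u - v)) ζ) := by
    intro ζ
    rw [atomW_gauss_pair, modul_add_left, atomW, atomW, real_inner_comm]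
    change _ * modul (u - v) ζ = _
    ring
  simp only [h1]
  -- The integral is the Fourier transform of a translated Gaussian, hence a Gaussian in y + (u - v)
  -- times a phase.
  have h2 : ∫ ζ : 𝔼, gauss (ζ - ξ) * modul (y + (u - v)) ζ =
      modul (y + (u - v)) ξ * ∫ ζ : 𝔼, gauss ζ * modul (y + (u - v)) ζ := by
    rw [← integral_const_mul,
      ← integral_add_right_eq_self (fun ζ => gauss (ζ - ξ) * modul (y + (u - v)) ζ) ξ]
    refine integral_congr_ae (Eventually.of_forall fun ζ => ?_)
    simp only [add_sub_cancel_right, modul_add_right]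
    ring
  change (stftConst ι : ℂ) * _ = _
  rw [integral_const_mul, h2, mul_left_comm, mul_left_comm (stftConst ι : ℂ),
    integral_gauss_mul_modul]
  have h3 : wignerWindow A (pair u v - pair (x - act A y) (x + act (1 - A) y)) =
      gauss (u - act A (u - v) - x) * gauss (y + (u - v)) := by
    rw [wignerWindow, Function.comp_apply, ← pair_sub, wignerEquiv_pair, gauss_pair]
    simp only [act_one_sub, act_eq_actL]
    have e1 : u - (x - actL A y) - (v - (x + (y - actL A y))) = y + (u - v) := by abel
    rw [e1]
    congr 2
    rw [map_add]
    abel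
  -- All exponents are real bilinear forms; moving A to the other side as its transpose collects
  -- those in u and in v.
  have h4 : modul η (u - act A (u - v)) * modul (y + (u - v)) ξ =
      modul ξ y * modul (pair (ξ + act (1 - A.transpose) η) (act A.transpose η - ξ))
        (pair u v) := by
    simp only [modul, ← Complex.exp_add]
    congr 1
    simp only [inner_pair, act_one_sub, inner_sub_left, inner_sub_right, inner_add_right,
      inner_act]
    rw [real_inner_comm y ξ, real_inner_comm u ξ, real_inner_comm v ξ]
    push_cast
    ring
  rw [atomW, atomW, h3, mul_left_comm (modul ξ y), ← h4]
  ring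

/-- The transposed Wigner transform as a superposition of wave packets. -/
theorem wignerTranspose_eq_integral (A : Matrix ι ι ℝ) {G : ℙ → ℂ} (hG : G ∈ GSBeurling ℙ 1)
    (u v : 𝔼) :
    wignerTranspose A G u v =
      ∫ Z : ℙ × ℙ, (((stftConst (ι ⊕ ι) ^ 2 : ℝ) : ℂ) * hat G Z.1 Z.2 *
        modul (sndP Z.1) (sndP Z.2)) *
          atomW (wignerWindow A) (wignerX A Z) (wignerXi A Z) (pair u v) := by
  set k : ℂ := ((stftConst (ι ⊕ ι) ^ 2 : ℝ) : ℂ) with hk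
  set a := u - act A (u - v) with ha
  let c : ℙ × ℙ → ℂ := fun Z => k * hat G Z.1 Z.2
  have hcm : StronglyMeasurable c := (stronglyMeasurable_hat hG.1.continuous).const_mul k
  have hci : Integrable c := by
    have h1 := (isCoeff_hat hG k).int 0
    simp only [zero_mul, Real.exp_zero, mul_one] at h1
    exact (integrable_norm_iff hcm.aestronglyMeasurable).1 h1
  let f : 𝔼 → ℙ × ℙ → ℂ := fun ξ Z =>
    (c Z * atomW gauss Z.1 Z.2 (pair a ξ)) * modul ξ (u - v)
  have hcont : Continuous fun p : 𝔼 × (ℙ × ℙ) =>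
      atomW gauss p.2.1 p.2.2 (pair a p.1) * modul p.1 (u - v) := by
    have h1 := (continuous_atomW (continuous_gauss (ι := ι ⊕ ι))).comp
      ((continuous_snd.comp continuous_fst).prodMk ((continuous_snd.comp continuous_snd).prodMk
      (continuous_pair.comp (show Continuous fun p : (𝔼 × ℙ) × (𝔼 × ℙ) => (a, p.1.1) by fun_prop))))
    have h2 := h1.comp (show Continuous fun p : 𝔼 × (ℙ × ℙ) => ((p.1, p.2.1), (p.1, p.2.2)) by
      fun_prop)
    have h3 := (continuous_modul (V := 𝔼)).comp
      (show Continuous fun p : 𝔼 × (ℙ × ℙ) => (p.1, u - v) by fun_prop)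
    exact h2.mul h3
  have hfm : StronglyMeasurable (Function.uncurry f) := by
    have h1 := (hcm.comp_measurable (measurable_snd (α := 𝔼))).mul hcont.stronglyMeasurable
    refine (congrArg StronglyMeasurable ?_).mp h1
    ext p
    simp only [Function.uncurry, f, Pi.mul_apply, Function.comp_apply]
    ring
  set D : ℝ := Real.pi ^ (-(Fintype.card ι : ℝ) / 4)
  have hbound : ∀ ξ Z, ‖f ξ Z‖ ≤ ‖c Z‖ * (D * ‖gauss (ξ - sndP Z.1)‖) := by
    intro ξ Z
    change ‖c Z * atomW gauss Z.1 Z.2 (pair a ξ) * modul ξ (u - v)‖ ≤ _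
    rw [norm_mul _ (modul ξ (u - v)), norm_modul, mul_one, norm_mul (c Z), norm_atomW]
    have : pair a ξ - Z.1 = pair (a - fstP Z.1) (ξ - sndP Z.1) := by
      rw [pair_sub, pair_fstP_sndP]
    rw [this, gauss_pair, norm_mul (gauss _)]
    have h0 := norm_gauss_le (ι := ι) (a - fstP Z.1)
    exact mul_le_mul_of_nonneg_left (mul_le_mul_of_nonneg_right h0 (norm_nonneg _))
      (norm_nonneg _)
  have hgi : ∀ b : 𝔼, Integrable fun ξ : 𝔼 => ‖gauss (ξ - b)‖ := fun b =>
    ((integrable_gauss (ι := ι)).comp_sub_right b).norm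
  -- Fubini's condition: of the two Gaussian factors one is bounded, the other is integrable in ξ,
  -- and the coefficient c is integrable in Z.
  have hfi : Integrable (Function.uncurry f) ((volume : Measure 𝔼).prod volume) := by
    refine (integrable_prod_iff' hfm.aestronglyMeasurable).2 ⟨Eventually.of_forall fun Z => ?_, ?_⟩
    · refine (((hgi (sndP Z.1)).const_mul D).const_mul ‖c Z‖).mono'
        (hfm.comp_measurable measurable_prodMk_right).aestronglyMeasurable
        (Eventually.of_forall fun ξ => hbound ξ Z)
    · refine (hci.norm.mul_const (D * ∫ ξ : 𝔼, ‖gauss ξ‖)).mono'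
        (hfm.norm.integral_prod_left').aestronglyMeasurable (Eventually.of_forall fun Z => ?_)
      rw [Real.norm_of_nonneg (integral_nonneg fun _ => norm_nonneg _)]
      refine (integral_mono_of_nonneg (Eventually.of_forall fun _ => norm_nonneg _)
        (((hgi (sndP Z.1)).const_mul D).const_mul ‖c Z‖)
        (Eventually.of_forall fun ξ => hbound ξ Z)).trans (le_of_eq ?_)
      rw [integral_const_mul, integral_const_mul,
        integral_sub_right_eq_self (fun ξ : 𝔼 => ‖gauss ξ‖) (sndP Z.1)]
  have h1 : ∀ ξ : 𝔼, G (pair a ξ) * Complex.exp (-Complex.I * (inner ℝ (u - v) ξ : ℝ)) =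
      ∫ Z, f ξ Z := by
    intro ξ
    rw [hat_inversion hG, ← integral_mul_const]
    rfl
  have h2 : ∀ Z : ℙ × ℙ, (stftConst ι : ℂ) * ∫ ξ, f ξ Z =
      (c Z * modul (sndP Z.1) (sndP Z.2)) *
          atomW (wignerWindow A) (wignerX A Z) (wignerXi A Z) (pair u v) := by
    intro Z
    rw [mul_assoc (c Z), ← wignerTranspose_atomW, wignerTranspose, mul_left_comm,
      ← integral_const_mul (c Z)]
    change _ = (stftConst ι : ℂ) * _
    congr 1
    refine integral_congr_ae (Eventually.of_forall fun ξ => ?_)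
    simp only [f]
    rw [mul_assoc]
    rfl
  rw [wignerTranspose]
  change (stftConst ι : ℂ) * _ = _
  simp only [← ha, h1]
  rw [integral_integral_swap hfi, ← integral_const_mul]
  exact integral_congr_ae (Eventually.of_forall h2)

end WignerTranspose

/-! ### Existence of the Wigner distribution and the pointwise bound for its transform -/

section Wigner

set_option linter.unusedSectionVars false

variable {ι : Type*} [Fintype ι]

local notation "𝔼" => EuclideanSpace ℝ ι

local notation "ℙ" => EuclideanSpace ℝ (ι ⊕ ι)

theorem pairOne_sub {V : Type*} [NormedAddCommGroup V] [InnerProductSpace ℝ V]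
    (F F' : GSBeurlingDual V 1) {g : V → ℂ} (hg : g ∈ GSBeurling V 1) :
    pairOne (F - F') g = pairOne F g - pairOne F' g := by
  rw [pairOne_of_mem _ hg, pairOne_of_mem _ hg, pairOne_of_mem _ hg]
  rfl

/-- The product increment, arranged so that every term contains the increment of at least one
factor; continuity of W is read off from it. -/
theorem tensorDensity_sub (F₁ F₂ G₁ G₂ : GSBeurlingDual 𝔼 1) (Z : ℙ × ℙ) :
    tensorDensity G₁ G₂ Z - tensorDensity F₁ F₂ Z =
      tensorDensity (G₁ - F₁) (G₂ - F₂) Z + tensorDensity F₁ (G₂ - F₂) Z +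
        tensorDensity (G₁ - F₁) F₂ Z := by
  simp only [tensorDensity, pairOne_sub _ _ (atomW_mem_beurling (isWindow_gauss (ι := ι)) _ _),
    map_sub]
  ring

/-- The exponential kernel. -/
def expKernel (r : ℝ) (y : 𝔼) : ℝ≥0∞ := ENNReal.ofReal (Real.exp (-(r * ‖y‖)))

theorem continuous_expKernel (r : ℝ) : Continuous (expKernel r : 𝔼 → ℝ≥0∞) := by
  exact ENNReal.continuous_ofReal.comp (by fun_prop)

/-- The average of a function on phase space with respect to the exponential kernel. -/
def expAverage (r : ℝ) (a : 𝔼 → 𝔼 → ℝ≥0∞) (x ξ : 𝔼) : ℝ≥0∞ :=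
  ∫⁻ ξ', expKernel r (ξ' - ξ) * ∫⁻ x', expKernel r (x' - x) * a x' ξ'

theorem lintegral_prod_pair (f : ℙ × ℙ → ℝ≥0∞) (hf : Measurable f) :
    ∫⁻ Z, f Z = ∫⁻ q : 𝔼 × 𝔼, ∫⁻ p : 𝔼 × 𝔼, f (pair p.1 p.2, pair q.1 q.2) := by
  have h1 : ∫⁻ Z, f Z = ∫⁻ w : ℙ, ∫⁻ z : ℙ, f (z, w) :=
    lintegral_prod_symm (μ := (volume : Measure ℙ)) (ν := (volume : Measure ℙ)) f hf.aemeasurable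
  rw [h1, ← (measurePreserving_pair ι).lintegral_comp_emb (measurableEmbedding_pair ι)]
  refine lintegral_congr fun q => ?_
  rw [← (measurePreserving_pair ι).lintegral_comp_emb (measurableEmbedding_pair ι)]

theorem lintegral_tensor (g₁ g₂ : 𝔼 → 𝔼 → ℝ≥0∞) (h₁ : Measurable (Function.uncurry g₁))
    (h₂ : Measurable (Function.uncurry g₂)) :
    ∫⁻ Z : ℙ × ℙ, g₁ (fstP Z.1) (fstP Z.2) * g₂ (sndP Z.1) (sndP Z.2) =
      (∫⁻ ξ, ∫⁻ x, g₁ x ξ) * ∫⁻ ξ, ∫⁻ x, g₂ x ξ := by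
  rw [lintegral_prod_pair]
  · simp only [fstP_pair, sndP_pair]
    have hi : ∀ q : 𝔼 × 𝔼, ∫⁻ p : 𝔼 × 𝔼, g₁ p.1 q.1 * g₂ p.2 q.2 =
        (∫⁻ x, g₁ x q.1) * ∫⁻ x, g₂ x q.2 := fun q =>
      lintegral_prod_mul (μ := (volume : Measure 𝔼)) (ν := (volume : Measure 𝔼))
        (f := fun x => g₁ x q.1) (g := fun x => g₂ x q.2)
        (h₁.comp measurable_prodMk_right).aemeasurable
        (h₂.comp measurable_prodMk_right).aemeasurable
    simp only [hi]
    exact lintegral_prod_mul (μ := (volume : Measure 𝔼)) (ν := (volume : Measure 𝔼))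
      (f := fun ξ => ∫⁻ x, g₁ x ξ) (g := fun ξ => ∫⁻ x, g₂ x ξ)
      (Measurable.lintegral_prod_left' h₁).aemeasurable
      (Measurable.lintegral_prod_left' h₂).aemeasurable
  · have e1 := h₁.comp (show Measurable fun Z : ℙ × ℙ => (fstP Z.1, fstP Z.2) by fun_prop)
    have e2 := h₂.comp (show Measurable fun Z : ℙ × ℙ => (sndP Z.1, sndP Z.2) by fun_prop)
    exact e1.mul e2

theorem expKernel_pair_le {r : ℝ} (hr : 0 ≤ r) (z : ℙ) :
    expKernel (2 * r) z ≤ expKernel r (fstP z) * expKernel r (sndP z) := by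
  rw [expKernel, expKernel, expKernel, ← ENNReal.ofReal_mul (Real.exp_pos _).le, ← Real.exp_add]
  refine ENNReal.ofReal_le_ofReal (Real.exp_le_exp.2 ?_)
  nlinarith [norm_fstP_le z, norm_sndP_le z]

theorem lintegral_expKernel_mul (r : ℝ) {a : 𝔼 → 𝔼 → ℝ≥0∞}
    (ha : Measurable (Function.uncurry a)) (x ξ : 𝔼) :
    ∫⁻ ξ', ∫⁻ x', expKernel r (ξ' - ξ) * (expKernel r (x' - x) * a x' ξ') =
      expAverage r a x ξ := by
  refine lintegral_congr fun ξ' => ?_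
  rw [lintegral_const_mul]
  exact ((continuous_expKernel r).measurable.comp (measurable_id.sub_const x)).mul
    (ha.comp measurable_prodMk_right)

theorem measurable_kernel_mul (r : ℝ) {a : 𝔼 → 𝔼 → ℝ≥0∞}
    (ha : Measurable (Function.uncurry a)) (x ξ : 𝔼) :
    Measurable (Function.uncurry fun x' ξ' : 𝔼 =>
      expKernel r (ξ' - ξ) * (expKernel r (x' - x) * a x' ξ')) := by
  have h := (continuous_expKernel (ι := ι) r).measurable
  exact (h.comp (measurable_snd.sub_const ξ)).mul
    ((h.comp (measurable_fst.sub_const x)).mul ha)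

theorem measurable_enorm_pairOne (F : GSBeurlingDual 𝔼 1) :
    Measurable (Function.uncurry fun x ξ : 𝔼 => ‖pairOne F (atomW gauss x ξ)‖ₑ) :=
  (continuous_pairOne_atomW F (isWindow_gauss (ι := ι))).measurable.enorm

theorem measurable_enorm_pairOne_neg (F : GSBeurlingDual 𝔼 1) :
    Measurable (Function.uncurry fun x ξ : 𝔼 => ‖pairOne F (atomW gauss x (-ξ))‖ₑ) := by
  have h := (continuous_pairOne_atomW F (isWindow_gauss (ι := ι))).comp
    (show Continuous fun z : 𝔼 × 𝔼 => (z.1, -z.2) by fun_prop)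
  exact h.measurable.enorm

theorem expAverage_neg (r : ℝ) (a : 𝔼 → 𝔼 → ℝ≥0∞) (x ξ : 𝔼) :
    expAverage r (fun x ξ => a x (-ξ)) x ξ = expAverage r a x (-ξ) := by
  rw [expAverage, expAverage, ← lintegral_neg_eq_self]
  refine lintegral_congr fun ξ' => ?_
  have : expKernel r (-ξ' - ξ) = expKernel r (ξ' - -ξ) := by
    rw [expKernel, expKernel, ← norm_neg]
    congr 5
    abel
  rw [this, neg_neg]

variable [DecidableEq ι]

theorem exists_norm_wignerX_le (A : Matrix ι ι ℝ) :
    ∃ M : ℝ, 0 ≤ M ∧ ∀ Z : ℙ × ℙ,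
      ‖wignerX A Z‖ + ‖wignerXi A Z‖ ≤ M * (‖Z.1‖ + ‖Z.2‖) := by
  set a := ‖(actL A : 𝔼 →L[ℝ] 𝔼)‖
  set b := ‖(actL (1 - A) : 𝔼 →L[ℝ] 𝔼)‖
  set c := ‖(actL (1 - A.transpose) : 𝔼 →L[ℝ] 𝔼)‖
  set d := ‖(actL A.transpose : 𝔼 →L[ℝ] 𝔼)‖
  refine ⟨4 + a + b + c + d, by positivity, fun Z => ?_⟩
  have h1 := norm_pair_le (fstP Z.1 - act A (sndP Z.2)) (fstP Z.1 + act (1 - A) (sndP Z.2))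
  have h2 := norm_pair_le (sndP Z.1 + act (1 - A.transpose) (fstP Z.2))
    (act A.transpose (fstP Z.2) - sndP Z.1)
  have h3 := norm_sub_le (fstP Z.1) (act A (sndP Z.2))
  have h4 := norm_add_le (fstP Z.1) (act (1 - A) (sndP Z.2))
  have h5 := norm_add_le (sndP Z.1) (act (1 - A.transpose) (fstP Z.2))
  have h6 := norm_sub_le (act A.transpose (fstP Z.2)) (sndP Z.1)
  have key : ∀ (B : Matrix ι ι ℝ) (w : 𝔼), ‖w‖ ≤ ‖Z.2‖ → ‖act B w‖ ≤ ‖actL B‖ * ‖Z.2‖ :=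
    fun B w hw => ((actL B).le_opNorm w).trans (by gcongr)
  have e1 := norm_fstP_le Z.1
  have e2 := norm_sndP_le Z.1
  have e3 := norm_fstP_le Z.2
  have e4 := norm_sndP_le Z.2
  have k1 := key A _ e4
  have k2 := key (1 - A) _ e4
  have k3 := key (1 - A.transpose) _ e3
  have k4 := key A.transpose _ e3
  have p : 0 ≤ (a + b + c + d) * ‖Z.1‖ := by positivity
  have p2 := norm_nonneg Z.2
  change ‖pair _ _‖ + ‖pair _ _‖ ≤ _
  calc _ ≤ 4 * ‖Z.1‖ + (a + b + c + d) * ‖Z.2‖ := by linarith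
    _ ≤ _ := by linarith

theorem continuous_wignerPhase :
    Continuous fun Z : ℙ × ℙ => modul (sndP Z.1 : 𝔼) (sndP Z.2) := by
  have h3 := (continuous_modul (V := 𝔼)).comp
    (show Continuous fun Z : ℙ × ℙ => (sndP Z.1, sndP Z.2) by fun_prop)
  exact h3

theorem isCoeff_wigner (A : Matrix ι ι ℝ) {G : ℙ → ℂ} (hG : G ∈ GSBeurling ℙ 1) :
    IsCoeff (volume : Measure (ℙ × ℙ)) (wignerX A) (wignerXi A)
      (fun Z => ((stftConst (ι ⊕ ι) ^ 2 : ℝ) : ℂ) * hat G Z.1 Z.2 *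
        modul (sndP Z.1) (sndP Z.2)) := by
  obtain ⟨M, hM, hMb⟩ := exists_norm_wignerX_le A
  have hc := isCoeff_hat hG ((stftConst (ι ⊕ ι) ^ 2 : ℝ) : ℂ)
  have hm := hc.meas.mul (continuous_wignerPhase (ι := ι)).aestronglyMeasurable
  have hX := continuous_wignerX A
  have hXi := continuous_wignerXi A
  refine ⟨hm, fun r => ?_⟩
  refine (hc.int (|r| * M)).mono' (hm.norm.mul (by fun_prop : Continuous fun Z : ℙ × ℙ =>
    Real.exp (r * (‖wignerX A Z‖ + ‖wignerXi A Z‖))).aestronglyMeasurable)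
    (Eventually.of_forall fun Z => ?_)
  rw [Real.norm_of_nonneg (by positivity), norm_mul _ (modul _ _), norm_modul, mul_one, mul_assoc]
  gcongr
  · exact le_abs_self r
  · exact hMb Z

/-- The density of W is the phase times the value of F₁ ⊗ conj F₂ on the transported atom. The
transport is linear on phase space, so the density stays exponentially bounded. -/
theorem exists_isWigner (A : Matrix ι ι ℝ) (F₁ F₂ : GSBeurlingDual 𝔼 1) :
    ∃ W, IsWigner A F₁ F₂ W := by
  obtain ⟨T, hT⟩ := exists_tensor F₁ F₂
  set k : ℂ := ((stftConst (ι ⊕ ι) ^ 2 : ℝ) : ℂ) with hk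
  have hQ := isWindow_wignerWindow A
  obtain ⟨C, r, hC, hr, hb⟩ := pairOne_atomW_growth T hQ
  obtain ⟨M, hM, hMb⟩ := exists_norm_wignerX_le A
  have hcont : Continuous fun Z : ℙ × ℙ => k * modul (sndP Z.1) (sndP Z.2) *
      pairOne T (atomW (wignerWindow A) (wignerX A Z) (wignerXi A Z)) := by
    have h1 := (continuous_pairOne_atomW T hQ).comp
      ((continuous_wignerX A).prodMk (continuous_wignerXi A))
    exact (continuous_const.mul continuous_wignerPhase).mul h1
  obtain ⟨W, hW⟩ := exists_beurlingDual (C := ‖k‖ * C) (R := r * M) (by positivity)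
    hcont.aestronglyMeasurable (fun Z => by
      rw [norm_mul, norm_mul, norm_modul, mul_one, mul_assoc ‖k‖, mul_assoc r]
      gcongr
      refine (hb _ _).trans ?_
      gcongr
      exact hMb Z)
  refine ⟨W, fun G hG => ?_⟩
  have hc := isCoeff_wigner A hG
  have h1 := hT _ (superposition_mem_beurling hQ (continuous_wignerX A) (continuous_wignerXi A) hc)
  simp only [wignerTranspose_eq_integral A hG]
  rw [← h1, pairOne_superposition T hQ (continuous_wignerX A) (continuous_wignerXi A) hc, hW G hG]
  exact integral_congr_ae (Eventually.of_forall fun Z => by ring)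

/-- The short-time Fourier transform of a Wigner distribution, up to a phase. -/
def wignerSTFT (A : Matrix ι ι ℝ) (F₁ F₂ : GSBeurlingDual 𝔼 1) (Z : ℙ × ℙ) : ℂ :=
  ∫ Z' : ℙ × ℙ, ((stftConst (ι ⊕ ι) ^ 2 : ℝ) : ℂ) *
    hat (atomW (wignerWindow A) (wignerX A Z) (wignerXi A Z)) Z'.1 Z'.2 * tensorDensity F₁ F₂ Z'

theorem IsWigner.pairOne_atomW {A : Matrix ι ι ℝ} {F₁ F₂ : GSBeurlingDual 𝔼 1}
    {W : GSBeurlingDual ℙ 1} (hW : IsWigner A F₁ F₂ W) (Z : ℙ × ℙ) :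
    pairOne W (atomW gauss Z.1 Z.2) = modul (sndP Z.1) (sndP Z.2) * wignerSTFT A F₁ F₂ Z := by
  have hQ := isWindow_wignerWindow A
  rw [hW _ (atomW_mem_beurling isWindow_gauss _ _), wignerSTFT, ← integral_const_mul]
  simp only [wignerTranspose_atomW]
  have hK := (GSBeurling ℙ 1).smul_mem (modul (sndP Z.1) (sndP Z.2))
    (atomW_mem_beurling hQ (wignerX A Z) (wignerXi A Z))
  have h1 := nested_pairOne_eq F₁ F₂ hK
  simp only [hat_smul, Pi.smul_apply, smul_eq_mul] at h1
  rw [h1]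
  exact integral_congr_ae (Eventually.of_forall fun Z' => by ring)

theorem integrable_wignerSTFT (A : Matrix ι ι ℝ) (F₁ F₂ : GSBeurlingDual 𝔼 1) (Z : ℙ × ℙ) :
    Integrable fun Z' : ℙ × ℙ => ((stftConst (ι ⊕ ι) ^ 2 : ℝ) : ℂ) *
      hat (atomW (wignerWindow A) (wignerX A Z) (wignerXi A Z)) Z'.1 Z'.2 *
        tensorDensity F₁ F₂ Z' := by
  obtain ⟨C, r, hC, hr, hb⟩ := tensorDensity_growth F₁ F₂
  have h := integrable_hat_mul
    (atomW_mem_beurling (isWindow_wignerWindow A) (wignerX A Z) (wignerXi A Z))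
    (continuous_tensorDensity F₁ F₂).aestronglyMeasurable hb
  simpa only [mul_assoc] using h.const_mul _

theorem wignerSTFT_sub (A : Matrix ι ι ℝ) (F₁ F₂ G₁ G₂ : GSBeurlingDual 𝔼 1) (Z : ℙ × ℙ) :
    wignerSTFT A G₁ G₂ Z - wignerSTFT A F₁ F₂ Z =
      wignerSTFT A (G₁ - F₁) (G₂ - F₂) Z + wignerSTFT A F₁ (G₂ - F₂) Z +
        wignerSTFT A (G₁ - F₁) F₂ Z := by
  have h := integrable_wignerSTFT A
  simp only [wignerSTFT]
  have h1 := integral_add (h (G₁ - F₁) (G₂ - F₂) Z) (h F₁ (G₂ - F₂) Z)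
  have h2 := integral_add ((h (G₁ - F₁) (G₂ - F₂) Z).add (h F₁ (G₂ - F₂) Z)) (h (G₁ - F₁) F₂ Z)
  simp only [Pi.add_apply] at h2
  rw [h1] at h2
  rw [← h2, ← integral_sub (h _ _ _) (h _ _ _)]
  refine integral_congr_ae (Eventually.of_forall fun Z' => ?_)
  simp only [← mul_sub, ← mul_add, tensorDensity_sub]

theorem wignerX_pair (A : Matrix ι ι ℝ) (x ξ η y : 𝔼) :
    wignerX A (pair x ξ, pair η y) = pair (x - act A y) (x + act (1 - A) y) := by
  simp only [wignerX, fstP_pair, sndP_pair]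

theorem wignerXi_pair (A : Matrix ι ι ℝ) (x ξ η y : 𝔼) :
    wignerXi A (pair x ξ, pair η y) =
      pair (ξ + act (1 - A.transpose) η) (act A.transpose η - ξ) := by
  simp only [wignerXi, fstP_pair, sndP_pair]

theorem enorm_tensorDensity (F₁ F₂ : GSBeurlingDual 𝔼 1) (Z : ℙ × ℙ) :
    ‖tensorDensity F₁ F₂ Z‖ₑ = ‖pairOne F₁ (atomW gauss (fstP Z.1) (fstP Z.2))‖ₑ *
      ‖pairOne F₂ (atomW gauss (sndP Z.1) (-sndP Z.2))‖ₑ := by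
  rw [tensorDensity, enorm_mul]
  congr 1
  rw [← ofReal_norm, RCLike.norm_conj, ofReal_norm]

/-- The rate 2r on ℝ^{2d} splits into the rate r for each component, because both component norms
are at most the full norm. -/
theorem exists_enorm_hat_wigner_le (A : Matrix ι ι ℝ) {r : ℝ} (hr : 0 ≤ r) :
    ∃ C : ℝ≥0, ∀ (X₁ X₂ Ξ₁ Ξ₂ : 𝔼) (Z : ℙ × ℙ),
      ‖((stftConst (ι ⊕ ι) ^ 2 : ℝ) : ℂ) *
        hat (atomW (wignerWindow A) (pair X₁ X₂) (pair Ξ₁ Ξ₂)) Z.1 Z.2‖ₑ ≤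
      C * ((expKernel r (fstP Z.1 - X₁) * expKernel r (sndP Z.1 - X₂)) *
        (expKernel r (fstP Z.2 - Ξ₁) * expKernel r (sndP Z.2 - Ξ₂))) := by
  obtain ⟨D, hD0, hD⟩ := (isWindow_wignerWindow A).hat_decay (show 0 ≤ 2 * r by positivity)
  have hs := stftConst_pos (ι := ι ⊕ ι)
  refine ⟨Real.toNNReal (stftConst (ι ⊕ ι) ^ 2 * D), fun X₁ X₂ Ξ₁ Ξ₂ Z => ?_⟩
  have h3 := expKernel_pair_le hr (Z.1 - pair X₁ X₂)
  have h4 := expKernel_pair_le hr (Z.2 - pair Ξ₁ Ξ₂)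
  simp only [map_sub, fstP_pair, sndP_pair] at h3 h4
  refine le_trans ?_ (mul_le_mul_right (mul_le_mul' h3 h4) _)
  rw [← ofReal_norm, norm_mul, norm_hat_atomW, expKernel, expKernel,
    ← ENNReal.ofReal_mul (Real.exp_pos _).le]
  change _ ≤ ENNReal.ofReal (stftConst (ι ⊕ ι) ^ 2 * D) * _
  rw [← ENNReal.ofReal_mul (by positivity), ← Real.exp_add]
  refine ENNReal.ofReal_le_ofReal ?_
  rw [Complex.norm_real, Real.norm_of_nonneg (by positivity), mul_assoc]
  gcongr
  refine (hD _ _).trans (le_of_eq ?_)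
  congr 2
  ring

/-- The pointwise bound for the short-time Fourier transform of a Wigner distribution. -/
theorem exists_enorm_wignerSTFT_le (A : Matrix ι ι ℝ) {r : ℝ} (hr : 0 ≤ r) :
    ∃ C : ℝ≥0, ∀ (F₁ F₂ : GSBeurlingDual 𝔼 1) (x ξ η y : 𝔼),
      ‖wignerSTFT A F₁ F₂ (pair x ξ, pair η y)‖ₑ ≤ C *
        (expAverage r (fun x ξ => ‖pairOne F₁ (atomW gauss x ξ)‖ₑ) (x - act A y)
            (ξ + act (1 - A.transpose) η) *
          expAverage r (fun x ξ => ‖pairOne F₂ (atomW gauss x ξ)‖ₑ) (x + act (1 - A) y)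
            (ξ - act A.transpose η)) := by
  obtain ⟨C, hC⟩ := exists_enorm_hat_wigner_le A hr
  refine ⟨C, fun F₁ F₂ x ξ η y => ?_⟩
  -- The conjugated factor is evaluated at the negative of its frequency variable, so the target
  -- frequency is written as -Ξ₂ and `expAverage_neg` applies.
  rw [wignerSTFT, wignerX_pair, wignerXi_pair, ← neg_sub (act A.transpose η) ξ]
  generalize x - act A y = X₁
  generalize x + act (1 - A) y = X₂
  generalize ξ + act (1 - A.transpose) η = Ξ₁
  generalize act A.transpose η - ξ = Ξ₂
  have hm₁ := measurable_enorm_pairOne F₁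
  have hm₂ := measurable_enorm_pairOne_neg F₂
  have e₁ := lintegral_expKernel_mul r hm₁ X₁ Ξ₁
  have e₂ := (lintegral_expKernel_mul r hm₂ X₂ Ξ₂).trans
    (expAverage_neg r (fun x ξ => ‖pairOne F₂ (atomW gauss x ξ)‖ₑ) X₂ Ξ₂)
  have e₃ := lintegral_tensor _ _ (measurable_kernel_mul r hm₁ X₁ Ξ₁)
    (measurable_kernel_mul r hm₂ X₂ Ξ₂)
  rw [e₁, e₂] at e₃
  rw [← e₃, ← lintegral_const_mul' _ _ ENNReal.coe_ne_top]
  refine (enorm_integral_le_lintegral_enorm _).trans (lintegral_mono fun Z => ?_)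
  simp only
  rw [enorm_mul, enorm_tensorDensity]
  refine (mul_le_mul_left (hC X₁ X₂ Ξ₁ Ξ₂ Z) _).trans (le_of_eq ?_)
  ring

end Wigner

/-! ## Moderate weights -/

section Weights

set_option linter.unusedSectionVars false

variable {V : Type*} [NormedAddCommGroup V] [NormedSpace ℝ V] [FiniteDimensional ℝ V]
  [MeasureSpace V] [BorelSpace V] [(volume : Measure V).IsAddHaarMeasure]

theorem IsWeight.exists_ae_le {v : V → ℝ} (hv : IsWeight v) {K : Set V} (hK : IsCompact K) :
    ∃ M : ℝ, 0 ≤ M ∧ ∀ᵐ y ∂(volume.restrict K), v y ≤ M := by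
  have h := (hv.2 K hK).1
  have h1 : eLpNormEssSup v (volume.restrict K) ≠ ∞ := by
    have := h.2
    rw [eLpNorm_exponent_top] at this
    exact this.ne
  refine ⟨(eLpNormEssSup v (volume.restrict K)).toReal, ENNReal.toReal_nonneg, ?_⟩
  filter_upwards [ae_le_eLpNormEssSup (f := v) (μ := volume.restrict K)] with y hy
  have h2 := (ENNReal.toReal_le_toReal enorm_ne_top h1).2 hy
  rw [toReal_enorm] at h2
  exact (le_abs_self _).trans h2

/-- The function v is only essentially bounded on balls. For ‖y‖ ≤ 1 almost every z in the unit ball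
has both v(z) ≤ M and v(y-z) ≤ M, so y is reached in the two steps y-z and z. -/
theorem IsModerateWeight.exists_le_of_norm_le_one {ω : V → ℝ} (hω : IsModerateWeight ω) :
    ∃ D : ℝ, 1 ≤ D ∧ ∀ x y, ‖y‖ ≤ 1 → ω (x + y) ≤ D * ω x := by
  obtain ⟨hw, v, hv, C, hC⟩ := hω
  obtain ⟨M, hM0, hM⟩ := hv.exists_ae_le (isCompact_closedBall (0 : V) 2)
  rw [ae_restrict_iff' measurableSet_closedBall] at hM
  have hC0 : 0 ≤ C := by
    have h := hC 0 0
    by_contra hneg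
    push Not at hneg
    have h1 := hw.1 (0 + 0)
    have h2 := mul_pos (hw.1 0) (hv.1 0)
    nlinarith
  have hstep : ∀ x y, v y ≤ M → ω (x + y) ≤ (C * M) * ω x := fun x y hy => by
    have h1 := hC x y
    have h2 := hw.1 x
    calc ω (x + y) ≤ C * (ω x * v y) := h1
      _ ≤ C * (ω x * M) := by gcongr
      _ = _ := by ring
  refine ⟨max 1 ((C * M) * (C * M)), le_max_left _ _, fun x y hy => ?_⟩
  have hM' : ∀ᵐ z : V, y - z ∈ Metric.closedBall (0 : V) 2 → v (y - z) ≤ M :=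
    (Measure.measurePreserving_sub_left (volume : Measure V) y).quasiMeasurePreserving.ae hM
  have hpos : volume (Metric.ball (0 : V) 1) ≠ 0 := (Metric.measure_ball_pos _ _ one_pos).ne'
  have hex : ∃ z ∈ Metric.ball (0 : V) 1, v z ≤ M ∧ v (y - z) ≤ M := by
    by_contra hne
    push Not at hne
    refine hpos (measure_mono_null (t := {z | ¬ ((z ∈ Metric.closedBall (0 : V) 2 → v z ≤ M) ∧
      (y - z ∈ Metric.closedBall (0 : V) 2 → v (y - z) ≤ M))}) (fun z hz => ?_)
      (hM.and hM'))
    rintro ⟨h1, h2⟩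
    have hz' : ‖z‖ < 1 := by simpa using hz
    have h3 := h1 (by simp; linarith)
    have h4 := h2 (by
      have := norm_sub_le y z
      simp only [Metric.mem_closedBall, dist_zero_right]
      linarith)
    exact absurd h4 (not_le.2 (hne z hz h3))
  obtain ⟨z, -, hz1, hz2⟩ := hex
  have h1 := hstep (x + (y - z)) z hz1
  have h2 := hstep x (y - z) hz2
  have h3 : x + (y - z) + z = x + y := by abel
  rw [h3] at h1
  have h4 := hw.1 x
  calc ω (x + y) ≤ (C * M) * ω (x + (y - z)) := h1
    _ ≤ (C * M) * ((C * M) * ω x) := by gcongr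
    _ = ((C * M) * (C * M)) * ω x := by ring
    _ ≤ _ := by gcongr; exact le_max_right _ _

/-- The displacement y is divided into ⌈‖y‖⌉ equal steps of length at most one, each costing a
factor D. -/
theorem IsModerateWeight.exists_exp {ω : V → ℝ} (hω : IsModerateWeight ω) :
    ∃ C r : ℝ, 0 ≤ C ∧ 0 ≤ r ∧ ∀ x y, ω (x + y) ≤ C * Real.exp (r * ‖y‖) * ω x := by
  obtain ⟨D, hD1, hD⟩ := hω.exists_le_of_norm_le_one
  have hpos := hω.1.1
  have hn : ∀ (n : ℕ) (x y : V), ‖y‖ ≤ n → ω (x + y) ≤ D ^ n * ω x := by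
    intro n
    induction n with
    | zero =>
      intro x y hy
      have : y = 0 := by simpa using hy
      simp [this]
    | succ n ih =>
      intro x y hy
      have hn0 : (0 : ℝ) < n + 1 := by positivity
      push_cast at hy
      have h1 : ‖((n : ℝ) / (n + 1)) • y‖ ≤ n := by
        rw [norm_smul, Real.norm_of_nonneg (by positivity), div_mul_eq_mul_div,
          div_le_iff₀ hn0]
        gcongr
      have h2 : ‖((1 : ℝ) / (n + 1)) • y‖ ≤ 1 := by
        rw [norm_smul, Real.norm_of_nonneg (by positivity), div_mul_eq_mul_div,
          div_le_iff₀ hn0, one_mul, one_mul]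
        exact hy
      have h3 : x + ((n : ℝ) / (n + 1)) • y + ((1 : ℝ) / (n + 1)) • y = x + y := by
        rw [add_assoc, ← add_smul, ← add_div, div_self hn0.ne', one_smul]
      have h4 := hD (x + ((n : ℝ) / (n + 1)) • y) _ h2
      rw [h3] at h4
      calc ω (x + y) ≤ D * ω (x + ((n : ℝ) / (n + 1)) • y) := h4
        _ ≤ D * (D ^ n * ω x) := by
          gcongr
          exact ih _ _ h1
        _ = _ := by rw [pow_succ]; ring
  refine ⟨D, Real.log D, by linarith, Real.log_nonneg hD1, fun x y => ?_⟩
  refine (hn ⌈‖y‖⌉₊ x y (Nat.le_ceil _)).trans ?_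
  have h1 := hpos x
  gcongr
  have hD0 : 0 < D := by linarith
  rw [← Real.rpow_natCast, ← Real.rpow_def_of_pos hD0]
  calc D ^ ((⌈‖y‖⌉₊ : ℝ)) ≤ D ^ (‖y‖ + 1) := by
        gcongr
        exact (Nat.ceil_lt_add_one (norm_nonneg y)).le
    _ = _ := by rw [Real.rpow_add hD0, Real.rpow_one, mul_comm]

/-- A moderate weight is equivalent to a continuous one. -/
theorem IsModerateWeight.exists_continuous {ω : V → ℝ} (hω : IsModerateWeight ω) :
    ∃ (w : V → ℝ) (C r : ℝ), Continuous w ∧ 0 < C ∧ 0 ≤ r ∧ (∀ x, 0 < w x) ∧ (∀ x, ω x ≤ w x) ∧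
      (∀ x, w x ≤ C * ω x) ∧ ∀ x y, w (x + y) ≤ Real.exp (r * ‖y‖) * w x := by
  obtain ⟨C, r, hC, hr, h⟩ := hω.exists_exp
  have hpos := hω.1.1
  -- The smallest majorant whose logarithm is r-Lipschitz; the Lipschitz property also provides
  -- continuity.
  let w : V → ℝ := fun x => ⨆ y, ω (x + y) * Real.exp (-(r * ‖y‖))
  have hb : ∀ x y, ω (x + y) * Real.exp (-(r * ‖y‖)) ≤ C * ω x := fun x y => by
    calc _ ≤ (C * Real.exp (r * ‖y‖) * ω x) * Real.exp (-(r * ‖y‖)) := by gcongr; exact h x y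
      _ = C * ω x * (Real.exp (r * ‖y‖) * Real.exp (-(r * ‖y‖))) := by ring
      _ = _ := by rw [← Real.exp_add, add_neg_cancel, Real.exp_zero, mul_one]
  have hbdd : ∀ x, BddAbove (Set.range fun y => ω (x + y) * Real.exp (-(r * ‖y‖))) := fun x =>
    ⟨C * ω x, by rintro _ ⟨y, rfl⟩; exact hb x y⟩
  have hle : ∀ x, ω x ≤ w x := fun x => by
    have := le_ciSup (hbdd x) 0
    simpa using this
  have hge : ∀ x, w x ≤ C * ω x := fun x => ciSup_le (hb x)
  have hwpos : ∀ x, 0 < w x := fun x => (hpos x).trans_le (hle x)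
  have hmod : ∀ x y, w (x + y) ≤ Real.exp (r * ‖y‖) * w x := by
    intro x y
    refine ciSup_le fun z => ?_
    have h1 := le_ciSup (hbdd x) (y + z)
    calc ω (x + y + z) * Real.exp (-(r * ‖z‖))
        ≤ ω (x + (y + z)) * (Real.exp (r * ‖y‖) * Real.exp (-(r * ‖y + z‖))) := by
          rw [add_assoc, ← Real.exp_add]
          have h2 := (hpos (x + (y + z))).le
          gcongr
          have := norm_add_le y z
          nlinarith
      _ = Real.exp (r * ‖y‖) * (ω (x + (y + z)) * Real.exp (-(r * ‖y + z‖))) := by ring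
      _ ≤ _ := by gcongr
  have hC' : 0 < C := by
    have h1 := (hle 0).trans (hge 0)
    have h2 := hpos 0
    by_contra hneg
    push Not at hneg
    nlinarith
  refine ⟨w, C, r, ?_, hC', hr, hwpos, hle, hge, hmod⟩
  have hlip : LipschitzWith (Real.toNNReal r) fun x => Real.log (w x) := by
    refine LipschitzWith.of_le_add_mul _ fun x y => ?_
    have h1 := hmod y (x - y)
    rw [add_sub_cancel] at h1
    have h2 := Real.log_le_log (hwpos x) h1
    rw [Real.log_mul (Real.exp_pos _).ne' (hwpos y).ne', Real.log_exp] at h2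
    rw [Real.coe_toNNReal r hr, dist_eq_norm]
    linarith
  have h1 : w = fun x => Real.exp (Real.log (w x)) :=
    funext fun x => (Real.exp_log (hwpos x)).symm
  rw [h1]
  exact Real.continuous_exp.comp hlip.continuous

end Weights

/-! ## Young functions and Luxemburg norms -/

section Young

variable {Φ : ℝ≥0∞ → ℝ≥0∞}

theorem IsYoung.map_mul_le (hΦ : IsYoung Φ) {l : ℝ≥0∞} (hl : l ≤ 1) (t : ℝ≥0∞) :
    Φ (l * t) ≤ l * Φ t := by
  lift l to ℝ≥0 using ne_top_of_le_ne_top ENNReal.one_ne_top hl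
  have hl' : l ≤ 1 := by exact_mod_cast hl
  induction t using ENNReal.recTopCoe with
  | top =>
    rcases eq_or_ne l 0 with rfl | h0
    · simp [hΦ.zero]
    · rw [ENNReal.mul_top (by simpa using h0), hΦ.top, ENNReal.mul_top (by simpa using h0)]
  | coe t =>
    have h := hΦ.convex l (1 - l) (add_tsub_cancel_of_le hl') t 0
    simpa [hΦ.zero] using h

theorem IsYoung.mono (hΦ : IsYoung Φ) : Monotone Φ := by
  intro s t hst
  rcases eq_or_ne t ∞ with rfl | ht
  · rw [hΦ.top]; exact le_top
  rcases eq_or_ne t 0 with rfl | h0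
  · rw [nonpos_iff_eq_zero.1 hst]
  have h1 : s / t ≤ 1 := ENNReal.div_le_of_le_mul (by rwa [one_mul])
  have h2 := hΦ.map_mul_le h1 t
  rw [ENNReal.div_mul_cancel h0 ht] at h2
  refine h2.trans ?_
  calc s / t * Φ t ≤ 1 * Φ t := by gcongr
    _ = _ := one_mul _

theorem IsYoung.measurable (hΦ : IsYoung Φ) : Measurable Φ := hΦ.mono.measurable

theorem IsYoung.exists_pos (hΦ : IsYoung Φ) : ∃ t : ℝ≥0∞, t ≠ 0 ∧ t ≠ ∞ ∧ 1 ≤ Φ t := by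
  have h := hΦ.lim.eventually (lt_mem_nhds ENNReal.one_lt_top)
  obtain ⟨t, ht, h0⟩ := (h.and (eventually_gt_atTop 0)).exists
  exact ⟨t, by simpa using h0.ne', ENNReal.coe_ne_top, ht.le⟩

/-- Above t₀ the quotient Φ(t)/t is at least Φ(t₀)/t₀; below t₀ the second summand suffices. Being
linear on the left, the inequality can be integrated. -/
theorem IsYoung.mul_le (hΦ : IsYoung Φ) {t₀ : ℝ≥0∞} (h₀ : t₀ ≠ ∞) (t : ℝ≥0∞) :
    t * Φ t₀ ≤ t₀ * (Φ t + Φ t₀) := by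
  rcases le_total t t₀ with h | h
  · calc t * Φ t₀ ≤ t₀ * Φ t₀ := by gcongr
      _ ≤ _ := by gcongr; exact le_add_self
  · rcases eq_or_ne t₀ 0 with rfl | h0
    · simp [hΦ.zero]
    rcases eq_or_ne t ∞ with rfl | ht
    · rw [hΦ.top, top_add, ENNReal.mul_top h0]; exact le_top
    have ht0 : t ≠ 0 := fun h' => h0 (nonpos_iff_eq_zero.1 (h' ▸ h))
    have h1 : t₀ / t ≤ 1 := ENNReal.div_le_of_le_mul (by rwa [one_mul])
    have h2 := hΦ.map_mul_le h1 t
    rw [ENNReal.div_mul_cancel ht0 ht] at h2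
    calc t * Φ t₀ ≤ t * (t₀ / t * Φ t) := by gcongr
      _ = t₀ * Φ t := by rw [← mul_assoc, ENNReal.mul_div_cancel ht0 ht]
      _ ≤ _ := by gcongr; exact le_self_add

/-- A quantity is bounded when its image under a Young function is. -/
theorem IsYoung.exists_le (hΦ : IsYoung Φ) :
    ∃ t₀ : ℝ≥0∞, t₀ ≠ 0 ∧ t₀ ≠ ∞ ∧ ∀ t, t ≤ t₀ * (Φ t + 1) := by
  obtain ⟨t₀, h0, htop, h1⟩ := hΦ.exists_pos
  refine ⟨t₀, h0, htop, fun t => ?_⟩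
  rcases le_total t t₀ with h | h
  · calc t ≤ t₀ * 1 := by rwa [mul_one]
      _ ≤ _ := by gcongr; exact le_add_self
  · rcases eq_or_ne t ∞ with rfl | ht
    · rw [hΦ.top, top_add, ENNReal.mul_top h0]
    have ht0 : t ≠ 0 := fun h' => h0 (nonpos_iff_eq_zero.1 (h' ▸ h))
    have h3 : t₀ / t ≤ 1 := ENNReal.div_le_of_le_mul (by rwa [one_mul])
    have h2 := hΦ.map_mul_le h3 t
    rw [ENNReal.div_mul_cancel ht0 ht] at h2
    calc t = t * 1 := (mul_one t).symm
      _ ≤ t * (t₀ / t * Φ t) := by gcongr; exact h1.trans h2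
      _ = t₀ * Φ t := by rw [← mul_assoc, ENNReal.mul_div_cancel ht0 ht]
      _ ≤ _ := by gcongr; exact le_self_add

variable {Z : Type*} [MeasurableSpace Z] {μ : Measure Z}

/-- A weak form of Jensen's inequality. -/
theorem IsYoung.jensen_of_le (hΦ : IsYoung Φ) (hμ : μ Set.univ ≤ 1) {g : Z → ℝ≥0∞}
    (hg : AEMeasurable g μ) {t₀ : ℝ≥0∞} (ht : t₀ ≠ ∞) (h : 2 * t₀ ≤ ∫⁻ z, g z ∂μ) :
    Φ t₀ ≤ ∫⁻ z, Φ (g z) ∂μ := by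
  rcases eq_or_ne t₀ 0 with rfl | h0
  · simp [hΦ.zero]
  have hΦg : AEMeasurable (fun z => Φ (g z)) μ := hΦ.measurable.comp_aemeasurable hg
  -- If Φ(t₀) = ∞ and the right side is finite, then g ≤ t₀ almost everywhere, contrary to the
  -- integral being at least 2t₀. Otherwise the chord inequality is integrated.
  rcases eq_or_ne (Φ t₀) ∞ with hinf | hfin
  · by_contra hne
    push Not at hne
    have h1 := ae_lt_top' hΦg (hne.trans_le le_top).ne
    have h2 : ∀ᵐ z ∂μ, g z ≤ t₀ := by
      filter_upwards [h1] with z hz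
      by_contra hlt
      push Not at hlt
      exact absurd (hΦ.mono hlt.le) (by rw [hinf]; exact not_le.2 hz)
    have h3 : ∫⁻ z, g z ∂μ ≤ t₀ := by
      calc ∫⁻ z, g z ∂μ ≤ ∫⁻ _, t₀ ∂μ := lintegral_mono_ae h2
        _ = t₀ * μ Set.univ := lintegral_const _
        _ ≤ t₀ * 1 := by gcongr
        _ = t₀ := mul_one _
    have h4 : t₀ + t₀ ≤ t₀ + 0 := by rw [add_zero, ← two_mul]; exact h.trans h3
    exact h0 (nonpos_iff_eq_zero.1 ((ENNReal.add_le_add_iff_left ht).1 h4))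
  · have h1 : (2 * t₀) * Φ t₀ ≤ t₀ * (∫⁻ z, Φ (g z) ∂μ + Φ t₀) := by
      calc (2 * t₀) * Φ t₀ ≤ (∫⁻ z, g z ∂μ) * Φ t₀ := by gcongr
        _ = ∫⁻ z, g z * Φ t₀ ∂μ := (lintegral_mul_const'' _ hg).symm
        _ ≤ ∫⁻ z, t₀ * (Φ (g z) + Φ t₀) ∂μ := lintegral_mono fun z => hΦ.mul_le ht _
        _ = t₀ * (∫⁻ z, Φ (g z) ∂μ + Φ t₀ * μ Set.univ) := by
          rw [lintegral_const_mul' _ _ ht, lintegral_add_right _ measurable_const,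
            lintegral_const]
        _ ≤ t₀ * (∫⁻ z, Φ (g z) ∂μ + Φ t₀ * 1) := by gcongr
        _ = _ := by rw [mul_one]
    rw [mul_comm 2, mul_assoc, ENNReal.mul_le_mul_iff_right h0 ht, two_mul] at h1
    exact (ENNReal.add_le_add_iff_right hfin).1 h1

/-- The loss of the factor 2 permits the elementary chord inequality and total mass at most one. An
infinite integral is handled by letting t₀ grow, since Φ tends to ∞. -/
theorem IsYoung.jensen (hΦ : IsYoung Φ) (hμ : μ Set.univ ≤ 1) {g : Z → ℝ≥0∞}
    (hg : AEMeasurable g μ) : Φ ((∫⁻ z, g z ∂μ) / 2) ≤ ∫⁻ z, Φ (g z) ∂μ := by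
  rcases eq_or_ne (∫⁻ z, g z ∂μ) ∞ with hinf | hfin
  · have h1 : ∀ t : ℝ≥0, Φ t ≤ ∫⁻ z, Φ (g z) ∂μ := fun t =>
      hΦ.jensen_of_le hμ hg ENNReal.coe_ne_top (by rw [hinf]; exact le_top)
    have h2 : ∞ ≤ ∫⁻ z, Φ (g z) ∂μ := le_of_tendsto hΦ.lim (Eventually.of_forall h1)
    exact le_top.trans h2
  · refine hΦ.jensen_of_le hμ hg (ENNReal.div_lt_top hfin two_ne_zero).ne ?_
    rw [ENNReal.mul_div_cancel two_ne_zero ENNReal.ofNat_ne_top]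

theorem IsYoung.jensen_mul (hΦ : IsYoung Φ) {w g : Z → ℝ≥0∞} (hw : Measurable w)
    (hw1 : ∫⁻ z, w z ∂μ ≤ 1) (hg : Measurable g) :
    Φ ((∫⁻ z, w z * g z ∂μ) / 2) ≤ ∫⁻ z, w z * Φ (g z) ∂μ := by
  have h := hΦ.jensen (μ := μ.withDensity w) (by simpa using hw1) hg.aemeasurable
  have h1 := lintegral_withDensity_eq_lintegral_mul μ hw hg
  have h2 := lintegral_withDensity_eq_lintegral_mul μ hw (hΦ.measurable.comp hg)
  simp only [Function.comp_apply, Pi.mul_apply] at h1 h2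
  rwa [h1, h2] at h

end Young

/-! ### Luxemburg norms: modular bounds, vanishing and measurability -/

section Lux

variable {V : Type*} [MeasureSpace V] {Φ : ℝ≥0∞ → ℝ≥0∞} {g : V → ℝ≥0∞}

theorem lintegral_le_one_of_luxNorm_lt (hΦ : IsYoung Φ) {l : ℝ≥0∞} (hl : luxNorm Φ g < l) :
    ∫⁻ x, Φ (g x / l) ≤ 1 := by
  obtain ⟨l', ⟨-, -, h1⟩, hl'⟩ := sInf_lt_iff.1 hl
  exact (lintegral_mono fun x => hΦ.mono (ENNReal.div_le_div_left hl'.le _)).trans h1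

theorem luxNorm_le {l : ℝ≥0∞} (h0 : l ≠ 0) (htop : l ≠ ∞) (h : ∫⁻ x, Φ (g x / l) ≤ 1) :
    luxNorm Φ g ≤ l :=
  sInf_le ⟨pos_iff_ne_zero.2 h0, htop.lt_top, h⟩

theorem luxNorm_mono (hΦ : IsYoung Φ) {g' : V → ℝ≥0∞} (h : ∀ x, g x ≤ g' x) :
    luxNorm Φ g ≤ luxNorm Φ g' := by
  refine le_sInf fun l hl => sInf_le ⟨hl.1, hl.2.1, le_trans (lintegral_mono fun x => ?_) hl.2.2⟩
  exact hΦ.mono (ENNReal.div_le_div_right (h x) _)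

theorem luxNorm_const_mul_le {c : ℝ≥0∞} (h0 : c ≠ 0) (htop : c ≠ ∞) :
    luxNorm Φ (fun x => c * g x) ≤ c * luxNorm Φ g := by
  rw [mul_comm, ← ENNReal.div_le_iff_le_mul (Or.inl h0) (Or.inl htop)]
  refine le_sInf fun l hl => ?_
  have h1 : luxNorm Φ (fun x => c * g x) ≤ c * l := by
    refine luxNorm_le (mul_ne_zero h0 hl.1.ne') (ENNReal.mul_ne_top htop hl.2.1.ne) ?_
    simpa only [ENNReal.mul_div_mul_left _ _ h0 htop] using hl.2.2
  exact ENNReal.div_le_of_le_mul' h1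

/-- All levels are admissible, and Φ(mt) ≤ mΦ(t) for m ≤ 1 makes ∫Φ(n g) arbitrarily small. Hence
Φ(n g) = 0 almost everywhere for every n, which bounds n g independently of n. -/
theorem ae_eq_zero_of_luxNorm_eq_zero (hΦ : IsYoung Φ) (hg : Measurable g)
    (h : luxNorm Φ g = 0) : ∀ᵐ x, g x = 0 := by
  have h1 : ∀ n : ℕ, ∀ᵐ x, Φ ((n : ℝ≥0∞) * g x) = 0 := by
    intro n
    have hm : Measurable fun x => Φ ((n : ℝ≥0∞) * g x) := hΦ.measurable.comp (hg.const_mul _)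
    refine (lintegral_eq_zero_iff hm).1 ?_
    refine nonpos_iff_eq_zero.1 (ENNReal.le_of_forall_pos_le_add fun ε hε _ => ?_)
    rw [zero_add]
    obtain ⟨m, hm0, hmε⟩ : ∃ m : ℝ≥0∞, m ≠ 0 ∧ m ≤ 1 ∧ m ≤ ε :=
      ⟨min 1 ε, by simpa using hε.ne', min_le_left _ _, min_le_right _ _⟩
    have hm_top : m ≠ ∞ := ne_top_of_le_ne_top ENNReal.one_ne_top hmε.1
    have hl : luxNorm Φ g < m / (n + 1) := by
      rw [h]
      exact ENNReal.div_pos hm0 (by finiteness)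
    have h2 := lintegral_le_one_of_luxNorm_lt hΦ hl
    calc ∫⁻ x, Φ ((n : ℝ≥0∞) * g x) ≤ ∫⁻ x, m * Φ (g x / (m / (n + 1))) := by
          refine lintegral_mono fun x => ?_
          refine le_trans (hΦ.mono ?_) (hΦ.map_mul_le hmε.1 _)
          rw [ENNReal.div_eq_inv_mul, ENNReal.inv_div (Or.inr hm_top) (Or.inr hm0), ← mul_assoc,
            ENNReal.mul_div_cancel hm0 hm_top]
          gcongr
          exact le_self_add
      _ = m * ∫⁻ x, Φ (g x / (m / (n + 1))) := lintegral_const_mul' _ _ hm_top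
      _ ≤ m * 1 := by gcongr
      _ ≤ ε := by rw [mul_one]; exact hmε.2
  obtain ⟨t₀, h0, htop, h2⟩ := hΦ.exists_le
  filter_upwards [ae_all_iff.2 h1] with x hx
  by_contra hne
  obtain ⟨n, hn⟩ := ENNReal.exists_nat_mul_gt hne htop
  have h3 := h2 (n * g x)
  rw [hx n, zero_add, mul_one] at h3
  exact absurd hn (not_lt.2 h3)

/-- The norm is below t exactly when some rational level below t is admissible, and admissibility of
a fixed level is a measurable condition. -/
theorem measurable_luxNorm {W : Type*} [MeasurableSpace W] [SFinite (volume : Measure V)]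
    (hΦ : IsYoung Φ)
    {a : V → W → ℝ≥0∞} (ha : Measurable (Function.uncurry a)) :
    Measurable fun ξ => luxNorm Φ fun x => a x ξ := by
  refine measurable_of_Iio fun t => ?_
  have h1 : (fun ξ => luxNorm Φ fun x => a x ξ) ⁻¹' Set.Iio t =
      ⋃ q : ℚ≥0, {ξ | 0 < (q : ℝ≥0) ∧ ((q : ℝ≥0) : ℝ≥0∞) < t ∧
        ∫⁻ x, Φ (a x ξ / ((q : ℝ≥0) : ℝ≥0∞)) ≤ 1} := by
    ext ξ
    simp only [Set.mem_preimage, Set.mem_Iio, Set.mem_iUnion, Set.mem_ofPred_eq]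
    constructor
    · intro h
      obtain ⟨l₁, h2, h3⟩ := ENNReal.lt_iff_exists_nnreal_btwn.1 h
      obtain ⟨l₂, h4, h5⟩ := ENNReal.lt_iff_exists_nnreal_btwn.1 h3
      have h6 : (l₁ : ℝ) < l₂ := by exact_mod_cast h4
      obtain ⟨q, h7, h8⟩ := exists_rat_btwn h6
      have hq0 : 0 < q := by
        have : (0 : ℝ) < q := lt_of_le_of_lt l₁.2 h7
        exact_mod_cast this
      lift q to ℚ≥0 using hq0.le
      have h9 : l₁ < (q : ℝ≥0) := by
        rw [← NNReal.coe_lt_coe]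
        exact_mod_cast h7
      have h10 : (q : ℝ≥0) < l₂ := by
        rw [← NNReal.coe_lt_coe]
        exact_mod_cast h8
      refine ⟨q, lt_of_le_of_lt l₁.2 h9, lt_trans (by exact_mod_cast h10) h5, ?_⟩
      exact lintegral_le_one_of_luxNorm_lt hΦ (h2.trans (by exact_mod_cast h9))
    · rintro ⟨q, h2, h3, h4⟩
      exact (luxNorm_le (by simpa using h2.ne') ENNReal.coe_ne_top h4).trans_lt h3
  rw [h1]
  refine MeasurableSet.iUnion fun q => ?_
  have hm : Measurable fun ξ => ∫⁻ x, Φ (a x ξ / ((q : ℝ≥0) : ℝ≥0∞)) :=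
    Measurable.lintegral_prod_left' (f := fun z : V × W => Φ (a z.1 z.2 / ((q : ℝ≥0) : ℝ≥0∞)))
      (hΦ.measurable.comp (ha.div_const _))
  by_cases hq : 0 < (q : ℝ≥0) ∧ ((q : ℝ≥0) : ℝ≥0∞) < t
  · simp only [hq, true_and]
    exact measurableSet_le hm measurable_const
  · have : {ξ | 0 < (q : ℝ≥0) ∧ ((q : ℝ≥0) : ℝ≥0∞) < t ∧
        ∫⁻ x, Φ (a x ξ / ((q : ℝ≥0) : ℝ≥0∞)) ≤ 1} = ∅ := by
      ext ξ
      simp only [Set.mem_ofPred_eq, Set.mem_empty_iff_false, iff_false]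
      exact fun h => hq ⟨h.1, h.2.1⟩
    rw [this]
    exact MeasurableSet.empty

end Lux

/-! ## Localisation of mixed Orlicz norms -/

section Localisation

set_option linter.unusedSectionVars false

variable {ι : Type*} [Fintype ι]

local notation "𝔼" => EuclideanSpace ℝ ι

/-- Bounded positive kernels of mass one. -/
structure IsKernel (w : 𝔼 → ℝ≥0∞) (M : ℝ≥0) : Prop where
  measurable : Measurable w
  mass_left : ∀ x, ∫⁻ y, w (y - x) = 1
  mass_right : ∀ y, ∫⁻ x, w (y - x) = 1
  le : ∀ y, w y ≤ M
  ne_zero : ∀ y, w y ≠ 0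

variable {w : EuclideanSpace ℝ ι → ℝ≥0∞} {M : ℝ≥0} {Φ Ψ : ℝ≥0∞ → ℝ≥0∞}

theorem IsKernel.measurable_sub (hw : IsKernel w M) (x : 𝔼) : Measurable fun y => w (y - x) :=
  hw.measurable.comp (measurable_id.sub_const x)

theorem IsKernel.measurable_mul (hw : IsKernel w M) {h : 𝔼 → ℝ≥0∞} (hh : Measurable h) (x : 𝔼) :
    Measurable fun y => w (y - x) * h y :=
  (hw.measurable_sub x).mul hh

theorem measurable_slice {a : 𝔼 → 𝔼 → ℝ≥0∞} (ha : Measurable (Function.uncurry a)) (ξ : 𝔼) :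
    Measurable fun x => a x ξ := ha.comp measurable_prodMk_right

/-- The average of a function with respect to a kernel. -/
def kerMean (w : EuclideanSpace ℝ ι → ℝ≥0∞) (h : EuclideanSpace ℝ ι → ℝ≥0∞)
    (ξ : EuclideanSpace ℝ ι) : ℝ≥0∞ := ∫⁻ ξ', w (ξ' - ξ) * h ξ'

theorem IsKernel.measurable_kerMean (hw : IsKernel w M) {h : 𝔼 → ℝ≥0∞} (hh : Measurable h) :
    Measurable (kerMean w h) :=
  Measurable.lintegral_prod_right' (f := fun z : 𝔼 × 𝔼 => w (z.2 - z.1) * h z.2)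
    ((hw.measurable.comp (measurable_snd.sub measurable_fst)).mul (hh.comp measurable_snd))

theorem IsKernel.kerMean_le (hw : IsKernel w M) (h : 𝔼 → ℝ≥0∞) (ξ : 𝔼) :
    kerMean w h ξ ≤ M * ∫⁻ ξ', h ξ' := by
  rw [kerMean, ← lintegral_const_mul' _ _ ENNReal.coe_ne_top]
  exact lintegral_mono fun ξ' => by gcongr; exact hw.le _

theorem IsKernel.lintegral_kerMean (hw : IsKernel w M) {h : 𝔼 → ℝ≥0∞} (hh : Measurable h) :
    ∫⁻ ξ, kerMean w h ξ = ∫⁻ ξ, h ξ := by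
  simp only [kerMean]
  rw [lintegral_lintegral_swap]
  · refine lintegral_congr fun ξ' => ?_
    have hm : Measurable fun ξ => w (ξ' - ξ) :=
      hw.measurable.comp (measurable_const.sub measurable_id)
    rw [lintegral_mul_const _ hm, hw.mass_right, one_mul]
  · exact ((hw.measurable.comp (measurable_snd.sub measurable_fst)).mul
      (hh.comp measurable_snd)).aemeasurable

theorem IsKernel.young_kerMean_le (hw : IsKernel w M) (hΨ : IsYoung Ψ) {h : 𝔼 → ℝ≥0∞}
    (hh : Measurable h) (ξ : 𝔼) : Ψ (kerMean w h ξ / 2) ≤ kerMean w (fun ξ => Ψ (h ξ)) ξ :=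
  hΨ.jensen_mul (hw.measurable_sub ξ) (hw.mass_left ξ).le hh

/-- The bound h ≤ t₀(Ψ(h)+1) is averaged: the kernel is bounded by M and has mass one. -/
theorem IsKernel.kerMean_le_of_young (hw : IsKernel w M) (hΨ : IsYoung Ψ) :
    ∃ D : ℝ≥0, ∀ h : 𝔼 → ℝ≥0∞, Measurable h → ∫⁻ ξ, Ψ (h ξ) ≤ 1 → ∀ ξ, kerMean w h ξ ≤ D := by
  obtain ⟨t₀, -, htop, ht⟩ := hΨ.exists_le
  lift t₀ to ℝ≥0 using htop
  refine ⟨t₀ * (M + 1), fun h hh h1 ξ => ?_⟩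
  have hm : Measurable fun ξ' => w (ξ' - ξ) * Ψ (h ξ') :=
    (hw.measurable_sub ξ).mul (hΨ.measurable.comp hh)
  calc kerMean w h ξ ≤ ∫⁻ ξ', (t₀ : ℝ≥0∞) * (w (ξ' - ξ) * Ψ (h ξ') + w (ξ' - ξ)) := by
        refine lintegral_mono fun ξ' => ?_
        calc w (ξ' - ξ) * h ξ' ≤ w (ξ' - ξ) * (t₀ * (Ψ (h ξ') + 1)) := by gcongr; exact ht _
          _ = _ := by ring
    _ = t₀ * (kerMean w (fun ξ => Ψ (h ξ)) ξ + 1) := by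
        rw [lintegral_const_mul' _ _ ENNReal.coe_ne_top, lintegral_add_left hm, hw.mass_left]
        rfl
    _ ≤ t₀ * (M * 1 + 1) := by
        gcongr
        exact (hw.kerMean_le _ ξ).trans (by gcongr)
    _ = _ := by push_cast; ring

/-- The normalised local average of `a` with respect to the norms `h` of its slices. -/
def normMean (w : EuclideanSpace ℝ ι → ℝ≥0∞) (h : EuclideanSpace ℝ ι → ℝ≥0∞)
    (a : EuclideanSpace ℝ ι → EuclideanSpace ℝ ι → ℝ≥0∞) (x ξ : EuclideanSpace ℝ ι) : ℝ≥0∞ :=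
  (∫⁻ ξ', (w (ξ' - ξ) * h ξ' / kerMean w h ξ) *
    (kerMean w (fun x' => a x' ξ' / (2 * h ξ')) x / 2)) / 2

/-! ### Separating the frequency profile of an average from its normalised slices -/

section NormMean

variable {h : EuclideanSpace ℝ ι → ℝ≥0∞}
  {a : EuclideanSpace ℝ ι → EuclideanSpace ℝ ι → ℝ≥0∞}

theorem measurable_slice_div (ha : Measurable (Function.uncurry a)) (h : 𝔼 → ℝ≥0∞) (ξ : 𝔼) :
    Measurable fun x => a x ξ / (2 * h ξ) :=
  (ha.comp measurable_prodMk_right).div_const _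

theorem IsKernel.measurable_kerMean_slice (hw : IsKernel w M)
    (ha : Measurable (Function.uncurry a)) (hh : Measurable h) :
    Measurable (Function.uncurry fun x ξ' => kerMean w (fun x' => a x' ξ' / (2 * h ξ')) x) :=
  Measurable.lintegral_prod_right'
    (f := fun z : (𝔼 × 𝔼) × 𝔼 => w (z.2 - z.1.1) * (a z.2 z.1.2 / (2 * h z.1.2)))
    ((hw.measurable.comp (measurable_snd.sub (measurable_fst.comp measurable_fst))).mul
      ((ha.comp (measurable_snd.prodMk (measurable_snd.comp measurable_fst))).div
        ((hh.comp (measurable_snd.comp measurable_fst)).const_mul 2)))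

theorem IsKernel.measurable_weight (hw : IsKernel w M) (hh : Measurable h) :
    Measurable fun z : 𝔼 × 𝔼 => w (z.2 - z.1) * h z.2 / kerMean w h z.1 :=
  ((hw.measurable.comp (measurable_snd.sub measurable_fst)).mul (hh.comp measurable_snd)).div
    ((hw.measurable_kerMean hh).comp measurable_fst)

theorem IsKernel.measurable_normMean (hw : IsKernel w M)
    (ha : Measurable (Function.uncurry a)) (hh : Measurable h) :
    Measurable (Function.uncurry (normMean w h a)) := by
  refine Measurable.div_const ?_ 2
  refine Measurable.lintegral_prod_right'
    (f := fun z : (𝔼 × 𝔼) × 𝔼 => (w (z.2 - z.1.2) * h z.2 / kerMean w h z.1.2) *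
      (kerMean w (fun x' => a x' z.2 / (2 * h z.2)) z.1.1 / 2)) ?_
  have h1 := (hw.measurable_weight hh).comp
    (show Measurable fun z : (𝔼 × 𝔼) × 𝔼 => (z.1.2, z.2) by fun_prop)
  have h2 := (hw.measurable_kerMean_slice ha hh).comp
    (show Measurable fun z : (𝔼 × 𝔼) × 𝔼 => (z.1.1, z.2) by fun_prop)
  exact h1.mul (h2.div_const 2)

theorem IsKernel.lintegral_weight_le (hw : IsKernel w M) (hh : Measurable h) (ξ : 𝔼) :
    ∫⁻ ξ', w (ξ' - ξ) * h ξ' / kerMean w h ξ ≤ 1 := by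
  have h1 : ∫⁻ ξ', w (ξ' - ξ) * h ξ' / kerMean w h ξ = kerMean w h ξ / kerMean w h ξ := by
    simp only [div_eq_mul_inv]
    rw [lintegral_mul_const _ (hw.measurable_mul hh ξ)]
    rfl
  rw [h1]
  exact ENNReal.div_self_le_one

/-- Two applications of Jensen, in x' against w and in ξ' against the normalised weight; each
accounts for one of the halves in `normMean`. -/
theorem IsKernel.young_normMean_le (hw : IsKernel w M) (hΦ : IsYoung Φ)
    (ha : Measurable (Function.uncurry a)) (hh : Measurable h) (x ξ : 𝔼) :
    Φ (normMean w h a x ξ) ≤ ∫⁻ ξ', (w (ξ' - ξ) * h ξ' / kerMean w h ξ) *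
      kerMean w (fun x' => Φ (a x' ξ' / (2 * h ξ'))) x := by
  have hm1 : Measurable fun ξ' => w (ξ' - ξ) * h ξ' / kerMean w h ξ :=
    (hw.measurable_weight hh).comp measurable_prodMk_left
  have hm2 : Measurable fun ξ' => kerMean w (fun x' => a x' ξ' / (2 * h ξ')) x / 2 :=
    ((hw.measurable_kerMean_slice ha hh).comp measurable_prodMk_left).div_const 2
  refine (hΦ.jensen_mul hm1 (hw.lintegral_weight_le hh ξ) hm2).trans (lintegral_mono fun ξ' => ?_)
  gcongr
  exact hw.young_kerMean_le hΦ (measurable_slice_div ha h ξ') x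

/-- If 0 < h(ξ') < ∞, the level 2h(ξ') lies strictly above the Luxemburg norm of the slice and its
modular is at most one. If h(ξ') = 0, the weight vanishes. -/
theorem weight_mul_modular_le (hΦ : IsYoung Φ) (ξ ξ' : 𝔼)
    (hlux : ∀ ξ, h ξ = luxNorm Φ fun x => a x ξ) (hfin : h ξ' ≠ ∞) :
    (w (ξ' - ξ) * h ξ' / kerMean w h ξ) * ∫⁻ x', Φ (a x' ξ' / (2 * h ξ')) ≤
      w (ξ' - ξ) * h ξ' / kerMean w h ξ := by
  rcases eq_or_ne (h ξ') 0 with h0 | h0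
  · simp [h0]
  · have h1 : luxNorm Φ (fun x => a x ξ') < 2 * h ξ' := by
      rw [← hlux, two_mul]
      exact ENNReal.lt_add_right hfin h0
    calc _ ≤ (w (ξ' - ξ) * h ξ' / kerMean w h ξ) * 1 := by
          gcongr
          exact lintegral_le_one_of_luxNorm_lt hΦ h1
      _ = _ := mul_one _

theorem ae_ne_top_of_young (hΨ : IsYoung Ψ) (hh : Measurable h) (h1 : ∫⁻ ξ, Ψ (h ξ) ≤ 1) :
    ∀ᵐ ξ, h ξ ≠ ∞ := by
  filter_upwards [ae_lt_top (hΨ.measurable.comp hh) (h1.trans_lt ENNReal.one_lt_top).ne] with ξ hξ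
  intro h2
  simp [h2, hΨ.top] at hξ

theorem IsKernel.young_normMean_le_const (hw : IsKernel w M) (hΦ : IsYoung Φ)
    (ha : Measurable (Function.uncurry a)) (hh : Measurable h)
    (hlux : ∀ ξ, h ξ = luxNorm Φ fun x => a x ξ) (hfin : ∀ᵐ ξ, h ξ ≠ ∞) (x ξ : 𝔼) :
    Φ (normMean w h a x ξ) ≤ M := by
  refine (hw.young_normMean_le hΦ ha hh x ξ).trans ?_
  calc _ ≤ ∫⁻ ξ', (M : ℝ≥0∞) * (w (ξ' - ξ) * h ξ' / kerMean w h ξ) := by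
        refine lintegral_mono_ae ?_
        filter_upwards [hfin] with ξ' hξ'
        calc _ ≤ (w (ξ' - ξ) * h ξ' / kerMean w h ξ) *
              (M * ∫⁻ x', Φ (a x' ξ' / (2 * h ξ'))) := by
              gcongr
              exact hw.kerMean_le _ x
          _ = M * ((w (ξ' - ξ) * h ξ' / kerMean w h ξ) *
              ∫⁻ x', Φ (a x' ξ' / (2 * h ξ'))) := by ring
          _ ≤ _ := by
              gcongr
              exact weight_mul_modular_le hΦ ξ ξ' hlux hξ'
    _ = M * ∫⁻ ξ', w (ξ' - ξ) * h ξ' / kerMean w h ξ :=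
        lintegral_const_mul' _ _ ENNReal.coe_ne_top
    _ ≤ M * 1 := by
        gcongr
        exact hw.lintegral_weight_le hh ξ
    _ = M := mul_one _

theorem IsKernel.lintegral_young_normMean_le (hw : IsKernel w M) (hΦ : IsYoung Φ)
    (ha : Measurable (Function.uncurry a)) (hh : Measurable h)
    (hlux : ∀ ξ, h ξ = luxNorm Φ fun x => a x ξ) (hfin : ∀ᵐ ξ, h ξ ≠ ∞) (ξ : 𝔼) :
    ∫⁻ x, Φ (normMean w h a x ξ) ≤ 1 := by
  have hmΦ : Measurable (Function.uncurry fun x' ξ' => Φ (a x' ξ' / (2 * h ξ'))) :=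
    hΦ.measurable.comp (ha.div ((hh.comp measurable_snd).const_mul 2))
  have hm : Measurable (Function.uncurry fun x ξ' : 𝔼 =>
      (w (ξ' - ξ) * h ξ' / kerMean w h ξ) *
        kerMean w (fun x' => Φ (a x' ξ' / (2 * h ξ'))) x) := by
    refine (((hw.measurable_weight hh).comp measurable_prodMk_left).comp measurable_snd).mul ?_
    exact Measurable.lintegral_prod_right'
      (f := fun z : (𝔼 × 𝔼) × 𝔼 => w (z.2 - z.1.1) * Φ (a z.2 z.1.2 / (2 * h z.1.2)))
      ((hw.measurable.comp (measurable_snd.sub (measurable_fst.comp measurable_fst))).mul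
        (hmΦ.comp (measurable_snd.prodMk (measurable_snd.comp measurable_fst))))
  calc _ ≤ ∫⁻ x, ∫⁻ ξ', (w (ξ' - ξ) * h ξ' / kerMean w h ξ) *
      kerMean w (fun x' => Φ (a x' ξ' / (2 * h ξ'))) x :=
        lintegral_mono fun x => hw.young_normMean_le hΦ ha hh x ξ
    _ = ∫⁻ ξ', ∫⁻ x, (w (ξ' - ξ) * h ξ' / kerMean w h ξ) *
      kerMean w (fun x' => Φ (a x' ξ' / (2 * h ξ'))) x :=
        lintegral_lintegral_swap hm.aemeasurable
    _ = ∫⁻ ξ', (w (ξ' - ξ) * h ξ' / kerMean w h ξ) * ∫⁻ x', Φ (a x' ξ' / (2 * h ξ')) := by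
        refine lintegral_congr fun ξ' => ?_
        have hs : Measurable fun x' => Φ (a x' ξ' / (2 * h ξ')) :=
          hmΦ.comp measurable_prodMk_right
        rw [lintegral_const_mul _ (hw.measurable_kerMean hs), hw.lintegral_kerMean hs]
    _ ≤ ∫⁻ ξ', w (ξ' - ξ) * h ξ' / kerMean w h ξ := by
        refine lintegral_mono_ae ?_
        filter_upwards [hfin] with ξ' hξ'
        exact weight_mul_modular_le hΦ ξ ξ' hlux hξ'
    _ ≤ 1 := hw.lintegral_weight_le hh ξ

/-- The normalisations are undone: division by 2h and the two halves contribute 8 = 2·2·2. Where h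
vanishes, the slice is zero almost everywhere and nothing is lost. -/
theorem IsKernel.kerMean_kerMean_le (hw : IsKernel w M) (hΦ : IsYoung Φ)
    (ha : Measurable (Function.uncurry a)) (hh : Measurable h)
    (hlux : ∀ ξ, h ξ = luxNorm Φ fun x => a x ξ) (hfin : ∀ᵐ ξ, h ξ ≠ ∞)
    (x ξ : 𝔼) (hH : kerMean w h ξ ≠ ∞) :
    kerMean w (fun ξ' => kerMean w (fun x' => a x' ξ') x) ξ ≤
      8 * (kerMean w h ξ * normMean w h a x ξ) := by
  have hzero : ∀ ξ', h ξ' = 0 → kerMean w (fun x' => a x' ξ') x = 0 := by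
    intro ξ' h0
    have h1 := ae_eq_zero_of_luxNorm_eq_zero hΦ (g := fun x => a x ξ')
      (ha.comp measurable_prodMk_right) ((hlux ξ').symm.trans h0)
    rw [kerMean, lintegral_eq_zero_iff (hw.measurable_mul (measurable_slice ha ξ') x)]
    filter_upwards [h1] with x' hx'
    simp [hx']
  rcases eq_or_ne (kerMean w h ξ) 0 with hH0 | hH0
  · have h2 : ∀ᵐ ξ', h ξ' = 0 := by
      have := (lintegral_eq_zero_iff ((hw.measurable_sub ξ).mul hh)).1 hH0
      filter_upwards [this] with ξ' hξ'
      simpa [hw.ne_zero] using hξ'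
    have h3 : kerMean w (fun ξ' => kerMean w (fun x' => a x' ξ') x) ξ = 0 := by
      refine (lintegral_congr_ae ?_).trans lintegral_zero
      filter_upwards [h2] with ξ' hξ'
      rw [hzero ξ' hξ', mul_zero]
    rw [h3]
    exact zero_le
  · have h1 : kerMean w h ξ * normMean w h a x ξ = (∫⁻ ξ', (w (ξ' - ξ) * h ξ') *
        (kerMean w (fun x' => a x' ξ' / (2 * h ξ')) x / 2)) / 2 := by
      rw [normMean, ← mul_div_assoc, ← lintegral_const_mul' _ _ hH]
      congr 1
      refine lintegral_congr fun ξ' => ?_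
      rw [← mul_assoc, ENNReal.mul_div_cancel hH0 hH]
    have h2 : ∀ᵐ ξ', w (ξ' - ξ) * kerMean w (fun x' => a x' ξ') x =
        4 * ((w (ξ' - ξ) * h ξ') * (kerMean w (fun x' => a x' ξ' / (2 * h ξ')) x / 2)) := by
      filter_upwards [hfin] with ξ' hξ'
      rcases eq_or_ne (h ξ') 0 with h0 | h0
      · rw [hzero ξ' h0, h0]
        simp
      · have h3 : kerMean w (fun x' => a x' ξ' / (2 * h ξ')) x =
            kerMean w (fun x' => a x' ξ') x / (2 * h ξ') := by
          simp only [kerMean, div_eq_mul_inv, ← mul_assoc]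
          rw [lintegral_mul_const _ (hw.measurable_mul (measurable_slice ha ξ') x)]
        have h4 : kerMean w (fun x' => a x' ξ') x =
            2 * h ξ' * (kerMean w (fun x' => a x' ξ') x / (2 * h ξ')) := by
          rw [ENNReal.mul_div_cancel (mul_ne_zero two_ne_zero h0)
            (ENNReal.mul_ne_top ENNReal.ofNat_ne_top hξ')]
        have h5 : (4 : ℝ≥0∞) = 2 * 2 := by norm_num
        rw [h3]
        conv_lhs => rw [h4]
        generalize kerMean w (fun x' => a x' ξ') x / (2 * h ξ') = t
        rw [h5]
        calc w (ξ' - ξ) * (2 * h ξ' * t) = (w (ξ' - ξ) * h ξ') * (2 * t) := by ring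
          _ = (w (ξ' - ξ) * h ξ') * (2 * (2 * (t / 2))) := by
            rw [ENNReal.mul_div_cancel two_ne_zero ENNReal.ofNat_ne_top]
          _ = _ := by ring
    rw [h1]
    calc kerMean w (fun ξ' => kerMean w (fun x' => a x' ξ') x) ξ = _ := lintegral_congr_ae h2
      _ = 4 * ∫⁻ ξ', (w (ξ' - ξ) * h ξ') *
          (kerMean w (fun x' => a x' ξ' / (2 * h ξ')) x / 2) :=
        lintegral_const_mul' _ _ (by norm_num)
      _ = 4 * (2 * ((∫⁻ ξ', (w (ξ' - ξ) * h ξ') *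
          (kerMean w (fun x' => a x' ξ' / (2 * h ξ')) x / 2)) / 2)) := by
        rw [ENNReal.mul_div_cancel two_ne_zero ENNReal.ofNat_ne_top]
      _ ≤ _ := by
        rw [← mul_assoc]
        gcongr
        norm_num

end NormMean

/-- Functions `u` and `H` that dominate the local averages of a function in the unit ball of a
mixed Orlicz space. -/
structure IsEnvelope (Φ Ψ : ℝ≥0∞ → ℝ≥0∞) (κ : ℝ≥0)
    (u : EuclideanSpace ℝ ι → EuclideanSpace ℝ ι → ℝ≥0∞) (H : EuclideanSpace ℝ ι → ℝ≥0∞) :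
    Prop where
  meas_u : Measurable (Function.uncurry u)
  meas_H : Measurable H
  u_le : ∀ x ξ, u x ξ ≤ κ
  young_u_le : ∀ x ξ, Φ (u x ξ) ≤ κ
  H_le : ∀ ξ, H ξ ≤ κ
  young_H_le : ∀ ξ, Ψ (H ξ) ≤ κ
  lintegral_u_le : ∀ ξ, ∫⁻ x, Φ (u x ξ) ≤ 1
  lintegral_H_le : ∫⁻ ξ, Ψ (H ξ) ≤ 1

/-- The profiles `kerMean w h / 2` and `normMean w h a`, and their Young values, are bounded by
constants independent of a. Multiplication by a small l ≤ 1 brings everything below κ, because Φ(lt)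
≤ lΦ(t). -/
theorem IsKernel.exists_isEnvelope (hw : IsKernel w M) (hΦ : IsYoung Φ) (hΨ : IsYoung Ψ)
    {κ : ℝ≥0} (hκ : 0 < κ) :
    ∃ K : ℝ≥0, ∀ a : 𝔼 → 𝔼 → ℝ≥0∞, Measurable (Function.uncurry a) →
      ∫⁻ ξ, Ψ (luxNorm Φ fun x => a x ξ) ≤ 1 →
      ∃ u H, IsEnvelope Φ Ψ κ u H ∧ ∀ x ξ,
        kerMean w (fun ξ' => kerMean w (fun x' => a x' ξ') x) ξ ≤ K * (H ξ * u x ξ) := by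
  obtain ⟨D, hD⟩ := hw.kerMean_le_of_young hΨ
  obtain ⟨t₀, -, htop, ht⟩ := hΦ.exists_le
  lift t₀ to ℝ≥0 using htop
  set B : ℝ≥0 := 1 + M + D + t₀ * (M + 1) with hB
  obtain ⟨l, hl0, hl1, hlB⟩ : ∃ l : ℝ≥0, 0 < l ∧ l ≤ 1 ∧ l * B ≤ κ := by
    refine ⟨min 1 (κ / B), lt_min one_pos (by positivity), min_le_left _ _, ?_⟩
    calc min 1 (κ / B) * B ≤ κ / B * B := by gcongr; exact min_le_right _ _
      _ = κ := div_mul_cancel₀ _ (by positivity)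
  have hl1' : (l : ℝ≥0∞) ≤ 1 := by exact_mod_cast hl1
  have hlB' : (l : ℝ≥0∞) * B ≤ κ := by exact_mod_cast hlB
  have hle : ∀ t : ℝ≥0∞, t ≤ B → (l : ℝ≥0∞) * t ≤ κ := fun t h =>
    le_trans (by gcongr) hlB'
  have hMB : (M : ℝ≥0∞) ≤ B := by
    have h1 : M ≤ B := by
      rw [hB]
      calc M ≤ 1 + M := le_add_self
        _ ≤ 1 + M + (D + t₀ * (M + 1)) := le_self_add
        _ = _ := by ring
    exact_mod_cast h1
  have hDB : (D : ℝ≥0∞) ≤ B := by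
    have h1 : D ≤ B := by
      rw [hB]
      calc D ≤ D + (1 + M + t₀ * (M + 1)) := le_self_add
        _ = _ := by ring
    exact_mod_cast h1
  have htB : (t₀ : ℝ≥0∞) * (M + 1) ≤ B := by
    have h1 : t₀ * (M + 1) ≤ B := le_add_self
    exact_mod_cast h1
  -- One 1/l for each profile; 16 is the 8 of `kerMean_kerMean_le` times 2 for the half in H.
  refine ⟨16 / (l * l), fun a ha h1 => ?_⟩
  set h : 𝔼 → ℝ≥0∞ := fun ξ => luxNorm Φ fun x => a x ξ with hh_def
  have hh : Measurable h := measurable_luxNorm hΦ ha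
  have hfin := ae_ne_top_of_young hΨ hh h1
  have hH := hD h hh h1
  have hu := hw.young_normMean_le_const hΦ ha hh (fun _ => rfl) hfin
  have hM0 : ∀ ξ, Ψ (kerMean w h ξ / 2) ≤ M := fun ξ =>
    ((hw.young_kerMean_le hΨ hh ξ).trans (hw.kerMean_le _ ξ)).trans
      ((mul_le_mul_right h1 _).trans (mul_one _).le)
  refine ⟨fun x ξ => l * normMean w h a x ξ, fun ξ => l * (kerMean w h ξ / 2),
    ⟨?_, ?_, fun x ξ => ?_, fun x ξ => ?_, fun ξ => ?_, fun ξ => ?_, fun ξ => ?_, ?_⟩,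
    fun x ξ => ?_⟩
  · exact (hw.measurable_normMean ha hh).const_mul _
  · exact ((hw.measurable_kerMean hh).div_const 2).const_mul _
  · refine hle _ (((ht _).trans ?_).trans htB)
    gcongr
    exact hu x ξ
  · exact (hΦ.map_mul_le hl1' _).trans (hle _ ((hu x ξ).trans hMB))
  · exact hle _ (ENNReal.half_le_self.trans ((hH ξ).trans hDB))
  · exact (hΨ.map_mul_le hl1' _).trans (hle _ ((hM0 ξ).trans hMB))
  · refine (lintegral_mono fun x => ?_).trans
      (hw.lintegral_young_normMean_le hΦ ha hh (fun _ => rfl) hfin ξ)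
    exact hΦ.mono (mul_le_of_le_one_left zero_le hl1')
  · calc ∫⁻ ξ, Ψ (l * (kerMean w h ξ / 2)) ≤ ∫⁻ ξ, kerMean w (fun ξ => Ψ (h ξ)) ξ :=
          lintegral_mono fun ξ => (hΨ.mono (mul_le_of_le_one_left zero_le hl1')).trans
            (hw.young_kerMean_le hΨ hh ξ)
      _ = ∫⁻ ξ, Ψ (h ξ) := hw.lintegral_kerMean (hΨ.measurable.comp hh)
      _ ≤ 1 := h1
  · have h2 := hw.kerMean_kerMean_le hΦ ha hh (fun _ => rfl) hfin x ξ
      (ne_top_of_le_ne_top ENNReal.coe_ne_top (hH ξ))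
    refine h2.trans (le_of_eq ?_)
    have h3 : ((16 / (l * l) : ℝ≥0) : ℝ≥0∞) * (l * l) = 16 := by
      rw [← ENNReal.coe_mul, ← ENNReal.coe_mul, div_mul_cancel₀ _ (by positivity)]
      rfl
    calc 8 * (kerMean w h ξ * normMean w h a x ξ)
        = 8 * ((2 * (kerMean w h ξ / 2)) * normMean w h a x ξ) := by
          rw [ENNReal.mul_div_cancel two_ne_zero ENNReal.ofNat_ne_top]
      _ = 16 * ((kerMean w h ξ / 2) * normMean w h a x ξ) := by
          rw [mul_assoc 2, ← mul_assoc 8]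
          norm_num
      _ = _ := by
          rw [← h3]
          ring

/-! ### The exponential kernel, normalised -/

variable (ι) in
/-- The mass of the exponential kernel. -/
def expMass : ℝ≥0∞ := ∫⁻ y : EuclideanSpace ℝ ι, expKernel 1 y

theorem expMass_ne_top : expMass ι ≠ ∞ := by
  have h := (integrable_exp_neg_mul_norm (ι := ι) one_pos).lintegral_lt_top
  exact h.ne

theorem expKernel_ne_zero (r : ℝ) (y : 𝔼) : expKernel r y ≠ 0 :=
  (ENNReal.ofReal_pos.2 (Real.exp_pos _)).ne'

theorem expMass_ne_zero : expMass ι ≠ 0 := by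
  rw [expMass, ne_eq, lintegral_eq_zero_iff (continuous_expKernel 1).measurable]
  intro h
  obtain ⟨y, hy⟩ := h.exists
  exact expKernel_ne_zero 1 y hy

theorem isKernel_exp :
    IsKernel (fun y : 𝔼 => expKernel 1 y / expMass ι) (expMass ι)⁻¹.toNNReal := by
  have hm := (continuous_expKernel (ι := ι) 1).measurable
  have h0 := expMass_ne_zero (ι := ι)
  have htop := expMass_ne_top (ι := ι)
  have hmass : ∫⁻ y : 𝔼, expKernel 1 y / expMass ι = 1 := by
    simp only [div_eq_mul_inv]
    rw [lintegral_mul_const _ hm]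
    exact ENNReal.mul_inv_cancel h0 htop
  refine ⟨hm.div_const _, fun x => ?_, fun y => ?_, fun y => ?_, fun y => ?_⟩
  · rw [lintegral_sub_right_eq_self (fun y : 𝔼 => expKernel 1 y / expMass ι) x, hmass]
  · rw [lintegral_sub_left_eq_self (fun y : 𝔼 => expKernel 1 y / expMass ι) y, hmass]
  · rw [ENNReal.coe_toNNReal (ENNReal.inv_ne_top.2 h0), ENNReal.div_eq_inv_mul]
    refine mul_le_of_le_one_right zero_le ?_
    rw [expKernel, ← ENNReal.ofReal_one]
    refine ENNReal.ofReal_le_ofReal (Real.exp_le_one_iff.2 ?_)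
    have := norm_nonneg y
    linarith
  · exact (ENNReal.div_pos (expKernel_ne_zero 1 y) htop).ne'

theorem exists_expAverage_le (hΦ : IsYoung Φ) (hΨ : IsYoung Ψ) {κ : ℝ≥0} (hκ : 0 < κ) :
    ∃ K : ℝ≥0, ∀ a : 𝔼 → 𝔼 → ℝ≥0∞, Measurable (Function.uncurry a) →
      ∫⁻ ξ, Ψ (luxNorm Φ fun x => a x ξ) ≤ 1 →
      ∃ u H, IsEnvelope Φ Ψ κ u H ∧ ∀ x ξ, expAverage 1 a x ξ ≤ K * (H ξ * u x ξ) := by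
  obtain ⟨K, hK⟩ := (isKernel_exp (ι := ι)).exists_isEnvelope hΦ hΨ hκ
  have h0 := expMass_ne_zero (ι := ι)
  have htop := expMass_ne_top (ι := ι)
  refine ⟨(expMass ι).toNNReal * (expMass ι).toNNReal * K, fun a ha h1 => ?_⟩
  obtain ⟨u, H, hE, hb⟩ := hK a ha h1
  refine ⟨u, H, hE, fun x ξ => ?_⟩
  have h2 : expAverage 1 a x ξ = expMass ι * expMass ι *
      kerMean (fun y : 𝔼 => expKernel 1 y / expMass ι) (fun ξ' =>
        kerMean (fun y : 𝔼 => expKernel 1 y / expMass ι) (fun x' => a x' ξ') x) ξ := by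
    simp only [kerMean, expAverage]
    rw [mul_assoc, ← lintegral_const_mul' _ _ htop, ← lintegral_const_mul' _ _ htop]
    refine lintegral_congr fun ξ' => ?_
    rw [← mul_assoc (expMass ι) (_ / _), ENNReal.mul_div_cancel h0 htop, mul_left_comm,
      ← lintegral_const_mul' _ _ htop]
    congr 1
    refine lintegral_congr fun x' => ?_
    rw [← mul_assoc, ENNReal.mul_div_cancel h0 htop]
  rw [h2]
  push_cast
  rw [ENNReal.coe_toNNReal htop, mul_assoc _ (K : ℝ≥0∞)]
  gcongr
  exact hb x ξ

end Localisation

/-! ## Products of Young functions -/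

section Pointwise

variable {Φ Φ₁ Φ₂ : ℝ≥0∞ → ℝ≥0∞}

theorem IsYoung.convexOn_toReal (hΦ : IsYoung Φ) {T : ℝ} (hT : Φ (ENNReal.ofReal T) < ∞) :
    ConvexOn ℝ (Set.Ioo 0 T) fun t => (Φ (ENNReal.ofReal t)).toReal := by
  have hfin : ∀ t ∈ Set.Ioo 0 T, Φ (ENNReal.ofReal t) ≠ ∞ := fun t ht =>
    ((hΦ.mono (ENNReal.ofReal_le_ofReal ht.2.le)).trans_lt hT).ne
  refine ⟨convex_Ioo 0 T, fun u hu v hv a b ha hb hab => ?_⟩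
  have h1 := hΦ.convex a.toNNReal b.toNNReal
    (by rw [← Real.toNNReal_add ha hb, hab, Real.toNNReal_one]) u.toNNReal v.toNNReal
  change Φ (ENNReal.ofReal a * ENNReal.ofReal u + ENNReal.ofReal b * ENNReal.ofReal v) ≤
    ENNReal.ofReal a * Φ (ENNReal.ofReal u) + ENNReal.ofReal b * Φ (ENNReal.ofReal v) at h1
  rw [← ENNReal.ofReal_mul ha, ← ENNReal.ofReal_mul hb,
    ← ENNReal.ofReal_add (mul_nonneg ha hu.1.le) (mul_nonneg hb hv.1.le)] at h1
  have h2 := ENNReal.mul_ne_top (ENNReal.ofReal_ne_top (r := a)) (hfin u hu)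
  have h3 := ENNReal.mul_ne_top (ENNReal.ofReal_ne_top (r := b)) (hfin v hv)
  have h4 := ENNReal.toReal_mono (ENNReal.add_ne_top.2 ⟨h2, h3⟩) h1
  rw [ENNReal.toReal_add h2 h3, ENNReal.toReal_mul, ENNReal.toReal_mul,
    ENNReal.toReal_ofReal ha, ENNReal.toReal_ofReal hb] at h4
  exact h4

/-- Values at which a Young function is at most `s` are bounded by the essential inverse. -/
theorem IsYoung.le_essInv (hΦ : IsYoung Φ) {x s : ℝ≥0∞} (hs0 : s ≠ 0) (hs : s ≠ ∞)
    (h : Φ x ≤ s) : x ≤ essInv Φ s := by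
  rw [essInv, if_neg hs0]
  split_ifs with h1
  · exact le_sSup (h.trans_lt hs.lt_top)
  · push Not at h1
    obtain ⟨_, ⟨t, ht, rfl⟩, hst⟩ := lt_sSup_iff.1 h1
    rcases eq_or_ne x 0 with rfl | hx0
    · exact zero_le
    obtain ⟨T, hT, htT⟩ := lt_sSup_iff.1 (show t < sSup {t | Φ t < ∞} from ht)
    have hTtop : T ≠ ∞ := fun h' => by
      rw [Set.mem_ofPred_eq, h', hΦ.top] at hT
      exact lt_irrefl _ hT
    have httop : t ≠ ∞ := (htT.trans_le le_top).ne
    have hxt : x < t := lt_of_not_ge fun h' => absurd (hst.trans_le (hΦ.mono h')) (not_lt.2 h)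
    have hxtop : x ≠ ∞ := (hxt.trans_le le_top).ne
    -- As a finite convex function on (0,T) the Young function is continuous there, so it attains
    -- the value s between x and t.
    set f : ℝ → ℝ := fun t => (Φ (ENNReal.ofReal t)).toReal with hf
    have hT' : Φ (ENNReal.ofReal T.toReal) < ∞ := by rwa [ENNReal.ofReal_toReal hTtop]
    have hcont : ContinuousOn f (Set.Ioo 0 T.toReal) :=
      (hΦ.convexOn_toReal hT').continuousOn isOpen_Ioo
    have hx0' : 0 < x.toReal := ENNReal.toReal_pos hx0 hxtop
    have hxt' : x.toReal ≤ t.toReal := ENNReal.toReal_mono httop hxt.le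
    have htT' : t.toReal < T.toReal := ENNReal.toReal_strict_mono hTtop htT
    have hsub : Set.Icc x.toReal t.toReal ⊆ Set.Ioo 0 T.toReal := fun z hz =>
      ⟨hx0'.trans_le hz.1, hz.2.trans_lt htT'⟩
    have hΦt : Φ t ≠ ∞ := ((hΦ.mono htT.le).trans_lt hT).ne
    have hmem : s.toReal ∈ Set.Icc (f x.toReal) (f t.toReal) := by
      simp only [hf, ENNReal.ofReal_toReal hxtop, ENNReal.ofReal_toReal httop]
      exact ⟨ENNReal.toReal_mono hs h, ENNReal.toReal_mono hΦt hst.le⟩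
    obtain ⟨τ, hτ, hfτ⟩ := intermediate_value_Icc hxt' (hcont.mono hsub) hmem
    have hτt : ENNReal.ofReal τ ≤ t := ENNReal.ofReal_le_of_le_toReal hτ.2
    have hΦτ : Φ (ENNReal.ofReal τ) = s :=
      (ENNReal.toReal_eq_toReal_iff' ((hΦ.mono hτt).trans_lt hΦt.lt_top).ne hs).1 hfτ
    -- By continuity Φ is still positive slightly to the left of τ, hence the zero point is strictly
    -- smaller.
    have hzero : zeroPoint Φ < ENNReal.ofReal τ := by
      have hτ' := hsub hτ
      have h2 : ContinuousAt f τ := hcont.continuousAt (Ioo_mem_nhds hτ'.1 hτ'.2)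
      have h3 : ∀ᶠ z in 𝓝[<] τ, 0 < f z := by
        refine (h2.eventually (lt_mem_nhds ?_)).filter_mono nhdsWithin_le_nhds
        rw [hfτ]
        exact ENNReal.toReal_pos hs0 hs
      obtain ⟨z, hz1, hz2⟩ := (h3.and (Ioo_mem_nhdsLT hτ'.1)).exists
      refine lt_of_le_of_lt (sSup_le fun w hw => ?_)
        ((ENNReal.ofReal_lt_ofReal_iff (hz2.1.trans hz2.2)).2 hz2.2)
      by_contra hlt
      push Not at hlt
      have h4 := hΦ.mono hlt.le
      rw [Set.mem_ofPred_eq] at hw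
      rw [hw, nonpos_iff_eq_zero] at h4
      simp [hf, h4] at hz1
    refine le_trans (ENNReal.le_ofReal_iff_toReal_le hxtop (hx0'.le.trans hτ.1) |>.2 hτ.1)
      (le_sSup ⟨hzero, hτt.trans_lt ht, hΦτ⟩)

/-- The two kinds of `p`-steered functions. -/
theorem IsSteered.cases {p : ℝ} (hp : 0 < p) (h : IsSteered p Φ) :
    ∃ δ : ℝ≥0, 0 < δ ∧ ((∃ C : ℝ≥0, ∀ t : ℝ≥0∞, t ≤ δ → t ^ p ≤ C * Φ t) ∨
      ∀ t l : ℝ≥0∞, t ≤ δ → l ≤ 1 → Φ (l ^ (1 / p) * t) ≤ l * Φ t) := by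
  rcases h with h | ⟨Φ₀, hΦ₀, r, hr, h⟩
  · obtain ⟨ε, hε0, hε⟩ := ENNReal.lt_iff_exists_nnreal_btwn.1 h
    have hε0' : ε ≠ 0 := by rintro rfl; simp at hε0
    have h1 := eventually_lt_of_lt_liminf hε
    obtain ⟨δ', hδ', hsub⟩ := (mem_nhdsGT_iff_exists_Ioo_subset' ENNReal.zero_lt_top).1 h1
    obtain ⟨δ, hδ0, hδ⟩ := ENNReal.lt_iff_exists_nnreal_btwn.1 (Set.mem_Ioi.1 hδ')
    refine ⟨δ, by exact_mod_cast hδ0, Or.inl ⟨ε⁻¹, fun t ht => ?_⟩⟩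
    rcases eq_or_ne t 0 with rfl | h0
    · rw [ENNReal.zero_rpow_of_pos hp]
      exact zero_le
    have h2 : (ε : ℝ≥0∞) < Φ t / t ^ p := hsub ⟨pos_iff_ne_zero.2 h0, ht.trans_lt hδ⟩
    have htop : t ≠ ∞ := ne_top_of_le_ne_top ENNReal.coe_ne_top ht
    have h3 := (ENNReal.le_div_iff_mul_le (Or.inl (ENNReal.rpow_pos (pos_iff_ne_zero.2 h0) htop).ne')
      (Or.inl (ENNReal.rpow_ne_top_of_nonneg hp.le htop))).1 h2.le
    rw [ENNReal.coe_inv hε0', ← ENNReal.div_eq_inv_mul]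
    rw [mul_comm] at h3
    exact ENNReal.le_div_iff_mul_le (Or.inl (by simpa using hε0')) (Or.inl ENNReal.coe_ne_top) |>.2 h3
  · refine ⟨r ^ (1 / p), NNReal.rpow_pos hr, Or.inr fun t l ht hl => ?_⟩
    have h1 : t ^ p ≤ r := by
      have := ENNReal.rpow_le_rpow ht hp.le
      rwa [← ENNReal.coe_rpow_of_nonneg _ hp.le, ← NNReal.rpow_mul, one_div_mul_cancel hp.ne',
        NNReal.rpow_one] at this
    have h2 : t = (t ^ p) ^ (1 / p) := by
      rw [← ENNReal.rpow_mul, mul_one_div_cancel hp.ne', ENNReal.rpow_one]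
    have h3 : l ^ (1 / p) * t = (l * t ^ p) ^ (1 / p) := by
      rw [ENNReal.mul_rpow_of_nonneg _ _ (by positivity), ← h2]
    have h4 := h (t ^ p) h1
    rw [← h2] at h4
    rw [h3, h _ ((mul_le_of_le_one_left zero_le hl).trans h1), h4]
    exact hΦ₀.map_mul_le hl _

/-- Both arguments lie below the essential inverses at the common level s, and raising s^{1/p+1/q}
to the power p gives s^{1+θ}. -/
theorem mul_rpow_le_of_essInv (h₁ : IsYoung Φ₁) (h₂ : IsYoung Φ₂) {P θ e : ℝ} (hP : 0 < P)
    (he : P * e = 1 + θ) {r c : ℝ≥0}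
    (hinv : ∀ s : ℝ≥0∞, s ≤ r → essInv Φ₁ s * essInv Φ₂ s ≤ c * s ^ e) {x y s : ℝ≥0∞}
    (hs0 : s ≠ 0) (hs : s ≤ r) (hx : Φ₁ x ≤ s) (hy : Φ₂ y ≤ s) :
    (x * y) ^ P ≤ (c : ℝ≥0∞) ^ P * s ^ (1 + θ) := by
  have hst : s ≠ ∞ := ne_top_of_le_ne_top ENNReal.coe_ne_top hs
  calc (x * y) ^ P ≤ (c * s ^ e) ^ P := by
        refine ENNReal.rpow_le_rpow ?_ hP.le
        exact (mul_le_mul' (h₁.le_essInv hs0 hst hx) (h₂.le_essInv hs0 hst hy)).trans (hinv s hs)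
    _ = _ := by
        rw [ENNReal.mul_rpow_of_nonneg _ _ hP.le, ← ENNReal.rpow_mul, mul_comm e, he]

/-- With s = Φ₁(x) ≤ t = Φ₂(y), the dilation l = s/t moves y down to the level s and multiplies
(xy)^P by l. The bound c^P s^{1+θ}, divided by l, is c^P t s^θ. -/
theorem mul_rpow_le_of_dilation (h₁ : IsYoung Φ₁) (h₂ : IsYoung Φ₂) {P θ e : ℝ} (hP : 0 < P)
    (he : P * e = 1 + θ) {r c : ℝ≥0}
    (hinv : ∀ s : ℝ≥0∞, s ≤ r → essInv Φ₁ s * essInv Φ₂ s ≤ c * s ^ e) {x y : ℝ≥0∞}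
    (hdil : ∀ l : ℝ≥0∞, l ≤ 1 → Φ₂ (l ^ (1 / P) * y) ≤ l * Φ₂ y) (h0 : Φ₁ x ≠ 0)
    (hle : Φ₁ x ≤ Φ₂ y) (hr : Φ₂ y ≤ r) :
    (x * y) ^ P ≤ (c : ℝ≥0∞) ^ P * (Φ₂ y * Φ₁ x ^ θ) := by
  set s := Φ₁ x with hs
  set t := Φ₂ y with ht
  have httop : t ≠ ∞ := ne_top_of_le_ne_top ENNReal.coe_ne_top hr
  have hs_top : s ≠ ∞ := ne_top_of_le_ne_top httop hle
  have ht0 : t ≠ 0 := fun h => h0 (nonpos_iff_eq_zero.1 (h ▸ hle))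
  have hl1 : s / t ≤ 1 := ENNReal.div_le_of_le_mul (by rwa [one_mul])
  have h1 := hdil (s / t) hl1
  rw [ENNReal.div_mul_cancel ht0 httop] at h1
  have h2 := mul_rpow_le_of_essInv h₁ h₂ hP he hinv h0 (hle.trans hr) le_rfl h1
  rw [mul_left_comm, ENNReal.mul_rpow_of_nonneg _ _ hP.le, ← ENNReal.rpow_mul,
    one_div_mul_cancel hP.ne', ENNReal.rpow_one, ENNReal.rpow_add _ _ h0 hs_top,
    ENNReal.rpow_one] at h2
  calc (x * y) ^ P = t / s * (s / t * (x * y) ^ P) := by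
        rw [← mul_assoc, ← mul_div_assoc, ENNReal.div_mul_cancel h0 hs_top,
          ENNReal.div_self ht0 httop, one_mul]
    _ ≤ t / s * ((c : ℝ≥0∞) ^ P * (s * s ^ θ)) := by gcongr
    _ = (c : ℝ≥0∞) ^ P * ((t / s * s) * s ^ θ) := by ring
    _ = _ := by rw [ENNReal.div_mul_cancel h0 hs_top]

/-- The pointwise inequality behind the mixed norm estimate. -/
theorem exists_mul_rpow_le {p q : ℝ≥0∞} (hp1 : 1 ≤ p) (hp : p ≠ ∞) (hpq : p ≤ q)
    (h₁ : IsYoung Φ₁) (h₂ : IsYoung Φ₂) (hs₁ : IsSteered p.toReal Φ₁)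
    (hs₂ : IsSteered p.toReal Φ₂) {r c : ℝ≥0} (hr : 0 < r)
    (hq₁ : ∀ t : ℝ≥0∞, t ≤ r → extPow q t ≤ c * Φ₁ t)
    (hq₂ : ∀ t : ℝ≥0∞, t ≤ r → extPow q t ≤ c * Φ₂ t)
    (hinv : ∀ s : ℝ≥0∞, s ≤ r → essInv Φ₁ s * essInv Φ₂ s ≤ c * s ^ (p⁻¹ + q⁻¹).toReal) :
    ∃ κ : ℝ≥0, 0 < κ ∧ ∃ C : ℝ≥0, ∀ x y : ℝ≥0∞, x ≤ κ → y ≤ κ → Φ₁ x ≤ κ → Φ₂ y ≤ κ →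
      (x * y) ^ p.toReal ≤ C * (Φ₁ x * Φ₂ y ^ (p.toReal * q⁻¹.toReal) +
        Φ₂ y * Φ₁ x ^ (p.toReal * q⁻¹.toReal)) := by
  have hp0 : p ≠ 0 := (zero_lt_one.trans_le hp1).ne'
  have hq0 : q ≠ 0 := ((zero_lt_one.trans_le hp1).trans_le hpq).ne'
  set P := p.toReal with hP_def
  set θ := P * q⁻¹.toReal with hθ_def
  have hP : 0 < P := ENNReal.toReal_pos hp0 hp
  have hθ : 0 ≤ θ := by positivity
  have he : P * (p⁻¹ + q⁻¹).toReal = 1 + θ := by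
    rw [ENNReal.toReal_add (ENNReal.inv_ne_top.2 hp0) (ENNReal.inv_ne_top.2 hq0),
      ENNReal.toReal_inv, mul_add, mul_inv_cancel₀ hP.ne']
  have hcP : (c : ℝ≥0∞) ^ P = ((c ^ P : ℝ≥0) : ℝ≥0∞) := (ENNReal.coe_rpow_of_nonneg _ hP.le).symm
  rcases eq_or_ne q ∞ with hq | hq
  -- For q = ∞ the claim is (xy)^P ≤ C(Φ₁(x)+Φ₂(y)), which follows at the level s = max(Φ₁(x),
  -- Φ₂(y)). If both values vanish, let s tend to 0.
  · have hθ0 : θ = 0 := by simp [hθ_def, hq]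
    refine ⟨r, hr, c ^ P, fun x y _ _ hx hy => ?_⟩
    rw [hθ0, ENNReal.rpow_zero, ENNReal.rpow_zero, mul_one, mul_one, ← hcP]
    have key : ∀ s : ℝ≥0∞, s ≠ 0 → s ≤ r → Φ₁ x ≤ s → Φ₂ y ≤ s →
        (x * y) ^ P ≤ (c : ℝ≥0∞) ^ P * s := fun s h0 hs hx hy => by
      have := mul_rpow_le_of_essInv h₁ h₂ hP he hinv h0 hs hx hy
      rwa [hθ0, add_zero, ENNReal.rpow_one] at this
    rcases eq_or_ne (Φ₁ x + Φ₂ y) 0 with h0 | h0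
    · have hx0 : Φ₁ x = 0 := (add_eq_zero.1 h0).1
      have hy0 : Φ₂ y = 0 := (add_eq_zero.1 h0).2
      rw [h0, mul_zero]
      have hlim : Tendsto (fun s : ℝ≥0∞ => (c : ℝ≥0∞) ^ P * s) (𝓝[>] 0) (𝓝 ((c : ℝ≥0∞) ^ P * 0)) :=
        ENNReal.Tendsto.const_mul (tendsto_id.mono_left nhdsWithin_le_nhds)
          (Or.inr (by rw [hcP]; exact ENNReal.coe_ne_top))
      rw [mul_zero] at hlim
      have : (𝓝[>] (0 : ℝ≥0∞)).NeBot := nhdsGT_neBot_of_exists_gt ⟨∞, ENNReal.zero_lt_top⟩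
      refine ge_of_tendsto hlim ?_
      have hr' : (0 : ℝ≥0∞) < r := by exact_mod_cast hr
      filter_upwards [Ioo_mem_nhdsGT hr'] with s hs
      exact key s hs.1.ne' hs.2.le (hx0 ▸ zero_le) (hy0 ▸ zero_le)
    · rcases le_total (Φ₁ x) (Φ₂ y) with h | h
      · have h3 : Φ₂ y ≠ 0 := fun h' => h0 (by
          rw [h', add_zero]; exact nonpos_iff_eq_zero.1 (h' ▸ h))
        exact (key _ h3 hy h le_rfl).trans (by gcongr; exact le_add_self)
      · have h3 : Φ₁ x ≠ 0 := fun h' => h0 (by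
          rw [h', zero_add]; exact nonpos_iff_eq_zero.1 (h' ▸ h))
        exact (key _ h3 hx le_rfl h).trans (by gcongr; exact le_self_add)
  · set Q := q.toReal with hQ_def
    have hQ : 0 < Q := ENNReal.toReal_pos hq0 hq
    have hQθ : Q * θ = P := by
      rw [hθ_def, ENNReal.toReal_inv, ← hQ_def]
      field_simp
    have hext : ∀ t, extPow q t = t ^ Q := fun t => if_neg hq
    -- Since p = qθ, the hypothesis on t^q raised to the power θ controls t^p.
    have hpow : ∀ (Φ : ℝ≥0∞ → ℝ≥0∞), (∀ t : ℝ≥0∞, t ≤ r → extPow q t ≤ c * Φ t) →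
        ∀ t : ℝ≥0∞, t ≤ r → t ^ P ≤ ((c ^ θ : ℝ≥0) : ℝ≥0∞) * Φ t ^ θ := by
      intro Φ hΦ t ht
      have h1 := hΦ t ht
      rw [hext] at h1
      rw [← hQθ, ENNReal.rpow_mul, ENNReal.coe_rpow_of_nonneg _ hθ,
        ← ENNReal.mul_rpow_of_nonneg _ _ hθ]
      exact ENNReal.rpow_le_rpow h1 hθ
    have hzero : ∀ (Φ : ℝ≥0∞ → ℝ≥0∞), (∀ t : ℝ≥0∞, t ≤ r → extPow q t ≤ c * Φ t) →
        ∀ t : ℝ≥0∞, t ≤ r → Φ t = 0 → t = 0 := by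
      intro Φ hΦ t ht h0
      have h1 := hΦ t ht
      rw [hext, h0, mul_zero, nonpos_iff_eq_zero, ENNReal.rpow_eq_zero_iff_of_pos hQ] at h1
      exact h1
    obtain ⟨δ₁, hδ₁, hc₁⟩ := hs₁.cases hP
    obtain ⟨δ₂, hδ₂, hc₂⟩ := hs₂.cases hP
    refine ⟨min r (min δ₁ δ₂), lt_min hr (lt_min hδ₁ hδ₂), ?_⟩
    have hκr : ((min r (min δ₁ δ₂) : ℝ≥0) : ℝ≥0∞) ≤ r := by exact_mod_cast min_le_left _ _
    have hκ₁ : ((min r (min δ₁ δ₂) : ℝ≥0) : ℝ≥0∞) ≤ δ₁ := by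
      exact_mod_cast (min_le_right _ _).trans (min_le_left _ _)
    have hκ₂ : ((min r (min δ₁ δ₂) : ℝ≥0) : ℝ≥0∞) ≤ δ₂ := by
      exact_mod_cast (min_le_right _ _).trans (min_le_right _ _)
    -- If one function dominates t^p, the two powers are estimated separately. Otherwise both
    -- satisfy the dilation inequality and the one with the larger value is dilated.
    rcases hc₁ with ⟨C, hC⟩ | hd₁
    · refine ⟨C * c ^ θ, fun x y hx hy _ _ => ?_⟩
      rw [ENNReal.mul_rpow_of_nonneg _ _ hP.le]
      calc x ^ P * y ^ P ≤ (C * Φ₁ x) * (((c ^ θ : ℝ≥0) : ℝ≥0∞) * Φ₂ y ^ θ) :=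
            mul_le_mul' (hC x (hx.trans hκ₁)) (hpow Φ₂ hq₂ y (hy.trans hκr))
        _ = ((C * c ^ θ : ℝ≥0) : ℝ≥0∞) * (Φ₁ x * Φ₂ y ^ θ) := by rw [ENNReal.coe_mul]; ring
        _ ≤ _ := by gcongr; exact le_self_add
    rcases hc₂ with ⟨C, hC⟩ | hd₂
    · refine ⟨C * c ^ θ, fun x y hx hy _ _ => ?_⟩
      rw [ENNReal.mul_rpow_of_nonneg _ _ hP.le]
      calc x ^ P * y ^ P ≤ (((c ^ θ : ℝ≥0) : ℝ≥0∞) * Φ₁ x ^ θ) * (C * Φ₂ y) :=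
            mul_le_mul' (hpow Φ₁ hq₁ x (hx.trans hκr)) (hC y (hy.trans hκ₂))
        _ = ((C * c ^ θ : ℝ≥0) : ℝ≥0∞) * (Φ₂ y * Φ₁ x ^ θ) := by rw [ENNReal.coe_mul]; ring
        _ ≤ _ := by gcongr; exact le_add_self
    refine ⟨c ^ P, fun x y hx hy hΦx hΦy => ?_⟩
    rcases eq_or_ne (Φ₁ x) 0 with h0 | h0
    · rw [hzero Φ₁ hq₁ x (hx.trans hκr) h0, zero_mul, ENNReal.zero_rpow_of_pos hP]
      exact zero_le
    rcases eq_or_ne (Φ₂ y) 0 with h0' | h0'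
    · rw [hzero Φ₂ hq₂ y (hy.trans hκr) h0', mul_zero, ENNReal.zero_rpow_of_pos hP]
      exact zero_le
    rw [← hcP]
    rcases le_total (Φ₁ x) (Φ₂ y) with h | h
    · refine (mul_rpow_le_of_dilation h₁ h₂ hP he hinv (fun l hl => hd₂ y l (hy.trans hκ₂) hl) h0
        h (hΦy.trans hκr)).trans ?_
      gcongr
      exact le_add_self
    · rw [mul_comm x y]
      refine (mul_rpow_le_of_dilation h₂ h₁ hP he (fun s hs => by
        rw [mul_comm]; exact hinv s hs) (fun l hl => hd₁ x l (hx.trans hκ₁) hl) h0'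
        h (hΦx.trans hκr)).trans ?_
      gcongr
      exact le_self_add

end Pointwise

/-! ## The mixed norm estimate -/

section Mixed

set_option linter.unusedSectionVars false

/-- Jensen for the concave power θ with respect to the measure f dμ of mass at most one, in the
guise of the comparison of L^θ and L^1. -/
theorem lintegral_mul_rpow_le {Z : Type*} [MeasurableSpace Z] {μ : Measure Z} {f g : Z → ℝ≥0∞}
    (hf : Measurable f) (hg : Measurable g) (hf1 : ∫⁻ z, f z ∂μ ≤ 1) {θ : ℝ} (h0 : 0 ≤ θ)
    (h1 : θ ≤ 1) : ∫⁻ z, f z * g z ^ θ ∂μ ≤ (∫⁻ z, f z * g z ∂μ) ^ θ := by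
  rcases h0.eq_or_lt with rfl | h0
  · simpa using hf1
  have hν : μ.withDensity f Set.univ ≤ 1 := by simpa using hf1
  have h2 := eLpNorm'_le_eLpNorm'_mul_rpow_measure_univ (μ := μ.withDensity f) h0 h1
    hg.aestronglyMeasurable
  have h3 := lintegral_withDensity_eq_lintegral_mul μ hf (hg.pow_const θ)
  have h4 := lintegral_withDensity_eq_lintegral_mul μ hf hg
  simp only [Pi.mul_apply] at h3 h4
  rw [← h3, ← h4]
  have h5 : eLpNorm' g θ (μ.withDensity f) ≤ eLpNorm' g 1 (μ.withDensity f) := by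
    refine h2.trans ?_
    refine mul_le_of_le_one_right zero_le (ENNReal.rpow_le_one hν ?_)
    rw [div_one, sub_nonneg]
    exact (one_le_div h0).2 h1
  have h6 := ENNReal.rpow_le_rpow h5 h0.le
  simp only [eLpNorm', enorm_eq_self, ENNReal.rpow_one, div_one] at h6
  rwa [← ENNReal.rpow_mul, one_div_mul_cancel h0.ne', ENNReal.rpow_one] at h6

variable {ι : Type*} [Fintype ι]

local notation "𝔼" => EuclideanSpace ℝ ι

local notation "ℙ" => EuclideanSpace ℝ (ι ⊕ ι)

/-! ### Correlations and their total mass -/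

section Correlation

variable {f₁ f₂ : EuclideanSpace ℝ ι → EuclideanSpace ℝ ι → ℝ≥0∞}
  {g₁ g₂ : EuclideanSpace ℝ ι → ℝ≥0∞}

/-- The correlation of two functions in the first variable. -/
def corr (f₁ f₂ : EuclideanSpace ℝ ι → EuclideanSpace ℝ ι → ℝ≥0∞)
    (ξ η y : EuclideanSpace ℝ ι) : ℝ≥0∞ :=
  ∫⁻ x, f₁ x ξ * f₂ (x + y) (ξ - η)

/-- The correlation of two products of functions in both variables. -/
def corrTwo (f₁ f₂ : EuclideanSpace ℝ ι → EuclideanSpace ℝ ι → ℝ≥0∞)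
    (g₁ g₂ : EuclideanSpace ℝ ι → ℝ≥0∞) (η y : EuclideanSpace ℝ ι) : ℝ≥0∞ :=
  ∫⁻ ξ, g₁ ξ * (g₂ (ξ - η) * corr f₁ f₂ ξ η y)

theorem measurable_corr (h₁ : Measurable (Function.uncurry f₁))
    (h₂ : Measurable (Function.uncurry f₂)) :
    Measurable fun z : 𝔼 × 𝔼 × 𝔼 => corr f₁ f₂ z.1 z.2.1 z.2.2 := by
  have e1 := h₁.comp (show Measurable fun z : (𝔼 × 𝔼 × 𝔼) × 𝔼 => (z.2, z.1.1) by fun_prop)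
  have e2 := h₂.comp (show Measurable fun z : (𝔼 × 𝔼 × 𝔼) × 𝔼 =>
    (z.2 + z.1.2.2, z.1.1 - z.1.2.1) by fun_prop)
  exact Measurable.lintegral_prod_right' (e1.mul e2)

theorem measurable_corrTwo (h₁ : Measurable (Function.uncurry f₁))
    (h₂ : Measurable (Function.uncurry f₂)) (hg₁ : Measurable g₁) (hg₂ : Measurable g₂) :
    Measurable fun z : 𝔼 × 𝔼 => corrTwo f₁ f₂ g₁ g₂ z.1 z.2 := by
  have e0 := hg₁.comp (show Measurable fun z : (𝔼 × 𝔼) × 𝔼 => z.2 by fun_prop)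
  have e1 := hg₂.comp (show Measurable fun z : (𝔼 × 𝔼) × 𝔼 => z.2 - z.1.1 by fun_prop)
  have e2 := (measurable_corr h₁ h₂).comp
    (show Measurable fun z : (𝔼 × 𝔼) × 𝔼 => (z.2, z.1.1, z.1.2) by fun_prop)
  exact Measurable.lintegral_prod_right' (e0.mul (e1.mul e2))

theorem lintegral_corr_le (h₁ : Measurable (Function.uncurry f₁))
    (h₂ : Measurable (Function.uncurry f₂)) (hi₁ : ∀ ξ, ∫⁻ x, f₁ x ξ ≤ 1)
    (hi₂ : ∀ ξ, ∫⁻ x, f₂ x ξ ≤ 1) (ξ η : 𝔼) : ∫⁻ y, corr f₁ f₂ ξ η y ≤ 1 := by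
  have e1 := h₁.comp (show Measurable fun z : 𝔼 × 𝔼 => (z.2, ξ) by fun_prop)
  have e2 := h₂.comp (show Measurable fun z : 𝔼 × 𝔼 => (z.2 + z.1, ξ - η) by fun_prop)
  have e3 : AEMeasurable (Function.uncurry fun y x => f₁ x ξ * f₂ (x + y) (ξ - η)) :=
    (e1.mul e2).aemeasurable
  simp only [corr]
  rw [lintegral_lintegral_swap e3]
  calc ∫⁻ x, ∫⁻ y, f₁ x ξ * f₂ (x + y) (ξ - η) ≤ ∫⁻ x, f₁ x ξ := by
        refine lintegral_mono fun x => ?_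
        have e4 : Measurable fun y => f₂ (x + y) (ξ - η) :=
          (measurable_slice h₂ (ξ - η)).comp (measurable_const.add measurable_id)
        rw [lintegral_const_mul _ e4, lintegral_add_left_eq_self (fun y => f₂ y (ξ - η)) x]
        exact (mul_le_mul_right (hi₂ _) _).trans (mul_one _).le
    _ ≤ 1 := hi₁ ξ

/-- By Fubini and translation invariance the four unit masses are used in succession: y, x, η, ξ. -/
theorem lintegral_corrTwo_le (h₁ : Measurable (Function.uncurry f₁))
    (h₂ : Measurable (Function.uncurry f₂)) (hg₁ : Measurable g₁) (hg₂ : Measurable g₂)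
    (hi₁ : ∀ ξ, ∫⁻ x, f₁ x ξ ≤ 1) (hi₂ : ∀ ξ, ∫⁻ x, f₂ x ξ ≤ 1) (hj₁ : ∫⁻ ξ, g₁ ξ ≤ 1)
    (hj₂ : ∫⁻ ξ, g₂ ξ ≤ 1) : ∫⁻ η, ∫⁻ y, corrTwo f₁ f₂ g₁ g₂ η y ≤ 1 := by
  have hinner : ∀ η : 𝔼, ∫⁻ y, corrTwo f₁ f₂ g₁ g₂ η y ≤ ∫⁻ ξ, g₁ ξ * g₂ (ξ - η) := by
    intro η
    have e0 := hg₁.comp (show Measurable fun z : 𝔼 × 𝔼 => z.2 by fun_prop)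
    have e1 := hg₂.comp (show Measurable fun z : 𝔼 × 𝔼 => z.2 - η by fun_prop)
    have e2 := (measurable_corr h₁ h₂).comp
      (show Measurable fun z : 𝔼 × 𝔼 => (z.2, η, z.1) by fun_prop)
    have e3 : AEMeasurable (Function.uncurry fun y ξ => g₁ ξ * (g₂ (ξ - η) * corr f₁ f₂ ξ η y)) :=
      (e0.mul (e1.mul e2)).aemeasurable
    simp only [corrTwo]
    rw [lintegral_lintegral_swap e3]
    refine lintegral_mono fun ξ => ?_
    have e4 : Measurable fun y => corr f₁ f₂ ξ η y :=
      (measurable_corr h₁ h₂).comp (show Measurable fun y : 𝔼 => (ξ, η, y) by fun_prop)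
    rw [lintegral_const_mul _ (e4.const_mul _), lintegral_const_mul _ e4]
    gcongr
    exact (mul_le_mul_right (lintegral_corr_le h₁ h₂ hi₁ hi₂ ξ η) _).trans (mul_one _).le
  have e0 := hg₁.comp (show Measurable fun z : 𝔼 × 𝔼 => z.2 by fun_prop)
  have e1 := hg₂.comp (show Measurable fun z : 𝔼 × 𝔼 => z.2 - z.1 by fun_prop)
  have e2 : AEMeasurable (Function.uncurry fun η ξ => g₁ ξ * g₂ (ξ - η)) :=
    (e0.mul e1).aemeasurable
  calc _ ≤ ∫⁻ η, ∫⁻ ξ, g₁ ξ * g₂ (ξ - η) := lintegral_mono hinner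
    _ = ∫⁻ ξ, ∫⁻ η, g₁ ξ * g₂ (ξ - η) := lintegral_lintegral_swap e2
    _ ≤ ∫⁻ ξ, g₁ ξ := by
        refine lintegral_mono fun ξ => ?_
        have e4 : Measurable fun η => g₂ (ξ - η) := hg₂.comp (measurable_const.sub measurable_id)
        rw [lintegral_const_mul _ e4, lintegral_sub_left_eq_self g₂ ξ]
        exact (mul_le_mul_right hj₂ _).trans (mul_one _).le
    _ ≤ 1 := hj₁

end Correlation

variable {Φ₁ Φ₂ Ψ₁ Ψ₂ : ℝ≥0∞ → ℝ≥0∞} {κ : ℝ≥0}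

/-- After Jensen both summands give the same power of ∫ f g t, whence the factor 2. -/
theorem lintegral_mul_rpow_add_le {Z : Type*} [MeasurableSpace Z] {μ : Measure Z}
    {f g t : Z → ℝ≥0∞} (hf : Measurable f) (hg : Measurable g) (ht : Measurable t)
    (hf1 : ∫⁻ z, f z ∂μ ≤ 1) (hg1 : ∫⁻ z, g z ∂μ ≤ 1) {θ : ℝ} (h0 : 0 ≤ θ) (h1 : θ ≤ 1) :
    ∫⁻ z, (f z * g z ^ θ + g z * f z ^ θ) * t z ^ θ ∂μ ≤
      2 * (∫⁻ z, f z * (g z * t z) ∂μ) ^ θ := by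
  have e : ∀ z, (f z * g z ^ θ + g z * f z ^ θ) * t z ^ θ =
      f z * (g z * t z) ^ θ + g z * (f z * t z) ^ θ := fun z => by
    rw [ENNReal.mul_rpow_of_nonneg _ _ h0, ENNReal.mul_rpow_of_nonneg _ _ h0]
    ring
  simp only [e]
  have hm : Measurable fun z => f z * (g z * t z) ^ θ := hf.mul ((hg.mul ht).pow_const θ)
  rw [lintegral_add_left hm, two_mul]
  refine add_le_add (lintegral_mul_rpow_le hf (hg.mul ht) hf1 h0 h1) ?_
  refine (lintegral_mul_rpow_le hg (hf.mul ht) hg1 h0 h1).trans (le_of_eq ?_)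
  congr 1
  refine lintegral_congr fun z => ?_
  simp only [Pi.mul_apply]
  ring

/-- The inner integral of the product of two envelopes. -/
theorem lintegral_envelope_le {u₁ u₂ : 𝔼 → 𝔼 → ℝ≥0∞} {H₁ H₂ : 𝔼 → ℝ≥0∞} (hΦ₁ : IsYoung Φ₁)
    (hΦ₂ : IsYoung Φ₂) (hΨ₁ : IsYoung Ψ₁) (hΨ₂ : IsYoung Ψ₂)
    (h₁ : IsEnvelope Φ₁ Ψ₁ κ u₁ H₁) (h₂ : IsEnvelope Φ₂ Ψ₂ κ u₂ H₂) {P θ : ℝ} (hP : 0 ≤ P)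
    (h0 : 0 ≤ θ) (h1 : θ ≤ 1) {C D : ℝ≥0}
    (hC : ∀ x y : ℝ≥0∞, x ≤ κ → y ≤ κ → Φ₁ x ≤ κ → Φ₂ y ≤ κ →
      (x * y) ^ P ≤ C * (Φ₁ x * Φ₂ y ^ θ + Φ₂ y * Φ₁ x ^ θ))
    (hD : ∀ x y : ℝ≥0∞, x ≤ κ → y ≤ κ → Ψ₁ x ≤ κ → Ψ₂ y ≤ κ →
      (x * y) ^ P ≤ D * (Ψ₁ x * Ψ₂ y ^ θ + Ψ₂ y * Ψ₁ x ^ θ)) (η y : 𝔼) :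
    ∫⁻ ξ, ∫⁻ x, ((H₁ ξ * u₁ x ξ) * (H₂ (ξ - η) * u₂ (x + y) (ξ - η))) ^ P ≤
      4 * C * D * corrTwo (fun x ξ => Φ₁ (u₁ x ξ)) (fun x ξ => Φ₂ (u₂ x ξ))
        (fun ξ => Ψ₁ (H₁ ξ)) (fun ξ => Ψ₂ (H₂ ξ)) η y ^ θ := by
  set f₁ : 𝔼 → 𝔼 → ℝ≥0∞ := fun x ξ => Φ₁ (u₁ x ξ) with hf₁
  set f₂ : 𝔼 → 𝔼 → ℝ≥0∞ := fun x ξ => Φ₂ (u₂ x ξ) with hf₂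
  set g₁ : 𝔼 → ℝ≥0∞ := fun ξ => Ψ₁ (H₁ ξ) with hg₁
  set g₂ : 𝔼 → ℝ≥0∞ := fun ξ => Ψ₂ (H₂ ξ) with hg₂
  have mf₁ : Measurable (Function.uncurry f₁) := hΦ₁.measurable.comp h₁.meas_u
  have mf₂ : Measurable (Function.uncurry f₂) := hΦ₂.measurable.comp h₂.meas_u
  have mg₁ : Measurable g₁ := hΨ₁.measurable.comp h₁.meas_H
  have mg₂ : Measurable g₂ := hΨ₂.measurable.comp h₂.meas_H
  -- The pointwise inequality is applied separately to the u and to the H factors. Jensen in x costs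
  -- 2, and the resulting power of `corr` enters Jensen in ξ as the extra factor, which costs
  -- another 2.
  have hinner : ∀ ξ, ∫⁻ x, ((H₁ ξ * u₁ x ξ) * (H₂ (ξ - η) * u₂ (x + y) (ξ - η))) ^ P ≤
      (2 * C * D) * ((g₁ ξ * g₂ (ξ - η) ^ θ + g₂ (ξ - η) * g₁ ξ ^ θ) *
        corr f₁ f₂ ξ η y ^ θ) := by
    intro ξ
    have mfs₁ : Measurable fun x => f₁ x ξ := measurable_slice mf₁ ξ
    have mfs₂ : Measurable fun x => f₂ (x + y) (ξ - η) :=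
      (measurable_slice mf₂ (ξ - η)).comp (measurable_id.add_const y)
    have e1 : ∀ x, ((H₁ ξ * u₁ x ξ) * (H₂ (ξ - η) * u₂ (x + y) (ξ - η))) ^ P ≤
        (D * (g₁ ξ * g₂ (ξ - η) ^ θ + g₂ (ξ - η) * g₁ ξ ^ θ)) *
          (C * (f₁ x ξ * f₂ (x + y) (ξ - η) ^ θ + f₂ (x + y) (ξ - η) * f₁ x ξ ^ θ)) := by
      intro x
      rw [mul_mul_mul_comm, ENNReal.mul_rpow_of_nonneg _ _ hP]
      exact mul_le_mul' (hD _ _ (h₁.H_le ξ) (h₂.H_le _) (h₁.young_H_le ξ) (h₂.young_H_le _))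
        (hC _ _ (h₁.u_le _ _) (h₂.u_le _ _) (h₁.young_u_le _ _) (h₂.young_u_le _ _))
    have e2 : ∫⁻ x, (f₁ x ξ * f₂ (x + y) (ξ - η) ^ θ + f₂ (x + y) (ξ - η) * f₁ x ξ ^ θ) ≤
        2 * corr f₁ f₂ ξ η y ^ θ := by
      have hi : ∫⁻ x, f₂ (x + y) (ξ - η) ≤ 1 := by
        rw [lintegral_add_right_eq_self (fun x => f₂ x (ξ - η)) y]
        exact h₂.lintegral_u_le _
      have := lintegral_mul_rpow_add_le (t := fun _ => 1) mfs₁ mfs₂ measurable_const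
        (h₁.lintegral_u_le ξ) hi h0 h1
      simp only [ENNReal.one_rpow, mul_one] at this
      exact this
    have ms : Measurable fun x =>
        f₁ x ξ * f₂ (x + y) (ξ - η) ^ θ + f₂ (x + y) (ξ - η) * f₁ x ξ ^ θ :=
      (mfs₁.mul (mfs₂.pow_const θ)).add (mfs₂.mul (mfs₁.pow_const θ))
    refine (lintegral_mono e1).trans ?_
    rw [lintegral_const_mul _ (ms.const_mul _), lintegral_const_mul _ ms]
    calc _ ≤ (D * (g₁ ξ * g₂ (ξ - η) ^ θ + g₂ (ξ - η) * g₁ ξ ^ θ)) *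
          (C * (2 * corr f₁ f₂ ξ η y ^ θ)) := by gcongr
      _ = _ := by ring
  have mc : Measurable fun ξ => corr f₁ f₂ ξ η y :=
    (measurable_corr mf₁ mf₂).comp (show Measurable fun ξ : 𝔼 => (ξ, η, y) by fun_prop)
  have mgs : Measurable fun ξ => g₂ (ξ - η) := mg₂.comp (measurable_id.sub_const η)
  have hj : ∫⁻ ξ, g₂ (ξ - η) ≤ 1 := by
    rw [lintegral_sub_right_eq_self g₂ η]
    exact h₂.lintegral_H_le
  refine (lintegral_mono hinner).trans ?_
  have ms : Measurable fun ξ => (g₁ ξ * g₂ (ξ - η) ^ θ + g₂ (ξ - η) * g₁ ξ ^ θ) *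
      corr f₁ f₂ ξ η y ^ θ :=
    ((mg₁.mul (mgs.pow_const θ)).add (mgs.mul (mg₁.pow_const θ))).mul (mc.pow_const θ)
  rw [lintegral_const_mul _ ms]
  calc _ ≤ (2 * C * D) * (2 * corrTwo f₁ f₂ g₁ g₂ η y ^ θ) := by
        gcongr
        exact lintegral_mul_rpow_add_le mg₁ mgs mc h₁.lintegral_H_le hj h0 h1
    _ = (2 * 2) * C * D * corrTwo f₁ f₂ g₁ g₂ η y ^ θ := by ring
    _ = _ := by norm_num

variable [DecidableEq ι]

/-- The product of two functions on phase space at the points that correspond to each other under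
the Wigner transform. -/
def wignerProd (A : Matrix ι ι ℝ) (b₁ b₂ : EuclideanSpace ℝ ι → EuclideanSpace ℝ ι → ℝ≥0∞)
    (X Ξ : EuclideanSpace ℝ (ι ⊕ ι)) : ℝ≥0∞ :=
  b₁ (fstP X - act A (sndP Ξ)) (sndP X + act (1 - A.transpose) (fstP Ξ)) *
    b₂ (fstP X + act (1 - A) (sndP Ξ)) (sndP X - act A.transpose (fstP Ξ))

theorem measurable_wignerProd (A : Matrix ι ι ℝ) {b₁ b₂ : 𝔼 → 𝔼 → ℝ≥0∞}
    (h₁ : Measurable (Function.uncurry b₁)) (h₂ : Measurable (Function.uncurry b₂)) :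
    Measurable (Function.uncurry (wignerProd A b₁ b₂)) := by
  have e1 := h₁.comp (show Measurable fun z : ℙ × ℙ => (fstP z.1 - actL A (sndP z.2),
    sndP z.1 + actL (1 - A.transpose) (fstP z.2)) by fun_prop)
  have e2 := h₂.comp (show Measurable fun z : ℙ × ℙ => (fstP z.1 + actL (1 - A) (sndP z.2),
    sndP z.1 - actL A.transpose (fstP z.2)) by fun_prop)
  exact e1.mul e2

/-- The norm of `L^{p,q}` on the phase space of `ℝ^{2d}`. -/
def mixedNorm (p q : ℝ≥0∞) (F : EuclideanSpace ℝ (ι ⊕ ι) → EuclideanSpace ℝ (ι ⊕ ι) → ℝ≥0∞) :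
    ℝ≥0∞ :=
  eLpNorm (fun Ξ => eLpNorm (fun X => F X Ξ) p volume) q volume

/-- Translation of x by Ay and of ξ by (1-A*)η frees the first factor of (η,y) and shifts the second
by (y,-η), so that A disappears from the estimate. -/
theorem lintegral_wignerProd_rpow (A : Matrix ι ι ℝ) {b₁ b₂ : 𝔼 → 𝔼 → ℝ≥0∞}
    (h₁ : Measurable (Function.uncurry b₁)) (h₂ : Measurable (Function.uncurry b₂)) (P : ℝ)
    (Ξ : ℙ) : ∫⁻ X, wignerProd A b₁ b₂ X Ξ ^ P =
      ∫⁻ ξ, ∫⁻ x, (b₁ x ξ * b₂ (x + sndP Ξ) (ξ - fstP Ξ)) ^ P := by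
  set η := fstP Ξ
  set y := sndP Ξ
  have hm : Measurable fun z : 𝔼 × 𝔼 => wignerProd A b₁ b₂ (pair z.1 z.2) Ξ ^ P := by
    have := (measurable_wignerProd A h₁ h₂).comp
      ((continuous_pair (ι := ι)).measurable.prodMk (measurable_const (a := Ξ)))
    exact this.pow_const P
  rw [← (measurePreserving_pair ι).lintegral_comp_emb (measurableEmbedding_pair ι)]
  have e1 : ∫⁻ z : 𝔼 × 𝔼, wignerProd A b₁ b₂ (pair z.1 z.2) Ξ ^ P =
      ∫⁻ ξ : 𝔼, ∫⁻ x : 𝔼, wignerProd A b₁ b₂ (pair x ξ) Ξ ^ P :=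
    lintegral_prod_symm (μ := (volume : Measure 𝔼)) (ν := (volume : Measure 𝔼)) _ hm.aemeasurable
  rw [e1, ← lintegral_sub_right_eq_self _ (act (1 - A.transpose) η)]
  refine lintegral_congr fun ξ => ?_
  rw [← lintegral_add_right_eq_self _ (act A y)]
  refine lintegral_congr fun x => ?_
  simp only [wignerProd, fstP_pair, sndP_pair, act_one_sub]
  congr 3
  · abel
  · change ξ - (η - act A.transpose η) + (η - act A.transpose η) = ξ
    abel
  · change x + act A y + (y - act A y) = x + y
    abel
  · change ξ - (η - act A.transpose η) - act A.transpose η = ξ - η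
    abel

theorem lintegral_eq_lintegral_lintegral_pair {N : 𝔼 → 𝔼 → ℝ≥0∞}
    (hN : Measurable (Function.uncurry N)) :
    ∫⁻ Ξ : ℙ, N (fstP Ξ) (sndP Ξ) = ∫⁻ η, ∫⁻ y, N η y := by
  rw [← (measurePreserving_pair ι).lintegral_comp_emb (measurableEmbedding_pair ι)]
  exact lintegral_prod (μ := (volume : Measure 𝔼)) (ν := (volume : Measure 𝔼))
    (fun z : 𝔼 × 𝔼 => N z.1 z.2) hN.aemeasurable

/-- The inner norm is at most (4CD)^{1/p} N^{1/q} because θ/p = 1/q. The q-th power of N^{1/q} is N,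
of mass at most one; for q = ∞ the power is 1. -/
theorem mixedNorm_envelope_le (A : Matrix ι ι ℝ) {p q : ℝ≥0∞} (hp1 : 1 ≤ p) (hp : p ≠ ∞)
    (hpq : p ≤ q) {u₁ u₂ : 𝔼 → 𝔼 → ℝ≥0∞} {H₁ H₂ : 𝔼 → ℝ≥0∞} (hΦ₁ : IsYoung Φ₁)
    (hΦ₂ : IsYoung Φ₂) (hΨ₁ : IsYoung Ψ₁) (hΨ₂ : IsYoung Ψ₂)
    (h₁ : IsEnvelope Φ₁ Ψ₁ κ u₁ H₁) (h₂ : IsEnvelope Φ₂ Ψ₂ κ u₂ H₂) {C D : ℝ≥0}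
    (hC : ∀ x y : ℝ≥0∞, x ≤ κ → y ≤ κ → Φ₁ x ≤ κ → Φ₂ y ≤ κ →
      (x * y) ^ p.toReal ≤ C * (Φ₁ x * Φ₂ y ^ (p.toReal * q⁻¹.toReal) +
        Φ₂ y * Φ₁ x ^ (p.toReal * q⁻¹.toReal)))
    (hD : ∀ x y : ℝ≥0∞, x ≤ κ → y ≤ κ → Ψ₁ x ≤ κ → Ψ₂ y ≤ κ →
      (x * y) ^ p.toReal ≤ D * (Ψ₁ x * Ψ₂ y ^ (p.toReal * q⁻¹.toReal) +
        Ψ₂ y * Ψ₁ x ^ (p.toReal * q⁻¹.toReal))) :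
    mixedNorm p q (wignerProd A (fun x ξ => H₁ ξ * u₁ x ξ) (fun x ξ => H₂ ξ * u₂ x ξ)) ≤
      (4 * C * D : ℝ≥0∞) ^ (1 / p.toReal) := by
  have hp0 : p ≠ 0 := (zero_lt_one.trans_le hp1).ne'
  have hq0 : q ≠ 0 := ((zero_lt_one.trans_le hp1).trans_le hpq).ne'
  set P := p.toReal with hP_def
  set θ := P * q⁻¹.toReal with hθ_def
  have hP : 0 < P := ENNReal.toReal_pos hp0 hp
  have hθ0 : 0 ≤ θ := by positivity
  have hθ1 : θ ≤ 1 := by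
    rw [hθ_def, hP_def, ← ENNReal.toReal_mul, ← ENNReal.toReal_one]
    refine ENNReal.toReal_mono ENNReal.one_ne_top ?_
    rw [← div_eq_mul_inv]
    exact ENNReal.div_le_of_le_mul (by rwa [one_mul])
  have m₁ : Measurable (Function.uncurry fun x ξ => H₁ ξ * u₁ x ξ) :=
    (h₁.meas_H.comp measurable_snd).mul h₁.meas_u
  have m₂ : Measurable (Function.uncurry fun x ξ => H₂ ξ * u₂ x ξ) :=
    (h₂.meas_H.comp measurable_snd).mul h₂.meas_u
  set N : 𝔼 → 𝔼 → ℝ≥0∞ := corrTwo (fun x ξ => Φ₁ (u₁ x ξ)) (fun x ξ => Φ₂ (u₂ x ξ))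
        (fun ξ => Ψ₁ (H₁ ξ)) (fun ξ => Ψ₂ (H₂ ξ)) with hN_def
  have mf₁ : Measurable (Function.uncurry fun x ξ => Φ₁ (u₁ x ξ)) :=
    hΦ₁.measurable.comp h₁.meas_u
  have mf₂ : Measurable (Function.uncurry fun x ξ => Φ₂ (u₂ x ξ)) :=
    hΦ₂.measurable.comp h₂.meas_u
  have mg₁ : Measurable fun ξ => Ψ₁ (H₁ ξ) := hΨ₁.measurable.comp h₁.meas_H
  have mg₂ : Measurable fun ξ => Ψ₂ (H₂ ξ) := hΨ₂.measurable.comp h₂.meas_H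
  have hN : ∫⁻ Ξ : ℙ, N (fstP Ξ) (sndP Ξ) ≤ 1 := by
    rw [lintegral_eq_lintegral_lintegral_pair (measurable_corrTwo mf₁ mf₂ mg₁ mg₂)]
    exact lintegral_corrTwo_le mf₁ mf₂ mg₁ mg₂ h₁.lintegral_u_le h₂.lintegral_u_le
      h₁.lintegral_H_le h₂.lintegral_H_le
  have hinner : ∀ Ξ : ℙ, eLpNorm (fun X => wignerProd A (fun x ξ => H₁ ξ * u₁ x ξ)
      (fun x ξ => H₂ ξ * u₂ x ξ) X Ξ) p volume ≤
      (4 * C * D : ℝ≥0∞) ^ (1 / P) * N (fstP Ξ) (sndP Ξ) ^ q⁻¹.toReal := by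
    intro Ξ
    rw [eLpNorm_eq_lintegral_rpow_enorm_toReal hp0 hp]
    simp only [enorm_eq_self]
    rw [← hP_def, lintegral_wignerProd_rpow A m₁ m₂ P Ξ]
    have h3 := lintegral_envelope_le hΦ₁ hΦ₂ hΨ₁ hΨ₂ h₁ h₂ hP.le hθ0 hθ1 hC hD
      (fstP Ξ) (sndP Ξ)
    refine (ENNReal.rpow_le_rpow h3 (by positivity)).trans (le_of_eq ?_)
    rw [ENNReal.mul_rpow_of_nonneg _ _ (by positivity), ← ENNReal.rpow_mul]
    congr 2
    rw [hθ_def]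
    field_simp
  rw [mixedNorm]
  rcases eq_or_ne q ∞ with hq | hq
  · subst hq
    rw [eLpNorm_exponent_top]
    refine eLpNormEssSup_le_of_ae_enorm_bound (Eventually.of_forall fun Ξ => ?_)
    rw [enorm_eq_self]
    simpa using hinner Ξ
  · set Q := q.toReal with hQ_def
    have hQ : 0 < Q := ENNReal.toReal_pos hq0 hq
    rw [eLpNorm_eq_lintegral_rpow_enorm_toReal hq0 hq]
    simp only [enorm_eq_self]
    rw [← hQ_def]
    set B : ℝ≥0∞ := (4 * C * D : ℝ≥0∞) ^ (1 / P) with hB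
    have hBtop : B ^ Q ≠ ∞ := by
      refine ENNReal.rpow_ne_top_of_nonneg hQ.le (ENNReal.rpow_ne_top_of_nonneg (by positivity) ?_)
      finiteness
    calc _ ≤ (∫⁻ Ξ : ℙ, B ^ Q * N (fstP Ξ) (sndP Ξ)) ^ (1 / Q) := by
          refine ENNReal.rpow_le_rpow (lintegral_mono fun Ξ => ?_) (by positivity)
          refine (ENNReal.rpow_le_rpow (hinner Ξ) hQ.le).trans (le_of_eq ?_)
          rw [ENNReal.mul_rpow_of_nonneg _ _ hQ.le, ← ENNReal.rpow_mul (N (fstP Ξ) (sndP Ξ)),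
            ENNReal.toReal_inv,
            ← hQ_def, inv_mul_cancel₀ hQ.ne', ENNReal.rpow_one]
      _ ≤ (B ^ Q * 1) ^ (1 / Q) := by
          rw [lintegral_const_mul' _ _ hBtop]
          gcongr
      _ = B := by
          rw [mul_one, ← ENNReal.rpow_mul, mul_one_div_cancel hQ.ne', ENNReal.rpow_one]

theorem mixedNorm_top_envelope_le (A : Matrix ι ι ℝ) {u₁ u₂ : 𝔼 → 𝔼 → ℝ≥0∞}
    {H₁ H₂ : 𝔼 → ℝ≥0∞} (h₁ : IsEnvelope Φ₁ Ψ₁ κ u₁ H₁) (h₂ : IsEnvelope Φ₂ Ψ₂ κ u₂ H₂) :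
    mixedNorm ∞ ∞ (wignerProd A (fun x ξ => H₁ ξ * u₁ x ξ) (fun x ξ => H₂ ξ * u₂ x ξ)) ≤
      (κ * κ) * (κ * κ) := by
  rw [mixedNorm, eLpNorm_exponent_top]
  refine eLpNormEssSup_le_of_ae_enorm_bound (Eventually.of_forall fun Ξ => ?_)
  rw [enorm_eq_self, eLpNorm_exponent_top]
  refine eLpNormEssSup_le_of_ae_enorm_bound (Eventually.of_forall fun X => ?_)
  rw [enorm_eq_self]
  exact mul_le_mul' (mul_le_mul' (h₁.H_le _) (h₁.u_le _ _)) (mul_le_mul' (h₂.H_le _) (h₂.u_le _ _))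

end Mixed

/-! ## Bilinear estimates in mixed Orlicz norms -/

section Bilinear

set_option linter.unusedSectionVars false

variable {ι : Type*} [Fintype ι]

local notation "𝔼" => EuclideanSpace ℝ ι

local notation "ℙ" => EuclideanSpace ℝ (ι ⊕ ι)

theorem mixedNorm_const_mul_le {p q : ℝ≥0∞} {c : ℝ≥0∞} (hc : c ≠ ∞) {F G : ℙ → ℙ → ℝ≥0∞}
    (h : ∀ X Ξ, F X Ξ ≤ c * G X Ξ) : mixedNorm p q F ≤ c * mixedNorm p q G := by
  lift c to ℝ≥0 using hc
  refine eLpNorm_le_mul_eLpNorm_of_ae_le_mul' (Eventually.of_forall fun Ξ => ?_) q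
  simp only [enorm_eq_self]
  refine eLpNorm_le_mul_eLpNorm_of_ae_le_mul' (Eventually.of_forall fun X => ?_) p
  simpa only [enorm_eq_self] using h X Ξ

theorem measurable_eLpNorm_slice {p : ℝ≥0∞} (hp0 : p ≠ 0) (hp : p ≠ ∞) {F : ℙ → ℙ → ℝ≥0∞}
    (hF : Measurable (Function.uncurry F)) :
    Measurable fun Ξ => eLpNorm (fun X => F X Ξ) p volume := by
  simp only [eLpNorm_eq_lintegral_rpow_enorm_toReal hp0 hp, enorm_eq_self]
  have h : Measurable fun Ξ => ∫⁻ X, F X Ξ ^ p.toReal :=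
    Measurable.lintegral_prod_left' (f := fun z : ℙ × ℙ => F z.1 z.2 ^ p.toReal) (hF.pow_const _)
  exact h.pow_const _

/-- Minkowski twice. If p = ∞ then also q = ∞, where the essential supremum is subadditive without
measurability of the inner norm. -/
theorem mixedNorm_add_le {p q : ℝ≥0∞} (hp1 : 1 ≤ p) (hpq : p ≤ q) {F G : ℙ → ℙ → ℝ≥0∞}
    (hF : Measurable (Function.uncurry F)) (hG : Measurable (Function.uncurry G)) :
    mixedNorm p q (fun X Ξ => F X Ξ + G X Ξ) ≤ mixedNorm p q F + mixedNorm p q G := by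
  have hinner : ∀ Ξ, eLpNorm (fun X => F X Ξ + G X Ξ) p volume ≤
      eLpNorm (fun X => F X Ξ) p volume + eLpNorm (fun X => G X Ξ) p volume := fun Ξ =>
    eLpNorm_add_le (hF.comp measurable_prodMk_right).aestronglyMeasurable
      (hG.comp measurable_prodMk_right).aestronglyMeasurable hp1
  have h1 : mixedNorm p q (fun X Ξ => F X Ξ + G X Ξ) ≤
      eLpNorm (fun Ξ => eLpNorm (fun X => F X Ξ) p volume + eLpNorm (fun X => G X Ξ) p volume)
        q volume :=
    eLpNorm_mono_enorm fun Ξ => by simpa only [enorm_eq_self] using hinner Ξ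
  refine h1.trans ?_
  rcases eq_or_ne p ∞ with hp | hp
  · have hq : q = ∞ := top_le_iff.1 (hp ▸ hpq)
    subst hq
    simp only [mixedNorm, eLpNorm_exponent_top]
    exact eLpNormEssSup_add_le
  · have hp0 : p ≠ 0 := (zero_lt_one.trans_le hp1).ne'
    exact eLpNorm_add_le (measurable_eLpNorm_slice hp0 hp hF).aestronglyMeasurable
      (measurable_eLpNorm_slice hp0 hp hG).aestronglyMeasurable (hp1.trans hpq)

theorem measurable_expAverage {r : ℝ} {a : 𝔼 → 𝔼 → ℝ≥0∞} (ha : Measurable (Function.uncurry a)) :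
    Measurable (Function.uncurry (expAverage r a)) := by
  have h := (continuous_expKernel (ι := ι) r).measurable
  have e1 : Measurable fun z : (𝔼 × 𝔼) × 𝔼 => ∫⁻ x', expKernel r (x' - z.1.1) * a x' z.2 := by
    have h1 := h.comp (show Measurable fun z : ((𝔼 × 𝔼) × 𝔼) × 𝔼 => z.2 - z.1.1.1 by fun_prop)
    have h2 := ha.comp (show Measurable fun z : ((𝔼 × 𝔼) × 𝔼) × 𝔼 => (z.2, z.1.2) by fun_prop)
    exact Measurable.lintegral_prod_right' (h1.mul h2)
  have e2 := h.comp (show Measurable fun z : (𝔼 × 𝔼) × 𝔼 => z.2 - z.1.2 by fun_prop)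
  exact Measurable.lintegral_prod_right' (e2.mul e1)

theorem expAverage_const_mul {r : ℝ} {c : ℝ≥0∞} (hc : c ≠ ∞) (a : 𝔼 → 𝔼 → ℝ≥0∞) (x ξ : 𝔼) :
    expAverage r (fun x ξ => c * a x ξ) x ξ = c * expAverage r a x ξ := by
  simp only [expAverage, mul_left_comm _ c, lintegral_const_mul' _ _ hc]

/-- The norm of the mixed Orlicz space `L^{Φ,Ψ}`. -/
def luxMixed (Φ Ψ : ℝ≥0∞ → ℝ≥0∞) (a : EuclideanSpace ℝ ι → EuclideanSpace ℝ ι → ℝ≥0∞) : ℝ≥0∞ :=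
  luxNorm Ψ fun ξ => luxNorm Φ fun x => a x ξ

variable {Φ Ψ Φ₁ Φ₂ Ψ₁ Ψ₂ : ℝ≥0∞ → ℝ≥0∞}

theorem luxMixed_le_const_mul (hΦ : IsYoung Φ) (hΨ : IsYoung Ψ) {c : ℝ≥0∞} (h0 : c ≠ 0)
    (htop : c ≠ ∞) {a b : 𝔼 → 𝔼 → ℝ≥0∞} (h : ∀ x ξ, a x ξ ≤ c * b x ξ) :
    luxMixed Φ Ψ a ≤ c * luxMixed Φ Ψ b := by
  have h1 : ∀ ξ, luxNorm Φ (fun x => a x ξ) ≤ c * luxNorm Φ fun x => b x ξ := fun ξ =>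
    (luxNorm_mono hΦ fun x => h x ξ).trans (luxNorm_const_mul_le h0 htop)
  exact (luxNorm_mono hΨ h1).trans (luxNorm_const_mul_le h0 htop)

theorem lintegral_luxNorm_inv_mul_le (hΨ : IsYoung Ψ) {a : 𝔼 → 𝔼 → ℝ≥0∞}
    {l : ℝ≥0∞} (hl : luxMixed Φ Ψ a < l) (htop : l ≠ ∞) :
    ∫⁻ ξ, Ψ (luxNorm Φ fun x => l⁻¹ * a x ξ) ≤ 1 := by
  have h0 : l ≠ 0 := (zero_le.trans_lt hl).ne'
  refine le_trans (lintegral_mono fun ξ => hΨ.mono ?_) (lintegral_le_one_of_luxNorm_lt hΨ hl)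
  rw [ENNReal.div_eq_inv_mul]
  exact luxNorm_const_mul_le (ENNReal.inv_ne_zero.2 htop) (ENNReal.inv_ne_top.2 h0)

/-- Modular bounds are available at levels strictly above the Luxemburg norms; the levels then
decrease to the norms, also when a norm is zero. -/
theorem le_mul_mul_of_forall_gt {M C N₁ N₂ : ℝ≥0∞} (hC : C ≠ ∞) (h₁ : N₁ ≠ ∞) (h₂ : N₂ ≠ ∞)
    (h : ∀ l₁ l₂ : ℝ≥0∞, N₁ < l₁ → N₂ < l₂ → l₁ ≠ ∞ → l₂ ≠ ∞ → M ≤ C * (l₁ * l₂)) :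
    M ≤ C * (N₁ * N₂) := by
  have t : ∀ N : ℝ≥0∞, Tendsto (fun ε => N + ε) (𝓝[>] 0) (𝓝 N) := fun N => by
    have : Tendsto (fun ε : ℝ≥0∞ => N + ε) (𝓝 0) (𝓝 (N + 0)) := tendsto_const_nhds.add tendsto_id
    rw [add_zero] at this
    exact this.mono_left nhdsWithin_le_nhds
  refine ge_of_tendsto (ENNReal.Tendsto.const_mul
    (ENNReal.Tendsto.mul (t N₁) (Or.inr h₂) (t N₂) (Or.inr h₁)) (Or.inr hC)) ?_
  filter_upwards [self_mem_nhdsWithin, nhdsWithin_le_nhds (gt_mem_nhds ENNReal.zero_lt_top)]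
    with ε hε hεtop
  have h0 : ε ≠ 0 := (show 0 < ε from hε).ne'
  exact h _ _ (ENNReal.lt_add_right h₁ h0) (ENNReal.lt_add_right h₂ h0)
    (ENNReal.add_ne_top.2 ⟨h₁, hεtop.ne⟩) (ENNReal.add_ne_top.2 ⟨h₂, hεtop.ne⟩)

variable [DecidableEq ι]

theorem wignerProd_le {A : Matrix ι ι ℝ} {c₁ c₂ : ℝ≥0∞} {a₁ a₂ b₁ b₂ : 𝔼 → 𝔼 → ℝ≥0∞}
    (h₁ : ∀ x ξ, a₁ x ξ ≤ c₁ * b₁ x ξ) (h₂ : ∀ x ξ, a₂ x ξ ≤ c₂ * b₂ x ξ) (X Ξ : ℙ) :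
    wignerProd A a₁ a₂ X Ξ ≤ (c₁ * c₂) * wignerProd A b₁ b₂ X Ξ := by
  refine (mul_le_mul' (h₁ _ _) (h₂ _ _)).trans (le_of_eq ?_)
  rw [wignerProd]
  ring

/-- Conditions on Young functions under which the Wigner product maps into `L^{p,q}`. -/
theorem exists_mixedNorm_wignerProd_le (A : Matrix ι ι ℝ) {p q : ℝ≥0∞} (hp1 : 1 ≤ p)
    (hpq : p ≤ q) (hΦ₁ : IsYoung Φ₁) (hΦ₂ : IsYoung Φ₂) (hΨ₁ : IsYoung Ψ₁) (hΨ₂ : IsYoung Ψ₂)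
    (hfin : p ≠ ∞ →
      (IsSteered p.toReal Φ₁ ∧ IsSteered p.toReal Φ₂ ∧
        IsSteered p.toReal Ψ₁ ∧ IsSteered p.toReal Ψ₂) ∧
      ∃ r : ℝ≥0, 0 < r ∧ ∃ c : ℝ≥0,
        (∀ t : ℝ≥0∞, t ≤ r →
          extPow q t ≤ c * Φ₁ t ∧ extPow q t ≤ c * Φ₂ t ∧
          extPow q t ≤ c * Ψ₁ t ∧ extPow q t ≤ c * Ψ₂ t) ∧
        (∀ s : ℝ≥0∞, s ≤ r →
          essInv Φ₁ s * essInv Φ₂ s ≤ c * s ^ (p⁻¹ + q⁻¹).toReal ∧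
          essInv Ψ₁ s * essInv Ψ₂ s ≤ c * s ^ (p⁻¹ + q⁻¹).toReal)) :
    ∃ C : ℝ≥0, ∀ a₁ a₂ : 𝔼 → 𝔼 → ℝ≥0∞, Measurable (Function.uncurry a₁) →
      Measurable (Function.uncurry a₂) → luxMixed Φ₁ Ψ₁ a₁ ≠ ∞ → luxMixed Φ₂ Ψ₂ a₂ ≠ ∞ →
      mixedNorm p q (wignerProd A (expAverage 1 a₁) (expAverage 1 a₂)) ≤
        C * (luxMixed Φ₁ Ψ₁ a₁ * luxMixed Φ₂ Ψ₂ a₂) := by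
  -- For p = ∞ the supremum bounds of envelopes suffice. For finite p, κ has to be small enough for
  -- both pointwise inequalities.
  have key : ∃ κ : ℝ≥0, 0 < κ ∧ ∃ B : ℝ≥0, ∀ (u₁ u₂ : 𝔼 → 𝔼 → ℝ≥0∞) (H₁ H₂ : 𝔼 → ℝ≥0∞),
      IsEnvelope Φ₁ Ψ₁ κ u₁ H₁ → IsEnvelope Φ₂ Ψ₂ κ u₂ H₂ →
      mixedNorm p q (wignerProd A (fun x ξ => H₁ ξ * u₁ x ξ) (fun x ξ => H₂ ξ * u₂ x ξ)) ≤ B := by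
    rcases eq_or_ne p ∞ with hp | hp
    · have hq : q = ∞ := top_le_iff.1 (hp ▸ hpq)
      subst hp hq
      refine ⟨1, one_pos, 1, fun u₁ u₂ H₁ H₂ h₁ h₂ => ?_⟩
      simpa using mixedNorm_top_envelope_le A h₁ h₂
    · obtain ⟨⟨hs₁, hs₂, hs₃, hs₄⟩, r, hr, c, hpow, hinv⟩ := hfin hp
      obtain ⟨κ₁, hκ₁, C, hC⟩ := exists_mul_rpow_le hp1 hp hpq hΦ₁ hΦ₂ hs₁ hs₂ hr
        (fun t ht => (hpow t ht).1) (fun t ht => (hpow t ht).2.1) (fun s hs => (hinv s hs).1)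
      obtain ⟨κ₂, hκ₂, D, hD⟩ := exists_mul_rpow_le hp1 hp hpq hΨ₁ hΨ₂ hs₃ hs₄ hr
        (fun t ht => (hpow t ht).2.2.1) (fun t ht => (hpow t ht).2.2.2)
        (fun s hs => (hinv s hs).2)
      have hB : (4 * C * D : ℝ≥0∞) ^ (1 / p.toReal) ≠ ∞ :=
        ENNReal.rpow_ne_top_of_nonneg (by positivity) (by finiteness)
      have l₁ : ((min κ₁ κ₂ : ℝ≥0) : ℝ≥0∞) ≤ κ₁ := by exact_mod_cast min_le_left κ₁ κ₂
      have l₂ : ((min κ₁ κ₂ : ℝ≥0) : ℝ≥0∞) ≤ κ₂ := by exact_mod_cast min_le_right κ₁ κ₂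
      refine ⟨min κ₁ κ₂, lt_min hκ₁ hκ₂, ((4 * C * D : ℝ≥0∞) ^ (1 / p.toReal)).toNNReal,
        fun u₁ u₂ H₁ H₂ h₁ h₂ => ?_⟩
      rw [ENNReal.coe_toNNReal hB]
      exact mixedNorm_envelope_le A hp1 hp hpq hΦ₁ hΦ₂ hΨ₁ hΨ₂ h₁ h₂
        (fun x y h1 h2 h3 h4 => hC x y (h1.trans l₁) (h2.trans l₁) (h3.trans l₁) (h4.trans l₁))
        (fun x y h1 h2 h3 h4 => hD x y (h1.trans l₂) (h2.trans l₂) (h3.trans l₂) (h4.trans l₂))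
  obtain ⟨κ, hκ, B, hB⟩ := key
  obtain ⟨K₁, hK₁⟩ := exists_expAverage_le (ι := ι) hΦ₁ hΨ₁ hκ
  obtain ⟨K₂, hK₂⟩ := exists_expAverage_le (ι := ι) hΦ₂ hΨ₂ hκ
  refine ⟨K₁ * K₂ * B, fun a₁ a₂ m₁ m₂ hN₁ hN₂ => ?_⟩
  refine le_mul_mul_of_forall_gt ENNReal.coe_ne_top hN₁ hN₂ fun l₁ l₂ hl₁ hl₂ ht₁ ht₂ => ?_
  have h0₁ : l₁ ≠ 0 := (zero_le.trans_lt hl₁).ne'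
  have h0₂ : l₂ ≠ 0 := (zero_le.trans_lt hl₂).ne'
  obtain ⟨u₁, H₁, hE₁, hb₁⟩ := hK₁ (fun x ξ => l₁⁻¹ * a₁ x ξ) (m₁.const_mul _)
    (lintegral_luxNorm_inv_mul_le hΨ₁ hl₁ ht₁)
  obtain ⟨u₂, H₂, hE₂, hb₂⟩ := hK₂ (fun x ξ => l₂⁻¹ * a₂ x ξ) (m₂.const_mul _)
    (lintegral_luxNorm_inv_mul_le hΨ₂ hl₂ ht₂)
  have e₁ : ∀ x ξ, expAverage 1 a₁ x ξ ≤ (l₁ * K₁) * (H₁ ξ * u₁ x ξ) := fun x ξ => by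
    have h := hb₁ x ξ
    rw [expAverage_const_mul (ENNReal.inv_ne_top.2 h0₁),
      ENNReal.inv_mul_le_iff h0₁ ht₁] at h
    rwa [mul_assoc]
  have e₂ : ∀ x ξ, expAverage 1 a₂ x ξ ≤ (l₂ * K₂) * (H₂ ξ * u₂ x ξ) := fun x ξ => by
    have h := hb₂ x ξ
    rw [expAverage_const_mul (ENNReal.inv_ne_top.2 h0₂),
      ENNReal.inv_mul_le_iff h0₂ ht₂] at h
    rwa [mul_assoc]
  have hc : (l₁ * K₁) * (l₂ * K₂) ≠ ∞ := by finiteness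
  calc _ ≤ ((l₁ * K₁) * (l₂ * K₂)) * mixedNorm p q
        (wignerProd A (fun x ξ => H₁ ξ * u₁ x ξ) (fun x ξ => H₂ ξ * u₂ x ξ)) :=
        mixedNorm_const_mul_le hc (wignerProd_le e₁ e₂)
    _ ≤ ((l₁ * K₁) * (l₂ * K₂)) * B := by
        gcongr
        exact hB _ _ _ _ hE₁ hE₂
    _ = _ := by
        push_cast
        ring

end Bilinear

/-! ## Weighted phase space densities -/

section Weighted

set_option linter.unusedSectionVars false

variable {ι : Type*} [Fintype ι]

local notation "𝔼" => EuclideanSpace ℝ ι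

local notation "ℙ" => EuclideanSpace ℝ (ι ⊕ ι)

instance isAddHaarMeasure_prod : (volume : Measure (𝔼 × 𝔼)).IsAddHaarMeasure :=
  inferInstanceAs ((volume : Measure 𝔼).prod volume).IsAddHaarMeasure

/-- The weighted modulus of the short-time Fourier transform. -/
def weightedDensity (w : EuclideanSpace ℝ ι × EuclideanSpace ℝ ι → ℝ)
    (f : GSRoumieuDual (EuclideanSpace ℝ ι) (1 / 2)) (x ξ : EuclideanSpace ℝ ι) : ℝ≥0∞ :=
  ‖pairHalf f (atomW gauss x ξ)‖ₑ * ENNReal.ofReal (w (x, ξ))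

theorem measurable_enorm_pairHalf (f : GSRoumieuDual 𝔼 (1 / 2)) :
    Measurable (Function.uncurry fun x ξ : 𝔼 => ‖pairHalf f (atomW gauss x ξ)‖ₑ) :=
  (continuous_pairHalf_atomW f (isWindow_gauss (ι := ι))).measurable.enorm

theorem measurable_weightedDensity {w : 𝔼 × 𝔼 → ℝ} (hw : Continuous w)
    (f : GSRoumieuDual 𝔼 (1 / 2)) : Measurable (Function.uncurry (weightedDensity w f)) := by
  have h : Measurable fun z : 𝔼 × 𝔼 => ENNReal.ofReal (w (z.1, z.2)) :=
    (ENNReal.continuous_ofReal.comp hw).measurable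
  exact (measurable_enorm_pairHalf f).mul h

theorem enorm_stft (f : GSRoumieuDual 𝔼 (1 / 2)) (x ξ : 𝔼) :
    ‖stft f x ξ‖ₑ = ENNReal.ofReal (stftConst ι) * ‖pairHalf f (atomW gauss x ξ)‖ₑ := by
  rw [stft_eq, enorm_mul, ← ofReal_norm, Complex.norm_real,
    Real.norm_of_nonneg (stftConst_pos (ι := ι)).le]

theorem pairHalf_toHalf_atomW (F : GSBeurlingDual 𝔼 1) (x ξ : 𝔼) :
    pairHalf (toHalf F) (atomW gauss x ξ) = pairOne F (atomW gauss x ξ) :=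
  pairHalf_toHalf F (atomW_mem_roumieu isWindow_gauss x ξ)

theorem exists_luxMixed_weightedDensity_le {ω w : 𝔼 × 𝔼 → ℝ} {C : ℝ} (hC : 0 < C)
    (hw : ∀ z, w z ≤ C * ω z) {Φ Ψ : ℝ≥0∞ → ℝ≥0∞} (hΦ : IsYoung Φ) (hΨ : IsYoung Ψ) :
    ∃ K : ℝ≥0, ∀ f : GSRoumieuDual 𝔼 (1 / 2),
      luxMixed Φ Ψ (weightedDensity w f) ≤ K * orliczModNorm Φ Ψ ω f := by
  have hs := stftConst_pos (ι := ι)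
  have hs0 : ENNReal.ofReal (stftConst ι) ≠ 0 := (ENNReal.ofReal_pos.2 hs).ne'
  have hK : ENNReal.ofReal C * (ENNReal.ofReal (stftConst ι))⁻¹ ≠ ∞ :=
    ENNReal.mul_ne_top ENNReal.ofReal_ne_top (ENNReal.inv_ne_top.2 hs0)
  refine ⟨(ENNReal.ofReal C * (ENNReal.ofReal (stftConst ι))⁻¹).toNNReal, fun f => ?_⟩
  rw [ENNReal.coe_toNNReal hK]
  refine luxMixed_le_const_mul hΦ hΨ (mul_ne_zero (ENNReal.ofReal_pos.2 hC).ne'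
    (ENNReal.inv_ne_zero.2 ENNReal.ofReal_ne_top)) hK fun x ξ => ?_
  have h1 : ENNReal.ofReal (w (x, ξ)) ≤ ENNReal.ofReal C * ENNReal.ofReal (ω (x, ξ)) := by
    rw [← ENNReal.ofReal_mul hC.le]
    exact ENNReal.ofReal_le_ofReal (hw _)
  calc weightedDensity w f x ξ
      ≤ ‖pairHalf f (atomW gauss x ξ)‖ₑ * (ENNReal.ofReal C * ENNReal.ofReal (ω (x, ξ))) :=
        mul_le_mul_right h1 _
    _ = ENNReal.ofReal C * (((ENNReal.ofReal (stftConst ι))⁻¹ * ENNReal.ofReal (stftConst ι)) *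
        (‖pairHalf f (atomW gauss x ξ)‖ₑ * ENNReal.ofReal (ω (x, ξ)))) := by
        rw [ENNReal.inv_mul_cancel hs0 ENNReal.ofReal_ne_top, one_mul, mul_left_comm]
    _ = _ := by
        rw [enorm_stft]
        ring

/-- A moderate weight can be moved inside a local average. -/
theorem weight_mul_expAverage_le {w : 𝔼 × 𝔼 → ℝ} {r R : ℝ} (hr : 0 ≤ r) (hR : r + 1 ≤ R)
    (hpos : ∀ z, 0 < w z) (hw : ∀ z y, w (z + y) ≤ Real.exp (r * ‖y‖) * w z) (a : 𝔼 → 𝔼 → ℝ≥0∞)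
    (x ξ : 𝔼) :
    expAverage R a x ξ * ENNReal.ofReal (w (x, ξ)) ≤
      expAverage 1 (fun x ξ => a x ξ * ENNReal.ofReal (w (x, ξ))) x ξ := by
  have hk : ∀ x' ξ' : 𝔼, ENNReal.ofReal (w (x, ξ)) * (expKernel R (ξ' - ξ) * expKernel R (x' - x)) ≤
      expKernel 1 (ξ' - ξ) * expKernel 1 (x' - x) * ENNReal.ofReal (w (x', ξ')) := by
    intro x' ξ'
    simp only [expKernel]
    rw [← ENNReal.ofReal_mul (Real.exp_pos _).le, ← ENNReal.ofReal_mul (hpos _).le,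
      ← ENNReal.ofReal_mul (Real.exp_pos _).le,
      ← ENNReal.ofReal_mul (mul_nonneg (Real.exp_pos _).le (Real.exp_pos _).le)]
    refine ENNReal.ofReal_le_ofReal ?_
    have h1 := hw (x', ξ') (x - x', ξ - ξ')
    rw [Prod.mk_add_mk, add_sub_cancel, add_sub_cancel] at h1
    have h2 : ‖(x - x', ξ - ξ')‖ ≤ ‖x' - x‖ + ‖ξ' - ξ‖ := by
      rw [Prod.norm_def, norm_sub_rev x' x, norm_sub_rev ξ' ξ]
      exact max_le (le_add_of_nonneg_right (norm_nonneg _))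
        (le_add_of_nonneg_left (norm_nonneg _))
    have hx := norm_nonneg (x' - x)
    have hξ := norm_nonneg (ξ' - ξ)
    have hw' := (hpos (x', ξ')).le
    calc w (x, ξ) * (Real.exp (-(R * ‖ξ' - ξ‖)) * Real.exp (-(R * ‖x' - x‖)))
        ≤ (Real.exp (r * (‖x' - x‖ + ‖ξ' - ξ‖)) * w (x', ξ')) *
          (Real.exp (-((r + 1) * ‖ξ' - ξ‖)) * Real.exp (-((r + 1) * ‖x' - x‖))) := by
          gcongr
          exact h1.trans (by gcongr)
      _ = (Real.exp (r * (‖x' - x‖ + ‖ξ' - ξ‖)) *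
          (Real.exp (-((r + 1) * ‖ξ' - ξ‖)) * Real.exp (-((r + 1) * ‖x' - x‖)))) *
            w (x', ξ') := by ring
      _ = _ := by
          rw [← Real.exp_add, ← Real.exp_add, ← Real.exp_add]
          congr 2
          ring
  rw [mul_comm]
  simp only [expAverage]
  rw [← lintegral_const_mul' _ _ ENNReal.ofReal_ne_top]
  refine lintegral_mono fun ξ' => ?_
  have htop : ∀ (s : ℝ) (y : 𝔼), expKernel s y ≠ ∞ := fun s y => ENNReal.ofReal_ne_top
  simp only
  rw [← mul_assoc, ← lintegral_const_mul' _ _ (ENNReal.mul_ne_top ENNReal.ofReal_ne_top (htop _ _)),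
    ← lintegral_const_mul' _ _ (htop _ _)]
  refine lintegral_mono fun x' => ?_
  calc _ = (ENNReal.ofReal (w (x, ξ)) * (expKernel R (ξ' - ξ) * expKernel R (x' - x))) *
        a x' ξ' := by ring
    _ ≤ (expKernel 1 (ξ' - ξ) * expKernel 1 (x' - x) * ENNReal.ofReal (w (x', ξ'))) *
        a x' ξ' := mul_le_mul_left (hk x' ξ') _
    _ = _ := by ring

theorem lintegral_prod_exp_mul (r : ℝ) {a : 𝔼 → 𝔼 → ℝ≥0∞} (ha : Measurable (Function.uncurry a))
    (x ξ : 𝔼) : ∫⁻ z : 𝔼 × 𝔼, ENNReal.ofReal (Real.exp (-(r * ‖z.1 - x‖ + r * ‖z.2 - ξ‖))) *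
      a z.1 z.2 = expAverage r a x ξ := by
  have h1 : ∀ z : 𝔼 × 𝔼, ENNReal.ofReal (Real.exp (-(r * ‖z.1 - x‖ + r * ‖z.2 - ξ‖))) *
      a z.1 z.2 = expKernel r (z.2 - ξ) * (expKernel r (z.1 - x) * a z.1 z.2) := fun z => by
    rw [expKernel, expKernel, ← mul_assoc, ← ENNReal.ofReal_mul (Real.exp_pos _).le,
      ← Real.exp_add]
    congr 3
    ring
  have h2 := measurable_kernel_mul r ha x ξ
  rw [lintegral_congr h1, ← lintegral_expKernel_mul r ha]
  exact lintegral_prod_symm (μ := (volume : Measure 𝔼)) (ν := (volume : Measure 𝔼))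
    (fun z : 𝔼 × 𝔼 => expKernel r (z.2 - ξ) * (expKernel r (z.1 - x) * a z.1 z.2)) h2.aemeasurable

/-- Orlicz modulation spaces consist of elements of `Σ_1'`. -/
theorem exists_toHalf_eq_of_mem_orliczMod {ω : 𝔼 × 𝔼 → ℝ} (hω : IsModerateWeight ω)
    {Φ Ψ : ℝ≥0∞ → ℝ≥0∞} (hΦ : IsYoung Φ) (hΨ : IsYoung Ψ) :
    ∀ f ∈ OrliczMod Φ Ψ ω, ∃ F : GSBeurlingDual 𝔼 1, toHalf F = f := by
  intro f hf
  obtain ⟨w, C, r, hwc, hC, hr, hpos, -, hwC, hwm⟩ := hω.exists_continuous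
  obtain ⟨K, hK⟩ := exists_luxMixed_weightedDensity_le hC hwC hΦ hΨ
  -- Only boundedness of averages is needed here, so the envelopes are normalised by κ = 1.
  obtain ⟨M, hM⟩ := exists_expAverage_le (ι := ι) hΦ hΨ one_pos
  obtain ⟨D, hD⟩ := enorm_pairHalf_atomW_le (ι := ι) (r := r + 1) (by positivity)
  have hm := measurable_weightedDensity hwc f
  have hN : luxMixed Φ Ψ (weightedDensity w f) ≠ ∞ :=
    ((hK f).trans_lt (ENNReal.mul_lt_top ENNReal.coe_lt_top hf)).ne
  set N := luxMixed Φ Ψ (weightedDensity w f) with hN_def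
  have hl : N < N + 1 := ENNReal.lt_add_right hN one_ne_zero
  have hltop : N + 1 ≠ ∞ := by finiteness
  obtain ⟨u, H, hE, hb⟩ := hM (fun x ξ => (N + 1)⁻¹ * weightedDensity w f x ξ) (hm.const_mul _)
    (lintegral_luxNorm_inv_mul_le hΨ hl hltop)
  have hl0 : N + 1 ≠ 0 := (zero_le.trans_lt hl).ne'
  have h1 : ∀ x ξ, expAverage 1 (weightedDensity w f) x ξ ≤ (N + 1) * M := fun x ξ => by
    have h := hb x ξ
    rw [expAverage_const_mul (ENNReal.inv_ne_top.2 hl0), ENNReal.inv_mul_le_iff hl0 hltop] at h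
    refine h.trans (mul_le_mul_right (mul_le_of_le_one_right zero_le ?_) _)
    exact mul_le_one' (by simpa using hE.H_le ξ) (by simpa using hE.u_le x ξ)
  -- The reproducing inequality is used at the rate r+1: the weight consumes r and the kernel of
  -- rate 1 remains.
  have h2 : ∀ x ξ, ‖pairHalf f (atomW gauss x ξ)‖ₑ * ENNReal.ofReal (w (x, ξ)) ≤
      D * ((N + 1) * M) := fun x ξ => by
    have h := hD f x ξ
    rw [lintegral_prod_exp_mul (r + 1) (measurable_enorm_pairHalf f)] at h
    calc _ ≤ (D * expAverage (r + 1) (fun x ξ => ‖pairHalf f (atomW gauss x ξ)‖ₑ) x ξ) *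
          ENNReal.ofReal (w (x, ξ)) := mul_le_mul_left h _
      _ ≤ D * expAverage 1 (weightedDensity w f) x ξ := by
          rw [mul_assoc]
          exact mul_le_mul_right (weight_mul_expAverage_le hr le_rfl hpos hwm _ x ξ) _
      _ ≤ _ := mul_le_mul_right (h1 x ξ) _
  have hB : D * ((N + 1) * M) ≠ ∞ := by finiteness
  refine exists_toHalf_eq f (C := (D * ((N + 1) * M)).toReal / w 0) (R := r)
    (div_nonneg ENNReal.toReal_nonneg (hpos 0).le) fun x ξ => ?_
  have h3 := ENNReal.toReal_mono hB (h2 x ξ)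
  rw [ENNReal.toReal_mul, toReal_enorm, ENNReal.toReal_ofReal (hpos _).le] at h3
  -- Comparison of w(x,ξ) with w(0) shows that 1/w grows at most exponentially.
  have h4 := hwm (x, ξ) (-(x, ξ))
  rw [add_neg_cancel, norm_neg] at h4
  have h5 : ‖(x, ξ)‖ ≤ ‖x‖ + ‖ξ‖ := by
    rw [Prod.norm_def]
    exact max_le (le_add_of_nonneg_right (norm_nonneg _)) (le_add_of_nonneg_left (norm_nonneg _))
  rw [div_mul_eq_mul_div, le_div_iff₀ (hpos 0)]
  have hw' := (hpos (x, ξ)).le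
  calc ‖pairHalf f (atomW gauss x ξ)‖ * w 0
      ≤ ‖pairHalf f (atomW gauss x ξ)‖ * (Real.exp (r * (‖x‖ + ‖ξ‖)) * w (x, ξ)) := by
        gcongr
        exact h4.trans (by gcongr)
    _ = (‖pairHalf f (atomW gauss x ξ)‖ * w (x, ξ)) * Real.exp (r * (‖x‖ + ‖ξ‖)) := by ring
    _ ≤ _ := by gcongr

variable [DecidableEq ι]

theorem modNorm_toHalf_eq {p q : ℝ≥0∞} {ω : ℙ × ℙ → ℝ} (W : GSBeurlingDual ℙ 1) :
    modNorm p q ω (toHalf W) = mixedNorm p q fun X Ξ =>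
      (ENNReal.ofReal (stftConst (ι ⊕ ι)) * ‖pairOne W (atomW gauss X Ξ)‖ₑ) *
        ENNReal.ofReal (ω (X, Ξ)) := by
  simp only [modNorm, mixedNorm, enorm_stft, pairHalf_toHalf_atomW]

/-- The weighted pointwise bound for the short-time Fourier transform of a Wigner distribution. -/
theorem exists_weighted_wignerSTFT_le (A : Matrix ι ι ℝ) {ω : ℙ × ℙ → ℝ} {w₁ w₂ : 𝔼 × 𝔼 → ℝ}
    {r₁ r₂ c : ℝ} (hr₁ : 0 ≤ r₁) (hr₂ : 0 ≤ r₂) (hpos₁ : ∀ z, 0 < w₁ z) (hpos₂ : ∀ z, 0 < w₂ z)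
    (hw₁ : ∀ z y, w₁ (z + y) ≤ Real.exp (r₁ * ‖y‖) * w₁ z)
    (hw₂ : ∀ z y, w₂ (z + y) ≤ Real.exp (r₂ * ‖y‖) * w₂ z) (hc : 0 ≤ c)
    (hω : ∀ x ξ η y : 𝔼, ω (pair x ξ, pair η y) ≤
        c * (w₁ (x - act A y, ξ + act (1 - A.transpose) η) *
          w₂ (x + act (1 - A) y, ξ - act A.transpose η))) :
    ∃ C : ℝ≥0, ∀ (F₁ F₂ : GSBeurlingDual 𝔼 1) (X Ξ : ℙ),
      ‖wignerSTFT A F₁ F₂ (X, Ξ)‖ₑ * ENNReal.ofReal (ω (X, Ξ)) ≤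
        C * wignerProd A (expAverage 1 (weightedDensity w₁ (toHalf F₁)))
          (expAverage 1 (weightedDensity w₂ (toHalf F₂))) X Ξ := by
  obtain ⟨C, hC⟩ := exists_enorm_wignerSTFT_le A (r := max r₁ r₂ + 1)
    (by have := hr₁.trans (le_max_left r₁ r₂); linarith)
  refine ⟨C * c.toNNReal, fun F₁ F₂ X Ξ => ?_⟩
  have h := hC F₁ F₂ (fstP X) (sndP X) (fstP Ξ) (sndP Ξ)
  have h' := hω (fstP X) (sndP X) (fstP Ξ) (sndP Ξ)
  simp only [pair_fstP_sndP, ← pairHalf_toHalf_atomW] at h h'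
  rw [wignerProd]
  generalize fstP X - act A (sndP Ξ) = x₁ at *
  generalize sndP X + act (1 - A.transpose) (fstP Ξ) = ξ₁ at *
  generalize fstP X + act (1 - A) (sndP Ξ) = x₂ at *
  generalize sndP X - act A.transpose (fstP Ξ) = ξ₂ at *
  have e₁ := weight_mul_expAverage_le (R := max r₁ r₂ + 1) hr₁
    (by have := le_max_left r₁ r₂; linarith) hpos₁ hw₁
    (fun x ξ => ‖pairHalf (toHalf F₁) (atomW gauss x ξ)‖ₑ) x₁ ξ₁
  have e₂ := weight_mul_expAverage_le (R := max r₁ r₂ + 1) hr₂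
    (by have := le_max_right r₁ r₂; linarith) hpos₂ hw₂
    (fun x ξ => ‖pairHalf (toHalf F₂) (atomW gauss x ξ)‖ₑ) x₂ ξ₂
  have h'' : ENNReal.ofReal (ω (X, Ξ)) ≤ c.toNNReal *
      (ENNReal.ofReal (w₁ (x₁, ξ₁)) * ENNReal.ofReal (w₂ (x₂, ξ₂))) := by
    change _ ≤ ENNReal.ofReal c * _
    rw [← ENNReal.ofReal_mul (hpos₁ _).le, ← ENNReal.ofReal_mul hc]
    exact ENNReal.ofReal_le_ofReal h'
  refine (mul_le_mul' h h'').trans ?_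
  refine le_trans (le_of_eq ?_) (mul_le_mul_right (mul_le_mul' e₁ e₂) _)
  push_cast
  ring

end Weighted

/-! ## Continuity of the Wigner map -/

section WignerBound

set_option linter.unusedSectionVars false

variable {ι : Type*} [Fintype ι] [DecidableEq ι]

local notation "𝔼" => EuclideanSpace ℝ ι

local notation "ℙ" => EuclideanSpace ℝ (ι ⊕ ι)

/-- The majorant of the short-time Fourier transform of a Wigner distribution. -/
def wignerMajorant (A : Matrix ι ι ℝ) (w₁ w₂ : EuclideanSpace ℝ ι × EuclideanSpace ℝ ι → ℝ)
    (F₁ F₂ : GSBeurlingDual (EuclideanSpace ℝ ι) 1) :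
    EuclideanSpace ℝ (ι ⊕ ι) → EuclideanSpace ℝ (ι ⊕ ι) → ℝ≥0∞ :=
  wignerProd A (expAverage 1 (weightedDensity w₁ (toHalf F₁)))
    (expAverage 1 (weightedDensity w₂ (toHalf F₂)))

theorem measurable_wignerMajorant (A : Matrix ι ι ℝ) {w₁ w₂ : 𝔼 × 𝔼 → ℝ} (h₁ : Continuous w₁)
    (h₂ : Continuous w₂) (F₁ F₂ : GSBeurlingDual 𝔼 1) :
    Measurable (Function.uncurry (wignerMajorant A w₁ w₂ F₁ F₂)) :=
  measurable_wignerProd A (measurable_expAverage (measurable_weightedDensity h₁ _))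
    (measurable_expAverage (measurable_weightedDensity h₂ _))

variable {A : Matrix ι ι ℝ} {p q : ℝ≥0∞}
  {ω : EuclideanSpace ℝ (ι ⊕ ι) × EuclideanSpace ℝ (ι ⊕ ι) → ℝ}
  {w₁ w₂ : EuclideanSpace ℝ ι × EuclideanSpace ℝ ι → ℝ} {C : ℝ≥0}

theorem modNorm_wigner_le
    (hC : ∀ (F₁ F₂ : GSBeurlingDual 𝔼 1) (X Ξ : ℙ),
      ‖wignerSTFT A F₁ F₂ (X, Ξ)‖ₑ * ENNReal.ofReal (ω (X, Ξ)) ≤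
        C * wignerMajorant A w₁ w₂ F₁ F₂ X Ξ)
    {F₁ F₂ : GSBeurlingDual 𝔼 1} {W : GSBeurlingDual ℙ 1} (hW : IsWigner A F₁ F₂ W) :
    modNorm p q ω (toHalf W) ≤ (ENNReal.ofReal (stftConst (ι ⊕ ι)) * C) *
      mixedNorm p q (wignerMajorant A w₁ w₂ F₁ F₂) := by
  rw [modNorm_toHalf_eq]
  refine mixedNorm_const_mul_le (ENNReal.mul_ne_top ENNReal.ofReal_ne_top ENNReal.coe_ne_top)
    fun X Ξ => ?_
  have h := hW.pairOne_atomW (X, Ξ)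
  rw [h, enorm_mul, ← ofReal_norm (modul _ _), norm_modul, ENNReal.ofReal_one, one_mul, mul_assoc,
    mul_assoc]
  exact mul_le_mul_right (hC F₁ F₂ X Ξ) _

/-- The phase in front of the transform depends only on the point of phase space, so it factors out
of the difference. The remaining increment is split by `wignerSTFT_sub`. -/
theorem modNorm_wigner_sub_le (hp1 : 1 ≤ p) (hpq : p ≤ q) (h₁ : Continuous w₁)
    (h₂ : Continuous w₂)
    (hC : ∀ (F₁ F₂ : GSBeurlingDual 𝔼 1) (X Ξ : ℙ),
      ‖wignerSTFT A F₁ F₂ (X, Ξ)‖ₑ * ENNReal.ofReal (ω (X, Ξ)) ≤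
        C * wignerMajorant A w₁ w₂ F₁ F₂ X Ξ)
    {F₁ F₂ G₁ G₂ : GSBeurlingDual 𝔼 1} {W W' : GSBeurlingDual ℙ 1} (hW : IsWigner A F₁ F₂ W)
    (hW' : IsWigner A G₁ G₂ W') :
    modNorm p q ω (toHalf (W' - W)) ≤ (ENNReal.ofReal (stftConst (ι ⊕ ι)) * C) *
      (mixedNorm p q (wignerMajorant A w₁ w₂ (G₁ - F₁) (G₂ - F₂)) +
        mixedNorm p q (wignerMajorant A w₁ w₂ F₁ (G₂ - F₂)) +
        mixedNorm p q (wignerMajorant A w₁ w₂ (G₁ - F₁) F₂)) := by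
  set M := wignerMajorant A w₁ w₂ with hM
  have hm : ∀ F₁ F₂, Measurable (Function.uncurry (M F₁ F₂)) :=
    measurable_wignerMajorant A h₁ h₂
  have hadd : mixedNorm p q (fun X Ξ => M (G₁ - F₁) (G₂ - F₂) X Ξ + M F₁ (G₂ - F₂) X Ξ +
      M (G₁ - F₁) F₂ X Ξ) ≤ mixedNorm p q (M (G₁ - F₁) (G₂ - F₂)) +
        mixedNorm p q (M F₁ (G₂ - F₂)) + mixedNorm p q (M (G₁ - F₁) F₂) := by
    have e1 := mixedNorm_add_le hp1 hpq (hm (G₁ - F₁) (G₂ - F₂)) (hm F₁ (G₂ - F₂))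
    have hm' : Measurable (Function.uncurry fun X Ξ =>
        M (G₁ - F₁) (G₂ - F₂) X Ξ + M F₁ (G₂ - F₂) X Ξ) := (hm _ _).add (hm _ _)
    exact (mixedNorm_add_le hp1 hpq hm' (hm (G₁ - F₁) F₂)).trans (add_le_add_left e1 _)
  refine le_trans ?_ (mul_le_mul_right hadd _)
  rw [modNorm_toHalf_eq]
  refine mixedNorm_const_mul_le (ENNReal.mul_ne_top ENNReal.ofReal_ne_top ENNReal.coe_ne_top)
    fun X Ξ => ?_
  have e1 := hW.pairOne_atomW (X, Ξ)
  have e2 := hW'.pairOne_atomW (X, Ξ)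
  rw [pairOne_sub _ _ (atomW_mem_beurling isWindow_gauss _ _), e1, e2, ← mul_sub,
    wignerSTFT_sub, enorm_mul, ← ofReal_norm (modul _ _), norm_modul, ENNReal.ofReal_one, one_mul,
    mul_assoc, mul_assoc]
  refine mul_le_mul_right ?_ _
  rw [mul_add, mul_add]
  refine (mul_le_mul_left ((enorm_add_le _ _).trans
    (add_le_add_left (enorm_add_le _ _) _)) _).trans ?_
  rw [add_mul, add_mul]
  exact add_le_add (add_le_add (hC _ _ _ _) (hC _ _ _ _)) (hC _ _ _ _)

theorem exists_pos_forall_lt {C N₁ N₂ ε : ℝ≥0∞} (hC : C ≠ ∞) (h₁ : N₁ ≠ ∞) (h₂ : N₂ ≠ ∞)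
    (hε : 0 < ε) : ∃ δ : ℝ≥0∞, 0 < δ ∧ δ ≠ ∞ ∧ C * (δ * δ + N₁ * δ + δ * N₂) < ε := by
  have t : Tendsto (fun δ : ℝ≥0∞ => C * (δ * δ + N₁ * δ + δ * N₂)) (𝓝[>] 0)
      (𝓝 (C * (0 * 0 + N₁ * 0 + 0 * N₂))) := by
    have hid : Tendsto (fun δ : ℝ≥0∞ => δ) (𝓝[>] 0) (𝓝 0) :=
      tendsto_id.mono_left nhdsWithin_le_nhds
    refine ENNReal.Tendsto.const_mul (((ENNReal.Tendsto.mul hid (Or.inr ENNReal.zero_ne_top) hid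
      (Or.inr ENNReal.zero_ne_top)).add (ENNReal.Tendsto.const_mul hid (Or.inr h₁))).add
      (ENNReal.Tendsto.mul_const hid (Or.inr h₂))) (Or.inr hC)
  simp only [mul_zero, zero_mul, add_zero] at t
  have h₀ : ∀ᶠ δ : ℝ≥0∞ in 𝓝[>] 0, δ < ∞ :=
    nhdsWithin_le_nhds (gt_mem_nhds ENNReal.zero_lt_top)
  have h := (t.eventually (gt_mem_nhds hε)).and (h₀.and self_mem_nhdsWithin)
  obtain ⟨δ, hδ1, hδ2, hδ3⟩ := h.exists
  exact ⟨δ, hδ3, hδ2.ne, hδ1⟩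

end WignerBound

end

end OrliczModulation

/-! ### Assembly of the estimates -/

theorem mainTheorem2 (d : ℕ) (A : Matrix (Fin d) (Fin d) ℝ)
    (p q : ℝ≥0∞) (hp : 1 ≤ p) (hpq : p ≤ q)
    (Φ₁ Φ₂ Ψ₁ Ψ₂ : ℝ≥0∞ → ℝ≥0∞)
    (hΦ₁ : IsYoung Φ₁) (hΦ₂ : IsYoung Φ₂) (hΨ₁ : IsYoung Ψ₁) (hΨ₂ : IsYoung Ψ₂)
    (hfin : p ≠ ∞ →
      (IsSteered p.toReal Φ₁ ∧ IsSteered p.toReal Φ₂ ∧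
        IsSteered p.toReal Ψ₁ ∧ IsSteered p.toReal Ψ₂) ∧
      (LocalDelta2 Φ₁ ∧ LocalDelta2 Φ₂ ∧ LocalDelta2 Ψ₁ ∧ LocalDelta2 Ψ₂) ∧
      ∃ r : ℝ≥0, 0 < r ∧ ∃ c : ℝ≥0,
        (∀ t : ℝ≥0∞, t ≤ r →
          extPow q t ≤ c * Φ₁ t ∧ extPow q t ≤ c * Φ₂ t ∧
          extPow q t ≤ c * Ψ₁ t ∧ extPow q t ≤ c * Ψ₂ t) ∧
        (∀ s : ℝ≥0∞, s ≤ r →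
          essInv Φ₁ s * essInv Φ₂ s ≤ c * s ^ (p⁻¹ + q⁻¹).toReal ∧
          essInv Ψ₁ s * essInv Ψ₂ s ≤ c * s ^ (p⁻¹ + q⁻¹).toReal))
    (ω : EuclideanSpace ℝ (Fin d ⊕ Fin d) × EuclideanSpace ℝ (Fin d ⊕ Fin d) → ℝ)
    (ω₁ ω₂ : EuclideanSpace ℝ (Fin d) × EuclideanSpace ℝ (Fin d) → ℝ)
    (hω : IsModerateWeight ω) (hω₁ : IsModerateWeight ω₁) (hω₂ : IsModerateWeight ω₂)
    (hweights : ∃ c : ℝ, ∀ x ξ η y : EuclideanSpace ℝ (Fin d),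
      ω (pair x ξ, pair η y) ≤
        c * (ω₁ (x - act A y, ξ + act (1 - A.transpose) η) *
          ω₂ (x + act (1 - A) y, ξ - act A.transpose η))) :
    -- the Orlicz modulation spaces are subspaces of `Σ_1'`
    (∀ f ∈ OrliczMod Φ₁ Ψ₁ ω₁, ∃ F : GSBeurlingDual (EuclideanSpace ℝ (Fin d)) 1, toHalf F = f) ∧
    (∀ f ∈ OrliczMod Φ₂ Ψ₂ ω₂, ∃ F : GSBeurlingDual (EuclideanSpace ℝ (Fin d)) 1, toHalf F = f) ∧
    -- the Wigner map from `Σ_1' × Σ_1'` to `Σ_1'` exists, and restricts as claimed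
    ∃ W : GSBeurlingDual (EuclideanSpace ℝ (Fin d)) 1 →
        GSBeurlingDual (EuclideanSpace ℝ (Fin d)) 1 →
        GSBeurlingDual (EuclideanSpace ℝ (Fin d ⊕ Fin d)) 1,
      (∀ F₁ F₂, IsWigner A F₁ F₂ (W F₁ F₂)) ∧
      (∃ C : ℝ≥0, ∀ F₁ F₂, toHalf F₁ ∈ OrliczMod Φ₁ Ψ₁ ω₁ → toHalf F₂ ∈ OrliczMod Φ₂ Ψ₂ ω₂ →
        toHalf (W F₁ F₂) ∈ Modulation p q ω ∧
        modNorm p q ω (toHalf (W F₁ F₂)) ≤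
          C * orliczModNorm Φ₁ Ψ₁ ω₁ (toHalf F₁) * orliczModNorm Φ₂ Ψ₂ ω₂ (toHalf F₂)) ∧
      (∀ F₁ F₂, toHalf F₁ ∈ OrliczMod Φ₁ Ψ₁ ω₁ → toHalf F₂ ∈ OrliczMod Φ₂ Ψ₂ ω₂ →
        ∀ ε : ℝ≥0∞, 0 < ε → ∃ δ : ℝ≥0∞, 0 < δ ∧
          ∀ G₁ G₂, toHalf G₁ ∈ OrliczMod Φ₁ Ψ₁ ω₁ → toHalf G₂ ∈ OrliczMod Φ₂ Ψ₂ ω₂ →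
            orliczModNorm Φ₁ Ψ₁ ω₁ (toHalf (G₁ - F₁)) < δ →
            orliczModNorm Φ₂ Ψ₂ ω₂ (toHalf (G₂ - F₂)) < δ →
            modNorm p q ω (toHalf (W G₁ G₂ - W F₁ F₂)) < ε) := by
  classical
  refine ⟨exists_toHalf_eq_of_mem_orliczMod hω₁ hΦ₁ hΨ₁,
    exists_toHalf_eq_of_mem_orliczMod hω₂ hΦ₂ hΨ₂, ?_⟩
  choose W hW using exists_isWigner A
  obtain ⟨w₁, C₁, r₁, hc₁, hC₁, hr₁, hpos₁, hle₁, hge₁, hw₁⟩ := hω₁.exists_continuous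
  obtain ⟨w₂, C₂, r₂, hc₂, hC₂, hr₂, hpos₂, hle₂, hge₂, hw₂⟩ := hω₂.exists_continuous
  obtain ⟨K₁, hK₁⟩ := exists_luxMixed_weightedDensity_le hC₁ hge₁ hΦ₁ hΨ₁
  obtain ⟨K₂, hK₂⟩ := exists_luxMixed_weightedDensity_le hC₂ hge₂ hΦ₂ hΨ₂
  obtain ⟨c, hc⟩ := hweights
  -- Passing from the given weights to the larger continuous ones w₁, w₂ preserves the inequality
  -- once the constant is nonnegative; hence max c 0.
  obtain ⟨D, hD⟩ := exists_weighted_wignerSTFT_le A (ω := ω) (c := max c 0) hr₁ hr₂ hpos₁ hpos₂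
    hw₁ hw₂ (le_max_right _ _) (fun x ξ η y => by
      refine (hc x ξ η y).trans ?_
      have p₁ := hω₁.1.1 (x - act A y, ξ + act (1 - A.transpose) η)
      have p₂ := hω₂.1.1 (x + act (1 - A) y, ξ - act A.transpose η)
      have l₁ := hle₁ (x - act A y, ξ + act (1 - A.transpose) η)
      have l₂ := hle₂ (x + act (1 - A) y, ξ - act A.transpose η)
      calc _ ≤ max c 0 * (ω₁ (x - act A y, ξ + act (1 - A.transpose) η) *
            ω₂ (x + act (1 - A) y, ξ - act A.transpose η)) := by
            gcongr
            exact le_max_left c 0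
        _ ≤ _ := mul_le_mul_of_nonneg_left (mul_le_mul l₁ l₂ p₂.le (hpos₁ _).le)
          (le_max_right c 0))
  obtain ⟨B, hB⟩ := exists_mixedNorm_wignerProd_le A hp hpq hΦ₁ hΦ₂ hΨ₁ hΨ₂
    (fun h => ⟨(hfin h).1, (hfin h).2.2⟩)
  set N₁ : GSBeurlingDual (EuclideanSpace ℝ (Fin d)) 1 → ℝ≥0∞ := fun F =>
    orliczModNorm Φ₁ Ψ₁ ω₁ (toHalf F) with hN₁
  set N₂ : GSBeurlingDual (EuclideanSpace ℝ (Fin d)) 1 → ℝ≥0∞ := fun F =>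
    orliczModNorm Φ₂ Ψ₂ ω₂ (toHalf F) with hN₂
  have hmaj : ∀ F₁ F₂, N₁ F₁ ≠ ∞ → N₂ F₂ ≠ ∞ →
      mixedNorm p q (wignerMajorant A w₁ w₂ F₁ F₂) ≤ (B * K₁ * K₂) * (N₁ F₁ * N₂ F₂) := by
    intro F₁ F₂ h₁ h₂
    have e₁ := hK₁ (toHalf F₁)
    have e₂ := hK₂ (toHalf F₂)
    refine (hB _ _ (measurable_weightedDensity hc₁ (toHalf F₁))
      (measurable_weightedDensity hc₂ (toHalf F₂))
      (ne_top_of_le_ne_top (ENNReal.mul_ne_top ENNReal.coe_ne_top h₁) e₁)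
      (ne_top_of_le_ne_top (ENNReal.mul_ne_top ENNReal.coe_ne_top h₂) e₂)).trans ?_
    calc _ ≤ (B : ℝ≥0∞) * ((K₁ * N₁ F₁) * (K₂ * N₂ F₂)) := by gcongr
      _ = _ := by ring
  have hT : ENNReal.ofReal (stftConst (Fin d ⊕ Fin d)) * D * (B * K₁ * K₂) ≠ ∞ := by
    finiteness
  have hbound : ∀ F₁ F₂, N₁ F₁ ≠ ∞ → N₂ F₂ ≠ ∞ → modNorm p q ω (toHalf (W F₁ F₂)) ≤
      (ENNReal.ofReal (stftConst (Fin d ⊕ Fin d)) * D * (B * K₁ * K₂)) * (N₁ F₁ * N₂ F₂) := by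
    intro F₁ F₂ h₁ h₂
    refine (modNorm_wigner_le hD (hW F₁ F₂)).trans ?_
    rw [mul_assoc _ (B * K₁ * K₂ : ℝ≥0∞)]
    exact mul_le_mul_right (hmaj F₁ F₂ h₁ h₂) _
  refine ⟨W, hW, ⟨(ENNReal.ofReal (stftConst (Fin d ⊕ Fin d)) * D * (B * K₁ * K₂)).toNNReal,
    fun F₁ F₂ h₁ h₂ => ?_⟩, fun F₁ F₂ h₁ h₂ ε hε => ?_⟩
  · have n₁ : N₁ F₁ ≠ ∞ := ne_of_lt h₁
    have n₂ : N₂ F₂ ≠ ∞ := ne_of_lt h₂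
    have h := hbound F₁ F₂ n₁ n₂
    refine ⟨h.trans_lt (ENNReal.mul_lt_top hT.lt_top (ENNReal.mul_lt_top h₁ h₂)), ?_⟩
    rw [ENNReal.coe_toNNReal hT, mul_assoc]
    exact h
  · have n₁ : N₁ F₁ ≠ ∞ := ne_of_lt h₁
    have n₂ : N₂ F₂ ≠ ∞ := ne_of_lt h₂
    -- The terms δδ, N₁δ and δN₂ are the contributions of the increment in both arguments, in the
    -- second and in the first.
    obtain ⟨δ, hδ0, -, hδ⟩ := exists_pos_forall_lt hT n₁ n₂ hε
    refine ⟨δ, hδ0, fun G₁ G₂ _ _ hG₁ hG₂ => lt_of_le_of_lt ?_ hδ⟩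
    have m₁ : N₁ (G₁ - F₁) ≠ ∞ := hG₁.ne_top
    have m₂ : N₂ (G₂ - F₂) ≠ ∞ := hG₂.ne_top
    have d₁ : N₁ (G₁ - F₁) ≤ δ := hG₁.le
    have d₂ : N₂ (G₂ - F₂) ≤ δ := hG₂.le
    refine (modNorm_wigner_sub_le hp hpq hc₁ hc₂ hD (hW F₁ F₂) (hW G₁ G₂)).trans ?_
    rw [mul_assoc _ (B * K₁ * K₂ : ℝ≥0∞)]
    refine mul_le_mul_right ?_ _
    rw [mul_add, mul_add]
    refine add_le_add (add_le_add ?_ ?_) ?_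
    · exact (hmaj _ _ m₁ m₂).trans (by gcongr)
    · exact (hmaj _ _ n₁ m₂).trans (by gcongr)
    · exact (hmaj _ _ m₁ n₂).trans (by gcongr)
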